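/- Let $M$ be a smooth manifold of dimension $n\ge 3$ with a conformal structure $[g]$ of signature $(p,q)$. Let $\mathcal T\to M$ be its standard tractor bundle, with tractor metric $h$ of signature $(p+1,q+1)$, canonical isotropic line subbundle $\mathcal T^1$ and standard tractor connection $\nabla^{\mathcal T}$ with curvature $\Omega=\Omega_{ab}{}^A{}_B$. In the splitting $\mathcal T\cong\mathbb R\oplus TM\oplus\mathbb R$ given by a metric $g\in[g]$ with Levi-Civita connection $\nabla$ and Schouten tensor $P_{ab}$, one has $h\big((\sigma,\mu,\rho),(\sigma,\mu,\rho)\big)=2\sigma\rho+g(\mu,\mu)$, $\mathcal T^1=\{(0,0,\rho)\}$ and $$\nabla^{\mathcal T}_a(\sigma,\mu^b,\rho)=(\nabla_a\sigma-\mu_a,\ \nabla_a\mu^b+\delta_a{}^b\rho+P_a{}^b\sigma,\ \nabla_a\rho-P_{ab}\mu^b).$$ Let $\mathcal A=\mathfrak{so}(\mathcal T)$ be the adjoint tractor bundle (endomorphisms of $\mathcal T$ that are skew for $h$) with the induced connection, and let $\Pi:\mathcal A\to TM$ be the canonical projection: $s\,(0,0,1)=(0,\Pi(s),*)$. **Proposition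 2.1.** Let $s=s^A{}_B$ be a smooth parallel section of $\mathcal A$ and $\kappa=\Pi(s)$ its underlying vector field. Then 1. $\kappa$ is a conformal Killing field, and $\kappa^a\,\Omega_{ab}{}^A{}_B=0$; 2. $\Omega_{ab}{}^A{}_B\,s^B{}_A=0$. Moreover, let $(p,q)=(2p'+1,2q'+1)$ and $x\in M$, and let $\mathcal T_x$ be identified with $\mathbb C^{p'+1,q'+1}$ by any real-linear isomorphism that takes $h_x$ to the real part of the standard Hermitian form. Let $\mathrm{Hol}_x$ be the holonomy group of $\nabla^{\mathcal T}$ at $x$, and let $\mathfrak{hol}_x$ be its Lie algebra (that is, the Lie algebra of the restricted holonomy group). Then 3. if $\mathrm{Hol}_x\subseteq U(p'+1,q'+1)$, then $\mathfrak{hol}_x\subseteq\mathfrak{su}(p'+1,q'+1)$; 4. $\mathfrak{hol}_x\ne\mathfrak u(p'+1,q'+1)$; so $\mathfrak u(p'+1,q'+1)$ is never a conformal holonomy Lie algebra. -/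

import Mathlib

open Set
open scoped Manifold ContDiff Bundle

noncomputable section

namespace ConformalTractor

/-! ## Conformal structures -/

/-- A smooth pseudo-Riemannian metric of signature `(p, q)` (`p` plus signs, `q` minus signs) on a
manifold `M` modelled on `ℝⁿ`. The signature condition makes every `g x` non-degenerate and forces
`n = p + q`. -/
structure PseudoMetric (n p q : ℕ) (M : Type*) [TopologicalSpace M]
    [ChartedSpace (EuclideanSpace ℝ (Fin n)) M] [IsManifold (𝓡 n) ∞ M] where
  inner (x : M) : TangentSpace (𝓡 n) x →L[ℝ] TangentSpace (𝓡 n) x →L[ℝ] ℝ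
  symm (x : M) (v w : TangentSpace (𝓡 n) x) : inner x v w = inner x w v
  signature (x : M) : ∃ b : Module.Basis (Fin p ⊕ Fin q) ℝ (TangentSpace (𝓡 n) x),
    ∀ i j, inner x (b i) (b j) = LieAlgebra.Orthogonal.indefiniteDiagonal (Fin p) (Fin q) ℝ i j
  contMDiff : ContMDiff (𝓡 n)
    ((𝓡 n).prod 𝓘(ℝ, EuclideanSpace ℝ (Fin n) →L[ℝ] EuclideanSpace ℝ (Fin n) →L[ℝ] ℝ)) ∞
    (fun x ↦ Bundle.TotalSpace.mk'
      (E := fun x : M ↦ TangentSpace (𝓡 n) x →L[ℝ] TangentSpace (𝓡 n) x →L[ℝ] ℝ)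
      (EuclideanSpace ℝ (Fin n) →L[ℝ] EuclideanSpace ℝ (Fin n) →L[ℝ] ℝ) x (inner x))

variable {n p q : ℕ} {M : Type*} [TopologicalSpace M]
  [ChartedSpace (EuclideanSpace ℝ (Fin n)) M] [IsManifold (𝓡 n) ∞ M]

/-- `g' = exp (2 Υ) g` with `Υ` a smooth function. -/
def IsRescaling (g g' : PseudoMetric n p q M) (Υ : M → ℝ) : Prop :=
  ContMDiff (𝓡 n) 𝓘(ℝ, ℝ) ∞ Υ ∧
    ∀ (x : M) (v w : TangentSpace (𝓡 n) x),
      g'.inner x v w = Real.exp (2 * Υ x) * g.inner x v w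

variable (n p q M) in
/-- Conformal equivalence of metrics. -/
def conformalSetoid : Setoid (PseudoMetric n p q M) where
  r g g' := ∃ Υ : M → ℝ, IsRescaling g g' Υ
  iseqv :=
    { refl := fun g ↦ ⟨fun _ ↦ 0, contMDiff_const, fun x v w ↦ by simp⟩
      symm := by
        rintro g g' ⟨Υ, h, h'⟩
        refine ⟨fun x ↦ -Υ x, h.neg, fun x v w ↦ ?_⟩
        rw [h', ← mul_assoc, ← Real.exp_add]
        simp
      trans := by
        rintro g g' g'' ⟨Υ, h, h'⟩ ⟨Υ', k, k'⟩
        refine ⟨fun x ↦ Υ x + Υ' x, h.add k, fun x v w ↦ ?_⟩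
        rw [k', h', ← mul_assoc, ← Real.exp_add]
        congr 2
        ring }

variable (n p q M) in
/-- A conformal structure of signature `(p, q)` on `M`: a conformal class of metrics. -/
def ConformalStructure : Type _ := Quotient (conformalSetoid n p q M)

/-- `g` belongs to the conformal class `c`. -/
def IsRepresentative (c : ConformalStructure n p q M) (g : PseudoMetric n p q M) : Prop :=
  (Quotient.mk (conformalSetoid n p q M) g : ConformalStructure n p q M) = c

/-! ## The standard tractor bundle

A metric `g` in the conformal class trivialises the density bundles and splits the standard tractor
bundle as `ℝ ⊕ TM ⊕ ℝ`. A tractor at `x` is thus represented in the scale `g` by a triple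
`(σ, μ, ρ)`, and a change of scale acts by the transformation law `IsTractorChange` below. -/

variable (n) in
/-- Representatives `(σ, μ, ρ)` of tractors at a point `x` in a given scale, `μ` being a tangent
vector at `x` (every `TangentSpace (𝓡 n) x` is by definition `EuclideanSpace ℝ (Fin n)`). The line
subbundle `𝒯¹` consists of the triples `(0, 0, ρ)`. -/
abbrev Tractor : Type := ℝ × EuclideanSpace ℝ (Fin n) × ℝ

/-- The tractor metric `2 σ ρ + g(μ, μ)`, polarised, in the scale `g`. -/
def tractorMetric (g : PseudoMetric n p q M) (x : M) (v w : Tractor n) : ℝ :=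
  v.1 * w.2.2 + v.2.2 * w.1 + g.inner x v.2.1 w.2.1

/-- The triples `v` in the scale `g` and `v'` in the scale `exp (2 Υ) g` represent the same tractor
at `x`. Here `N` is the `g`-gradient of `Υ`. -/
def IsTractorChange (g : PseudoMetric n p q M) (Υ : M → ℝ) (x : M) (v v' : Tractor n) : Prop :=
  ∃ N : EuclideanSpace ℝ (Fin n),
    (∀ w : TangentSpace (𝓡 n) x, g.inner x N w = mvfderiv (𝓡 n) Υ x w) ∧
    v'.1 = Real.exp (Υ x) * v.1 ∧
    v'.2.1 = Real.exp (-Υ x) • (v.2.1 + v.1 • N) ∧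
    v'.2.2 = Real.exp (-Υ x) *
      (v.2.2 - mvfderiv (𝓡 n) Υ x v.2.1 - 1 / 2 * v.1 * g.inner x N N)

/-! ## Local expressions

Everything is expressed in the coordinates of the preferred charts of `M`. -/

/-- The `i`-th partial derivative. -/
def pd (i : Fin n) (f : EuclideanSpace ℝ (Fin n) → ℝ) (z : EuclideanSpace ℝ (Fin n)) : ℝ :=
  fderiv ℝ f z (EuclideanSpace.single i 1)

section LocalMetric

variable (G : EuclideanSpace ℝ (Fin n) → Matrix (Fin n) (Fin n) ℝ)

/-- Christoffel symbols `Γᵏᵢⱼ` of the Levi-Civita connection of the metric with components `G`. -/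
def christoffel (k i j : Fin n) (z : EuclideanSpace ℝ (Fin n)) : ℝ :=
  1 / 2 * ∑ l, (G z)⁻¹ k l *
    (pd i (fun y ↦ G y l j) z + pd j (fun y ↦ G y l i) z - pd l (fun y ↦ G y i j) z)

/-- Riemann tensor `Rᵢⱼᵏₗ`, with `(∇ᵢ∇ⱼ - ∇ⱼ∇ᵢ) Vᵏ = Rᵢⱼᵏₗ Vˡ`. -/
def riemann (i j k l : Fin n) (z : EuclideanSpace ℝ (Fin n)) : ℝ :=
  pd i (christoffel G k j l) z - pd j (christoffel G k i l) z
    + ∑ m, (christoffel G k i m z * christoffel G m j l z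
      - christoffel G k j m z * christoffel G m i l z)

/-- Ricci tensor `Rⱼₗ = Rₖⱼᵏₗ`. -/
def ricci (j l : Fin n) (z : EuclideanSpace ℝ (Fin n)) : ℝ := ∑ k, riemann G k j k l z

/-- Scalar curvature. -/
def scalarCurvature (z : EuclideanSpace ℝ (Fin n)) : ℝ := ∑ i, ∑ j, (G z)⁻¹ i j * ricci G i j z

/-- Schouten tensor `Pᵢⱼ` (used for `n ≥ 3`). -/
def schouten (i j : Fin n) (z : EuclideanSpace ℝ (Fin n)) : ℝ :=
  1 / ((n : ℝ) - 2) * (ricci G i j z - scalarCurvature G z / (2 * ((n : ℝ) - 1)) * G z i j)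

variable (n) in
/-- Index set of a tractor frame: top slot, tangent slots, bottom slot. -/
abbrev TIndex : Type := Unit ⊕ Fin n ⊕ Unit

/-- The connection matrices `ωᵢ` of the standard tractor connection
`∇ᵢ (σ, μ, ρ) = (∂ᵢσ - gᵢⱼ μʲ, ∇ᵢ μᵏ + δᵢᵏ ρ + Pᵢᵏ σ, ∂ᵢρ - Pᵢⱼ μʲ)`, so that
`∇ᵢ τ = ∂ᵢ τ + ωᵢ τ` for the column `τ` of components. -/
def connectionMatrix (i : Fin n) (z : EuclideanSpace ℝ (Fin n)) :
    Matrix (TIndex n) (TIndex n) ℝ := Matrix.of fun A B ↦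
  match A, B with
  | .inl _, .inr (.inl j) => -G z i j
  | .inr (.inl k), .inl _ => ∑ l, (G z)⁻¹ k l * schouten G i l z
  | .inr (.inl k), .inr (.inl j) => christoffel G k i j z
  | .inr (.inl k), .inr (.inr _) => if k = i then 1 else 0
  | .inr (.inr _), .inr (.inl j) => -schouten G i j z
  | _, _ => 0

/-- Curvature `Ωᵢⱼ = ∂ᵢωⱼ - ∂ⱼωᵢ + [ωᵢ, ωⱼ]` of the standard tractor connection, an
endomorphism-valued two-form `Ω_{ij}{}^A{}_B`. -/
def tractorCurvature (i j : Fin n) (z : EuclideanSpace ℝ (Fin n)) :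
    Matrix (TIndex n) (TIndex n) ℝ :=
  (Matrix.of fun A B ↦ pd i (fun y ↦ connectionMatrix G j y A B) z
      - pd j (fun y ↦ connectionMatrix G i y A B) z)
    + connectionMatrix G i z * connectionMatrix G j z
    - connectionMatrix G j z * connectionMatrix G i z

/-- Covariant derivative `∇ᵢ S = ∂ᵢ S + [ωᵢ, S]` induced on endomorphisms of the standard tractor
bundle, `S` being given by its matrix in the tractor frame. -/
def covDerivEnd (i : Fin n) (S : EuclideanSpace ℝ (Fin n) → Matrix (TIndex n) (TIndex n) ℝ)
    (z : EuclideanSpace ℝ (Fin n)) : Matrix (TIndex n) (TIndex n) ℝ :=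
  (Matrix.of fun A B ↦ pd i (fun y ↦ S y A B) z)
    + connectionMatrix G i z * S z - S z * connectionMatrix G i z

end LocalMetric

/-! ## Components in a chart

Throughout `c : M` labels the preferred chart `extChartAt (𝓡 n) c`. -/

/-- The point of `M` with coordinates `z` in the chart at `c`. -/
def pt (c : M) (z : EuclideanSpace ℝ (Fin n)) : M := (extChartAt (𝓡 n) c).symm z

/-- The coordinate vector field `∂ᵢ` of the chart at `c`, at the point with coordinates `z`. -/
def coordVector (c : M) (z : EuclideanSpace ℝ (Fin n)) (i : Fin n) :
    TangentSpace (𝓡 n) (pt c z) :=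
  mfderiv 𝓘(ℝ, EuclideanSpace ℝ (Fin n)) (𝓡 n) (extChartAt (𝓡 n) c).symm z
    (EuclideanSpace.single i (1 : ℝ) : EuclideanSpace ℝ (Fin n))

/-- Components of a tangent vector at `x` in the chart at `c`. -/
def vectorCoord (c x : M) (v : TangentSpace (𝓡 n) x) (i : Fin n) : ℝ :=
  mvfderiv (𝓡 n) (extChartAt (𝓡 n) c) x v i

/-- Components `gᵢⱼ` of a metric in the chart at `c`. -/
def metricMatrix (g : PseudoMetric n p q M) (c : M) (z : EuclideanSpace ℝ (Fin n)) :
    Matrix (Fin n) (Fin n) ℝ :=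
  Matrix.of fun i j ↦ g.inner (pt c z) (coordVector c z i) (coordVector c z j)

/-- The tractor frame `(1, 0, 0), (0, ∂ᵢ, 0), (0, 0, 1)`. -/
def tractorFrame (c : M) (z : EuclideanSpace ℝ (Fin n)) : TIndex n → Tractor n
  | .inl _ => (1, 0, 0)
  | .inr (.inl i) => (0, coordVector c z i, 0)
  | .inr (.inr _) => (0, 0, 1)

/-- Components of a tractor at `x` with respect to the tractor frame of the chart at `c`. -/
def tractorCoord (c x : M) (v : Tractor n) : TIndex n → ℝ
  | .inl _ => v.1
  | .inr (.inl i) => vectorCoord c x v.2.1 i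
  | .inr (.inr _) => v.2.2

/-- The matrix `s^A{}_B` of a field of endomorphisms in the tractor frame of the chart at `c`. -/
def endMatrix (s : M → (Tractor n →L[ℝ] Tractor n)) (c : M) (z : EuclideanSpace ℝ (Fin n)) :
    Matrix (TIndex n) (TIndex n) ℝ :=
  Matrix.of fun A B ↦ tractorCoord c (pt c z) (s (pt c z) (tractorFrame c z B)) A

/-! ## Adjoint tractors -/

/-- A smooth section of the adjoint tractor bundle `𝔰𝔬(𝒯)` of the conformal structure `c`: for every
metric `g` in the class, a smooth field of endomorphisms of `ℝ ⊕ TM ⊕ ℝ`, skew for the tractor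
metric, where the fields belonging to different metrics are related by the change of scale. -/
structure AdjointTractorField (c : ConformalStructure n p q M) where
  toEnd : ∀ g : PseudoMetric n p q M, IsRepresentative c g → M → (Tractor n →L[ℝ] Tractor n)
  skew : ∀ g hg (x : M) (v w : Tractor n),
    tractorMetric g x (toEnd g hg x v) w + tractorMetric g x v (toEnd g hg x w) = 0
  smooth : ∀ g hg (a : M) (A B : TIndex n),
    ContDiffOn ℝ ∞ (fun z ↦ endMatrix (toEnd g hg) a z A B) (extChartAt (𝓡 n) a).target
  change : ∀ g hg g' hg' (Υ : M → ℝ), IsRescaling g g' Υ → ∀ (x : M) (v v' : Tractor n),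
    IsTractorChange g Υ x v v' → IsTractorChange g Υ x (toEnd g hg x v) (toEnd g' hg' x v')

namespace AdjointTractorField

/-- The section is parallel for the connection induced by the standard tractor connection. -/
def IsParallel {c : ConformalStructure n p q M} (s : AdjointTractorField c) : Prop :=
  ∀ g hg (a : M), ∀ z ∈ (extChartAt (𝓡 n) a).target, ∀ i : Fin n,
    covDerivEnd (metricMatrix g a) i (endMatrix (s.toEnd g hg) a) z = 0

lemma isRepresentative_out (c : ConformalStructure n p q M) :
    IsRepresentative c (Quotient.out (s := conformalSetoid n p q M) c) :=
  Quotient.out_eq (s := conformalSetoid n p q M) c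

/-- The vector field `Π(s)` underlying an adjoint tractor field: `s` maps the canonical generator
`(0, 0, 1)` of `𝒯¹` to `(0, κ, *)`, and `κ` does not depend on the scale
(see `toEnd_bottom_eq`). -/
def vectorField {c : ConformalStructure n p q M} (s : AdjointTractorField c) (x : M) :
    TangentSpace (𝓡 n) x :=
  (s.toEnd _ (isRepresentative_out c) x (0, 0, 1)).2.1

end AdjointTractorField

lemma exists_gradient (g : PseudoMetric n p q M) (x : M) (f : TangentSpace (𝓡 n) x →L[ℝ] ℝ) :
    ∃ N : TangentSpace (𝓡 n) x, ∀ w, g.inner x N w = f w := by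
  obtain ⟨b, hb⟩ := g.signature x
  refine ⟨∑ i, (LieAlgebra.Orthogonal.indefiniteDiagonal (Fin p) (Fin q) ℝ i i * f (b i)) • b i,
    fun w ↦ ?_⟩
  have key : (g.inner x (∑ i, (LieAlgebra.Orthogonal.indefiniteDiagonal (Fin p) (Fin q) ℝ i i
      * f (b i)) • b i)).toLinearMap = f.toLinearMap := by
    refine b.ext fun j ↦ ?_
    simp only [map_sum, map_smul, ContinuousLinearMap.coe_coe, sum_apply,
      smul_apply, hb, smul_eq_mul]
    rw [Finset.sum_eq_single j]
    · rcases j with j | j <;> simp [LieAlgebra.Orthogonal.indefiniteDiagonal]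
    · intro i _ hij
      simp [LieAlgebra.Orthogonal.indefiniteDiagonal, Matrix.diagonal_apply_ne _ hij]
    · simp
  exact congrArg (fun L ↦ L w) key

/-- The underlying vector field can be computed in any scale. -/
lemma AdjointTractorField.toEnd_bottom_eq {c : ConformalStructure n p q M}
    (s : AdjointTractorField c) (g : PseudoMetric n p q M) (hg : IsRepresentative c g) (x : M) :
    ∃ φ : ℝ, s.toEnd g hg x (0, 0, 1) = (0, s.vectorField x, φ) := by
  have top : (s.toEnd g hg x (0, 0, 1)).1 = 0 := by
    have h := s.skew g hg x (0, 0, 1) (0, 0, 1)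
    simp only [tractorMetric] at h
    have e : (g.inner x (0 : EuclideanSpace ℝ (Fin n)) (s.toEnd g hg x (0, 0, 1)).2.1) = 0 := by
      exact congrArg (fun L : TangentSpace (𝓡 n) x →L[ℝ] ℝ ↦ L (s.toEnd g hg x (0, 0, 1)).2.1)
        (map_zero (g.inner x))
    have e' : (g.inner x (s.toEnd g hg x (0, 0, 1)).2.1 (0 : EuclideanSpace ℝ (Fin n))) = 0 := by
      exact map_zero _
    rw [e, e'] at h
    linarith
  have mid : (s.toEnd g hg x (0, 0, 1)).2.1 = s.vectorField x := by
    obtain ⟨Υ, hΥ⟩ := Quotient.exact (s := conformalSetoid n p q M)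
      (hg.trans (isRepresentative_out c).symm)
    obtain ⟨N, hN⟩ : ∃ N : EuclideanSpace ℝ (Fin n), ∀ w : TangentSpace (𝓡 n) x,
        g.inner x N w = mvfderiv (𝓡 n) Υ x w := exists_gradient g x (mvfderiv (𝓡 n) Υ x)
    have h := s.change g hg _ (isRepresentative_out c) Υ hΥ x (0, 0, 1)
      (Real.exp (-Υ x) • (0, 0, 1)) ⟨N, hN, by simp, by simp, by
        have : mvfderiv (𝓡 n) Υ x (0 : EuclideanSpace ℝ (Fin n)) = 0 := map_zero _
        simp [this]⟩
    obtain ⟨N', -, -, h2, -⟩ := h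
    rw [top, map_smul] at h2
    simp only [Prod.smul_snd, Prod.smul_fst, zero_smul, add_zero] at h2
    exact ((smul_right_injective _ (Real.exp_pos (-Υ x)).ne') h2).symm
  exact ⟨(s.toEnd g hg x (0, 0, 1)).2.2, Prod.ext top (Prod.ext mid rfl)⟩

/-- `κ` is a conformal Killing field of `g`: a smooth vector field with `ℒ_κ g = f g` for some
function `f`. The Lie derivative is written out in the charts of `M`. -/
def IsConformalKilling (g : PseudoMetric n p q M) (κ : ∀ x : M, TangentSpace (𝓡 n) x) : Prop :=
  ContMDiff (𝓡 n) (𝓡 n).tangent ∞ (fun x ↦ (⟨x, κ x⟩ : TangentBundle (𝓡 n) M)) ∧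
  ∃ f : M → ℝ, ∀ a : M, ∀ z ∈ (extChartAt (𝓡 n) a).target, ∀ i j : Fin n,
    ∑ k, (vectorCoord a (pt a z) (κ (pt a z)) k * pd k (fun y ↦ metricMatrix g a y i j) z
        + metricMatrix g a z k j * pd i (fun y ↦ vectorCoord a (pt a y) (κ (pt a y)) k) z
        + metricMatrix g a z i k * pd j (fun y ↦ vectorCoord a (pt a y) (κ (pt a y)) k) z)
      = f (pt a z) * metricMatrix g a z i j

/-! ## Conformal holonomy -/

/-- `τ` (with `τ u` a tractor at `γ u`) is parallel along the curve `γ` on the interval `[a, b]`, on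
which `γ` runs in the chart at `c`: `d/du τ^A + γ̇ⁱ ωᵢ^A_B τ^B = 0`. -/
def IsParallelAlong (g : PseudoMetric n p q M) (c : M) (γ : ℝ → M) (τ : ℝ → Tractor n)
    (a b : ℝ) : Prop :=
  ∀ u ∈ Icc a b, ∀ A : TIndex n,
    HasDerivWithinAt (fun r ↦ tractorCoord c (γ r) (τ r) A)
      (-∑ i, derivWithin (fun r ↦ extChartAt (𝓡 n) c (γ r) i) (Icc a b) u *
        ∑ B, connectionMatrix (metricMatrix g c) i (extChartAt (𝓡 n) c (γ u)) A B *
          tractorCoord c (γ u) (τ u) B)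
      (Icc a b) u

/-- `γ` is piecewise smooth and `P` is the parallel transport along `γ` of the standard tractor
connection in the scale `g`. The partition of `[0, 1]` is taken so fine that each piece of `γ` lies
in a chart. -/
def IsParallelTransport (g : PseudoMetric n p q M) {x y : M} (γ : Path x y)
    (P : Tractor n →L[ℝ] Tractor n) : Prop :=
  ∃ (N : ℕ) (t : Fin (N + 1) → ℝ) (c : Fin N → M),
    Monotone t ∧ t 0 = 0 ∧ t (Fin.last N) = 1 ∧
    (∀ k : Fin N, ∀ u ∈ Icc (t k.castSucc) (t k.succ),
      γ.extend u ∈ (extChartAt (𝓡 n) (c k)).source) ∧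
    (∀ k : Fin N, ContDiffOn ℝ ∞ (fun u ↦ extChartAt (𝓡 n) (c k) (γ.extend u))
      (Icc (t k.castSucc) (t k.succ))) ∧
    ∀ v : Tractor n, ∃ τ : ℝ → Tractor n, τ 0 = v ∧ τ 1 = P v ∧
      ∀ k : Fin N, IsParallelAlong g (c k) γ.extend τ (t k.castSucc) (t k.succ)

/-- The holonomy group at `x` of the standard tractor connection, acting on the tractors at `x` in
the scale `g` (for another metric in the conformal class it is conjugated by the change of
scale). -/
def holonomyGroup (g : PseudoMetric n p q M) (x : M) : Set (Tractor n →L[ℝ] Tractor n) :=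
  {P | ∃ γ : Path x x, IsParallelTransport g γ P}

/-- The restricted holonomy group, from null-homotopic loops. -/
def restrictedHolonomyGroup (g : PseudoMetric n p q M) (x : M) :
    Set (Tractor n →L[ℝ] Tractor n) :=
  {P | ∃ γ : Path x x, γ.Homotopic (Path.refl x) ∧ IsParallelTransport g γ P}

/-- The holonomy Lie algebra: the Lie algebra of the restricted holonomy group, which is the identity
component of the holonomy group. -/
def holonomyAlgebra (g : PseudoMetric n p q M) (x : M) : Set (Tractor n →L[ℝ] Tractor n) :=
  {A | ∀ t : ℝ, NormedSpace.exp (t • A) ∈ restrictedHolonomyGroup g x}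

/-! ## The unitary groups and algebras -/

/-- The diagonal matrix with `k` entries `1` and `l` entries `-1`. -/
abbrev hermitianForm (k l : ℕ) : Matrix (Fin k ⊕ Fin l) (Fin k ⊕ Fin l) ℂ :=
  LieAlgebra.Orthogonal.indefiniteDiagonal (Fin k) (Fin l) ℂ

open scoped Matrix in
/-- The group `U(k, l)`. -/
def unitaryGroup (k l : ℕ) : Set (Matrix (Fin k ⊕ Fin l) (Fin k ⊕ Fin l) ℂ) :=
  {X | Xᴴ * hermitianForm k l * X = hermitianForm k l}

open scoped Matrix in
/-- The Lie algebra `𝔲(k, l)`. -/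
def unitaryAlgebra (k l : ℕ) : Set (Matrix (Fin k ⊕ Fin l) (Fin k ⊕ Fin l) ℂ) :=
  {X | Xᴴ * hermitianForm k l + hermitianForm k l * X = 0}

/-- The Lie algebra `𝔰𝔲(k, l)`. -/
def specialUnitaryAlgebra (k l : ℕ) : Set (Matrix (Fin k ⊕ Fin l) (Fin k ⊕ Fin l) ℂ) :=
  {X | X ∈ unitaryAlgebra k l ∧ X.trace = 0}

open scoped Matrix in
/-- `Φ` is an isometry from the tractors at `x` onto `ℂ^{k+l}` with the real part of the standard
Hermitian form of signature `(k, l)`. -/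
def IsHermitianIdentification (g : PseudoMetric n p q M) (x : M) {k l : ℕ}
    (Φ : Tractor n ≃ₗ[ℝ] (Fin k ⊕ Fin l → ℂ)) : Prop :=
  ∀ v w : Tractor n,
    tractorMetric g x v w = (star (Φ v) ⬝ᵥ (hermitianForm k l *ᵥ Φ w)).re

/-- The set of endomorphisms of the tractors at a point that correspond under `Φ` to a complex matrix
in `𝒮`. -/
def transfer {k l : ℕ} (Φ : Tractor n ≃ₗ[ℝ] (Fin k ⊕ Fin l → ℂ))
    (𝒮 : Set (Matrix (Fin k ⊕ Fin l) (Fin k ⊕ Fin l) ℂ)) : Set (Tractor n →L[ℝ] Tractor n) :=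
  {A | ∃ X ∈ 𝒮, ∀ v, Φ (A v) = X.mulVec (Φ v)}

end ConformalTractor

end

open Set
open scoped Manifold ContDiff Bundle

noncomputable section

namespace ConformalTractor


/-! Everything local is done with matrices. In a chart a metric gives connection matrices `ωᵢ`, and
a parallel endomorphism field satisfies `∂ᵢS = [S, ωᵢ]`. Equality of mixed partial derivatives turns
this into `[Ωᵢⱼ, S] = 0` (`curv_commute`), and from there the statements on the curvature are
algebra at a point (`IsMetricOn.curvature_of_commute`).

In the splitting, `Ω` has the Weyl tensor `W` as its middle block and, up to sign, the Cotton tensor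
as its bottom row `c`. The left column is the bottom row with its index raised, up to sign, and all
other entries vanish. Let `K` be the vector underlying `S` and `A` the middle block of `S`. The last
column of `[Ω, S] = 0` says that `K` is annihilated in the endomorphism slots of `W` and `c`.
Contracting the middle block, where the traces of `W` and `c` drop out, gives `Kⁱ cᵢⱼₗ = -Aⁱₘ
Wᵢⱼᵐₗ`. The right side is antisymmetric in `j, l` by the pair symmetry of `W`, the left side
symmetric by the cyclic identity for `c`, so both are zero. Pair symmetry then also moves `K` into
the form slots of `W`, so that `K` inserts trivially into `Ω`. The trace of `ΩS` reduces to the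
contraction of `A` with `W`, which the cyclic identity for `W` expresses by the contractions that
were just shown to vanish. The conformal Killing equation is the last column of `∇S = 0`,
symmetrised.

For the holonomy, let `J` be the complex structure of the tractors at `x`. It is skew for the
tractor metric. Where `J` extends to a parallel field, `tr Ω = 0` and `tr (ΩJ) = 0`; these are the
real and imaginary parts of the complex trace of `Ω`. In a frame in which `J` is constant, the
complex trace of the connection matrices is therefore a closed form, and a primitive of it computes
the complex determinant of transport. Hence transport around small loops has complex determinant `1`
(`IsSegmentTransport.det_cmat_eq_one`). To reach all null-homotopic loops, transport is reduced
modulo the complex linear maps of determinant `1`. What is left is locally constant, that is, a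
covering space, and null-homotopic loops have trivial monodromy in it
(`continuation_eq_of_nullhomotopic`, `transport_mem_specialSubgroup`). Differentiating one-parameter
groups gives complex trace `0` on the holonomy algebra.

If only the holonomy algebra is known to be `𝔲`, the holonomy group may be larger, but it normalises
the algebra. So a holonomy `P` sends `J` to a complex structure that commutes with all of `𝔲`, which
can only be `±J`. For this reason the whole argument is run for holonomies that commute or
anticommute with `J`. Transport around a small loop is close to the identity and cannot anticommute
with `J`, so `J` still extends locally to a parallel field, and the algebra has complex trace `0`.
But `𝔲` contains `J` itself, whose complex trace is not zero (`holonomyAlgebra_ne_unitary`). -/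

/-! ### Entrywise calculus for matrix functions -/

section MatrixCalculus

variable {n : ℕ} {ι κ l : Type*}

/-- The functions on `O` all of whose entries are smooth. -/
def SmoothM (O : Set (EuclideanSpace ℝ (Fin n))) (S : EuclideanSpace ℝ (Fin n) → Matrix ι κ ℝ) :
    Prop :=
  ∀ A B, ContDiffOn ℝ ∞ (fun z ↦ S z A B) O

/-- Entrywise partial derivative. -/
def pdm (i : Fin n) (S : EuclideanSpace ℝ (Fin n) → Matrix ι κ ℝ)
    (z : EuclideanSpace ℝ (Fin n)) : Matrix ι κ ℝ :=
  Matrix.of fun A B ↦ pd i (fun y ↦ S y A B) z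

variable {O : Set (EuclideanSpace ℝ (Fin n))} {z : EuclideanSpace ℝ (Fin n)}
  {f g : EuclideanSpace ℝ (Fin n) → ℝ}

lemma pd_congr (hO : IsOpen O) (hz : z ∈ O) (h : EqOn f g O) (i : Fin n) : pd i f z = pd i g z := by
  unfold pd
  rw [(Filter.eventuallyEq_of_mem (hO.mem_nhds hz) h).fderiv_eq]

lemma pdm_congr {S T : EuclideanSpace ℝ (Fin n) → Matrix ι κ ℝ} (hO : IsOpen O) (hz : z ∈ O)
    (h : EqOn S T O) (i : Fin n) : pdm i S z = pdm i T z := by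
  ext A B
  exact pd_congr hO hz (fun y hy ↦ by simp [h hy]) i

lemma pd_const (i : Fin n) (c : ℝ) : pd i (fun _ ↦ c) z = 0 := by simp [pd]

lemma pd_add (hf : DifferentiableAt ℝ f z) (hg : DifferentiableAt ℝ g z) (i : Fin n) :
    pd i (fun y ↦ f y + g y) z = pd i f z + pd i g z := by
  simp [pd, fderiv_fun_add hf hg]

lemma pd_neg (i : Fin n) : pd i (fun y ↦ -f y) z = -pd i f z := by
  simp [pd, fderiv_fun_neg]

lemma pd_sub (hf : DifferentiableAt ℝ f z) (hg : DifferentiableAt ℝ g z) (i : Fin n) :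
    pd i (fun y ↦ f y - g y) z = pd i f z - pd i g z := by
  simp [pd, fderiv_fun_sub hf hg]

lemma pd_mul (hf : DifferentiableAt ℝ f z) (hg : DifferentiableAt ℝ g z) (i : Fin n) :
    pd i (fun y ↦ f y * g y) z = pd i f z * g z + f z * pd i g z := by
  simp only [pd, fderiv_fun_mul hf hg, add_apply,
    smul_apply, smul_eq_mul]
  ring

lemma pd_sum {s : Finset ι} {F : ι → EuclideanSpace ℝ (Fin n) → ℝ}
    (hF : ∀ a ∈ s, DifferentiableAt ℝ (F a) z) (i : Fin n) :
    pd i (fun y ↦ ∑ a ∈ s, F a y) z = ∑ a ∈ s, pd i (F a) z := by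
  simp only [pd]
  rw [fderiv_fun_sum hF]
  simp

lemma contDiffOn_pd (hO : IsOpen O) (hf : ContDiffOn ℝ ∞ f O) (i : Fin n) :
    ContDiffOn ℝ ∞ (pd i f) O :=
  (hf.fderiv_of_isOpen hO (m := ∞) (by simp)).clm_apply contDiffOn_const

lemma ContDiffOn.diffAt (hf : ContDiffOn ℝ ∞ f O) (hO : IsOpen O) (hz : z ∈ O) :
    DifferentiableAt ℝ f z :=
  (hf.contDiffAt (hO.mem_nhds hz)).differentiableAt (by simp)

lemma pd_comm (hO : IsOpen O) (hf : ContDiffOn ℝ ∞ f O) (hz : z ∈ O) (i j : Fin n) :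
    pd i (pd j f) z = pd j (pd i f) z := by
  have hfz : ContDiffAt ℝ ∞ f z := hf.contDiffAt (hO.mem_nhds hz)
  have hd : DifferentiableAt ℝ (fderiv ℝ f) z :=
    ((hf.fderiv_of_isOpen hO (m := ∞) (by simp)).contDiffAt (hO.mem_nhds hz)).differentiableAt
      (by simp)
  have hsym := hfz.isSymmSndFDerivAt (by
    simp only [minSmoothness_of_isRCLikeNormedField]
    exact WithTop.coe_le_coe.mpr (le_top (a := (2 : ℕ∞))))
  have key : ∀ v w : EuclideanSpace ℝ (Fin n),
      fderiv ℝ (fun y ↦ fderiv ℝ f y v) z w = fderiv ℝ (fderiv ℝ f) z w v := by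
    intro v w
    rw [fderiv_clm_apply hd (differentiableAt_const v)]
    simp
  unfold pd
  rw [key, key]
  exact hsym _ _

lemma SmoothM.diffAt {S : EuclideanSpace ℝ (Fin n) → Matrix ι κ ℝ} (hS : SmoothM O S)
    (hO : IsOpen O) (hz : z ∈ O) (A : ι) (B : κ) : DifferentiableAt ℝ (fun y ↦ S y A B) z :=
  ContDiffOn.diffAt (hS A B) hO hz

lemma SmoothM.mono {O' : Set (EuclideanSpace ℝ (Fin n))}
    {S : EuclideanSpace ℝ (Fin n) → Matrix ι κ ℝ} (hS : SmoothM O S) (h : O' ⊆ O) : SmoothM O' S :=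
  fun A B ↦ (hS A B).mono h

lemma SmoothM.congr {S T : EuclideanSpace ℝ (Fin n) → Matrix ι κ ℝ} (hS : SmoothM O S)
    (h : EqOn T S O) : SmoothM O T :=
  fun A B ↦ (hS A B).congr fun y hy ↦ by simp [h hy]

lemma SmoothM.add {S T : EuclideanSpace ℝ (Fin n) → Matrix ι κ ℝ} (hS : SmoothM O S)
    (hT : SmoothM O T) : SmoothM O (fun z ↦ S z + T z) :=
  fun A B ↦ (hS A B).add (hT A B)

lemma SmoothM.sub {S T : EuclideanSpace ℝ (Fin n) → Matrix ι κ ℝ} (hS : SmoothM O S)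
    (hT : SmoothM O T) : SmoothM O (fun z ↦ S z - T z) :=
  fun A B ↦ (hS A B).sub (hT A B)

lemma SmoothM.neg {S : EuclideanSpace ℝ (Fin n) → Matrix ι κ ℝ} (hS : SmoothM O S) :
    SmoothM O (fun z ↦ -S z) :=
  fun A B ↦ (hS A B).neg

lemma SmoothM.smul {S : EuclideanSpace ℝ (Fin n) → Matrix ι κ ℝ} (hf : ContDiffOn ℝ ∞ f O)
    (hS : SmoothM O S) : SmoothM O (fun z ↦ f z • S z) :=
  fun A B ↦ hf.mul (hS A B)

lemma SmoothM.sum {s : Finset l} {S : l → EuclideanSpace ℝ (Fin n) → Matrix ι κ ℝ}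
    (hS : ∀ a ∈ s, SmoothM O (S a)) : SmoothM O (fun z ↦ ∑ a ∈ s, S a z) := by
  intro A B
  simp only [Matrix.sum_apply]
  exact ContDiffOn.sum fun a ha ↦ hS a ha A B

lemma SmoothM.const (c : Matrix ι κ ℝ) : SmoothM O (fun _ ↦ c) := fun _ _ ↦ contDiffOn_const

lemma SmoothM.mul [Fintype κ] {S : EuclideanSpace ℝ (Fin n) → Matrix ι κ ℝ}
    {T : EuclideanSpace ℝ (Fin n) → Matrix κ l ℝ} (hS : SmoothM O S)
    (hT : SmoothM O T) : SmoothM O (fun z ↦ S z * T z) := by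
  intro A B
  simp only [Matrix.mul_apply]
  exact ContDiffOn.sum fun a _ ↦ (hS A a).mul (hT a B)

lemma SmoothM.transpose {S : EuclideanSpace ℝ (Fin n) → Matrix ι κ ℝ} (hS : SmoothM O S) :
    SmoothM O (fun z ↦ (S z).transpose) :=
  fun A B ↦ hS B A

lemma SmoothM.pdm (hO : IsOpen O) {S : EuclideanSpace ℝ (Fin n) → Matrix ι κ ℝ}
    (hS : SmoothM O S) (i : Fin n) : SmoothM O (pdm i S) :=
  fun A B ↦ contDiffOn_pd hO (hS A B) i

lemma SmoothM.det [Fintype ι] [DecidableEq ι] {S : EuclideanSpace ℝ (Fin n) → Matrix ι ι ℝ}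
    (hS : SmoothM O S) : ContDiffOn ℝ ∞ (fun z ↦ (S z).det) O := by
  simp only [Matrix.det_apply]
  refine ContDiffOn.sum fun σ _ ↦ ContDiffOn.const_smul _ ?_
  exact contDiffOn_prod fun a _ ↦ hS _ _

lemma SmoothM.inv [Fintype ι] [DecidableEq ι] {S : EuclideanSpace ℝ (Fin n) → Matrix ι ι ℝ}
    (hS : SmoothM O S) (h : ∀ z ∈ O, IsUnit (S z).det) : SmoothM O (fun z ↦ (S z)⁻¹) := by
  intro A B
  have h2 : SmoothM O (fun z ↦ (S z).adjugate) := by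
    intro A B
    simp only [Matrix.adjugate_apply]
    refine SmoothM.det fun C D ↦ ?_
    simp only [Matrix.updateRow_apply]
    split_ifs
    · exact contDiffOn_const
    · exact hS _ _
  have : EqOn (fun z ↦ (S z)⁻¹ A B) (fun z ↦ ((S z).det)⁻¹ * (S z).adjugate A B) O := by
    intro z _
    simp [Matrix.inv_def]
  exact ((hS.det.inv fun z hz ↦ (h z hz).ne_zero).mul (h2 A B)).congr this

variable (hO : IsOpen O) (hz : z ∈ O)
include hO hz

lemma pdm_add {S T : EuclideanSpace ℝ (Fin n) → Matrix ι κ ℝ} (hS : SmoothM O S)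
    (hT : SmoothM O T) (i : Fin n) :
    pdm i (fun y ↦ S y + T y) z = pdm i S z + pdm i T z := by
  ext A B
  exact pd_add (hS.diffAt hO hz A B) (hT.diffAt hO hz A B) i

lemma pdm_sub {S T : EuclideanSpace ℝ (Fin n) → Matrix ι κ ℝ} (hS : SmoothM O S)
    (hT : SmoothM O T) (i : Fin n) :
    pdm i (fun y ↦ S y - T y) z = pdm i S z - pdm i T z := by
  ext A B
  exact pd_sub (hS.diffAt hO hz A B) (hT.diffAt hO hz A B) i

lemma pdm_smul {S : EuclideanSpace ℝ (Fin n) → Matrix ι κ ℝ} (hf : ContDiffOn ℝ ∞ f O)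
    (hS : SmoothM O S) (i : Fin n) :
    pdm i (fun y ↦ f y • S y) z = pd i f z • S z + f z • pdm i S z := by
  ext A B
  exact pd_mul (ContDiffOn.diffAt hf hO hz) (hS.diffAt hO hz A B) i

lemma pdm_mul [Fintype κ] {S : EuclideanSpace ℝ (Fin n) → Matrix ι κ ℝ}
    {T : EuclideanSpace ℝ (Fin n) → Matrix κ l ℝ} (hS : SmoothM O S)
    (hT : SmoothM O T) (i : Fin n) :
    pdm i (fun y ↦ S y * T y) z = pdm i S z * T z + S z * pdm i T z := by
  ext A B
  simp only [pdm, Matrix.mul_apply, Matrix.add_apply, Matrix.of_apply]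
  rw [pd_sum (F := fun a y ↦ S y A a * T y a B)
    fun a _ ↦ (hS.diffAt hO hz A a).mul (hT.diffAt hO hz a B), ← Finset.sum_add_distrib]
  exact Finset.sum_congr rfl fun a _ ↦ pd_mul (hS.diffAt hO hz A a) (hT.diffAt hO hz a B) i

lemma pdm_sum {s : Finset l} {S : l → EuclideanSpace ℝ (Fin n) → Matrix ι κ ℝ}
    (hS : ∀ a ∈ s, SmoothM O (S a)) (i : Fin n) :
    pdm i (fun y ↦ ∑ a ∈ s, S a y) z = ∑ a ∈ s, pdm i (S a) z := by
  ext A B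
  simp only [pdm, Matrix.sum_apply, Matrix.of_apply]
  exact pd_sum (fun a ha ↦ (hS a ha).diffAt hO hz A B) i

lemma pdm_comm {S : EuclideanSpace ℝ (Fin n) → Matrix ι κ ℝ} (hS : SmoothM O S) (i j : Fin n) :
    pdm i (pdm j S) z = pdm j (pdm i S) z := by
  ext A B
  exact pd_comm hO (hS A B) hz i j

omit hO hz in
lemma pdm_transpose {S : EuclideanSpace ℝ (Fin n) → Matrix ι κ ℝ} (i : Fin n) :
    pdm i (fun y ↦ (S y).transpose) z = (pdm i S z).transpose := rfl

omit hO hz in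
lemma pdm_const (c : Matrix ι κ ℝ) (i : Fin n) : pdm i (fun _ ↦ c) z = 0 := by
  ext A B
  exact pd_const i _

lemma pdm_inverse [Fintype ι] [DecidableEq ι] {S T : EuclideanSpace ℝ (Fin n) → Matrix ι ι ℝ}
    (hS : SmoothM O S) (hT : SmoothM O T) (h : ∀ y ∈ O, T y * S y = 1) (i : Fin n) :
    pdm i T z = -(T z * pdm i S z * T z) := by
  have h1 : pdm i (fun y ↦ T y * S y) z = 0 := by
    rw [pdm_congr hO hz (T := fun _ ↦ 1) (fun y hy ↦ h y hy), pdm_const]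
  rw [pdm_mul hO hz hT hS] at h1
  have h2 : S z * T z = 1 := mul_eq_one_comm.mp (h z hz)
  calc pdm i T z = (pdm i T z * S z) * T z := by rw [mul_assoc, h2, mul_one]
    _ = _ := by rw [eq_neg_of_add_eq_zero_left h1, neg_mul]

/-! ### Connection matrices and their curvature -/

variable [Fintype ι]

omit hO hz in
/-- Curvature of the connection with matrices `W i`. -/
def curv (W : Fin n → EuclideanSpace ℝ (Fin n) → Matrix ι ι ℝ) (i j : Fin n)
    (z : EuclideanSpace ℝ (Fin n)) : Matrix ι ι ℝ :=
  pdm i (W j) z - pdm j (W i) z + W i z * W j z - W j z * W i z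

omit hO hz in
lemma curv_antisymm (W : Fin n → EuclideanSpace ℝ (Fin n) → Matrix ι ι ℝ) (i j : Fin n) :
    curv W i j z = -curv W j i z := by
  unfold curv; abel

variable {W : Fin n → EuclideanSpace ℝ (Fin n) → Matrix ι ι ℝ} (hW : ∀ i, SmoothM O (W i))
include hW

omit hz in
lemma SmoothM.curv (i j : Fin n) : SmoothM O (curv W i j) :=
  ((((hW j).pdm hO i).sub ((hW i).pdm hO j)).add ((hW i).mul (hW j))).sub ((hW j).mul (hW i))

/-- The second derivatives of `F` cancel by symmetry, and the derivatives of `F'` are eliminated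
with `pdm_inverse`. The inhomogeneous part of the new connection matrices therefore drops out, and
the curvature is merely conjugated. -/
lemma curv_gauge [DecidableEq ι] {F F' : EuclideanSpace ℝ (Fin n) → Matrix ι ι ℝ}
    (hF : SmoothM O F) (hF' : SmoothM O F') (h : ∀ y ∈ O, F' y * F y = 1)
    (i j : Fin n) :
    curv (fun i y ↦ F' y * W i y * F y + F' y * pdm i F y) i j z = F' z * curv W i j z * F z := by
  have h2 : F z * F' z = 1 := mul_eq_one_comm.mp (h z hz)
  have e : ∀ a b, pdm a (fun y ↦ F' y * W b y * F y + F' y * pdm b F y) z =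
      -(F' z * pdm a F z * F' z) * W b z * F z + F' z * pdm a (W b) z * F z
        + F' z * W b z * pdm a F z + -(F' z * pdm a F z * F' z) * pdm b F z
        + F' z * pdm a (pdm b F) z := by
    intro a b
    rw [pdm_add hO hz ((hF'.mul (hW b)).mul hF) (hF'.mul (hF.pdm hO b)),
      pdm_mul hO hz (hF'.mul (hW b)) hF, pdm_mul hO hz hF' (hW b), pdm_mul hO hz hF' (hF.pdm hO b),
      pdm_inverse hO hz hF hF' h]
    noncomm_ring
  have k : ∀ X Y : Matrix ι ι ℝ, X * F z * (F' z * Y) = X * Y := by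
    intro X Y
    rw [mul_assoc, ← mul_assoc (F z), h2, one_mul]
  simp only [curv, e, pdm_comm hO hz hF i j]
  have k1 : ∀ X : Matrix ι ι ℝ, F z * (F' z * X) = X := fun X ↦ by rw [← mul_assoc, h2, one_mul]
  simp only [mul_add, add_mul, mul_sub, sub_mul, neg_mul, mul_assoc, k1]
  abel

/-- The hypothesis says that the bilinear form `H` is parallel. Substituted twice, it turns the
antisymmetric part of the second derivatives of `H`, which is zero, into the action of the curvature
on `H`. -/
lemma curv_skew {H : EuclideanSpace ℝ (Fin n) → Matrix ι ι ℝ} (hH : SmoothM O H)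
    (h : ∀ y ∈ O, ∀ i, pdm i H y = (W i y).transpose * H y + H y * W i y) (i j : Fin n) :
    (curv W i j z).transpose * H z + H z * curv W i j z = 0 := by
  have e : ∀ a b, pdm a (pdm b H) z = (pdm a (W b) z).transpose * H z
      + (W b z).transpose * ((W a z).transpose * H z + H z * W a z)
      + (((W a z).transpose * H z + H z * W a z) * W b z + H z * pdm a (W b) z) := by
    intro a b
    rw [pdm_congr hO hz (fun y hy ↦ h y hy b), pdm_add hO hz ((hW b).transpose.mul hH)
      (hH.mul (hW b)), pdm_mul hO hz (hW b).transpose hH, pdm_mul hO hz hH (hW b), pdm_transpose,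
      h z hz]
  have := pdm_comm hO hz hH i j
  rw [e, e, ← sub_eq_zero] at this
  rw [← this]
  simp only [curv, Matrix.transpose_add, Matrix.transpose_sub, Matrix.transpose_mul]
  noncomm_ring

/-- In the cyclic sum the second derivatives of `W` cancel in pairs, and the cubic terms cancel by
the Jacobi identity. -/
lemma curv_bianchi (i j k : Fin n) :
    (pdm k (curv W i j) z + W k z * curv W i j z - curv W i j z * W k z)
    + (pdm i (curv W j k) z + W i z * curv W j k z - curv W j k z * W i z)
    + (pdm j (curv W k i) z + W j z * curv W k i z - curv W k i z * W j z) = 0 := by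
  have e : ∀ k i j, pdm k (curv W i j) z = pdm k (pdm i (W j)) z - pdm k (pdm j (W i)) z
      + (pdm k (W i) z * W j z + W i z * pdm k (W j) z)
      - (pdm k (W j) z * W i z + W j z * pdm k (W i) z) := by
    intro k i j
    unfold curv
    rw [pdm_sub hO hz ((((hW j).pdm hO i).sub ((hW i).pdm hO j)).add ((hW i).mul (hW j)))
      ((hW j).mul (hW i)), pdm_add hO hz (((hW j).pdm hO i).sub ((hW i).pdm hO j))
      ((hW i).mul (hW j)), pdm_sub hO hz ((hW j).pdm hO i) ((hW i).pdm hO j),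
      pdm_mul hO hz (hW i) (hW j), pdm_mul hO hz (hW j) (hW i)]
  rw [e, e, e, pdm_comm hO hz (hW j) k i, pdm_comm hO hz (hW i) k j, pdm_comm hO hz (hW k) i j]
  simp only [curv]
  noncomm_ring

/-- The Ricci identity: antisymmetrised second covariant derivatives of `S` give `[curv, S]`, and
the hypothesis is `∇S = 0`. This is how parallelism enters the pointwise algebra. -/
lemma curv_commute {S : EuclideanSpace ℝ (Fin n) → Matrix ι ι ℝ} (hS : SmoothM O S)
    (h : ∀ y ∈ O, ∀ i, pdm i S y = S y * W i y - W i y * S y) (i j : Fin n) :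
    curv W i j z * S z = S z * curv W i j z := by
  have e : ∀ a b, pdm a (pdm b S) z =
      (S z * W a z - W a z * S z) * W b z + S z * pdm a (W b) z
      - (pdm a (W b) z * S z + W b z * (S z * W a z - W a z * S z)) := by
    intro a b
    rw [pdm_congr hO hz (fun y hy ↦ h y hy b), pdm_sub hO hz (hS.mul (hW b)) ((hW b).mul hS),
      pdm_mul hO hz hS (hW b), pdm_mul hO hz (hW b) hS, h z hz]
  have := pdm_comm hO hz hS i j
  rw [e, e, ← sub_eq_zero] at this
  rw [← sub_eq_zero, ← neg_eq_zero, ← this]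
  simp only [curv]
  noncomm_ring

end MatrixCalculus

/-! ### Local Riemannian geometry of a metric given by its matrix of components -/

section LocalGeometry

variable {n : ℕ}

/-- The components of a smooth non-degenerate metric on the open set `O`. -/
structure IsMetricOn (O : Set (EuclideanSpace ℝ (Fin n)))
    (G : EuclideanSpace ℝ (Fin n) → Matrix (Fin n) (Fin n) ℝ) : Prop where
  isOpen : IsOpen O
  smooth : SmoothM O G
  symm : ∀ z ∈ O, ∀ i j, G z i j = G z j i
  isUnit : ∀ z ∈ O, IsUnit (G z).det

/-- Connection matrices of the Levi-Civita connection. -/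
def chr (G : EuclideanSpace ℝ (Fin n) → Matrix (Fin n) (Fin n) ℝ) (i : Fin n)
    (z : EuclideanSpace ℝ (Fin n)) : Matrix (Fin n) (Fin n) ℝ :=
  Matrix.of fun k j ↦ christoffel G k i j z

variable {O : Set (EuclideanSpace ℝ (Fin n))} {z : EuclideanSpace ℝ (Fin n)}
  {G : EuclideanSpace ℝ (Fin n) → Matrix (Fin n) (Fin n) ℝ}

lemma riemann_eq_curv (i j k l : Fin n) :
    riemann G i j k l z = curv (chr G) i j z k l := by
  simp only [riemann, curv, chr, pdm, Matrix.sub_apply, Matrix.add_apply, Matrix.mul_apply,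
    Matrix.of_apply, Finset.sum_sub_distrib]
  ring

namespace IsMetricOn

variable (h : IsMetricOn O G)
include h

lemma inv_smooth : SmoothM O (fun y ↦ (G y)⁻¹) := h.smooth.inv h.isUnit

lemma chr_smooth (i : Fin n) : SmoothM O (chr G i) := by
  intro k j
  refine contDiffOn_const.mul (ContDiffOn.sum fun l _ ↦ (h.inv_smooth k l).mul ?_)
  exact ((contDiffOn_pd h.isOpen (h.smooth l j) i).add
    (contDiffOn_pd h.isOpen (h.smooth l i) j)).sub (contDiffOn_pd h.isOpen (h.smooth i j) l)

lemma riemann_smooth (i j k l : Fin n) : ContDiffOn ℝ ∞ (riemann G i j k l) O :=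
  (SmoothM.curv h.isOpen h.chr_smooth i j k l).congr fun _ _ ↦ riemann_eq_curv i j k l

lemma ricci_smooth (j l : Fin n) : ContDiffOn ℝ ∞ (ricci G j l) O :=
  ContDiffOn.sum fun k _ ↦ h.riemann_smooth k j k l

lemma schouten_smooth (i j : Fin n) : ContDiffOn ℝ ∞ (schouten G i j) O := by
  have : ContDiffOn ℝ ∞ (scalarCurvature G) O :=
    ContDiffOn.sum fun i _ ↦ ContDiffOn.sum fun j _ ↦ (h.inv_smooth i j).mul (h.ricci_smooth i j)
  exact contDiffOn_const.mul ((h.ricci_smooth i j).sub ((this.div_const _).mul (h.smooth i j)))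

lemma connectionMatrix_smooth (i : Fin n) : SmoothM O (connectionMatrix G i) := by
  rintro (_ | j | _) (_ | l | _)
  all_goals simp only [connectionMatrix, Matrix.of_apply]
  all_goals try exact contDiffOn_const
  · exact (h.smooth _ _).neg
  · exact ContDiffOn.sum fun a _ ↦ (h.inv_smooth _ _).mul (h.schouten_smooth _ _)
  · exact h.chr_smooth i _ _
  · exact (h.schouten_smooth _ _).neg

variable (hz : z ∈ O)
include hz

lemma pd_symm (a i j : Fin n) : pd a (fun y ↦ G y i j) z = pd a (fun y ↦ G y j i) z :=
  pd_congr h.isOpen hz (fun y hy ↦ h.symm y hy i j) a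

lemma transpose_eq : (G z).transpose = G z := by
  ext i j
  exact h.symm z hz j i

lemma inv_mul : (G z)⁻¹ * G z = 1 := Matrix.nonsing_inv_mul _ (h.isUnit z hz)

lemma mul_inv : G z * (G z)⁻¹ = 1 := Matrix.mul_nonsing_inv _ (h.isUnit z hz)

lemma inv_transpose : ((G z)⁻¹).transpose = (G z)⁻¹ := by
  rw [Matrix.transpose_nonsing_inv, h.transpose_eq hz]

lemma inv_symm (i j : Fin n) : (G z)⁻¹ i j = (G z)⁻¹ j i :=
  congrFun (congrFun (h.inv_transpose hz) j) i

lemma christoffel_symm (k i j : Fin n) : christoffel G k i j z = christoffel G k j i z := by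
  unfold christoffel
  congr 1
  refine Finset.sum_congr rfl fun l _ ↦ ?_
  rw [h.pd_symm hz l i j]
  ring

lemma mul_chr (i : Fin n) : G z * chr G i z = Matrix.of fun l j ↦
    1 / 2 * (pd i (fun y ↦ G y l j) z + pd j (fun y ↦ G y l i) z - pd l (fun y ↦ G y i j) z) := by
  have : chr G i z = (G z)⁻¹ * Matrix.of fun l j ↦
    1 / 2 * (pd i (fun y ↦ G y l j) z + pd j (fun y ↦ G y l i) z - pd l (fun y ↦ G y i j) z) := by
    ext k j
    simp only [chr, christoffel, Matrix.of_apply, Matrix.mul_apply, Finset.mul_sum]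
    exact Finset.sum_congr rfl fun l _ ↦ by ring
  rw [this, ← mul_assoc, h.mul_inv hz, one_mul]

/-- This is `∇g = 0` in matrix form, read off from the Koszul formula `mul_chr`. -/
lemma pdm_metric (i : Fin n) :
    pdm i G z = (chr G i z).transpose * G z + G z * chr G i z := by
  have : (chr G i z).transpose * G z = (G z * chr G i z).transpose := by
    rw [Matrix.transpose_mul, h.transpose_eq hz]
  rw [this, h.mul_chr hz]
  ext l j
  simp only [pdm, Matrix.add_apply, Matrix.transpose_apply, Matrix.of_apply]
  rw [h.pd_symm hz i j l, h.pd_symm hz j l i, h.pd_symm hz l i j]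
  ring

lemma pdm_inv (i : Fin n) : pdm i (fun y ↦ (G y)⁻¹) z =
    -(chr G i z * (G z)⁻¹ + (G z)⁻¹ * (chr G i z).transpose) := by
  rw [pdm_inverse h.isOpen hz h.smooth h.inv_smooth (fun y hy ↦ h.inv_mul hy), h.pdm_metric hz]
  have h1 : ∀ X, (G z)⁻¹ * (G z * X) = X := fun X ↦ by rw [← mul_assoc, h.inv_mul hz, one_mul]
  simp only [mul_add, add_mul, mul_assoc, h.mul_inv hz, h1, mul_one]
  abel

/-- The Levi-Civita connection is the only symmetric metric connection. -/
lemma chr_unique {W : Fin n → Matrix (Fin n) (Fin n) ℝ}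
    (hm : ∀ i, pdm i G z = (W i).transpose * G z + G z * W i)
    (hs : ∀ i j k, W i k j = W j k i) (i : Fin n) : W i = chr G i z := by
  have key : G z * W i = G z * chr G i z := by
    rw [h.mul_chr hz]
    have e : ∀ a l j, pd a (fun y ↦ G y l j) z = (G z * W a) j l + (G z * W a) l j := by
      intro a l j
      have h1 : (W a).transpose * G z = (G z * W a).transpose := by
        rw [Matrix.transpose_mul, h.transpose_eq hz]
      have := congrFun (congrFun (hm a) l) j
      rw [h1] at this
      simpa only [pdm, Matrix.of_apply, Matrix.add_apply, Matrix.transpose_apply] using this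
    have s : ∀ a b l, (G z * W a) l b = (G z * W b) l a := by
      intro a b l
      simp only [Matrix.mul_apply]
      exact Finset.sum_congr rfl fun k _ ↦ by rw [hs]
    ext l j
    simp only [Matrix.of_apply, e]
    -- Of the six terms of the Koszul formula, symmetry cancels four in pairs and makes the other
    -- two equal.
    rw [s l i j, s l j i, s j i l]
    ring
  calc W i = (G z)⁻¹ * (G z * W i) := by rw [← mul_assoc, h.inv_mul hz, one_mul]
    _ = _ := by rw [key, ← mul_assoc, h.inv_mul hz, one_mul]

lemma riemann_skew (i j : Fin n) :
    (curv (chr G) i j z).transpose * G z + G z * curv (chr G) i j z = 0 :=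
  curv_skew h.isOpen hz h.chr_smooth h.smooth (fun _ hy ↦ h.pdm_metric hy) i j

/-- Torsion-freeness alone: the lower indices of the Christoffel symbols are symmetric, so the
derivative terms and the quadratic terms cancel in pairs in the cyclic sum. -/
lemma riemann_cyclic (i j l k : Fin n) :
    curv (chr G) i j z k l + curv (chr G) j l z k i + curv (chr G) l i z k j = 0 := by
  simp only [← riemann_eq_curv, riemann]
  have e : ∀ a b c, pd a (christoffel G k b c) z = pd a (christoffel G k c b) z :=
    fun a b c ↦ pd_congr h.isOpen hz (fun y hy ↦ h.christoffel_symm hy k b c) a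
  have s : ∀ a b c, ∑ m, christoffel G k a m z * christoffel G m b c z =
      ∑ m, christoffel G k a m z * christoffel G m c b z := fun a b c ↦
    Finset.sum_congr rfl fun m _ ↦ by rw [h.christoffel_symm hz m b c]
  simp only [Finset.sum_sub_distrib]
  rw [e i j l, e j l i, e l i j, s i j l, s j l i, s l i j]
  ring

end IsMetricOn

/-- The algebraic symmetries of a curvature tensor imply its pair symmetry. -/
lemma pair_symm {ι : Type*} {T : ι → ι → ι → ι → ℝ} (h1 : ∀ i j k l, T i j k l = -T j i k l)
    (h2 : ∀ i j k l, T i j k l = -T i j l k)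
    (h3 : ∀ i j l k, T i j k l + T j l k i + T l i k j = 0) (i j k l : ι) :
    T i j k l = T k l i j := by
  have a1 := h3 i j l k
  have a2 := h3 j k l i
  have a3 := h3 k l i j
  have a4 := h3 l i j k
  have a5 := h3 i j k l
  have a6 := h3 k l i j
  have a7 := h3 j l k i
  linarith [h1 i j k l, h1 j l k i, h1 l i k j, h1 k i l j, h1 k l i j, h1 k l j i, h1 j k i l,
    h1 i k j l, h1 l i j k, h1 l j i k, h1 j k l i, h1 i j l k, h1 l k i j, h1 l k j i, h1 k i j l,
    h2 i j k l, h2 j l k i, h2 l i k j, h2 k i l j, h2 k l i j, h2 j k i l, h2 i k j l, h2 l j i k,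
    h2 l k i j, h2 k i j l, h2 l i j k, h2 j k l i]

namespace IsMetricOn

variable (h : IsMetricOn O G) (hz : z ∈ O)
include h hz

/-- The pair symmetry of the lowered curvature tensor `T`, contracted with the symmetric inverse
metric. -/
lemma ricci_symm (j l : Fin n) : ricci G j l z = ricci G l j z := by
  set T : Fin n → Fin n → Fin n → Fin n → ℝ := fun i j k l ↦ (G z * curv (chr G) i j z) k l with hT
  have t1 : ∀ i j k l, T i j k l = -T j i k l := by
    intro i j k l
    simp only [hT]
    rw [curv_antisymm, mul_neg, Matrix.neg_apply]
  have t2 : ∀ i j k l, T i j k l = -T i j l k := by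
    intro i j k l
    have := congrFun (congrFun (h.riemann_skew hz i j) k) l
    have h1 : (curv (chr G) i j z).transpose * G z = (G z * curv (chr G) i j z).transpose := by
      rw [Matrix.transpose_mul, h.transpose_eq hz]
    rw [h1] at this
    simp only [Matrix.add_apply, Matrix.transpose_apply, Matrix.zero_apply] at this
    simp only [hT]
    linarith
  have t3 : ∀ i j l k, T i j k l + T j l k i + T l i k j = 0 := by
    intro i j l k
    simp only [hT, Matrix.mul_apply, ← Finset.sum_add_distrib, ← mul_add]
    refine Finset.sum_eq_zero fun m _ ↦ ?_
    rw [h.riemann_cyclic hz i j l m, mul_zero]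
  have e : ∀ j l, ricci G j l z = ∑ k, ∑ m, (G z)⁻¹ k m * T k j m l := by
    intro j l
    refine Finset.sum_congr rfl fun k _ ↦ ?_
    rw [riemann_eq_curv, ← Matrix.mul_apply (M := (G z)⁻¹) (N := G z * curv (chr G) k j z),
      ← mul_assoc, h.inv_mul hz, one_mul]
  rw [e, e, Finset.sum_comm]
  refine Finset.sum_congr rfl fun k _ ↦ Finset.sum_congr rfl fun m _ ↦ ?_
  rw [h.inv_symm hz, pair_symm t1 t2 t3]

lemma schouten_symm (i j : Fin n) : schouten G i j z = schouten G j i z := by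
  rw [schouten, schouten, h.ricci_symm hz, h.symm z hz]

end IsMetricOn

end LocalGeometry

/-! ### Curvature of the standard tractor connection -/

section TractorCurvature

variable {n : ℕ}

variable (n) in
/-- The index of the top slot. -/
abbrev topIdx : TIndex n := .inl ()

/-- The index of a tangent slot. -/
abbrev midIdx (k : Fin n) : TIndex n := .inr (.inl k)

variable (n) in
/-- The index of the bottom slot. -/
abbrev botIdx : TIndex n := .inr (.inr ())

lemma TIndex_cases (A : TIndex n) : A = topIdx n ∨ (∃ k, A = midIdx k) ∨ A = botIdx n := by
  rcases A with A | k | A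
  · exact Or.inl rfl
  · exact Or.inr (Or.inl ⟨k, rfl⟩)
  · exact Or.inr (Or.inr rfl)

lemma sum_TIndex {M : Type*} [AddCommMonoid M] (f : TIndex n → M) :
    ∑ A, f A = f (topIdx n) + (∑ k, f (midIdx k) + f (botIdx n)) := by
  simp [Fintype.sum_sum_type]

/-- Matrix of the tractor metric in the tractor frame. -/
def tractorH (G : EuclideanSpace ℝ (Fin n) → Matrix (Fin n) (Fin n) ℝ)
    (z : EuclideanSpace ℝ (Fin n)) : Matrix (TIndex n) (TIndex n) ℝ := Matrix.of fun A B ↦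
  match A, B with
  | .inl _, .inr (.inr _) => 1
  | .inr (.inl k), .inr (.inl j) => G z k j
  | .inr (.inr _), .inl _ => 1
  | _, _ => 0

variable {O : Set (EuclideanSpace ℝ (Fin n))} {z : EuclideanSpace ℝ (Fin n)}
  {G : EuclideanSpace ℝ (Fin n) → Matrix (Fin n) (Fin n) ℝ}

section Entries

variable (i k j : Fin n)

@[simp] lemma conn_top_top : connectionMatrix G i z (topIdx n) (topIdx n) = 0 := rfl
@[simp] lemma conn_top_mid : connectionMatrix G i z (topIdx n) (midIdx j) = -G z i j := rfl
@[simp] lemma conn_top_bot : connectionMatrix G i z (topIdx n) (botIdx n) = 0 := rfl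
@[simp] lemma conn_mid_top : connectionMatrix G i z (midIdx k) (topIdx n) =
  ∑ l, (G z)⁻¹ k l * schouten G i l z := rfl
@[simp] lemma conn_mid_mid : connectionMatrix G i z (midIdx k) (midIdx j) =
  christoffel G k i j z := rfl
@[simp] lemma conn_mid_bot : connectionMatrix G i z (midIdx k) (botIdx n) =
  if k = i then 1 else 0 := rfl
@[simp] lemma conn_bot_top : connectionMatrix G i z (botIdx n) (topIdx n) = 0 := rfl
@[simp] lemma conn_bot_mid : connectionMatrix G i z (botIdx n) (midIdx j) =
  -schouten G i j z := rfl
@[simp] lemma conn_bot_bot : connectionMatrix G i z (botIdx n) (botIdx n) = 0 := rfl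
@[simp] lemma tH_top_top : tractorH G z (topIdx n) (topIdx n) = 0 := rfl
@[simp] lemma tH_top_mid : tractorH G z (topIdx n) (midIdx j) = 0 := rfl
@[simp] lemma tH_top_bot : tractorH G z (topIdx n) (botIdx n) = 1 := rfl
@[simp] lemma tH_mid_top : tractorH G z (midIdx k) (topIdx n) = 0 := rfl
@[simp] lemma tH_mid_mid : tractorH G z (midIdx k) (midIdx j) = G z k j := rfl
@[simp] lemma tH_mid_bot : tractorH G z (midIdx k) (botIdx n) = 0 := rfl
@[simp] lemma tH_bot_top : tractorH G z (botIdx n) (topIdx n) = 1 := rfl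
@[simp] lemma tH_bot_mid : tractorH G z (botIdx n) (midIdx j) = 0 := rfl
@[simp] lemma tH_bot_bot : tractorH G z (botIdx n) (botIdx n) = 0 := rfl

end Entries

/-- Entries of the statement that `S` is skew for the tractor metric. -/
lemma skew_entries {S : Matrix (TIndex n) (TIndex n) ℝ}
    (hS : S.transpose * tractorH G z + tractorH G z * S = 0) :
    S (topIdx n) (botIdx n) = 0 ∧ S (botIdx n) (topIdx n) = 0 ∧
    S (botIdx n) (botIdx n) = -S (topIdx n) (topIdx n) ∧
    (∀ k, S (topIdx n) (midIdx k) = -∑ m, G z k m * S (midIdx m) (botIdx n)) ∧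
    (∀ k, S (botIdx n) (midIdx k) = -∑ m, S (midIdx m) (topIdx n) * G z m k) ∧
    ∀ k l, ∑ m, S (midIdx m) (midIdx k) * G z m l + ∑ m, G z k m * S (midIdx m) (midIdx l) = 0 := by
  have e : ∀ A B, (∑ C, S C A * tractorH G z C B) + ∑ C, tractorH G z A C * S C B = 0 :=
    fun A B ↦ congrFun (congrFun hS A) B
  simp only [sum_TIndex] at e
  refine ⟨?_, ?_, ?_, fun k ↦ ?_, fun k ↦ ?_, fun k l ↦ ?_⟩
  · have := e (botIdx n) (botIdx n)
    simp at this
    linarith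
  · have := e (topIdx n) (topIdx n)
    simp at this
    linarith
  · have := e (topIdx n) (botIdx n)
    simp at this
    linarith
  · have := e (midIdx k) (botIdx n)
    simp at this
    linarith
  · have := e (topIdx n) (midIdx k)
    simp at this
    linarith
  · have := e (midIdx k) (midIdx l)
    simpa using this

lemma sum_symm_mul_antisymm {ι : Type*} [Fintype ι] {S T : ι → ι → ℝ} (hS : ∀ a b, S a b = S b a)
    (hT : ∀ a b, T a b = -T b a) : ∑ a, ∑ b, S a b * T a b = 0 := by
  have : ∑ a, ∑ b, S a b * T a b = -∑ a, ∑ b, S a b * T a b := by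
    conv_lhs => rw [Finset.sum_comm]
    simp only [← Finset.sum_neg_distrib]
    exact Finset.sum_congr rfl fun a _ ↦ Finset.sum_congr rfl fun b _ ↦ by
      rw [hS b a, hT b a]; ring
  linarith

namespace IsMetricOn

variable (h : IsMetricOn O G)
include h

lemma tractorH_smooth : SmoothM O (tractorH G) := by
  rintro (_ | j | _) (_ | l | _)
  all_goals simp only [tractorH, Matrix.of_apply]
  all_goals first | exact contDiffOn_const | exact h.smooth _ _

variable (hz : z ∈ O)
include hz

lemma sum_metric_inv (a : Fin n) (f : Fin n → ℝ) :
    ∑ k, G z a k * ∑ l, (G z)⁻¹ k l * f l = f a := by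
  have : (G z).mulVec ((G z)⁻¹.mulVec f) a = f a := by
    rw [Matrix.mulVec_mulVec, h.mul_inv hz, Matrix.one_mulVec]
  simpa [Matrix.mulVec, dotProduct] using this

lemma sum_inv_metric (a : Fin n) (f : Fin n → ℝ) :
    ∑ k, (G z)⁻¹ a k * ∑ l, G z k l * f l = f a := by
  have : (G z)⁻¹.mulVec ((G z).mulVec f) a = f a := by
    rw [Matrix.mulVec_mulVec, h.inv_mul hz, Matrix.one_mulVec]
  simpa [Matrix.mulVec, dotProduct] using this

/-- The tractor metric is parallel. The tangent block is `∇g = 0`; in the mixed blocks `-G` cancels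
against the lowered identity, and `-P` against the raised Schouten tensor lowered again. -/
lemma pdm_tractorH (i : Fin n) : pdm i (tractorH G) z =
    (connectionMatrix G i z).transpose * tractorH G z
      + tractorH G z * connectionMatrix G i z := by
  have hG := h.pdm_metric hz i
  have sG : ∀ i j, schouten G i j z = ∑ m, (∑ l, (G z)⁻¹ m l * schouten G i l z) * G z m j := by
    intro i j
    rw [← h.sum_metric_inv hz j (fun l ↦ schouten G i l z)]
    exact Finset.sum_congr rfl fun m _ ↦ by rw [h.symm z hz j m, mul_comm]
  ext A B
  simp only [Matrix.add_apply, Matrix.mul_apply, Matrix.transpose_apply, sum_TIndex]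
  rcases TIndex_cases A with rfl | ⟨k, rfl⟩ | rfl <;> rcases TIndex_cases B with rfl | ⟨l, rfl⟩ | rfl
  · simp [pdm, pd_const]
  · simp [pdm, pd_const, ← sG]
  · simp [pdm, pd_const]
  · simp only [pdm, pd_const, Matrix.of_apply, tH_mid_top, conn_top_mid, conn_mid_mid, tH_top_top,
      conn_mid_top, conn_bot_mid, tH_bot_top, tH_mid_mid, conn_top_top, tH_mid_bot]
    rw [h.sum_metric_inv hz k (fun l ↦ schouten G i l z)]
    simp
  · have := congrFun (congrFun hG k) l
    simp only [pdm, Matrix.add_apply, Matrix.mul_apply, Matrix.transpose_apply,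
      Matrix.of_apply, chr] at this
    simpa [pdm] using this
  · simp [pdm, pd_const, h.symm z hz i k]
  · simp [pdm, pd_const]
  · simp [pdm, pd_const, h.symm z hz i]
  · simp [pdm, pd_const]

lemma tractorCurvature_skew (i j : Fin n) :
    (curv (connectionMatrix G) i j z).transpose * tractorH G z
      + tractorH G z * curv (connectionMatrix G) i j z = 0 :=
  curv_skew h.isOpen hz h.connectionMatrix_smooth h.tractorH_smooth
    (fun _ hy i ↦ h.pdm_tractorH hy i) i j

omit h hz in
lemma _root_.ConformalTractor.curv_entry (i j : Fin n) (A B : TIndex n) :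
    curv (connectionMatrix G) i j z A B =
      pd i (fun y ↦ connectionMatrix G j y A B) z - pd j (fun y ↦ connectionMatrix G i y A B) z
      + ∑ C, connectionMatrix G i z A C * connectionMatrix G j z C B
      - ∑ C, connectionMatrix G j z A C * connectionMatrix G i z C B := rfl

/-- The entry is the torsion of the Levi-Civita connection. -/
lemma curv_mid_bot (i j k : Fin n) :
    curv (connectionMatrix G) i j z (midIdx k) (botIdx n) = 0 := by
  rw [curv_entry]
  simp [pd_const, h.christoffel_symm hz k i j]

lemma curv_top_mid (i j k : Fin n) :
    curv (connectionMatrix G) i j z (topIdx n) (midIdx k) = 0 := by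
  rw [(skew_entries (h.tractorCurvature_skew hz i j)).2.2.2.1]
  simp [h.curv_mid_bot hz]

/-- The entry is the antisymmetric part of the Schouten tensor. -/
lemma curv_top_top (i j : Fin n) :
    curv (connectionMatrix G) i j z (topIdx n) (topIdx n) = 0 := by
  rw [curv_entry]
  simp only [sum_TIndex, conn_top_top, conn_top_mid, conn_mid_top, conn_bot_top, pd_const, neg_mul,
    Finset.sum_neg_distrib]
  rw [h.sum_metric_inv hz i fun l ↦ schouten G j l z,
    h.sum_metric_inv hz j fun l ↦ schouten G i l z, h.schouten_symm hz]
  ring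

lemma curv_bot_bot (i j : Fin n) :
    curv (connectionMatrix G) i j z (botIdx n) (botIdx n) = 0 := by
  rw [(skew_entries (h.tractorCurvature_skew hz i j)).2.2.1, h.curv_top_top hz, neg_zero]

lemma curv_top_bot (i j : Fin n) :
    curv (connectionMatrix G) i j z (topIdx n) (botIdx n) = 0 :=
  (skew_entries (h.tractorCurvature_skew hz i j)).1

lemma curv_bot_top (i j : Fin n) :
    curv (connectionMatrix G) i j z (botIdx n) (topIdx n) = 0 :=
  (skew_entries (h.tractorCurvature_skew hz i j)).2.1

/-- By skewness for the tractor metric the left column is the bottom row with its index raised, up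
to sign. Hence `Ω` is determined by its middle block and its bottom row. -/
lemma curv_mid_top (i j k : Fin n) :
    curv (connectionMatrix G) i j z (midIdx k) (topIdx n) =
      -∑ l, (G z)⁻¹ k l * curv (connectionMatrix G) i j z (botIdx n) (midIdx l) := by
  have := (skew_entries (h.tractorCurvature_skew hz i j)).2.2.2.2.1
  simp only [this, mul_neg, Finset.sum_neg_distrib, neg_neg]
  rw [← h.sum_inv_metric hz k fun l ↦ curv (connectionMatrix G) i j z (midIdx l) (topIdx n)]
  exact Finset.sum_congr rfl fun l _ ↦ by
    congr 1
    exact Finset.sum_congr rfl fun m _ ↦ by rw [h.symm z hz l m, mul_comm]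

/-- Identifies the middle block as the Weyl tensor: Riemann tensor minus the terms built from the
Schouten tensor and the metric. -/
lemma curv_mid_mid (i j k l : Fin n) :
    curv (connectionMatrix G) i j z (midIdx k) (midIdx l) = curv (chr G) i j z k l
      - (∑ m, (G z)⁻¹ k m * schouten G i m z) * G z j l - (if k = i then 1 else 0) * schouten G j l z
      + (∑ m, (G z)⁻¹ k m * schouten G j m z) * G z i l
      + (if k = j then 1 else 0) * schouten G i l z := by
  rw [curv_entry]
  simp only [sum_TIndex, curv, chr, pdm, Matrix.sub_apply, Matrix.add_apply, Matrix.mul_apply,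
    Matrix.of_apply, conn_mid_mid, conn_mid_top, conn_top_mid, conn_mid_bot, conn_bot_mid]
  ring

/-- Up to sign this is the Cotton tensor `∇ᵢPⱼₗ - ∇ⱼPᵢₗ`; the Christoffel symbols with lower indices
`i, j` cancel in it. -/
lemma curv_bot_mid (i j l : Fin n) :
    curv (connectionMatrix G) i j z (botIdx n) (midIdx l) =
      -pd i (schouten G j l) z + pd j (schouten G i l) z
      - ∑ m, schouten G i m z * christoffel G m j l z
      + ∑ m, schouten G j m z * christoffel G m i l z := by
  rw [curv_entry]
  simp only [sum_TIndex, conn_bot_top, conn_bot_mid, conn_bot_bot, conn_mid_mid, pd_neg, neg_mul,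
    Finset.sum_neg_distrib]
  ring

/-- The first Bianchi identity of the Riemann tensor; the correction terms cancel because the metric
and the Schouten tensor are symmetric. -/
lemma weyl_cyclic (i j l k : Fin n) :
    curv (connectionMatrix G) i j z (midIdx k) (midIdx l)
      + curv (connectionMatrix G) j l z (midIdx k) (midIdx i)
      + curv (connectionMatrix G) l i z (midIdx k) (midIdx j) = 0 := by
  simp only [h.curv_mid_mid hz]
  have := h.riemann_cyclic hz i j l k
  rw [h.symm z hz l i, h.symm z hz l j, h.symm z hz j i, h.schouten_symm hz l i,
    h.schouten_symm hz l j, h.schouten_symm hz j i]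
  linear_combination this

lemma cotton_cyclic (i j l : Fin n) :
    curv (connectionMatrix G) i j z (botIdx n) (midIdx l)
      + curv (connectionMatrix G) j l z (botIdx n) (midIdx i)
      + curv (connectionMatrix G) l i z (botIdx n) (midIdx j) = 0 := by
  simp only [h.curv_bot_mid hz]
  have e : ∀ a b c, pd a (schouten G b c) z = pd a (schouten G c b) z :=
    fun a b c ↦ pd_congr h.isOpen hz (fun y hy ↦ h.schouten_symm hy b c) a
  have s : ∀ a b c, ∑ m, schouten G a m z * christoffel G m b c z =
      ∑ m, schouten G a m z * christoffel G m c b z := fun a b c ↦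
    Finset.sum_congr rfl fun m _ ↦ by rw [h.christoffel_symm hz m b c]
  rw [e i j l, e j l i, e l i j, s i j l, s j l i, s l i j]
  ring

lemma inv_trace : ∑ i, ∑ j, (G z)⁻¹ i j * G z i j = n := by
  have : ((G z)⁻¹ * G z).trace = n := by rw [h.inv_mul hz]; simp
  rw [← this, Matrix.trace]
  refine Finset.sum_congr rfl fun i _ ↦ ?_
  simp only [Matrix.diag, Matrix.mul_apply]
  exact Finset.sum_congr rfl fun j _ ↦ by rw [h.symm z hz i j]

lemma schouten_trace (hn : 3 ≤ n) : ∑ i, ∑ j, (G z)⁻¹ i j * schouten G i j z =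
    scalarCurvature G z / (2 * ((n : ℝ) - 1)) := by
  have h1 : (3 : ℝ) ≤ n := by exact_mod_cast hn
  have : ∑ i, ∑ j, (G z)⁻¹ i j * schouten G i j z = 1 / ((n : ℝ) - 2) * (scalarCurvature G z
      - scalarCurvature G z / (2 * ((n : ℝ) - 1)) * ∑ i, ∑ j, (G z)⁻¹ i j * G z i j) := by
    rw [scalarCurvature, mul_sub, ← scalarCurvature]
    simp only [Finset.mul_sum, scalarCurvature]
    simp only [← Finset.sum_sub_distrib]
    refine Finset.sum_congr rfl fun i _ ↦ Finset.sum_congr rfl fun j _ ↦ ?_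
    rw [schouten, scalarCurvature]
    ring
  rw [this, h.inv_trace hz]
  have h2 : (n : ℝ) - 2 ≠ 0 := by linarith
  have h3 : (n : ℝ) - 1 ≠ 0 := by linarith
  field_simp
  ring

/-- The trace of the middle block is `Ric - (n - 2) P - (tr P) g`, and the normalisation of the
Schouten tensor is the one that makes it vanish. -/
lemma weyl_trace (hn : 3 ≤ n) (j l : Fin n) :
    ∑ k, curv (connectionMatrix G) k j z (midIdx k) (midIdx l) = 0 := by
  have h1 : (3 : ℝ) ≤ n := by exact_mod_cast hn
  have h2 : (n : ℝ) - 2 ≠ 0 := by linarith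
  simp only [h.curv_mid_mid hz, Finset.sum_add_distrib, Finset.sum_sub_distrib, ← Finset.sum_mul,
    if_true, Finset.sum_const, Finset.card_univ, Fintype.card_fin, nsmul_eq_mul,
    h.schouten_trace hz hn]
  have e1 : ∑ k, (∑ m, (G z)⁻¹ k m * schouten G j m z) * G z k l = schouten G j l z := by
    rw [← h.sum_metric_inv hz l fun m ↦ schouten G j m z]
    exact Finset.sum_congr rfl fun m _ ↦ by rw [h.symm z hz l m, mul_comm]
  have e2 : ∑ k, (if k = j then 1 else 0) * schouten G k l z = schouten G j l z := by simp
  have e3 : ∑ k, curv (chr G) k j z k l = ricci G j l z :=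
    Finset.sum_congr rfl fun k _ ↦ (riemann_eq_curv k j k l).symm
  rw [e1, e2, e3, schouten]
  field_simp
  ring

end IsMetricOn

end TractorCurvature

/-! ### Weyl and Cotton tensors, and endomorphisms commuting with the tractor curvature -/

section ParallelAdjoint

variable {n : ℕ} {O : Set (EuclideanSpace ℝ (Fin n))} {z : EuclideanSpace ℝ (Fin n)}
  {G : EuclideanSpace ℝ (Fin n) → Matrix (Fin n) (Fin n) ℝ}

/-- The middle block of the tractor curvature. -/
def weylM (G : EuclideanSpace ℝ (Fin n) → Matrix (Fin n) (Fin n) ℝ) (i j : Fin n)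
    (z : EuclideanSpace ℝ (Fin n)) : Matrix (Fin n) (Fin n) ℝ :=
  Matrix.of fun k l ↦ curv (connectionMatrix G) i j z (midIdx k) (midIdx l)

/-- The bottom row of the tractor curvature. -/
def cotton (G : EuclideanSpace ℝ (Fin n) → Matrix (Fin n) (Fin n) ℝ) (i j l : Fin n)
    (z : EuclideanSpace ℝ (Fin n)) : ℝ :=
  curv (connectionMatrix G) i j z (botIdx n) (midIdx l)

lemma weylM_antisymm (i j : Fin n) : weylM G i j z = -weylM G j i z := by
  ext k l
  simp only [weylM, Matrix.of_apply, Matrix.neg_apply]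
  rw [curv_antisymm, Matrix.neg_apply]

lemma cotton_antisymm (i j l : Fin n) : cotton G i j l z = -cotton G j i l z := by
  rw [cotton, curv_antisymm, Matrix.neg_apply, cotton]

/-- The middle block of the tractor curvature with the last index raised. -/
def weylUp (G : EuclideanSpace ℝ (Fin n) → Matrix (Fin n) (Fin n) ℝ) (i j : Fin n)
    (z : EuclideanSpace ℝ (Fin n)) : Matrix (Fin n) (Fin n) ℝ :=
  weylM G i j z * (G z)⁻¹

/-- The bottom row of the tractor curvature with its index raised. -/
def cottonUp (G : EuclideanSpace ℝ (Fin n) → Matrix (Fin n) (Fin n) ℝ) (i j b : Fin n)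
    (z : EuclideanSpace ℝ (Fin n)) : ℝ :=
  ∑ l, (G z)⁻¹ b l * cotton G i j l z

lemma cottonUp_antisymm (i j b : Fin n) : cottonUp G i j b z = -cottonUp G j i b z := by
  simp only [cottonUp, ← Finset.sum_neg_distrib]
  exact Finset.sum_congr rfl fun l _ ↦ by rw [cotton_antisymm]; ring

namespace IsMetricOn

variable (h : IsMetricOn O G)
include h

lemma weylM_smooth (i j : Fin n) : SmoothM O (weylM G i j) :=
  fun k l ↦ SmoothM.curv h.isOpen h.connectionMatrix_smooth i j (midIdx k) (midIdx l)

lemma weylUp_smooth (i j : Fin n) : SmoothM O (weylUp G i j) :=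
  (h.weylM_smooth i j).mul h.inv_smooth

variable (hz : z ∈ O)
include hz

lemma weylM_skew (i j : Fin n) : (weylM G i j z).transpose * G z + G z * weylM G i j z = 0 := by
  ext k l
  exact (skew_entries (h.tractorCurvature_skew hz i j)).2.2.2.2.2 k l

/-- Raising an index turns skewness for `G` into plain antisymmetry. With both endomorphism indices
up, contractions with form indices need no metric, so their derivatives produce no derivatives of
`G`. -/
lemma weylUp_skew (i j a b : Fin n) : weylUp G i j z a b = -weylUp G i j z b a := by
  have h1 : (weylUp G i j z).transpose + weylUp G i j z = 0 := by
    have := congrArg (fun X ↦ (G z)⁻¹ * X * (G z)⁻¹) (h.weylM_skew hz i j)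
    simp only [mul_add, add_mul, mul_zero, zero_mul] at this
    rw [← this, weylUp, Matrix.transpose_mul, h.inv_transpose hz, ← mul_assoc,
      ← mul_assoc ((G z)⁻¹) (G z), h.inv_mul hz, one_mul, mul_assoc, mul_assoc, h.mul_inv hz,
      mul_one]
  have := congrFun (congrFun h1 b) a
  simp only [Matrix.add_apply, Matrix.transpose_apply, Matrix.zero_apply] at this
  linarith

lemma weylUp_trace (hn : 3 ≤ n) (j b : Fin n) : ∑ k, weylUp G k j z k b = 0 := by
  simp only [weylUp, Matrix.mul_apply]
  rw [Finset.sum_comm]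
  refine Finset.sum_eq_zero fun l _ ↦ ?_
  rw [← Finset.sum_mul]
  simp only [weylM, Matrix.of_apply, h.weyl_trace hz hn, zero_mul]

lemma weylUp_trace' (hn : 3 ≤ n) (i a : Fin n) : ∑ j, weylUp G i j z a j = 0 := by
  rw [← h.weylUp_trace hz hn i a]
  refine Finset.sum_congr rfl fun j _ ↦ ?_
  rw [h.weylUp_skew hz, weylUp, weylM_antisymm, neg_mul, Matrix.neg_apply, neg_neg, weylUp]

/-- The differential Bianchi identity, in the middle block and with the last index raised. -/
lemma weyl_bianchi (k i j a b : Fin n) :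
    let E := fun k i j : Fin n ↦ (pdm k (weylUp G i j) z + chr G k z * weylUp G i j z
      + weylUp G i j z * (chr G k z).transpose) a b
      + (if a = k then 1 else 0) * cottonUp G i j b z
      - cottonUp G i j a z * (if k = b then 1 else 0)
    E k i j + E i j k + E j k i = 0 := by
  intro E
  set Q : Fin n → Fin n → Fin n → Matrix (Fin n) (Fin n) ℝ := fun k i j ↦
    pdm k (weylM G i j) z + chr G k z * weylM G i j z - weylM G i j z * chr G k z
    + Matrix.of (fun a l ↦ (if a = k then 1 else 0) * cotton G i j l z
      - cottonUp G i j a z * G z k l) with hQ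
  have hsum : Q k i j + Q i j k + Q j k i = 0 := by
    ext a l
    have := congrFun (congrFun (curv_bianchi h.isOpen hz h.connectionMatrix_smooth i j k)
      (midIdx a)) (midIdx l)
    simp only [Matrix.add_apply, Matrix.sub_apply, Matrix.mul_apply, sum_TIndex, conn_mid_top,
      conn_mid_mid, conn_mid_bot, conn_top_mid, conn_bot_mid, h.curv_top_mid hz, h.curv_mid_bot hz,
      h.curv_mid_top hz, Matrix.zero_apply, mul_zero, zero_mul, zero_add, add_zero] at this
    refine Eq.trans ?_ this
    simp only [hQ, Matrix.add_apply, Matrix.sub_apply, Matrix.mul_apply, Matrix.of_apply, pdm,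
      weylM, chr, cottonUp, cotton]
    ring
  have hE : ∀ k i j, E k i j = (Q k i j * (G z)⁻¹) a b := by
    intro k i j
    have e1 : pdm k (weylUp G i j) z = pdm k (weylM G i j) z * (G z)⁻¹ +
        weylM G i j z * -(chr G k z * (G z)⁻¹ + (G z)⁻¹ * (chr G k z).transpose) := by
      unfold weylUp
      rw [pdm_mul h.isOpen hz (h.weylM_smooth i j) h.inv_smooth, h.pdm_inv hz]
    have e2 : pdm k (weylUp G i j) z + chr G k z * weylUp G i j z
      + weylUp G i j z * (chr G k z).transpose =
      (pdm k (weylM G i j) z + chr G k z * weylM G i j z - weylM G i j z * chr G k z)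
        * (G z)⁻¹ := by
      rw [e1, weylUp]
      noncomm_ring
    simp only [E]
    rw [e2]
    simp only [hQ, add_mul _ (Matrix.of _), Matrix.add_apply _ (Matrix.of _ * _)]
    rw [add_sub_assoc]
    congr 1
    simp only [Matrix.mul_apply, Matrix.of_apply, sub_mul, Finset.sum_sub_distrib]
    congr 1
    · rw [cottonUp, Finset.mul_sum]
      exact Finset.sum_congr rfl fun l _ ↦ by rw [h.inv_symm hz b l]; ring
    · have : ∑ l, G z k l * (G z)⁻¹ l b = if k = b then 1 else 0 := by
        rw [← Matrix.mul_apply, h.mul_inv hz, Matrix.one_apply]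
      rw [← this, Finset.mul_sum]
      exact Finset.sum_congr rfl fun l _ ↦ by ring
  rw [hE, hE, hE, ← Matrix.add_apply, ← Matrix.add_apply, ← add_mul, ← add_mul, hsum, zero_mul,
    Matrix.zero_apply]

/-- Both upper indices of the differential Bianchi identity are contracted with form indices. The
traces of `weylUp` vanish identically, hence so do their derivatives, and the Christoffel terms
vanish either as traces or as symmetric against antisymmetric. What remains is `2n - 4` times the
trace of the bottom row. -/
lemma cotton_trace (hn : 3 ≤ n) (i : Fin n) :
    ∑ j, ∑ l, (G z)⁻¹ j l * cotton G i j l z = 0 := by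
  set t : ℝ := ∑ j, cottonUp G i j j z with ht
  change t = 0
  have ht' : ∑ j, cottonUp G j i j z = -t := by
    rw [ht, ← Finset.sum_neg_distrib]
    exact Finset.sum_congr rfl fun l _ ↦ cottonUp_antisymm _ _ _
  have hS : ∀ k a b, christoffel G k a b z = christoffel G k b a z :=
    fun k a b ↦ h.christoffel_symm hz k a b
  have hU : ∀ i j a b, weylUp G i j z a b = -weylUp G i j z b a :=
    fun i j a b ↦ h.weylUp_skew hz i j a b
  have hI : ∀ i j a b, weylUp G i j z a b = -weylUp G j i z a b := by
    intro i j a b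
    rw [weylUp, weylM_antisymm, neg_mul, Matrix.neg_apply, weylUp]
  have t1 : ∀ j b, ∑ k, weylUp G k j z k b = 0 := h.weylUp_trace hz hn
  have t2 : ∀ i a, ∑ j, weylUp G i j z a j = 0 := h.weylUp_trace' hz hn
  have t3 : ∀ j b, ∑ k, weylUp G j k z k b = 0 := fun j b ↦ by
    rw [← neg_eq_zero, ← t1 j b, ← Finset.sum_neg_distrib]
    exact Finset.sum_congr rfl fun k _ ↦ by rw [hI, neg_neg]
  have t4 : ∀ i a, ∑ j, weylUp G j i z a j = 0 := fun i a ↦ by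
    rw [← neg_eq_zero, ← t2 i a, ← Finset.sum_neg_distrib]
    exact Finset.sum_congr rfl fun k _ ↦ by rw [hI, neg_neg]
  have pdsum : ∀ (m : Fin n) (f : Fin n → EuclideanSpace ℝ (Fin n) → ℝ),
      (∀ k, ContDiffOn ℝ ∞ (f k) O) → (∀ y ∈ O, ∑ k, f k y = 0) → ∑ k, pd m (f k) z = 0 := by
    intro m f hf h0
    rw [← pd_sum fun k _ ↦ ContDiffOn.diffAt (hf k) h.isOpen hz, pd_congr h.isOpen hz h0, pd_const]
  -- The upper indices are set equal to the form indices `k` and `j`, which will be summed; `i`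
  -- stays free.
  have key := fun k j ↦ h.weyl_bianchi hz k i j k j
  simp only [Matrix.add_apply, Matrix.mul_apply, Matrix.transpose_apply, pdm, Matrix.of_apply,
    chr] at key
  have tot := Finset.sum_eq_zero fun k (_ : k ∈ Finset.univ) ↦
    Finset.sum_eq_zero fun j (_ : j ∈ Finset.univ) ↦ key k j
  simp only [Finset.sum_add_distrib, Finset.sum_sub_distrib] at tot
  have a1 : ∑ k, ∑ j, pd k (fun y ↦ weylUp G i j y k j) z = 0 :=
    Finset.sum_eq_zero fun k _ ↦ pdsum k (fun j y ↦ weylUp G i j y k j)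
      (fun j ↦ h.weylUp_smooth i j k j) fun y hy ↦ h.weylUp_trace' hy hn i k
  have a2 : ∑ k, ∑ j, ∑ m, christoffel G k k m z * weylUp G i j z m j = 0 := by
    refine Finset.sum_eq_zero fun k _ ↦ ?_
    rw [Finset.sum_comm]
    exact Finset.sum_eq_zero fun m _ ↦ by rw [← Finset.mul_sum, t2, mul_zero]
  have a3 : ∑ k, ∑ j, ∑ m, weylUp G i j z k m * christoffel G j k m z = 0 := by
    rw [Finset.sum_comm]
    refine Finset.sum_eq_zero fun j _ ↦ ?_
    rw [← sum_symm_mul_antisymm (hS j) (hU i j)]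
    exact Finset.sum_congr rfl fun k _ ↦ Finset.sum_congr rfl fun m _ ↦ mul_comm _ _
  have a4 : ∑ k, ∑ j, pd i (fun y ↦ weylUp G j k y k j) z = 0 := by
    refine Finset.sum_eq_zero fun k _ ↦ ?_
    refine pdsum i (fun j y ↦ weylUp G j k y k j) (fun j ↦ h.weylUp_smooth j k k j) fun y hy ↦ ?_
    rw [← neg_eq_zero, ← h.weylUp_trace' hy hn k k, ← Finset.sum_neg_distrib]
    refine Finset.sum_congr rfl fun j _ ↦ ?_
    rw [weylUp, weylM_antisymm, neg_mul, Matrix.neg_apply, neg_neg, weylUp]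
  have a5 : ∑ k, ∑ j, ∑ m, christoffel G k i m z * weylUp G j k z m j = 0 := by
    refine Finset.sum_eq_zero fun k _ ↦ ?_
    rw [Finset.sum_comm]
    exact Finset.sum_eq_zero fun m _ ↦ by rw [← Finset.mul_sum, t4, mul_zero]
  have a6 : ∑ k, ∑ j, ∑ m, weylUp G j k z k m * christoffel G j i m z = 0 := by
    rw [Finset.sum_comm]
    refine Finset.sum_eq_zero fun j _ ↦ ?_
    rw [Finset.sum_comm]
    exact Finset.sum_eq_zero fun m _ ↦ by rw [← Finset.sum_mul, t3, zero_mul]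
  have a7 : ∑ k, ∑ j, pd j (fun y ↦ weylUp G k i y k j) z = 0 := by
    rw [Finset.sum_comm]
    exact Finset.sum_eq_zero fun j _ ↦ pdsum j (fun k y ↦ weylUp G k i y k j)
      (fun k ↦ h.weylUp_smooth k i k j) fun y hy ↦ h.weylUp_trace hy hn i j
  have a8 : ∑ k, ∑ j, ∑ m, christoffel G k j m z * weylUp G k i z m j = 0 := by
    refine Finset.sum_eq_zero fun k _ ↦ ?_
    rw [Finset.sum_comm, ← sum_symm_mul_antisymm (hS k) (hU k i)]
    exact Finset.sum_congr rfl fun m _ ↦ Finset.sum_congr rfl fun j _ ↦ by rw [hS]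
  have a9 : ∑ k, ∑ j, ∑ m, weylUp G k i z k m * christoffel G j j m z = 0 := by
    rw [Finset.sum_comm]
    refine Finset.sum_eq_zero fun j _ ↦ ?_
    rw [Finset.sum_comm]
    exact Finset.sum_eq_zero fun m _ ↦ by rw [← Finset.sum_mul, t1, zero_mul]
  simp only [a1, a2, a3, a4, a5, a6, a7, a8, a9] at tot
  have c1 : ∑ k, ∑ j, (if k = i then 1 else 0) * cottonUp G j k j z = -t := by
    rw [Finset.sum_comm, ← ht']
    simp
  simp only [c1] at tot
  simp [ht', ← ht, ← Finset.mul_sum] at tot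
  have h1 : (3 : ℝ) ≤ n := by exact_mod_cast hn
  have h2 : (2 * (n : ℝ) - 4) * t = 0 := by linarith
  rcases mul_eq_zero.mp h2 with h3 | h3
  · linarith
  · exact h3

lemma weylLow_symm (i j a l : Fin n) : (G z * weylM G i j z) a l = (G z * weylM G a l z) i j := by
  refine pair_symm (T := fun i j a l ↦ (G z * weylM G i j z) a l) (fun i j k l ↦ ?_)
    (fun i j k l ↦ ?_) (fun i j l k ↦ ?_) i j a l
  · rw [weylM_antisymm, mul_neg, Matrix.neg_apply]
  · have := congrFun (congrFun (h.weylM_skew hz i j) k) l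
    rw [← h.transpose_eq hz, ← Matrix.transpose_mul, h.transpose_eq hz] at this
    simp only [Matrix.add_apply, Matrix.transpose_apply, Matrix.zero_apply] at this
    linarith
  · simp only [Matrix.mul_apply, ← Finset.sum_add_distrib, ← mul_add]
    refine Finset.sum_eq_zero fun m _ ↦ ?_
    rw [← mul_zero (G z k m), ← h.weyl_cyclic hz i j l m]
    rfl

/-- The outer diagonal entries vanish, and the trace of the middle block contracts the antisymmetric
`weylUp` with the symmetric metric. -/
lemma tractorCurvature_trace (i j : Fin n) :
    (curv (connectionMatrix G) i j z).trace = 0 := by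
  have h1 : weylM G i j z = weylUp G i j z * G z := by
    rw [weylUp, mul_assoc, h.inv_mul hz, mul_one]
  have h2 : (weylM G i j z).trace = 0 := by
    rw [h1, Matrix.trace, ← sum_symm_mul_antisymm (fun a b ↦ h.symm z hz a b)
      (fun a b ↦ h.weylUp_skew hz i j a b)]
    refine Finset.sum_congr rfl fun k _ ↦ ?_
    simp only [Matrix.diag, Matrix.mul_apply]
    exact Finset.sum_congr rfl fun l _ ↦ by rw [h.symm z hz l k, mul_comm]
  simp only [Matrix.trace, Matrix.diag, sum_TIndex, h.curv_top_top hz, h.curv_bot_bot hz]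
  rw [zero_add, add_zero, ← h2]
  rfl

/-- If a skew endomorphism of the tractor bundle commutes with the tractor curvature, then its
underlying vector inserts trivially into the curvature, and it is trace-orthogonal to it. -/
theorem curvature_of_commute (hn : 3 ≤ n) {S : Matrix (TIndex n) (TIndex n) ℝ}
    (hS : S.transpose * tractorH G z + tractorH G z * S = 0)
    (hc : ∀ i j, curv (connectionMatrix G) i j z * S = S * curv (connectionMatrix G) i j z) :
    (∀ j, ∑ i, S (midIdx i) (botIdx n) • curv (connectionMatrix G) i j z = 0) ∧
      ∀ i j, (curv (connectionMatrix G) i j z * S).trace = 0 := by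
  obtain ⟨s1, s2, s3, s4, s5, s6⟩ := skew_entries hS
  set K : Fin n → ℝ := fun m ↦ S (midIdx m) (botIdx n) with hK
  set A : Matrix (Fin n) (Fin n) ℝ := Matrix.of fun k l ↦ S (midIdx k) (midIdx l) with hA
  set w := fun i j ↦ weylM G i j z with hw
  set c := fun i j l ↦ cotton G i j l z with hc'
  have ce : ∀ i j X Y, ∑ C, curv (connectionMatrix G) i j z X C * S C Y =
      ∑ C, S X C * curv (connectionMatrix G) i j z C Y :=
    fun i j X Y ↦ congrFun (congrFun (hc i j) X) Y
  simp only [sum_TIndex] at ce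
  -- The last column of `ΩS = SΩ`: that of `Ω` is zero, so `Ω` kills the last column of `S`, whose
  -- tangent part is `K`. The bottom entry of the same column gives `cK`.
  have wK : ∀ i j k, ∑ m, w i j k m * K m = 0 := by
    intro i j k
    have := ce i j (midIdx k) (botIdx n)
    simp only [s1, h.curv_mid_bot hz, h.curv_top_bot hz, h.curv_bot_bot hz, mul_zero, zero_mul,
      zero_add, add_zero, Finset.sum_const_zero] at this
    exact this
  have cK : ∀ i j, ∑ m, c i j m * K m = 0 := by
    intro i j
    have := ce i j (botIdx n) (botIdx n)
    simp only [s1, h.curv_mid_bot hz, h.curv_bot_top hz, h.curv_top_bot hz, h.curv_bot_bot hz,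
      mul_zero, zero_mul, zero_add, add_zero, Finset.sum_const_zero] at this
    exact this
  have cu : ∀ i j k, curv (connectionMatrix G) i j z (midIdx k) (topIdx n) = -cottonUp G i j k z :=
    fun i j k ↦ h.curv_mid_top hz i j k
  have mm : ∀ i j k l, -cottonUp G i j k z * S (topIdx n) (midIdx l) + ∑ m, w i j k m * A m l =
      ∑ m, A k m * w i j m l + K k * c i j l := by
    intro i j k l
    have := ce i j (midIdx k) (midIdx l)
    simp only [cu, h.curv_mid_bot hz, h.curv_top_mid hz,
      mul_zero, zero_mul, zero_add, add_zero] at this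
    exact this
  -- The insertion of `K` into a form slot of the bottom row. It vanishes because it is both
  -- antisymmetric and symmetric.
  set X : Fin n → Fin n → ℝ := fun j l ↦ ∑ i, K i * c i j l with hX
  have tr1 : ∀ j, ∑ i, cottonUp G i j i z = 0 := by
    intro j
    rw [← neg_eq_zero, ← h.cotton_trace hz hn j, ← Finset.sum_neg_distrib]
    refine Finset.sum_congr rfl fun i _ ↦ ?_
    rw [cottonUp_antisymm, neg_neg, cottonUp]
  -- The middle block of the commutator, contracted over `k = i`; the traces of the Weyl and Cotton
  -- tensors remove the left side.
  have X1 : ∀ j l, X j l = -∑ i, ∑ m, A i m * w i j m l := by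
    intro j l
    have := Finset.sum_congr rfl fun i (_ : i ∈ Finset.univ) ↦ mm i j i l
    simp only [Finset.sum_add_distrib, ← Finset.sum_mul, Finset.sum_neg_distrib, tr1] at this
    have e : ∑ i, ∑ m, w i j i m * A m l = 0 := by
      rw [Finset.sum_comm]
      exact Finset.sum_eq_zero fun m _ ↦ by
        rw [← Finset.sum_mul, show ∑ i, w i j i m = 0 from h.weyl_trace hz hn j m, zero_mul]
    rw [e] at this
    simp only [hX]
    linarith
  set a : Matrix (Fin n) (Fin n) ℝ := A * (G z)⁻¹ with ha
  have aA : A = a * G z := by rw [ha, mul_assoc, h.inv_mul hz, mul_one]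
  have a_skew : ∀ i m, a i m = -a m i := by
    have h0 : A.transpose * G z + G z * A = 0 := by
      ext k l
      exact s6 k l
    have h1 : a.transpose + a = 0 := by
      have := congrArg (fun X ↦ (G z)⁻¹ * X * (G z)⁻¹) h0
      simp only [mul_add, add_mul, mul_zero, zero_mul] at this
      rw [← this, ha, Matrix.transpose_mul, h.inv_transpose hz, ← mul_assoc,
        ← mul_assoc ((G z)⁻¹) (G z), h.inv_mul hz, one_mul, mul_assoc, mul_assoc, h.mul_inv hz,
        mul_one]
    intro i m
    have := congrFun (congrFun h1 m) i
    simp only [Matrix.add_apply, Matrix.transpose_apply, Matrix.zero_apply] at this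
    linarith
  set T : Fin n → Fin n → Fin n → Fin n → ℝ := fun i j k l ↦ (G z * w i j) k l with hT
  have Ts : ∀ i j k l, T i j k l = T k l i j := h.weylLow_symm hz
  have T1 : ∀ i j k l, T i j k l = -T j i k l := by
    intro i j k l
    simp only [hT, hw]
    rw [weylM_antisymm, mul_neg, Matrix.neg_apply]
  have T3 : ∀ i j l k, T i j k l + T j l k i + T l i k j = 0 := by
    intro i j l k
    simp only [hT, Matrix.mul_apply, ← Finset.sum_add_distrib, ← mul_add]
    refine Finset.sum_eq_zero fun m _ ↦ ?_
    rw [← mul_zero (G z k m), ← h.weyl_cyclic hz i j l m]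
    rfl
  have AT : ∀ i j k l, ∑ m, A i m * w j k m l = ∑ m, a i m * T j k m l := by
    intro i j k l
    rw [← Matrix.mul_apply, aA, mul_assoc, Matrix.mul_apply]
  have X2 : ∀ j l, X j l = -∑ i, ∑ m, a i m * T i j m l := by
    intro j l
    rw [X1]
    simp only [AT]
  -- Pair symmetry makes `T i j m l + T i l m j` symmetric in `i, m`, and it is contracted with the
  -- antisymmetric `a`.
  have X_anti : ∀ j l, X j l + X l j = 0 := by
    intro j l
    rw [X2, X2, ← neg_add, neg_eq_zero, ← Finset.sum_add_distrib]
    simp only [← Finset.sum_add_distrib, ← mul_add]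
    rw [← sum_symm_mul_antisymm (S := fun i m ↦ T i j m l + T i l m j) (T := a) (fun i m ↦ by
      rw [Ts m j i l, Ts m l i j]; ring) a_skew]
    exact Finset.sum_congr rfl fun i _ ↦ Finset.sum_congr rfl fun m _ ↦ mul_comm _ _
  -- The cyclic identity for the bottom row, contracted with `K`; one of its three terms is zero by
  -- `cK`.
  have X_symm : ∀ i j, X i j = X j i := by
    intro i j
    have e : ∑ l, (c i j l + c j l i + c l i j) * K l = 0 := by
      refine Finset.sum_eq_zero fun l _ ↦ ?_
      rw [show c i j l + c j l i + c l i j = 0 from h.cotton_cyclic hz i j l, zero_mul]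
    simp only [add_mul, Finset.sum_add_distrib, cK] at e
    have e1 : ∑ l, c j l i * K l = -X j i := by
      simp only [hX, hc']
      rw [← Finset.sum_neg_distrib]
      exact Finset.sum_congr rfl fun l _ ↦ by rw [cotton_antisymm]; ring
    have e2 : ∑ l, c l i j * K l = X i j := by
      simp only [hX]
      exact Finset.sum_congr rfl fun l _ ↦ mul_comm _ _
    rw [e1, e2] at e
    linarith
  have X0 : ∀ j l, X j l = 0 := fun j l ↦ by linarith [X_anti j l, X_symm j l]
  -- Pair symmetry moves `K` from a form slot to an endomorphism slot, where `wK` applies.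
  have KT : ∀ j k l, ∑ i, K i * T i j k l = 0 := by
    intro j k l
    have : ∑ i, K i * T i j k l = -(G z).mulVec ((w k l).mulVec K) j := by
      rw [Matrix.mulVec_mulVec]
      simp only [Matrix.mulVec, dotProduct, ← Finset.sum_neg_distrib]
      exact Finset.sum_congr rfl fun i _ ↦ by rw [T1, Ts]; simp only [hT]; ring
    rw [this, show (w k l).mulVec K = 0 from funext fun m ↦ wK k l m]
    simp
  have Kw : ∀ j k l, ∑ i, K i * w i j k l = 0 := by
    intro j k l
    have e : ∀ i, w i j k l = ∑ m, (G z)⁻¹ k m * T i j m l := by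
      intro i
      rw [← Matrix.mul_apply, ← mul_assoc, h.inv_mul hz, one_mul]
    simp only [e, Finset.mul_sum]
    rw [Finset.sum_comm]
    refine Finset.sum_eq_zero fun m _ ↦ ?_
    rw [← mul_zero ((G z)⁻¹ k m), ← KT j m l, Finset.mul_sum]
    exact Finset.sum_congr rfl fun i _ ↦ by ring
  refine ⟨fun j ↦ ?_, fun i j ↦ ?_⟩
  · ext P Q
    simp only [Matrix.sum_apply, Matrix.smul_apply, smul_eq_mul, Matrix.zero_apply]
    rcases TIndex_cases P with rfl | ⟨k, rfl⟩ | rfl <;>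
      rcases TIndex_cases Q with rfl | ⟨l, rfl⟩ | rfl
    · simp [h.curv_top_top hz]
    · simp [h.curv_top_mid hz]
    · simp [h.curv_top_bot hz]
    · simp only [cu, cottonUp, Finset.mul_sum, mul_neg, Finset.sum_neg_distrib, neg_eq_zero]
      rw [Finset.sum_comm]
      refine Finset.sum_eq_zero fun m _ ↦ ?_
      rw [← mul_zero ((G z)⁻¹ k m), ← X0 j m, hX, Finset.mul_sum]
      exact Finset.sum_congr rfl fun i _ ↦ by ring
    · exact Kw j k l
    · simp [h.curv_mid_bot hz]
    · simp [h.curv_bot_top hz]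
    · exact X0 j l
    · simp [h.curv_bot_bot hz]
  -- The top row of `S` is minus `K` with its index lowered, so this contraction is again `cK`.
  · have e1 : ∑ k, cottonUp G i j k z * S (topIdx n) (midIdx k) = 0 := by
      have u : ∀ m, ∑ k, G z m k * cottonUp G i j k z = c i j m := fun m ↦
        h.sum_metric_inv hz m (c i j)
      rw [← neg_eq_zero, ← cK i j, ← Finset.sum_neg_distrib]
      simp only [s4, ← u, mul_neg, neg_neg, Finset.sum_mul, Finset.mul_sum]
      rw [Finset.sum_comm]
      exact Finset.sum_congr rfl fun m _ ↦ Finset.sum_congr rfl fun k _ ↦ by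
        rw [h.symm z hz k m]; ring
    have e2 : ∑ k, ∑ m, w i j k m * A m k = 0 := by
      have T2 : ∀ i j k l, T i j k l = -T i j l k := fun i j k l ↦ by
        rw [Ts, T1, Ts]
      have X3 : ∀ j l, ∑ i, ∑ m, a i m * T i j m l = 0 := fun j l ↦ by
        rw [← neg_eq_zero, ← X2, X0]
      have e3 : ∑ k, ∑ m, w i j k m * A m k = -∑ m, ∑ l, a m l * T m l i j := by
        rw [Finset.sum_comm, ← Finset.sum_neg_distrib]
        refine Finset.sum_congr rfl fun m _ ↦ ?_
        rw [← Finset.sum_neg_distrib, Finset.sum_congr rfl fun k _ ↦ mul_comm _ _, AT]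
        exact Finset.sum_congr rfl fun l _ ↦ by rw [Ts i j, T1 l m]; ring
      rw [e3, neg_eq_zero]
      have X4 : ∑ m, ∑ l, a l m * T l j m i = 0 := by rw [Finset.sum_comm, X3]
      -- The cyclic identity, contracted with `a`, writes the trace of `w A` by two contractions of
      -- the form `X`.
      have e4 : (∑ m, ∑ l, a m l * T m l i j) + (∑ m, ∑ l, a l m * T l j m i)
          + ∑ m, ∑ l, a m l * T m j l i = 0 := by
        simp only [← Finset.sum_add_distrib]
        refine Finset.sum_eq_zero fun m _ ↦ Finset.sum_eq_zero fun l _ ↦ ?_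
        have t3 := T3 m l j i
        rw [T2 l j i m, T1 j m i l, T2 m j i l] at t3
        rw [a_skew l m]
        linear_combination a m l * t3
      rwa [X4, X3, add_zero, add_zero] at e4
    simp only [Matrix.trace, Matrix.diag, Matrix.mul_apply, sum_TIndex, cu, h.curv_top_top hz,
      h.curv_top_mid hz, h.curv_top_bot hz, h.curv_mid_bot hz, h.curv_bot_top hz,
      h.curv_bot_bot hz, zero_mul, Finset.sum_add_distrib, Finset.sum_const_zero, neg_mul,
      Finset.sum_neg_distrib, e1]
    rw [show ∑ k, ∑ m, curv (connectionMatrix G) i j z (midIdx k) (midIdx m) *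
      S (midIdx m) (midIdx k) = 0 from e2, show ∑ k, curv (connectionMatrix G) i j z (botIdx n)
      (midIdx k) * S (midIdx k) (botIdx n) = 0 from cK i j]
    simp

end IsMetricOn

end ParallelAdjoint

/-! ### Components of vectors and metrics in the charts of the manifold -/

section Charts

variable {n p q : ℕ} {M : Type*} [TopologicalSpace M]
  [ChartedSpace (EuclideanSpace ℝ (Fin n)) M]

/-- The domain of the chart at `a`. -/
abbrev chartSource (a : M) : Set M := (extChartAt (𝓡 n) a).source

/-- The range of the chart at `a`. -/
abbrev chartTarget (a : M) : Set (EuclideanSpace ℝ (Fin n)) := (extChartAt (𝓡 n) a).target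

lemma isOpen_chartTarget (a : M) : IsOpen (chartTarget (n := n) a) := isOpen_extChartAt_target a

lemma pt_mem {a : M} {z : EuclideanSpace ℝ (Fin n)} (hz : z ∈ chartTarget a) :
    pt a z ∈ chartSource (n := n) a := (extChartAt (𝓡 n) a).map_target hz

lemma extChartAt_pt {a : M} {z : EuclideanSpace ℝ (Fin n)} (hz : z ∈ chartTarget a) :
    extChartAt (𝓡 n) a (pt a z) = z := (extChartAt (𝓡 n) a).right_inv hz

lemma pt_extChartAt {a x : M} (hx : x ∈ chartSource (n := n) a) :
    pt a (extChartAt (𝓡 n) a x) = x := (extChartAt (𝓡 n) a).left_inv hx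

/-- All components of a tangent vector in the chart at `a`. -/
def chartVec (a x : M) : TangentSpace (𝓡 n) x →L[ℝ] EuclideanSpace ℝ (Fin n) :=
  mvfderiv (𝓡 n) (extChartAt (𝓡 n) a) x

lemma vectorCoord_eq (a x : M) (v : TangentSpace (𝓡 n) x) (i : Fin n) :
    vectorCoord a x v i = chartVec a x v i := rfl

variable [IsManifold (𝓡 n) ∞ M]

/-- The derivative of the chart is the tangent bundle trivialisation, which supplies the inverse on
fibres and the smoothness of the coordinate frame. -/
lemma chartVec_eq {a x : M} (hx : x ∈ chartSource (n := n) a) (v : TangentSpace (𝓡 n) x) :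
    chartVec a x v =
      (trivializationAt (EuclideanSpace ℝ (Fin n)) (TangentSpace (𝓡 n)) a).continuousLinearMapAt ℝ x
        v := by
  rw [TangentBundle.continuousLinearMapAt_trivializationAt (I := 𝓡 n)
    (by rwa [← extChartAt_source (I := 𝓡 n)])]
  rfl

lemma coordVector_eq {a : M} {z : EuclideanSpace ℝ (Fin n)} (hz : z ∈ chartTarget a) (i : Fin n) :
    coordVector a z i =
      (trivializationAt (EuclideanSpace ℝ (Fin n)) (TangentSpace (𝓡 n)) a).symmL ℝ (pt a z)
        (EuclideanSpace.single i 1) := by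
  have := TangentBundle.symmL_trivializationAt (I := 𝓡 n) (x₀ := a) (x := pt a z)
    (by rw [← extChartAt_source (I := 𝓡 n)]; exact pt_mem hz)
  rw [this, extChartAt_pt hz, modelWithCornersSelf_coe, Set.range_id, mfderivWithin_univ]
  rfl

lemma mem_baseSet {a x : M} (hx : x ∈ chartSource (n := n) a) :
    x ∈ (trivializationAt (EuclideanSpace ℝ (Fin n)) (TangentSpace (𝓡 n)) a).baseSet := by
  rwa [TangentBundle.trivializationAt_baseSet, ← extChartAt_source (I := 𝓡 n)]

lemma chartVec_coordVector {a : M} {z : EuclideanSpace ℝ (Fin n)} (hz : z ∈ chartTarget a)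
    (i : Fin n) : chartVec a (pt a z) (coordVector a z i) = EuclideanSpace.single i 1 := by
  rw [coordVector_eq hz, chartVec_eq (pt_mem hz)]
  exact Bundle.Trivialization.continuousLinearMapAt_symmL _ (mem_baseSet (pt_mem hz)) _

lemma chartVec_injective {a x : M} (hx : x ∈ chartSource (n := n) a) :
    Function.Injective (chartVec (n := n) a x) := by
  intro v w hvw
  rw [chartVec_eq hx, chartVec_eq hx] at hvw
  have := congrArg ((trivializationAt (EuclideanSpace ℝ (Fin n)) (TangentSpace (𝓡 n)) a).symmL ℝ x)
    hvw
  rwa [Bundle.Trivialization.symmL_continuousLinearMapAt _ (mem_baseSet hx),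
    Bundle.Trivialization.symmL_continuousLinearMapAt _ (mem_baseSet hx)] at this

lemma sum_vectorCoord {a : M} {z : EuclideanSpace ℝ (Fin n)} (hz : z ∈ chartTarget a)
    (v : TangentSpace (𝓡 n) (pt a z)) : ∑ i, vectorCoord a (pt a z) v i • coordVector a z i = v := by
  apply chartVec_injective (pt_mem hz)
  rw [map_sum]
  ext j
  simp [chartVec_coordVector hz, vectorCoord_eq, Finset.sum_apply, Pi.single_apply]

lemma contMDiffOn_frame (a : M) (i : Fin n) :
    ContMDiffOn (𝓡 n) ((𝓡 n).prod 𝓘(ℝ, EuclideanSpace ℝ (Fin n))) ∞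
      (fun x ↦ Bundle.TotalSpace.mk' (E := (TangentSpace (𝓡 n) : M → Type _))
        (EuclideanSpace ℝ (Fin n)) x
        ((trivializationAt (EuclideanSpace ℝ (Fin n)) (TangentSpace (𝓡 n)) a).symmL ℝ x
          (EuclideanSpace.single i 1))) (chartSource (n := n) a) := by
  rw [(trivializationAt (EuclideanSpace ℝ (Fin n))
    (TangentSpace (𝓡 n)) a).contMDiffOn_section_iff (isOpen_extChartAt_source a)
    fun x hx ↦ mem_baseSet hx]
  refine (contMDiffOn_const (c := EuclideanSpace.single i (1 : ℝ))).congr fun x hx ↦ ?_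
  refine Eq.trans ?_ (Bundle.Trivialization.continuousLinearMapAt_symmL (R := ℝ) _ (mem_baseSet hx) _)
  rw [Bundle.Trivialization.continuousLinearMapAt_apply,
    Bundle.Trivialization.coe_linearMapAt_of_mem _ (mem_baseSet hx)]

/-- The metric is a smooth section evaluated on coordinate vector fields, and these are smooth
because they are constant in the trivialisation. Composing with the inverse chart gives the
components. -/
lemma metricMatrix_smooth (g : PseudoMetric n p q M) (a : M) :
    SmoothM (chartTarget a) (metricMatrix g a) := by
  intro i j
  rw [← contMDiffOn_iff_contDiffOn]
  set e := trivializationAt (EuclideanSpace ℝ (Fin n)) (TangentSpace (𝓡 n) : M → Type _) a with he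
  have h1 : ContMDiffOn (𝓡 n) 𝓘(ℝ, ℝ) ∞ (fun x ↦ g.inner x
      (e.symmL ℝ x (EuclideanSpace.single i 1)) (e.symmL ℝ x (EuclideanSpace.single j 1)))
      (chartSource (n := n) a) := by
    have := ContMDiffOn.clm_bundle_apply₂ (F₃ := ℝ) (E₃ := Bundle.Trivial M ℝ)
      (g.contMDiff.contMDiffOn (s := chartSource (n := n) a)) (contMDiffOn_frame a i) (contMDiffOn_frame a j)
    intro x hx
    have h2 := this x hx
    rw [Bundle.contMDiffWithinAt_totalSpace] at h2
    exact h2.2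
  refine (h1.comp (contMDiffOn_extChartAt_symm a) fun z hz ↦ pt_mem hz).congr fun z hz ↦ ?_
  simp only [metricMatrix, Matrix.of_apply, coordVector_eq hz]
  rfl

lemma metric_expand (g : PseudoMetric n p q M) {a : M} {z : EuclideanSpace ℝ (Fin n)}
    (hz : z ∈ chartTarget a) (v w : TangentSpace (𝓡 n) (pt a z)) :
    g.inner (pt a z) v w =
      ∑ i, ∑ j, metricMatrix g a z i j * vectorCoord a _ v i * vectorCoord a _ w j := by
  conv_lhs => rw [← sum_vectorCoord hz v, ← sum_vectorCoord hz w]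
  simp only [map_sum, map_smul, sum_apply, smul_apply, smul_eq_mul, Finset.mul_sum]
  rw [Finset.sum_comm]
  refine Finset.sum_congr rfl fun i _ ↦ Finset.sum_congr rfl fun j _ ↦ ?_
  simp only [metricMatrix, Matrix.of_apply]
  ring

lemma inner_nondegenerate (g : PseudoMetric n p q M) (x : M) {v : TangentSpace (𝓡 n) x}
    (hv : ∀ w, g.inner x v w = 0) : v = 0 := by
  obtain ⟨b, hb⟩ := g.signature x
  have h1 : ∀ i, b.repr v i = 0 := by
    intro i
    have h2 := hv (b i)
    rw [← b.sum_repr v] at h2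
    simp only [map_sum, map_smul, sum_apply, smul_apply, smul_eq_mul, hb] at h2
    rw [Finset.sum_eq_single i (fun j _ hj ↦ by
      simp [LieAlgebra.Orthogonal.indefiniteDiagonal, Matrix.diagonal_apply_ne _ hj]) (by simp)] at h2
    rcases i with i | i <;> simpa [LieAlgebra.Orthogonal.indefiniteDiagonal] using h2
  rw [← b.sum_repr v]
  simp [h1]

lemma isMetricOn_metricMatrix (g : PseudoMetric n p q M) (a : M) :
    IsMetricOn (chartTarget a) (metricMatrix g a) where
  isOpen := isOpen_chartTarget a
  smooth := metricMatrix_smooth g a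
  symm z hz i j := g.symm _ _ _
  isUnit z hz := by
    rw [isUnit_iff_ne_zero]
    intro h0
    obtain ⟨v, hv, hv0⟩ := Matrix.exists_vecMul_eq_zero_iff.mpr h0
    refine hv ?_
    have h1 : ∑ i, v i • coordVector a z i = 0 := by
      refine inner_nondegenerate g (pt a z) fun w ↦ ?_
      rw [← sum_vectorCoord hz w]
      simp only [map_sum, map_smul, sum_apply, smul_apply, smul_eq_mul]
      refine Finset.sum_eq_zero fun j _ ↦ ?_
      have h2 := congrFun hv0 j
      simp only [Matrix.vecMul, dotProduct, metricMatrix, Matrix.of_apply, Pi.zero_apply] at h2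
      rw [h2, mul_zero]
    have h2 := congrArg (chartVec a (pt a z)) h1
    rw [map_sum] at h2
    ext j
    have h3 := congrArg (fun u : EuclideanSpace ℝ (Fin n) ↦ u j) h2
    simpa [chartVec_coordVector hz, Finset.sum_apply, Pi.single_apply] using h3

end Charts

/-! ### Adjoint tractor fields in tractor frames, and the conformal Killing equation -/

section AdjointFields

variable {n p q : ℕ} {M : Type*} [TopologicalSpace M]
  [ChartedSpace (EuclideanSpace ℝ (Fin n)) M]

lemma tractorCoord_add (a x : M) (v w : Tractor n) (A : TIndex n) :
    tractorCoord a x (v + w) A = tractorCoord a x v A + tractorCoord a x w A := by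
  rcases TIndex_cases A with rfl | ⟨k, rfl⟩ | rfl
  · rfl
  · have : chartVec a x (v + w).2.1 = chartVec a x v.2.1 + chartVec a x w.2.1 := map_add _ _ _
    exact congrArg (fun u : EuclideanSpace ℝ (Fin n) ↦ u k) this
  · rfl

lemma tractorCoord_smul (a x : M) (r : ℝ) (v : Tractor n) (A : TIndex n) :
    tractorCoord a x (r • v) A = r * tractorCoord a x v A := by
  rcases TIndex_cases A with rfl | ⟨k, rfl⟩ | rfl
  · rfl
  · have : chartVec a x (r • v).2.1 = r • chartVec a x v.2.1 := map_smul _ _ _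
    exact congrArg (fun u : EuclideanSpace ℝ (Fin n) ↦ u k) this
  · rfl

/-- The tractor frame coordinates at `x`, as a linear map. -/
def coordMap (a x : M) : Tractor n →ₗ[ℝ] (TIndex n → ℝ) where
  toFun v := tractorCoord a x v
  map_add' v w := funext fun A ↦ tractorCoord_add a x v w A
  map_smul' r v := funext fun A ↦ tractorCoord_smul a x r v A

variable [IsManifold (𝓡 n) ∞ M] {a : M} {z : EuclideanSpace ℝ (Fin n)}

lemma coordMap_injective {x : M} (hx : x ∈ chartSource (n := n) a) :
    Function.Injective (coordMap (n := n) a x) := by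
  intro v w hvw
  have h1 : ∀ A, tractorCoord a x v A = tractorCoord a x w A := fun A ↦ congrFun hvw A
  have h2 : v.2.1 = w.2.1 := chartVec_injective hx (PiLp.ext fun k ↦ h1 (midIdx k))
  exact Prod.ext (h1 (topIdx n)) (Prod.ext h2 (h1 (botIdx n)))

lemma tractorCoord_frame (hz : z ∈ chartTarget a) (A B : TIndex n) :
    tractorCoord a (pt a z) (tractorFrame a z B) A = if A = B then 1 else 0 := by
  have h0 : ∀ k, vectorCoord (n := n) a (pt a z) 0 k = 0 := fun k ↦ by
    rw [vectorCoord_eq, map_zero]; rfl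
  rcases TIndex_cases A with rfl | ⟨k, rfl⟩ | rfl <;>
    rcases TIndex_cases B with rfl | ⟨l, rfl⟩ | rfl
  · simp [tractorCoord, tractorFrame]
  · simp [tractorCoord, tractorFrame]
  · simp [tractorCoord, tractorFrame]
  · exact (h0 k).trans (by simp)
  · change chartVec a (pt a z) (coordVector a z l) k = _
    rw [chartVec_coordVector hz]
    simp
  · exact (h0 k).trans (by simp)
  · simp [tractorCoord, tractorFrame]
  · simp [tractorCoord, tractorFrame]
  · simp [tractorCoord, tractorFrame]

lemma tractorMetric_expand (g : PseudoMetric n p q M) (hz : z ∈ chartTarget a) (v w : Tractor n) :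
    tractorMetric g (pt a z) v w = ∑ A, ∑ B, tractorCoord a (pt a z) v A *
      tractorH (metricMatrix g a) z A B * tractorCoord a (pt a z) w B := by
  have h1 : g.inner (pt a z) v.2.1 w.2.1 = _ := metric_expand g hz v.2.1 w.2.1
  simp only [tractorMetric, sum_TIndex, tH_top_top, tH_top_mid, tH_top_bot, tH_mid_top, tH_mid_mid,
    tH_mid_bot, tH_bot_top, tH_bot_mid, tH_bot_bot, mul_zero, zero_mul, Finset.sum_const_zero,
    mul_one, zero_add, add_zero]
  rw [h1]
  have h2 : ∑ i, ∑ j, metricMatrix g a z i j * vectorCoord a (pt a z) v.2.1 i *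
      vectorCoord a (pt a z) w.2.1 j = ∑ k, ∑ l, tractorCoord a (pt a z) v (midIdx k) *
        metricMatrix g a z k l * tractorCoord a (pt a z) w (midIdx l) :=
    Finset.sum_congr rfl fun i _ ↦ Finset.sum_congr rfl fun j _ ↦ by
      simp only [tractorCoord]; ring
  rw [h2]
  simp only [tractorCoord]
  ring

/-- The matrix in the tractor frame of an endomorphism that is skew for the tractor metric. -/
lemma skew_matrix (g : PseudoMetric n p q M) (hz : z ∈ chartTarget a) {S : Tractor n → Tractor n}
    (hS : ∀ v w, tractorMetric g (pt a z) (S v) w + tractorMetric g (pt a z) v (S w) = 0) :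
    let X : Matrix (TIndex n) (TIndex n) ℝ :=
      Matrix.of fun A B ↦ tractorCoord a (pt a z) (S (tractorFrame a z B)) A
    X.transpose * tractorH (metricMatrix g a) z + tractorH (metricMatrix g a) z * X = 0 := by
  intro X
  ext A B
  have := hS (tractorFrame a z A) (tractorFrame a z B)
  rw [tractorMetric_expand g hz, tractorMetric_expand g hz] at this
  simp only [tractorCoord_frame hz] at this
  simp only [Matrix.add_apply, Matrix.mul_apply, Matrix.transpose_apply, X, Matrix.of_apply,
    Matrix.zero_apply]
  rw [← this]
  congr 1
  · simp
  · simp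

namespace AdjointTractorField

variable {c : ConformalStructure n p q M} (s : AdjointTractorField c) (hs : s.IsParallel)
  {g : PseudoMetric n p q M} (hg : IsRepresentative c g)

lemma endMatrix_skew (hz : z ∈ chartTarget a) :
    (endMatrix (s.toEnd g hg) a z).transpose * tractorH (metricMatrix g a) z
      + tractorH (metricMatrix g a) z * endMatrix (s.toEnd g hg) a z = 0 :=
  skew_matrix g hz (s.skew g hg (pt a z))

lemma endMatrix_mid_bot (z : EuclideanSpace ℝ (Fin n)) (i : Fin n) :
    endMatrix (s.toEnd g hg) a z (midIdx i) (botIdx n) =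
      vectorCoord a (pt a z) (s.vectorField (pt a z)) i := by
  obtain ⟨φ, hφ⟩ := s.toEnd_bottom_eq g hg (pt a z)
  simp only [endMatrix, Matrix.of_apply, tractorFrame, hφ, tractorCoord]

lemma endMatrix_bot_bot (z : EuclideanSpace ℝ (Fin n)) :
    endMatrix (s.toEnd g hg) a z (botIdx n) (botIdx n) =
      (s.toEnd g hg (pt a z) (0, 0, 1)).2.2 := rfl

include hs

lemma pdm_endMatrix (hz : z ∈ chartTarget a) (i : Fin n) :
    pdm i (endMatrix (s.toEnd g hg) a) z =
      endMatrix (s.toEnd g hg) a z * connectionMatrix (metricMatrix g a) i z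
        - connectionMatrix (metricMatrix g a) i z * endMatrix (s.toEnd g hg) a z := by
  have h : pdm i (endMatrix (s.toEnd g hg) a) z
    + connectionMatrix (metricMatrix g a) i z * endMatrix (s.toEnd g hg) a z
    - endMatrix (s.toEnd g hg) a z * connectionMatrix (metricMatrix g a) i z = 0 :=
    hs g hg a z hz i
  rw [← sub_eq_zero, ← h]
  abel

lemma curvature_eq_zero (hn : 3 ≤ n) (hz : z ∈ chartTarget a) :
    (∀ j : Fin n, ∑ i, vectorCoord a (pt a z) (s.vectorField (pt a z)) i •
      tractorCurvature (metricMatrix g a) i j z = 0) ∧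
    ∀ i j : Fin n, (tractorCurvature (metricMatrix g a) i j z *
      endMatrix (s.toEnd g hg) a z).trace = 0 := by
  have h := isMetricOn_metricMatrix g a
  have := h.curvature_of_commute hz hn (s.endMatrix_skew hg hz) (curv_commute h.isOpen hz
    h.connectionMatrix_smooth (s.smooth g hg a) fun y hy i ↦ s.pdm_endMatrix hs hg hy i)
  simp only [endMatrix_mid_bot] at this
  -- `tractorCurvature` unfolds to `curv` of the connection matrices.
  exact this

include hg in
-- With its index lowered, the last column of `∇s = 0` says that `∇κ` is the middle block of `s`,
-- which is skew, minus `φ g`, where `φ` is the bottom right entry of `s`. Symmetrising leaves `-2 φ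
-- g`.
lemma isConformalKilling : IsConformalKilling g s.vectorField := by
  constructor
  · intro x
    rw [Bundle.contMDiffAt_section]
    have h1 : ContDiffOn ℝ ∞ (fun z ↦ chartVec (n := n) x (pt x z) (s.vectorField (pt x z)))
        (chartTarget (n := n) x) := by
      rw [contDiffOn_euclidean]
      intro i
      refine (s.smooth g hg x (midIdx i) (botIdx n)).congr fun z _ ↦ ?_
      rw [endMatrix_mid_bot]
      rfl
    have h2 : ContMDiffOn (𝓡 n) 𝓘(ℝ, EuclideanSpace ℝ (Fin n)) ∞
        (fun y ↦ chartVec (n := n) x (pt x (extChartAt (𝓡 n) x y))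
          (s.vectorField (pt x (extChartAt (𝓡 n) x y)))) (chartSource (n := n) x) :=
      h1.contMDiffOn.comp (contMDiffOn_extChartAt (x := x)
        |>.mono (by rw [← extChartAt_source (I := 𝓡 n)])) fun y hy ↦
          (extChartAt (𝓡 n) x).map_source hy
    refine (h2.congr (fun y hy ↦ ?_)).contMDiffAt (extChartAt_source_mem_nhds x)
    rw [pt_extChartAt hy, chartVec_eq hy]
    rw [Bundle.Trivialization.continuousLinearMapAt_apply,
      Bundle.Trivialization.coe_linearMapAt_of_mem _ (mem_baseSet hy)]
  · refine ⟨fun x ↦ -2 * (s.toEnd g hg x (0, 0, 1)).2.2, fun a z hz i j ↦ ?_⟩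
    have h := isMetricOn_metricMatrix g a
    set G := metricMatrix g a with hG
    set S := endMatrix (s.toEnd g hg) a with hS
    set K : Fin n → ℝ := fun k ↦ S z (midIdx k) (botIdx n) with hK
    obtain ⟨s1, -, -, -, -, s6⟩ := skew_entries (s.endMatrix_skew hg hz)
    have dK : ∀ i k, pd i (fun y ↦ vectorCoord a (pt a y) (s.vectorField (pt a y)) k) z =
        S z (midIdx k) (midIdx i) - (chr G i z).mulVec K k
          - (if k = i then 1 else 0) * S z (botIdx n) (botIdx n) := by
      intro i k
      have := congrFun (congrFun (s.pdm_endMatrix hs hg hz i) (midIdx k)) (botIdx n)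
      simp only [pdm, Matrix.of_apply, endMatrix_mid_bot] at this
      rw [this]
      have s1' : S z (Sum.inl PUnit.unit) (botIdx n) = 0 := s1
      simp [Matrix.sub_apply, Matrix.mul_apply, s1', Matrix.mulVec, dotProduct, chr, ← hS, ← hG,
        hK]
      exact (sub_sub _ _ _).symm
    have e1 : ∀ i j, ∑ k, G z j k * (S z (midIdx k) (midIdx i) - (chr G i z).mulVec K k
          - (if k = i then 1 else 0) * S z (botIdx n) (botIdx n)) =
        ∑ k, G z j k * S z (midIdx k) (midIdx i) - (G z * chr G i z).mulVec K j
          - G z j i * S z (botIdx n) (botIdx n) := by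
      intro i j
      rw [← Matrix.mulVec_mulVec]
      simp [mul_sub, Finset.sum_sub_distrib, Matrix.mulVec, dotProduct]
    have e2 : ∀ k, pd k (fun y ↦ G y i j) z = (G z * chr G k z) j i + (G z * chr G k z) i j := by
      intro k
      have h1 : (chr G k z).transpose * G z = (G z * chr G k z).transpose := by
        rw [Matrix.transpose_mul, h.transpose_eq hz]
      have := congrFun (congrFun (h.pdm_metric hz k) i) j
      rw [h1] at this
      exact this
    have e3 : ∀ i k l, (G z * chr G k z) l i = (G z * chr G i z) l k := by
      intro i k l
      simp only [Matrix.mul_apply, chr, Matrix.of_apply]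
      exact Finset.sum_congr rfl fun m _ ↦ by rw [h.christoffel_symm hz]
    -- The derivative of the metric along `κ` supplies exactly the Christoffel terms that turn the
    -- partial derivatives of `κ` into covariant ones.
    have e4 : ∑ k, K k * pd k (fun y ↦ G y i j) z =
        (G z * chr G i z).mulVec K j + (G z * chr G j z).mulVec K i := by
      simp only [e2, Matrix.mulVec, dotProduct, ← Finset.sum_add_distrib]
      exact Finset.sum_congr rfl fun k _ ↦ by rw [e3 i k j, e3 j k i]; ring
    have e5 := s6 i j
    simp only [← endMatrix_mid_bot (g := g) (hg := hg), Finset.sum_add_distrib] at *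
    rw [show ∑ k, S z (midIdx k) (botIdx n) * pd k (fun y ↦ G y i j) z = _ from e4]
    have e6 : ∑ k, G z k j * pd i (fun y ↦ S y (midIdx k) (botIdx n)) z = _ :=
      (Finset.sum_congr rfl fun k _ ↦ by rw [h.symm z hz k j, dK i k]).trans (e1 i j)
    have e7 : ∑ k, G z i k * pd j (fun y ↦ S y (midIdx k) (botIdx n)) z = _ :=
      (Finset.sum_congr rfl fun k _ ↦ by rw [dK j k]).trans (e1 j i)
    rw [e6, e7, h.symm z hz j i, ← endMatrix_bot_bot]
    have e8 : ∑ k, G z j k * S z (midIdx k) (midIdx i) = ∑ m, S z (midIdx m) (midIdx i) * G z m j :=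
      Finset.sum_congr rfl fun m _ ↦ by rw [h.symm z hz j m, mul_comm]
    rw [e8]
    linear_combination e5

end AdjointTractorField

end AdjointFields

/-! ### Change of coordinates -/

section CoordChange

variable {n : ℕ} {ι κ : Type*}

/-- The Jacobian matrix of `φ`. -/
def jac (φ : EuclideanSpace ℝ (Fin n) → EuclideanSpace ℝ (Fin n)) (y : EuclideanSpace ℝ (Fin n)) :
    Matrix (Fin n) (Fin n) ℝ :=
  Matrix.of fun a i ↦ pd i (fun x ↦ φ x a) y

/-- The pull-back of the matrix-valued one-form `W` by `φ`. -/
def pullForm (φ : EuclideanSpace ℝ (Fin n) → EuclideanSpace ℝ (Fin n))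
    (W : Fin n → EuclideanSpace ℝ (Fin n) → Matrix ι κ ℝ) (i : Fin n)
    (y : EuclideanSpace ℝ (Fin n)) : Matrix ι κ ℝ :=
  ∑ a, jac φ y a i • W a (φ y)

/-- `φ` is a change of coordinates from `O'` into `O` that pulls the metric `G` back to `G'`. -/
structure IsCoordChange (O' O : Set (EuclideanSpace ℝ (Fin n)))
    (φ : EuclideanSpace ℝ (Fin n) → EuclideanSpace ℝ (Fin n))
    (G' G : EuclideanSpace ℝ (Fin n) → Matrix (Fin n) (Fin n) ℝ) : Prop where
  source : IsMetricOn O' G'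
  target : IsMetricOn O G
  mapsTo : MapsTo φ O' O
  smooth : ContDiffOn ℝ ∞ φ O'
  isUnit : ∀ y ∈ O', IsUnit (jac φ y).det
  pullback : ∀ y ∈ O', G' y = (jac φ y).transpose * G (φ y) * jac φ y

namespace IsCoordChange

variable {O' O : Set (EuclideanSpace ℝ (Fin n))}
  {φ : EuclideanSpace ℝ (Fin n) → EuclideanSpace ℝ (Fin n)}
  {G' G : EuclideanSpace ℝ (Fin n) → Matrix (Fin n) (Fin n) ℝ} {y : EuclideanSpace ℝ (Fin n)}
  (h : IsCoordChange O' O φ G' G)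
include h

lemma comp_smooth {W : EuclideanSpace ℝ (Fin n) → Matrix ι κ ℝ} (hW : SmoothM O W) :
    SmoothM O' (fun x ↦ W (φ x)) :=
  fun A B ↦ (hW A B).comp h.smooth h.mapsTo

lemma apply_smooth (a : Fin n) : ContDiffOn ℝ ∞ (fun x ↦ φ x a) O' :=
  contDiffOn_euclidean.mp h.smooth a

lemma jac_smooth : SmoothM O' (jac φ) :=
  fun a i ↦ contDiffOn_pd h.source.isOpen (h.apply_smooth a) i

lemma jacInv_smooth : SmoothM O' (fun x ↦ (jac φ x)⁻¹) := h.jac_smooth.inv h.isUnit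

lemma pullForm_smooth {W : Fin n → EuclideanSpace ℝ (Fin n) → Matrix ι κ ℝ}
    (hW : ∀ i, SmoothM O (W i)) (i : Fin n) : SmoothM O' (pullForm φ W i) :=
  SmoothM.sum fun a _ ↦ SmoothM.smul (h.jac_smooth a i) (h.comp_smooth (hW a))

variable (hy : y ∈ O')
include hy

lemma pd_comp {f : EuclideanSpace ℝ (Fin n) → ℝ} (hf : ContDiffOn ℝ ∞ f O) (i : Fin n) :
    pd i (fun x ↦ f (φ x)) y = ∑ a, jac φ y a i * pd a f (φ y) := by
  have h1 : DifferentiableAt ℝ φ y :=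
    (h.smooth.contDiffAt (h.source.isOpen.mem_nhds hy)).differentiableAt (by simp)
  have h2 : DifferentiableAt ℝ f (φ y) := ContDiffOn.diffAt hf h.target.isOpen (h.mapsTo hy)
  have h3 : ∀ a, (fderiv ℝ φ y (EuclideanSpace.single i 1)) a = jac φ y a i := by
    intro a
    have : HasFDerivAt (fun x ↦ φ x a)
        ((EuclideanSpace.proj (𝕜 := ℝ) a : EuclideanSpace ℝ (Fin n) →L[ℝ] ℝ) ∘L fderiv ℝ φ y) y :=
      (EuclideanSpace.proj (𝕜 := ℝ) a : EuclideanSpace ℝ (Fin n) →L[ℝ] ℝ).hasFDerivAt.comp y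
        h1.hasFDerivAt
    simp only [jac, Matrix.of_apply, pd, this.fderiv]
    rfl
  have h4 : fderiv ℝ φ y (EuclideanSpace.single i 1) =
      ∑ a, jac φ y a i • EuclideanSpace.single a (1 : ℝ) := by
    ext a
    rw [h3]
    simp [Finset.sum_apply, Pi.single_apply]
  unfold pd
  rw [show (fun x ↦ f (φ x)) = f ∘ φ from rfl, fderiv_comp y h2 h1,
    ContinuousLinearMap.comp_apply, h4]
  simp

lemma pdm_comp {W : EuclideanSpace ℝ (Fin n) → Matrix ι κ ℝ} (hW : SmoothM O W) (i : Fin n) :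
    pdm i (fun x ↦ W (φ x)) y = pullForm φ (fun a ↦ pdm a W) i y := by
  ext A B
  simp only [pdm, pullForm, Matrix.of_apply, Matrix.sum_apply, Matrix.smul_apply, smul_eq_mul]
  exact h.pd_comp hy (hW A B) i

lemma pdm_jac_symm (i j a : Fin n) : pdm i (jac φ) y a j = pdm j (jac φ) y a i :=
  pd_comm h.source.isOpen (h.apply_smooth a) hy i j

lemma mul_inv : jac φ y * (jac φ y)⁻¹ = 1 := Matrix.mul_nonsing_inv _ (h.isUnit y hy)

lemma inv_mul : (jac φ y)⁻¹ * jac φ y = 1 := Matrix.nonsing_inv_mul _ (h.isUnit y hy)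

/-- The second derivatives of `φ` are symmetric in the form indices, so they drop out of the
antisymmetrised derivative. -/
lemma curv_pullForm [Fintype ι] {W : Fin n → EuclideanSpace ℝ (Fin n) → Matrix ι ι ℝ}
    (hW : ∀ i, SmoothM O (W i)) (i j : Fin n) : curv (pullForm φ W) i j y =
      ∑ a, ∑ b, (jac φ y a i * jac φ y b j) • curv W a b (φ y) := by
  have e : ∀ i j, pdm i (pullForm φ W j) y = ∑ b, pdm i (jac φ) y b j • W b (φ y)
      + ∑ a, ∑ b, (jac φ y a i * jac φ y b j) • pdm a (W b) (φ y) := by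
    intro i j
    have h1 : pdm i (pullForm φ W j) y = ∑ b, pdm i (fun x ↦ jac φ x b j • W b (φ x)) y :=
      pdm_sum h.source.isOpen hy (S := fun b x ↦ jac φ x b j • W b (φ x))
        (fun b _ ↦ SmoothM.smul (h.jac_smooth b j) (h.comp_smooth (hW b))) i
    rw [h1, Finset.sum_comm (f := fun a b ↦ (jac φ y a i * jac φ y b j) • pdm a (W b) (φ y)),
      ← Finset.sum_add_distrib]
    refine Finset.sum_congr rfl fun b _ ↦ ?_
    rw [pdm_smul h.source.isOpen hy (h.jac_smooth b j) (h.comp_smooth (hW b)),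
      h.pdm_comp hy (hW b)]
    simp only [pullForm, Finset.smul_sum, smul_smul]
    congr 1
    exact Finset.sum_congr rfl fun a _ ↦ by rw [mul_comm]
  have m : ∀ i j, pullForm φ W i y * pullForm φ W j y =
      ∑ a, ∑ b, (jac φ y a i * jac φ y b j) • (W a (φ y) * W b (φ y)) := by
    intro i j
    simp only [pullForm, Finset.sum_mul, Finset.mul_sum, smul_mul_assoc, mul_smul_comm,
      Finset.smul_sum, smul_smul]
    rw [Finset.sum_comm]
    exact Finset.sum_congr rfl fun a _ ↦ Finset.sum_congr rfl fun b _ ↦ by rw [mul_comm]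
  have sw : ∀ F : Fin n → Fin n → Matrix ι ι ℝ,
      ∑ a, ∑ b, (jac φ y a j * jac φ y b i) • F a b =
        ∑ a, ∑ b, (jac φ y a i * jac φ y b j) • F b a := by
    intro F
    rw [Finset.sum_comm]
    exact Finset.sum_congr rfl fun a _ ↦ Finset.sum_congr rfl fun b _ ↦ by rw [mul_comm]
  have s : ∑ b, pdm i (jac φ) y b j • W b (φ y) = ∑ b, pdm j (jac φ) y b i • W b (φ y) :=
    Finset.sum_congr rfl fun b _ ↦ by rw [h.pdm_jac_symm hy]
  simp only [curv]
  rw [e, e, m, m, s, sw fun a b ↦ pdm a (W b) (φ y), sw fun a b ↦ W a (φ y) * W b (φ y),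
    add_sub_add_left_eq_sub]
  simp only [← Finset.sum_add_distrib, ← Finset.sum_sub_distrib, ← smul_add, ← smul_sub]

/-- The right side is torsion-free and compatible with the pulled-back metric, so uniqueness of the
Levi-Civita connection replaces a computation with Christoffel symbols. -/
lemma chr_eq (i : Fin n) : chr G' i y =
    (jac φ y)⁻¹ * pullForm φ (chr G) i y * jac φ y + (jac φ y)⁻¹ * pdm i (jac φ) y := by
  set S := jac φ y with hS
  set T := (jac φ y)⁻¹ with hT
  have hTS : T * S = 1 := h.inv_mul hy
  have hST : S * T = 1 := h.mul_inv hy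
  have hST' : T.transpose * S.transpose = 1 := by
    rw [← Matrix.transpose_mul, hST, Matrix.transpose_one]
  refine (h.source.chr_unique hy
    (W := fun i ↦ T * pullForm φ (chr G) i y * S + T * pdm i (jac φ) y) (fun i ↦ ?_)
    (fun i j k ↦ ?_) i).symm
  · have e1 : pullForm φ (fun a ↦ pdm a G) i y =
        (pullForm φ (chr G) i y).transpose * G (φ y) + G (φ y) * pullForm φ (chr G) i y := by
      simp only [pullForm, Matrix.transpose_sum, Matrix.transpose_smul, Finset.sum_mul,
        Finset.mul_sum, smul_mul_assoc, mul_smul_comm, ← Finset.sum_add_distrib, ← smul_add]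
      exact Finset.sum_congr rfl fun a _ ↦ by rw [h.target.pdm_metric (h.mapsTo hy)]
    have hsm := h.comp_smooth h.target.smooth
    rw [pdm_congr h.source.isOpen hy h.pullback, pdm_mul h.source.isOpen hy
      (h.jac_smooth.transpose.mul hsm) h.jac_smooth, pdm_mul h.source.isOpen hy
      h.jac_smooth.transpose hsm, pdm_transpose, h.pdm_comp hy h.target.smooth, e1, h.pullback y hy]
    simp only [Matrix.transpose_add, Matrix.transpose_mul, ← hS]
    have k1 : ∀ X : Matrix (Fin n) (Fin n) ℝ, T.transpose * (S.transpose * X) = X := fun X ↦ by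
      rw [← mul_assoc, hST', one_mul]
    have k2 : ∀ X : Matrix (Fin n) (Fin n) ℝ, S * (T * X) = X := fun X ↦ by
      rw [← mul_assoc, hST, one_mul]
    simp only [add_mul, mul_add, mul_assoc, k1, k2]
    abel
  · have e1 : (T * pullForm φ (chr G) i y * S) k j = (T * pullForm φ (chr G) j y * S) k i := by
      rw [mul_assoc, mul_assoc, Matrix.mul_apply, Matrix.mul_apply]
      refine Finset.sum_congr rfl fun c _ ↦ ?_
      congr 1
      simp only [pullForm, Finset.sum_mul, Matrix.sum_apply, Matrix.smul_apply,
        Matrix.mul_apply, smul_eq_mul, chr, Matrix.of_apply]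
      rw [Finset.sum_comm]
      refine Finset.sum_congr rfl fun a _ ↦ Finset.sum_congr rfl fun b _ ↦ ?_
      rw [h.target.christoffel_symm (h.mapsTo hy)]
      ring
    simp only [Matrix.add_apply, e1]
    congr 1
    simp only [Matrix.mul_apply]
    exact Finset.sum_congr rfl fun c _ ↦ by rw [h.pdm_jac_symm hy]

lemma curv_chr_eq (i j : Fin n) : curv (chr G') i j y = (jac φ y)⁻¹ *
    (∑ a, ∑ b, (jac φ y a i * jac φ y b j) • curv (chr G) a b (φ y)) * jac φ y := by
  rw [← h.curv_pullForm hy h.target.chr_smooth, ← curv_gauge h.source.isOpen hy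
    (h.pullForm_smooth h.target.chr_smooth) h.jac_smooth h.jacInv_smooth
    (fun x hx ↦ h.inv_mul hx)]
  unfold curv
  simp only [h.chr_eq hy]
  rw [pdm_congr h.source.isOpen hy fun x hx ↦ h.chr_eq hx j,
    pdm_congr h.source.isOpen hy fun x hx ↦ h.chr_eq hx i]

omit h hy in
/-- The Ricci tensor as a matrix. -/
def _root_.ConformalTractor.ricciM (G : EuclideanSpace ℝ (Fin n) → Matrix (Fin n) (Fin n) ℝ)
    (z : EuclideanSpace ℝ (Fin n)) : Matrix (Fin n) (Fin n) ℝ :=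
  Matrix.of fun j l ↦ ricci G j l z

omit h hy in
/-- The Schouten tensor as a matrix. -/
def _root_.ConformalTractor.schoutenM (G : EuclideanSpace ℝ (Fin n) → Matrix (Fin n) (Fin n) ℝ)
    (z : EuclideanSpace ℝ (Fin n)) : Matrix (Fin n) (Fin n) ℝ :=
  Matrix.of fun j l ↦ schouten G j l z

omit h hy in
lemma _root_.ConformalTractor.schoutenM_eq (G : EuclideanSpace ℝ (Fin n) → Matrix (Fin n) (Fin n) ℝ)
    (z : EuclideanSpace ℝ (Fin n)) : schoutenM G z = (1 / ((n : ℝ) - 2)) •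
      (ricciM G z - (scalarCurvature G z / (2 * ((n : ℝ) - 1))) • G z) := rfl

/-- In the trace, the Jacobian of the contracted form index cancels the inverse Jacobian of the
upper index; those of the two free lower indices remain. -/
lemma ricciM_eq : ricciM G' y = (jac φ y).transpose * ricciM G (φ y) * jac φ y := by
  ext j l
  set S := jac φ y with hS
  have hST : S * S⁻¹ = 1 := h.mul_inv hy
  have e1 : ∀ k, curv (chr G') k j y k l =
      ∑ a, ∑ b, S b j * ((∑ c, S a k * S⁻¹ k c * (curv (chr G) a b (φ y) * S) c l)) := by
    intro k
    rw [h.curv_chr_eq hy, mul_assoc, Matrix.mul_apply]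
    simp only [Finset.sum_mul, smul_mul_assoc, Matrix.sum_apply, Matrix.smul_apply, smul_eq_mul,
      Finset.mul_sum]
    rw [Finset.sum_comm]
    refine Finset.sum_congr rfl fun a _ ↦ ?_
    rw [Finset.sum_comm]
    exact Finset.sum_congr rfl fun b _ ↦ Finset.sum_congr rfl fun c _ ↦ by ring
  simp only [ricciM, Matrix.of_apply, ricci, riemann_eq_curv, e1]
  have e2 : ∀ a b, ∑ k, ∑ c, S a k * S⁻¹ k c * (curv (chr G) a b (φ y) * S) c l =
      (curv (chr G) a b (φ y) * S) a l := by
    intro a b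
    rw [Finset.sum_comm]
    have : ∀ c, ∑ k, S a k * S⁻¹ k c = if a = c then 1 else 0 := fun c ↦ by
      rw [← Matrix.mul_apply, hST, Matrix.one_apply]
    simp only [← Finset.sum_mul, this]
    simp
  rw [Finset.sum_comm]
  have e3 : ∀ a, ∑ k, ∑ b, S b j * (∑ c, S a k * S⁻¹ k c * (curv (chr G) a b (φ y) * S) c l) =
      ∑ b, S b j * (curv (chr G) a b (φ y) * S) a l := by
    intro a
    rw [Finset.sum_comm]
    simp only [← Finset.mul_sum, e2]
  simp only [e3]
  rw [Finset.sum_comm, mul_assoc, Matrix.mul_apply]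
  refine Finset.sum_congr rfl fun b _ ↦ ?_
  rw [← Finset.mul_sum, Matrix.transpose_apply]
  congr 1
  simp only [Matrix.mul_apply, Matrix.of_apply, Finset.sum_mul]
  rw [Finset.sum_comm]

lemma metric_inv_eq : (G' y)⁻¹ = (jac φ y)⁻¹ * (G (φ y))⁻¹ * ((jac φ y)⁻¹).transpose := by
  rw [h.pullback y hy, Matrix.mul_inv_rev, Matrix.mul_inv_rev, Matrix.transpose_nonsing_inv,
    mul_assoc]

lemma scalar_eq : scalarCurvature G' y = scalarCurvature G (φ y) := by
  have e : ∀ {O : Set (EuclideanSpace ℝ (Fin n))} {G} (_ : IsMetricOn O G) {z} (_ : z ∈ O),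
      scalarCurvature G z = ((G z)⁻¹ * ricciM G z).trace := by
    intro O G hG z hz
    simp only [scalarCurvature, Matrix.trace, Matrix.diag, Matrix.mul_apply, ricciM,
      Matrix.of_apply]
    exact Finset.sum_congr rfl fun i _ ↦ Finset.sum_congr rfl fun j _ ↦ by rw [hG.ricci_symm hz]
  rw [e h.source hy, e h.target (h.mapsTo hy), h.metric_inv_eq hy, h.ricciM_eq hy]
  have hST' : (jac φ y)⁻¹.transpose * (jac φ y).transpose = 1 := by
    rw [← Matrix.transpose_mul, h.mul_inv hy, Matrix.transpose_one]
  have : (jac φ y)⁻¹ * (G (φ y))⁻¹ * (jac φ y)⁻¹.transpose *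
      ((jac φ y).transpose * ricciM G (φ y) * jac φ y) =
      (jac φ y)⁻¹ * ((G (φ y))⁻¹ * ricciM G (φ y) * jac φ y) := by
    simp only [mul_assoc]
    rw [← mul_assoc (jac φ y)⁻¹.transpose, hST', one_mul]
  rw [this, Matrix.trace_mul_comm, mul_assoc, h.mul_inv hy, mul_one]

lemma schoutenM_eq : schoutenM G' y = (jac φ y).transpose * schoutenM G (φ y) * jac φ y := by
  rw [ConformalTractor.schoutenM_eq, ConformalTractor.schoutenM_eq, h.scalar_eq hy,
    h.ricciM_eq hy, h.pullback y hy]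
  simp only [Matrix.mul_smul, Matrix.smul_mul, mul_sub, sub_mul]

omit h hy in
/-- The matrix relating the tractor frames of two charts. -/
def _root_.ConformalTractor.tractorJac (S : Matrix (Fin n) (Fin n) ℝ) :
    Matrix (TIndex n) (TIndex n) ℝ := Matrix.of fun A B ↦
  match A, B with
  | .inl _, .inl _ => 1
  | .inr (.inl k), .inr (.inl j) => S k j
  | .inr (.inr _), .inr (.inr _) => 1
  | _, _ => 0

/-- The tractor connection is independent of the coordinates. -/
lemma connectionMatrix_eq (i : Fin n) :
    tractorJac (jac φ y) * connectionMatrix G' i y =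
      pullForm φ (connectionMatrix G) i y * tractorJac (jac φ y)
        + pdm i (fun x ↦ tractorJac (jac φ x)) y := by
  set S := jac φ y with hS
  have t1 : tractorJac S (topIdx n) (topIdx n) = 1 := rfl
  have t2 : ∀ k, tractorJac S (topIdx n) (midIdx k) = 0 := fun _ ↦ rfl
  have t3 : tractorJac S (topIdx n) (botIdx n) = 0 := rfl
  have t4 : ∀ k, tractorJac S (midIdx k) (topIdx n) = 0 := fun _ ↦ rfl
  have t5 : ∀ k l, tractorJac S (midIdx k) (midIdx l) = S k l := fun _ _ ↦ rfl
  have t6 : ∀ k, tractorJac S (midIdx k) (botIdx n) = 0 := fun _ ↦ rfl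
  have t7 : tractorJac S (botIdx n) (topIdx n) = 0 := rfl
  have t8 : ∀ k, tractorJac S (botIdx n) (midIdx k) = 0 := fun _ ↦ rfl
  have t9 : tractorJac S (botIdx n) (botIdx n) = 1 := rfl
  have d0 : ∀ A B, pdm i (fun x ↦ tractorJac (jac φ x)) y A B =
    pd i (fun x ↦ tractorJac (jac φ x) A B) y := fun _ _ ↦ rfl
  have hP := h.schoutenM_eq hy
  have pf : ∀ A B, pullForm φ (connectionMatrix G) i y A B =
      ∑ a, S a i * connectionMatrix G a (φ y) A B := fun A B ↦ by
    simp [pullForm, Matrix.sum_apply, hS]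
  have hPe : ∀ i j, schouten G' i j y = ∑ a, S a i * ∑ m, schouten G a m (φ y) * S m j := by
    intro i j
    have := congrFun (congrFun hP i) j
    rw [mul_assoc] at this
    exact this
  have hGe : ∀ i j, G' y i j = ∑ a, S a i * ∑ m, G (φ y) a m * S m j := by
    intro i j
    have := congrFun (congrFun (h.pullback y hy) i) j
    rw [mul_assoc] at this
    exact this
  have hST : S * S⁻¹ = 1 := h.mul_inv hy
  have hC : S * chr G' i y = pullForm φ (chr G) i y * S + pdm i (jac φ) y := by
    rw [h.chr_eq hy, mul_add, mul_assoc S⁻¹, ← mul_assoc S, ← mul_assoc S, hST, one_mul,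
      one_mul]
  have hIP : S * ((G' y)⁻¹ * (schoutenM G' y).transpose) =
      (G (φ y))⁻¹ * ((schoutenM G (φ y)).transpose * S) := by
    have hST' : S⁻¹.transpose * S.transpose = 1 := by
      rw [← Matrix.transpose_mul, hST, Matrix.transpose_one]
    rw [h.metric_inv_eq hy, hP, Matrix.transpose_mul, Matrix.transpose_mul,
      Matrix.transpose_transpose]
    simp only [← hS, mul_assoc]
    rw [← mul_assoc S⁻¹.transpose, hST', one_mul, ← mul_assoc, hST, one_mul]
  ext A B
  simp only [Matrix.add_apply, Matrix.mul_apply, sum_TIndex]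
  rcases TIndex_cases A with rfl | ⟨k, rfl⟩ | rfl <;>
    rcases TIndex_cases B with rfl | ⟨l, rfl⟩ | rfl
  · have e : pd i (fun x ↦ tractorJac (jac φ x) (topIdx n) (topIdx n)) y = 0 := pd_const i 1
    simp [t1, t2, t3, t4, t7, pf, d0, e]
  · have e : pd i (fun x ↦ tractorJac (jac φ x) (topIdx n) (midIdx l)) y = 0 := pd_const i 0
    simp [t1, t2, t3, t5, t8, pf, d0, e, hGe, Finset.mul_sum, Finset.sum_mul]
    rw [Finset.sum_comm]
    exact Finset.sum_congr rfl fun a _ ↦ Finset.sum_congr rfl fun b _ ↦ by ring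
  · have e : pd i (fun x ↦ tractorJac (jac φ x) (topIdx n) (botIdx n)) y = 0 := pd_const i 0
    simp [t1, t2, t3, t6, t9, pf, d0, e]
  · have e : pd i (fun x ↦ tractorJac (jac φ x) (midIdx k) (topIdx n)) y = 0 := pd_const i 0
    have hm := congrFun (congrFun hIP k) i
    simp only [Matrix.mul_apply, Matrix.transpose_apply, schoutenM, Matrix.of_apply] at hm
    simp only [t1, t4, t5, t6, t7, pf, d0, e, conn_mid_top, zero_mul, mul_zero, zero_add, add_zero,
      mul_one, Finset.sum_const_zero]
    rw [hm]
    simp only [Finset.mul_sum]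
    rw [Finset.sum_comm]
    exact Finset.sum_congr rfl fun a _ ↦ Finset.sum_congr rfl fun b _ ↦ by ring
  · have e : pd i (fun x ↦ tractorJac (jac φ x) (midIdx k) (midIdx l)) y = pdm i (jac φ) y k l := rfl
    have hm := congrFun (congrFun hC k) l
    simp only [Matrix.mul_apply, Matrix.add_apply, chr, pullForm, Matrix.of_apply,
      Matrix.sum_apply, Matrix.smul_apply, smul_eq_mul] at hm
    simp only [t2, t4, t5, t6, t8, pf, d0, e, conn_mid_mid, zero_mul, mul_zero, zero_add, add_zero]
    exact hm
  · have e : pd i (fun x ↦ tractorJac (jac φ x) (midIdx k) (botIdx n)) y = 0 := pd_const i 0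
    simp [t4, t5, t6, t3, t9, pf, d0, e]
  · have e : pd i (fun x ↦ tractorJac (jac φ x) (botIdx n) (topIdx n)) y = 0 := pd_const i 0
    simp [t1, t4, t7, t8, t9, pf, d0, e]
  · have e : pd i (fun x ↦ tractorJac (jac φ x) (botIdx n) (midIdx l)) y = 0 := pd_const i 0
    simp [t2, t5, t7, t8, t9, pf, d0, e, hPe, Finset.mul_sum, Finset.sum_mul]
    rw [Finset.sum_comm]
    exact Finset.sum_congr rfl fun a _ ↦ Finset.sum_congr rfl fun b _ ↦ by ring
  · have e : pd i (fun x ↦ tractorJac (jac φ x) (botIdx n) (botIdx n)) y = 0 := pd_const i 1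
    simp [t3, t6, t7, t8, t9, pf, d0, e]

end IsCoordChange

end CoordChange

/-! ### Linear parallel transport equations along curves -/

section Transport

variable {n : ℕ} {ι κ l : Type*} {O : Set (EuclideanSpace ℝ (Fin n))}
  {ζ : ℝ → EuclideanSpace ℝ (Fin n)} {a b u : ℝ}

/-- The velocity of the curve `ζ` on the interval `[a, b]`. -/
def vel (ζ : ℝ → EuclideanSpace ℝ (Fin n)) (a b u : ℝ) (i : Fin n) : ℝ :=
  derivWithin (fun r ↦ ζ r i) (Icc a b) u

/-- `ζ` is a smooth curve in `O` on the interval `[a, b]`. -/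
structure IsCurve (O : Set (EuclideanSpace ℝ (Fin n))) (ζ : ℝ → EuclideanSpace ℝ (Fin n))
    (a b : ℝ) : Prop where
  smooth : ContDiffOn ℝ ∞ ζ (Icc a b)
  mapsTo : ∀ u ∈ Icc a b, ζ u ∈ O

/-- The columns of `X` are parallel along `ζ` for the connection matrices `W`. -/
def IsSol [Fintype ι] (W : Fin n → EuclideanSpace ℝ (Fin n) → Matrix ι ι ℝ)
    (ζ : ℝ → EuclideanSpace ℝ (Fin n)) (a b : ℝ) (X : ℝ → Matrix ι κ ℝ) : Prop :=
  ∀ u ∈ Icc a b, ∀ A B, HasDerivWithinAt (fun r ↦ X r A B)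
    (-∑ i, vel ζ a b u i * (W i (ζ u) * X u) A B) (Icc a b) u

/-- Within a single point every number is a derivative. This disposes of degenerate intervals, where
`vel` carries no information. -/
lemma hasDerivWithinAt_Icc_self {f : ℝ → ℝ} {f' : ℝ} (hab : b ≤ a) (hu : u ∈ Icc a b) :
    HasDerivWithinAt f f' (Icc a b) u := by
  have h1 : a = b := le_antisymm (hu.1.trans hu.2) hab
  subst h1
  have h2 : u = a := le_antisymm hu.2 hu.1
  subst h2
  rw [Icc_self]
  exact HasFDerivWithinAt.singleton

namespace IsCurve

lemma mono {a' b' : ℝ} (h : IsCurve O ζ a b) (ha : a ≤ a') (hb : b' ≤ b) : IsCurve O ζ a' b' :=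
  ⟨h.smooth.mono (Icc_subset_Icc ha hb), fun u hu ↦ h.mapsTo u (Icc_subset_Icc ha hb hu)⟩

lemma mono_set {O' : Set (EuclideanSpace ℝ (Fin n))} (h : IsCurve O ζ a b)
    (hO : ∀ u ∈ Icc a b, ζ u ∈ O') : IsCurve O' ζ a b := ⟨h.smooth, hO⟩

variable (h : IsCurve O ζ a b)
include h

lemma continuousOn : ContinuousOn ζ (Icc a b) := h.smooth.continuousOn

lemma apply_smooth (i : Fin n) : ContDiffOn ℝ ∞ (fun r ↦ ζ r i) (Icc a b) :=
  contDiffOn_euclidean.mp h.smooth i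

lemma hasDeriv_apply (hu : u ∈ Icc a b) (i : Fin n) :
    HasDerivWithinAt (fun r ↦ ζ r i) (vel ζ a b u i) (Icc a b) u :=
  (((h.apply_smooth i).differentiableOn (by simp)) u hu).hasDerivWithinAt

lemma hasDeriv_comp (hu : u ∈ Icc a b) {f : EuclideanSpace ℝ (Fin n) → ℝ}
    (hf : DifferentiableAt ℝ f (ζ u)) :
    HasDerivWithinAt (fun r ↦ f (ζ r)) (∑ i, vel ζ a b u i * pd i f (ζ u)) (Icc a b) u := by
  have h1 : HasDerivWithinAt ζ (derivWithin ζ (Icc a b) u) (Icc a b) u :=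
    ((h.smooth.differentiableOn (by simp)) u hu).hasDerivWithinAt
  rcases le_or_gt b a with hab | hab
  · exact hasDerivWithinAt_Icc_self hab hu
  have h2 : ∀ i, (derivWithin ζ (Icc a b) u) i = vel ζ a b u i := fun i ↦
    (((EuclideanSpace.proj (𝕜 := ℝ) i : EuclideanSpace ℝ (Fin n) →L[ℝ] ℝ).hasFDerivAt
      (x := ζ u)).comp_hasDerivWithinAt u h1).derivWithin (uniqueDiffOn_Icc hab u hu) |>.symm
  have h3 : derivWithin ζ (Icc a b) u = ∑ i, vel ζ a b u i • EuclideanSpace.single i (1 : ℝ) := by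
    ext i
    rw [h2]
    simp [Finset.sum_apply, Pi.single_apply]
  rw [h3] at h1
  refine (hf.hasFDerivAt.comp_hasDerivWithinAt u h1).congr_deriv ?_
  simp [map_sum, pd]

lemma continuousOn_vel (hab : a < b) (i : Fin n) :
    ContinuousOn (fun u ↦ vel ζ a b u i) (Icc a b) :=
  (h.apply_smooth i).continuousOn_derivWithin (uniqueDiffOn_Icc hab) (by simp)

lemma vel_mono {a' b' : ℝ} (ha : a ≤ a') (hb : b' ≤ b) (hab : a' < b') (hu : u ∈ Icc a' b')
    (i : Fin n) : vel ζ a' b' u i = vel ζ a b u i :=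
  ((h.hasDeriv_apply (Icc_subset_Icc ha hb hu) i).mono
    (Icc_subset_Icc ha hb)).derivWithin (uniqueDiffOn_Icc hab u hu)

lemma comp_affine {a' b' m k : ℝ} (hm : ∀ u ∈ Icc a' b', m * u + k ∈ Icc a b) :
    IsCurve O (fun r ↦ ζ (m * r + k)) a' b' := by
  refine ⟨h.smooth.comp ?_ hm, fun u hu ↦ h.mapsTo _ (hm u hu)⟩
  fun_prop

lemma vel_comp_affine {a' b' m k : ℝ} (hm : ∀ u ∈ Icc a' b', m * u + k ∈ Icc a b) (hab : a' < b')
    (hu : u ∈ Icc a' b') (i : Fin n) :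
    vel (fun r ↦ ζ (m * r + k)) a' b' u i = m * vel ζ a b (m * u + k) i := by
  have h1 : HasDerivWithinAt (fun r : ℝ ↦ m * r + k) m (Icc a' b') u := by
    simpa using (((hasDerivAt_id u).const_mul m).add_const k).hasDerivWithinAt
  exact ((h.hasDeriv_apply (hm u hu) i).scomp u h1 hm).derivWithin (uniqueDiffOn_Icc hab u hu)

lemma comp {O' : Set (EuclideanSpace ℝ (Fin n))}
    {φ : EuclideanSpace ℝ (Fin n) → EuclideanSpace ℝ (Fin n)} (hφ : ContDiffOn ℝ ∞ φ O)
    (hO : MapsTo φ O O') : IsCurve O' (fun r ↦ φ (ζ r)) a b :=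
  ⟨hφ.comp h.smooth h.mapsTo, fun u hu ↦ hO (h.mapsTo u hu)⟩

lemma vel_comp {φ : EuclideanSpace ℝ (Fin n) → EuclideanSpace ℝ (Fin n)} (hO : IsOpen O)
    (hφ : ContDiffOn ℝ ∞ φ O) (hab : a < b) (hu : u ∈ Icc a b) (c : Fin n) :
    vel (fun r ↦ φ (ζ r)) a b u c = ∑ i, vel ζ a b u i * jac φ (ζ u) c i :=
  (h.hasDeriv_comp hu (f := fun x ↦ φ x c) (ContDiffOn.diffAt (contDiffOn_euclidean.mp hφ c) hO
    (h.mapsTo u hu))).derivWithin (uniqueDiffOn_Icc hab u hu)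

lemma hasDeriv_entry {S : EuclideanSpace ℝ (Fin n) → Matrix ι κ ℝ} (hO : IsOpen O)
    (hS : SmoothM O S) (hu : u ∈ Icc a b) (A : ι) (B : κ) :
    HasDerivWithinAt (fun r ↦ S (ζ r) A B) (∑ i, vel ζ a b u i * pdm i S (ζ u) A B) (Icc a b) u :=
  h.hasDeriv_comp hu (hS.diffAt hO (h.mapsTo u hu) A B)

end IsCurve

variable [Fintype ι] {W : Fin n → EuclideanSpace ℝ (Fin n) → Matrix ι ι ℝ}
  {X : ℝ → Matrix ι κ ℝ}

lemma isSol_of_le (hab : b ≤ a) : IsSol W ζ a b X :=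
  fun _ hu _ _ ↦ hasDerivWithinAt_Icc_self hab hu

namespace IsSol

lemma continuousOn (hX : IsSol W ζ a b X) (A : ι) (B : κ) :
    ContinuousOn (fun r ↦ X r A B) (Icc a b) := fun u hu ↦ (hX u hu A B).continuousWithinAt

lemma congr {Y : ℝ → Matrix ι κ ℝ} (hX : IsSol W ζ a b X) (h : EqOn Y X (Icc a b)) :
    IsSol W ζ a b Y := by
  intro u hu A B
  rw [h hu]
  exact (hX u hu A B).congr (fun r hr ↦ by rw [h hr]) (by rw [h hu])

lemma congr_curve {ζ' : ℝ → EuclideanSpace ℝ (Fin n)} (hX : IsSol W ζ a b X)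
    (h : EqOn ζ' ζ (Icc a b)) : IsSol W ζ' a b X := by
  intro u hu A B
  have e : ∀ i, vel ζ' a b u i = vel ζ a b u i := fun i ↦
    derivWithin_congr (fun r hr ↦ by simp only [h hr]) (by simp only [h hu])
  simp only [e, h hu]
  exact hX u hu A B

lemma mono {a' b' : ℝ} (hX : IsSol W ζ a b X) (hζ : IsCurve O ζ a b) (ha : a ≤ a') (hb : b' ≤ b) :
    IsSol W ζ a' b' X := by
  rcases le_or_gt b' a' with hab | hab
  · exact isSol_of_le hab
  intro u hu A B
  simp only [hζ.vel_mono ha hb hab hu]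
  exact (hX u (Icc_subset_Icc ha hb hu) A B).mono (Icc_subset_Icc ha hb)

lemma comp_affine {a' b' m k : ℝ} (hX : IsSol W ζ a b X) (hζ : IsCurve O ζ a b)
    (hm : ∀ u ∈ Icc a' b', m * u + k ∈ Icc a b) :
    IsSol W (fun r ↦ ζ (m * r + k)) a' b' (fun r ↦ X (m * r + k)) := by
  rcases le_or_gt b' a' with hab | hab
  · exact isSol_of_le hab
  intro u hu A B
  have h1 : HasDerivWithinAt (fun r : ℝ ↦ m * r + k) m (Icc a' b') u := by
    simpa using (((hasDerivAt_id u).const_mul m).add_const k).hasDerivWithinAt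
  have h2 := (hX _ (hm u hu) A B).scomp u h1 hm
  simp only [hζ.vel_comp_affine hm hab hu, mul_assoc, ← Finset.mul_sum]
  simpa [smul_eq_mul, Function.comp_def] using h2

lemma mul_const [Fintype κ] (hX : IsSol W ζ a b X) (C : Matrix κ l ℝ) :
    IsSol W ζ a b (fun r ↦ X r * C) := by
  intro u hu A B
  have e : ∀ r, (X r * C) A B = ∑ k, X r A k * C k B := fun r ↦ Matrix.mul_apply
  have e' : ∀ i, (W i (ζ u) * (X u * C)) A B = ∑ k, (W i (ζ u) * X u) A k * C k B := fun i ↦ by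
    rw [← Matrix.mul_assoc, Matrix.mul_apply]
  simp only [e, e']
  refine (HasDerivWithinAt.fun_sum fun k _ ↦ (hX u hu A k).mul_const (C k B)).congr_deriv ?_
  simp only [neg_mul, Finset.sum_neg_distrib, Finset.sum_mul, Finset.mul_sum, mul_assoc]
  rw [Finset.sum_comm]

lemma sub {Y : ℝ → Matrix ι κ ℝ} (hX : IsSol W ζ a b X) (hY : IsSol W ζ a b Y) :
    IsSol W ζ a b (fun r ↦ X r - Y r) := by
  intro u hu A B
  refine ((hX u hu A B).sub (hY u hu A B)).congr_deriv ?_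
  simp only [Matrix.mul_sub, Matrix.sub_apply, mul_sub, Finset.sum_sub_distrib]
  ring

/-- Multiplication by `T` with `dT = T W - W' T` turns solutions for `W` into solutions for `W'`. -/
lemma gauge {W' : Fin n → EuclideanSpace ℝ (Fin n) → Matrix ι ι ℝ}
    {T : EuclideanSpace ℝ (Fin n) → Matrix ι ι ℝ} (hX : IsSol W ζ a b X) (hζ : IsCurve O ζ a b)
    (hO : IsOpen O) (hT : SmoothM O T)
    (h : ∀ y ∈ O, ∀ i, pdm i T y = T y * W i y - W' i y * T y) :
    IsSol W' ζ a b (fun r ↦ T (ζ r) * X r) := by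
  intro u hu A B
  have e : ∀ r, (T (ζ r) * X r) A B = ∑ k, T (ζ r) A k * X r k B := fun r ↦ Matrix.mul_apply
  simp only [e]
  refine (HasDerivWithinAt.fun_sum fun k _ ↦
    (hζ.hasDeriv_entry hO hT hu A k).mul (hX u hu k B)).congr_deriv ?_
  have e1 : ∀ i, W' i (ζ u) * (T (ζ u) * X u) =
      T (ζ u) * (W i (ζ u) * X u) - pdm i T (ζ u) * X u := fun i ↦ by
    rw [h _ (hζ.mapsTo u hu), Matrix.sub_mul, Matrix.mul_assoc, Matrix.mul_assoc, sub_sub_cancel]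
  simp only [e1, Matrix.sub_apply, Matrix.mul_apply (M := T (ζ u)),
    Matrix.mul_apply (M := pdm _ T (ζ u)), mul_sub, Finset.sum_sub_distrib, Finset.sum_add_distrib,
    mul_neg, Finset.sum_neg_distrib, Finset.sum_mul, Finset.mul_sum]
  rw [Finset.sum_comm (f := fun k i ↦ vel ζ a b u i * pdm i T (ζ u) A k * X u k B),
    Finset.sum_comm (f := fun k i ↦ T (ζ u) A k * (vel ζ a b u i * (W i (ζ u) * X u) k B))]
  simp only [mul_assoc, mul_left_comm (T (ζ u) A _)]
  ring

/-- A solution for `W` pairs with a solution for the dual connection to a constant. -/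
lemma pairing {Z : ℝ → Matrix ι l ℝ} (hX : IsSol W ζ a b X)
    (hZ : IsSol (fun i y ↦ -(W i y).transpose) ζ a b Z) (hu : u ∈ Icc a b) :
    (X u).transpose * Z u = (X a).transpose * Z a := by
  rcases le_or_gt b a with hab | hab
  · rw [le_antisymm (hu.2.trans hab) hu.1]
  ext A B
  have key : ∀ v ∈ Icc a b, HasDerivWithinAt (fun r ↦ ((X r).transpose * Z r) A B) 0
      (Icc a b) v := by
    intro v hv
    have e : ∀ r, ((X r).transpose * Z r) A B = ∑ k, X r k A * Z r k B := fun r ↦ Matrix.mul_apply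
    simp only [e]
    refine (HasDerivWithinAt.fun_sum fun k _ ↦ (hX v hv k A).mul (hZ v hv k B)).congr_deriv ?_
    have e2 : ∀ i, ∑ k, (W i (ζ v) * X v) k A * Z v k B =
        ∑ k, X v k A * ((W i (ζ v)).transpose * Z v) k B := by
      intro i
      have : ((W i (ζ v) * X v).transpose * Z v) A B =
          ((X v).transpose * ((W i (ζ v)).transpose * Z v)) A B := by
        rw [Matrix.transpose_mul, Matrix.mul_assoc]
      simpa only [Matrix.mul_apply (M := (W i (ζ v) * X v).transpose),
        Matrix.mul_apply (M := (X v).transpose), Matrix.transpose_apply (M := W i (ζ v) * X v),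
        Matrix.transpose_apply (M := X v)] using this
    simp only [Matrix.neg_mul, Matrix.neg_apply, mul_neg, neg_mul, Finset.sum_neg_distrib, neg_neg,
      Finset.sum_add_distrib, Finset.sum_mul, Finset.mul_sum]
    rw [Finset.sum_comm, Finset.sum_comm (f := fun k i ↦ X v k A *
      (vel ζ a b v i * ((W i (ζ v)).transpose * Z v) k B)), neg_add_eq_zero]
    refine Finset.sum_congr rfl fun i _ ↦ ?_
    simp only [mul_assoc, mul_left_comm (X v _ A), ← Finset.mul_sum, e2]
  exact constant_of_derivWithin_zero (fun v hv ↦ (key v hv).differentiableWithinAt)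
    (fun v hv ↦ (key v (Ico_subset_Icc_self hv)).derivWithin
      (uniqueDiffOn_Icc hab v (Ico_subset_Icc_self hv))) u hu

/-- Grönwall for each column; the coefficients are continuous on a compact interval, hence bounded
by some `K`. -/
lemma eq_zero (hX : IsSol W ζ a b X) (hζ : IsCurve O ζ a b) (hW : ∀ i, SmoothM O (W i))
    (h0 : X a = 0) (hu : u ∈ Icc a b) : X u = 0 := by
  rcases le_or_gt b a with hab | hab
  · rw [le_antisymm (hu.2.trans hab) hu.1, h0]
  obtain ⟨K, hK⟩ : ∃ K : ℝ, ∀ v ∈ Icc a b,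
      ∑ i, ∑ A, ∑ C, |vel ζ a b v i * W i (ζ v) A C| ≤ K := by
    have hc : ContinuousOn (fun v ↦ ∑ i, ∑ A, ∑ C, |vel ζ a b v i * W i (ζ v) A C|) (Icc a b) := by
      refine continuousOn_finsetSum _ fun i _ ↦ continuousOn_finsetSum _ fun A _ ↦
        continuousOn_finsetSum _ fun C _ ↦ ((hζ.continuousOn_vel hab i).mul ?_).abs
      exact (hW i A C).continuousOn.comp hζ.continuousOn hζ.mapsTo
    obtain ⟨K, hK⟩ := (isCompact_Icc.image_of_continuousOn hc).bddAbove
    exact ⟨K, fun v hv ↦ hK (mem_image_of_mem _ hv)⟩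
  ext A B
  have key := eq_zero_of_abs_deriv_le_mul_abs_self_of_eq_zero_right
    (f := fun r ↦ fun A ↦ X r A B) (K := K) (a := a) (b := b)
    (f' := fun v A ↦ -∑ i, vel ζ a b v i * (W i (ζ v) * X v) A B)
    (continuousOn_pi.mpr fun A ↦ hX.continuousOn A B)
    (fun v hv ↦ hasDerivWithinAt_pi.mpr fun A ↦
      (hX v (Ico_subset_Icc_self hv) A B).mono_of_mem_nhdsWithin (Icc_mem_nhdsGE_of_mem hv))
    (by funext A; simp [h0]) ?_ u hu
  · exact congrFun key A
  intro v hv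
  have hK0 := hK v (Ico_subset_Icc_self hv)
  have hnn : 0 ≤ K := le_trans (Finset.sum_nonneg fun i _ ↦ Finset.sum_nonneg fun A _ ↦
    Finset.sum_nonneg fun C _ ↦ abs_nonneg _) hK0
  refine (pi_norm_le_iff_of_nonneg (by positivity)).mpr fun A ↦ ?_
  rw [Real.norm_eq_abs, abs_neg]
  calc |∑ i, vel ζ a b v i * (W i (ζ v) * X v) A B|
      ≤ ∑ i, ∑ C, |vel ζ a b v i * W i (ζ v) A C| * ‖fun A ↦ X v A B‖ := by
        refine (Finset.abs_sum_le_sum_abs _ _).trans (Finset.sum_le_sum fun i _ ↦ ?_)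
        rw [Matrix.mul_apply, Finset.mul_sum]
        refine (Finset.abs_sum_le_sum_abs _ _).trans (Finset.sum_le_sum fun C _ ↦ ?_)
        rw [← mul_assoc, abs_mul]
        exact mul_le_mul_of_nonneg_left (norm_le_pi_norm (fun A ↦ X v A B) C) (abs_nonneg _)
    _ ≤ K * ‖fun A ↦ X v A B‖ := by
        simp only [← Finset.sum_mul]
        refine mul_le_mul_of_nonneg_right (le_trans (Finset.sum_le_sum fun i _ ↦ ?_) hK0)
          (norm_nonneg _)
        exact Finset.single_le_sum (f := fun A ↦ ∑ C, |vel ζ a b v i * W i (ζ v) A C|)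
          (fun A _ ↦ Finset.sum_nonneg fun C _ ↦ abs_nonneg _) (Finset.mem_univ A)

lemma eq_of_eq {Y : ℝ → Matrix ι κ ℝ} (hX : IsSol W ζ a b X) (hY : IsSol W ζ a b Y)
    (hζ : IsCurve O ζ a b) (hW : ∀ i, SmoothM O (W i)) (h0 : X a = Y a) (hu : u ∈ Icc a b) :
    X u = Y u :=
  sub_eq_zero.mp ((hX.sub hY).eq_zero hζ hW (sub_eq_zero.mpr h0) hu)

/-- Parallel endomorphism fields are preserved by parallel transport. -/
lemma commute [DecidableEq ι] {X : ℝ → Matrix ι ι ℝ} {J : EuclideanSpace ℝ (Fin n) → Matrix ι ι ℝ}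
    (hX : IsSol W ζ a b X) (hζ : IsCurve O ζ a b) (hO : IsOpen O) (hW : ∀ i, SmoothM O (W i))
    (hJ : SmoothM O J) (h : ∀ y ∈ O, ∀ i, pdm i J y = J y * W i y - W i y * J y)
    (h1 : X a = 1) (hu : u ∈ Icc a b) : J (ζ u) * X u = X u * J (ζ a) :=
  -- Both sides are solutions: on the left `J` intertwines `W` with itself, on the right a constant
  -- factor is multiplied from the right.
  (hX.gauge hζ hO hJ h).eq_of_eq (hX.mul_const (J (ζ a))) hζ hW (by simp [h1]) hu

/-- Parallel transport preserves parallel bilinear forms. -/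
lemma isometry {H : EuclideanSpace ℝ (Fin n) → Matrix ι ι ℝ}
    (hX : IsSol W ζ a b X) (hζ : IsCurve O ζ a b) (hO : IsOpen O) (hH : SmoothM O H)
    (h : ∀ y ∈ O, ∀ i, pdm i H y = (W i y).transpose * H y + H y * W i y) (hu : u ∈ Icc a b) :
    (X u).transpose * H (ζ u) * X u = (X a).transpose * H (ζ a) * X a := by
  rw [Matrix.mul_assoc, Matrix.mul_assoc]
  -- A parallel form `H` intertwines `W` with the dual connection `-Wᵀ`, so `H X` solves the dual
  -- equation and pairs with `X` to a constant.
  exact hX.pairing (hX.gauge (W' := fun i y ↦ -(W i y).transpose) hζ hO hH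
    fun y hy i ↦ by rw [h y hy, Matrix.neg_mul, sub_neg_eq_add, add_comm]) hu

end IsSol

/-- Solutions along the image of a curve under `φ` are solutions for the pulled-back form. -/
lemma isSol_pullForm {O' : Set (EuclideanSpace ℝ (Fin n))}
    {φ : EuclideanSpace ℝ (Fin n) → EuclideanSpace ℝ (Fin n)} (hζ : IsCurve O' ζ a b)
    (hO : IsOpen O') (hφ : ContDiffOn ℝ ∞ φ O') :
    IsSol (pullForm φ W) ζ a b X ↔ IsSol W (fun r ↦ φ (ζ r)) a b X := by
  rcases le_or_gt b a with hab | hab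
  · exact iff_of_true (isSol_of_le hab) (isSol_of_le hab)
  refine forall₂_congr fun u hu ↦ forall₂_congr fun A B ↦ ?_
  have e : ∑ i, vel ζ a b u i * (pullForm φ W i (ζ u) * X u) A B =
      ∑ i, vel (fun r ↦ φ (ζ r)) a b u i * (W i (φ (ζ u)) * X u) A B := by
    simp only [hζ.vel_comp hO hφ hab hu, pullForm, Matrix.sum_mul, Matrix.smul_mul,
      Matrix.sum_apply, Matrix.smul_apply, smul_eq_mul, Finset.mul_sum, Finset.sum_mul]
    rw [Finset.sum_comm]
    exact Finset.sum_congr rfl fun _ _ ↦ Finset.sum_congr rfl fun _ _ ↦ by ring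
  rw [e]

/-- A change of coordinates turns tractors parallel along a curve into such tractors. -/
lemma IsCoordChange.isSol {O' O : Set (EuclideanSpace ℝ (Fin n))}
    {φ : EuclideanSpace ℝ (Fin n) → EuclideanSpace ℝ (Fin n)}
    {G' G : EuclideanSpace ℝ (Fin n) → Matrix (Fin n) (Fin n) ℝ} (h : IsCoordChange O' O φ G' G)
    (hζ : IsCurve O' ζ a b) {X : ℝ → Matrix (TIndex n) κ ℝ}
    (hX : IsSol (connectionMatrix G') ζ a b X) :
    IsSol (connectionMatrix G) (fun r ↦ φ (ζ r)) a b (fun r ↦ tractorJac (jac φ (ζ r)) * X r) := by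
  rw [← isSol_pullForm hζ h.source.isOpen h.smooth]
  refine hX.gauge hζ h.source.isOpen (T := fun y ↦ tractorJac (jac φ y)) ?_ fun y hy i ↦ ?_
  · rintro (_ | j | _) (_ | l | _)
    all_goals simp only [tractorJac, Matrix.of_apply]
    all_goals first | exact contDiffOn_const | exact h.jac_smooth _ _
  · rw [h.connectionMatrix_eq hy]
    abel

end Transport

/-! ### Change of charts -/

section Transition

variable {n p q : ℕ} {M : Type*} [TopologicalSpace M]
  [ChartedSpace (EuclideanSpace ℝ (Fin n)) M]

/-- The coordinate change from the chart at `a'` to the chart at `a`. -/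
def transition (a' a : M) (z : EuclideanSpace ℝ (Fin n)) : EuclideanSpace ℝ (Fin n) :=
  extChartAt (𝓡 n) a (pt a' z)

/-- The domain of the coordinate change from the chart at `a'` to the chart at `a`. -/
def transitionSource (a' a : M) : Set (EuclideanSpace ℝ (Fin n)) :=
  chartTarget a' ∩ pt a' ⁻¹' chartSource (n := n) a

variable {a' a : M} {z : EuclideanSpace ℝ (Fin n)}

lemma isOpen_transitionSource : IsOpen (transitionSource (n := n) a' a) :=
  (continuousOn_extChartAt_symm a').isOpen_inter_preimage (isOpen_chartTarget a')
    (isOpen_extChartAt_source a)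

lemma pt_transition (hz : z ∈ transitionSource a' a) : pt a (transition a' a z) = pt a' z :=
  pt_extChartAt hz.2

lemma mapsTo_transition : MapsTo (transition (n := n) a' a) (transitionSource a' a)
    (chartTarget a) := fun _ hz ↦ (extChartAt (𝓡 n) a).map_source hz.2

variable [IsManifold (𝓡 n) ∞ M]

lemma transition_smooth :
    ContDiffOn ℝ ∞ (transition (n := n) a' a) (transitionSource a' a) :=
  (contDiffOn_ext_coord_change (I := 𝓡 n) a a').mono fun _ hz ↦ ⟨hz.1, hz.2⟩

lemma chartVec_coordVector' (hz : z ∈ transitionSource a' a) (i c : Fin n) :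
    vectorCoord a (pt a' z) (coordVector a' z i) c = jac (transition a' a) z c i := by
  have h1 : MDifferentiableAt 𝓘(ℝ, EuclideanSpace ℝ (Fin n)) (𝓡 n)
      (extChartAt (𝓡 n) a').symm z :=
    (mdifferentiableOn_extChartAt_symm z hz.1).mdifferentiableAt
      ((isOpen_chartTarget a').mem_nhds hz.1)
  have h2 : MDifferentiableAt (𝓡 n) 𝓘(ℝ, EuclideanSpace ℝ (Fin n)) (extChartAt (𝓡 n) a)
      ((extChartAt (𝓡 n) a').symm z) :=
    mdifferentiableAt_extChartAt (by rw [← extChartAt_source (𝓡 n)]; exact hz.2)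
  have h3 := mfderiv_comp z h2 h1
  rw [mfderiv_eq_fderiv] at h3
  have h4 : vectorCoord a (pt a' z) (coordVector a' z i) c =
      (fderiv ℝ (extChartAt (𝓡 n) a ∘ (extChartAt (𝓡 n) a').symm) z
        (EuclideanSpace.single i 1)) c := by
    rw [h3]; rfl
  rw [h4]
  have h5 : HasFDerivAt (fun x ↦ transition a' a x c)
      ((EuclideanSpace.proj (𝕜 := ℝ) c : EuclideanSpace ℝ (Fin n) →L[ℝ] ℝ) ∘L
        fderiv ℝ (transition a' a) z) z :=
    (EuclideanSpace.proj (𝕜 := ℝ) c : EuclideanSpace ℝ (Fin n) →L[ℝ] ℝ).hasFDerivAt.comp z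
      (((transition_smooth.contDiffAt
        (isOpen_transitionSource.mem_nhds hz)).differentiableAt (by simp)).hasFDerivAt)
  simp only [jac, Matrix.of_apply, pd, h5.fderiv]
  rfl

lemma vectorCoord_transition (hz : z ∈ transitionSource a' a) (v : TangentSpace (𝓡 n) (pt a' z))
    (c : Fin n) : vectorCoord a (pt a' z) v c =
      ∑ i, jac (transition a' a) z c i * vectorCoord a' (pt a' z) v i := by
  conv_lhs => rw [← sum_vectorCoord hz.1 v, vectorCoord_eq, map_sum]
  simp only [map_smul]
  have : ∀ w : Fin n → EuclideanSpace ℝ (Fin n), (∑ i, w i) c = ∑ i, w i c := fun w ↦ by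
    simp [Finset.sum_apply]
  refine (this _).trans (Finset.sum_congr rfl fun i _ ↦ ?_)
  rw [← chartVec_coordVector' hz, mul_comm]
  rfl

lemma isCoordChange_transition (g : PseudoMetric n p q M) (a' a : M) :
    IsCoordChange (transitionSource a' a) (chartTarget a) (transition a' a)
      (metricMatrix g a') (metricMatrix g a) := by
  have hG' := isMetricOn_metricMatrix g a'
  have hpb : ∀ y ∈ transitionSource a' a, metricMatrix g a' y =
      (jac (transition a' a) y).transpose * metricMatrix g a (transition a' a y) *
        jac (transition a' a) y := by
    intro y hy
    ext i j
    have h1 := metric_expand g (mapsTo_transition hy) (coordVector a' y i) (coordVector a' y j)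
    rw [pt_transition hy] at h1
    refine h1.trans ?_
    simp only [chartVec_coordVector' hy, Matrix.mul_apply, Matrix.transpose_apply, Finset.sum_mul]
    rw [Finset.sum_comm]
    exact Finset.sum_congr rfl fun _ _ ↦ Finset.sum_congr rfl fun _ _ ↦ by ring
  refine ⟨⟨isOpen_transitionSource, hG'.smooth.mono inter_subset_left,
    fun z hz ↦ hG'.symm z hz.1, fun z hz ↦ hG'.isUnit z hz.1⟩, isMetricOn_metricMatrix g a,
    mapsTo_transition, transition_smooth, fun y hy ↦ ?_, hpb⟩
  -- The Jacobian is invertible because the pulled-back metric is non-degenerate.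
  have h1 := hG'.isUnit y hy.1
  rw [hpb y hy, Matrix.det_mul] at h1
  exact isUnit_of_mul_isUnit_right h1

lemma coordMap_transition (hz : z ∈ transitionSource a' a) (v : Tractor n) :
    coordMap a (pt a' z) v =
      (tractorJac (jac (transition a' a) z)).mulVec (coordMap a' (pt a' z) v) := by
  funext A
  rcases TIndex_cases A with rfl | ⟨k, rfl⟩ | rfl
  · simp [coordMap, Matrix.mulVec, dotProduct, tractorCoord, tractorJac]
  · simp only [Matrix.mulVec, dotProduct, sum_TIndex]
    simpa [coordMap, tractorCoord, tractorJac] using vectorCoord_transition hz v.2.1 k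
  · simp [coordMap, Matrix.mulVec, dotProduct, tractorCoord, tractorJac]

end Transition

/-! ### Parallel transport inside a chart -/

section Flow

variable {n p q : ℕ} {M : Type*} [TopologicalSpace M]
  [ChartedSpace (EuclideanSpace ℝ (Fin n)) M]

/-- The components in the chart at `c` of the tractors `F u v`. -/
def frameMat (c : M) (γ : ℝ → M) (F : ℝ → Tractor n → Tractor n) (u : ℝ) :
    Matrix (TIndex n) (Tractor n) ℝ := Matrix.of fun A v ↦ tractorCoord c (γ u) (F u v) A

/-- `γ` runs in the chart at `c`. -/
structure InChart (c : M) (γ : ℝ → M) (a b : ℝ) : Prop where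
  source : ∀ u ∈ Icc a b, γ u ∈ chartSource (n := n) c
  smooth : ContDiffOn ℝ ∞ (fun u ↦ extChartAt (𝓡 n) c (γ u)) (Icc a b)

variable [IsManifold (𝓡 n) ∞ M]

/-- `γ` runs in the chart at `c`, and `F · v` is parallel along it for every `v`. -/
structure IsFlow (g : PseudoMetric n p q M) (c : M) (γ : ℝ → M) (F : ℝ → Tractor n → Tractor n)
    (a b : ℝ) : Prop extends InChart (n := n) c γ a b where
  sol : IsSol (connectionMatrix (metricMatrix g c)) (fun u ↦ extChartAt (𝓡 n) c (γ u)) a b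
    (frameMat c γ F)

variable {g : PseudoMetric n p q M} {c c' : M} {γ γ' : ℝ → M} {F F' : ℝ → Tractor n → Tractor n}
  {a b u : ℝ}

omit [IsManifold (𝓡 n) ∞ M] in
lemma InChart.isCurve (h : InChart (n := n) c γ a b) :
    IsCurve (chartTarget c) (fun u ↦ extChartAt (𝓡 n) c (γ u)) a b :=
  ⟨h.smooth, fun u hu ↦ (extChartAt (𝓡 n) c).map_source (h.source u hu)⟩

omit [IsManifold (𝓡 n) ∞ M] in
lemma InChart.continuousOn (h : InChart (n := n) c γ a b) : ContinuousOn γ (Icc a b) :=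
  ((continuousOn_extChartAt_symm (I := 𝓡 n) c).comp h.smooth.continuousOn h.isCurve.mapsTo).congr
    fun u hu ↦ (pt_extChartAt (h.source u hu)).symm

lemma isParallelAlong_iff : (∀ v, IsParallelAlong g c γ (fun u ↦ F u v) a b) ↔
    IsSol (connectionMatrix (metricMatrix g c)) (fun u ↦ extChartAt (𝓡 n) c (γ u)) a b
      (frameMat c γ F) :=
  ⟨fun h u hu A v ↦ h v u hu A, fun h v u hu A ↦ h u hu A v⟩

lemma connectionMatrix_metricMatrix_smooth (g : PseudoMetric n p q M) (c : M) (i : Fin n) :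
    SmoothM (chartTarget c) (connectionMatrix (metricMatrix g c) i) :=
  (isMetricOn_metricMatrix g c).connectionMatrix_smooth i

namespace IsFlow

lemma mono {a' b' : ℝ} (h : IsFlow g c γ F a b) (ha : a ≤ a') (hb : b' ≤ b) :
    IsFlow g c γ F a' b' where
  source u hu := h.source u (Icc_subset_Icc ha hb hu)
  smooth := h.smooth.mono (Icc_subset_Icc ha hb)
  sol := h.sol.mono h.isCurve ha hb

lemma congr (h : IsFlow g c γ F a b) (hγ : EqOn γ' γ (Icc a b)) (hF : EqOn F' F (Icc a b)) :
    IsFlow g c γ' F' a b where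
  source u hu := by rw [hγ hu]; exact h.source u hu
  smooth := h.smooth.congr fun u hu ↦ by rw [hγ hu]
  sol := (h.sol.congr_curve fun u hu ↦ by simp only [hγ hu]).congr fun u hu ↦ by
    simp only [frameMat, hγ hu, hF hu]

lemma comp_affine {a' b' m k : ℝ} (h : IsFlow g c γ F a b)
    (hm : ∀ u ∈ Icc a' b', m * u + k ∈ Icc a b) :
    IsFlow g c (fun r ↦ γ (m * r + k)) (fun r ↦ F (m * r + k)) a' b' where
  source u hu := h.source _ (hm u hu)
  smooth := (h.isCurve.comp_affine hm).smooth
  sol := h.sol.comp_affine h.isCurve hm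

lemma comp_right (h : IsFlow g c γ F a b) (Q : Tractor n → Tractor n) :
    IsFlow g c γ (fun r v ↦ F r (Q v)) a b where
  toInChart := h.toInChart
  sol := fun u hu A v ↦ h.sol u hu A (Q v)

/-- The pieces of a transport may use any charts, whereas the analysis near a point uses a single
one. Invariance of the tractor connection under coordinate changes passes between them. -/
lemma change_chart (h : IsFlow g c γ F a b) (hc : ∀ u ∈ Icc a b, γ u ∈ chartSource (n := n) c') :
    IsFlow g c' γ F a b := by
  have h1 : IsCurve (transitionSource c c') (fun u ↦ extChartAt (𝓡 n) c (γ u)) a b :=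
    h.isCurve.mono_set fun u hu ↦ ⟨h.isCurve.mapsTo u hu, by
      rw [mem_preimage, pt_extChartAt (h.source u hu)]; exact hc u hu⟩
  have e : ∀ u ∈ Icc a b, extChartAt (𝓡 n) c' (γ u) =
      transition c c' (extChartAt (𝓡 n) c (γ u)) := fun u hu ↦ by
    rw [transition, pt_extChartAt (h.source u hu)]
  refine ⟨⟨hc, (transition_smooth.comp h1.smooth h1.mapsTo).congr e⟩, ?_⟩
  refine (((isCoordChange_transition g c c').isSol h1 h.sol).congr_curve e).congr fun u hu ↦ ?_
  ext A v
  have h2 := congrFun (coordMap_transition (h1.mapsTo u hu) (F u v)) A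
  rw [pt_extChartAt (h.source u hu)] at h2
  exact h2

lemma metric_eq (h : IsFlow g c γ F a b) (hu : u ∈ Icc a b) (v w : Tractor n) :
    tractorMetric g (γ u) (F u v) (F u w) = tractorMetric g (γ a) (F a v) (F a w) := by
  have hG := isMetricOn_metricMatrix g c
  have h1 := h.sol.isometry h.isCurve hG.isOpen hG.tractorH_smooth
    (fun y hy i ↦ hG.pdm_tractorH hy i) hu
  have h2 : ∀ r ∈ Icc a b, tractorMetric g (γ r) (F r v) (F r w) =
      ((frameMat c γ F r).transpose * tractorH (metricMatrix g c) (extChartAt (𝓡 n) c (γ r)) *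
        frameMat c γ F r) v w := by
    intro r hr
    have h3 := tractorMetric_expand g (h.isCurve.mapsTo r hr) (F r v) (F r w)
    rw [pt_extChartAt (h.source r hr)] at h3
    rw [h3]
    simp only [Matrix.mul_apply, Finset.sum_mul, Matrix.transpose_apply]
    rw [Finset.sum_comm]
    rfl
  rw [h2 u hu, h1, ← h2 a ⟨le_rfl, hu.1.trans hu.2⟩]

lemma eq_of_eq (h : IsFlow g c γ F a b) (h' : IsFlow g c γ F' a b) {v v' : Tractor n}
    (h0 : F a v = F' a v') (hu : u ∈ Icc a b) : F u v = F' u v' := by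
  have h1 := (h.comp_right fun _ ↦ v).sol.eq_of_eq (h'.comp_right fun _ ↦ v').sol h.isCurve
    (connectionMatrix_metricMatrix_smooth g c) (by simp only [frameMat, h0]) hu
  exact coordMap_injective (h.source u hu) (funext fun A ↦ congrFun (congrFun h1 A) 0)

/-- The columns of `frameMat` are indexed by all initial tractors, with no linearity built in.
Linearity comes from uniqueness: sums and multiples of solutions are solutions with the right
initial value. -/
lemma isLinearMap (h : IsFlow g c γ F a b) (h0 : IsLinearMap ℝ (F a)) (hu : u ∈ Icc a b) :
    IsLinearMap ℝ (F u) := by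
  refine ⟨fun v w ↦ ?_, fun r v ↦ ?_⟩
  · have h1 : IsFlow g c γ (fun r _ ↦ F r v + F r w) a b := by
      refine ⟨h.toInChart, fun u hu A _ ↦ ?_⟩
      have e : ∀ r, frameMat c γ (fun r _ ↦ F r v + F r w) r A v =
          frameMat c γ F r A v + frameMat c γ F r A w := fun r ↦ tractorCoord_add _ _ _ _ _
      have e' : ∀ i, (connectionMatrix (metricMatrix g c) i (extChartAt (𝓡 n) c (γ u)) *
          frameMat c γ (fun r _ ↦ F r v + F r w) u) A v =
          (connectionMatrix (metricMatrix g c) i (extChartAt (𝓡 n) c (γ u)) * frameMat c γ F u) A v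
          + (connectionMatrix (metricMatrix g c) i (extChartAt (𝓡 n) c (γ u)) *
            frameMat c γ F u) A w := fun i ↦ by
        simp only [Matrix.mul_apply, ← Finset.sum_add_distrib, ← mul_add]
        exact Finset.sum_congr rfl fun B _ ↦ congrArg _ (tractorCoord_add _ _ _ _ _)
      refine ((((h.sol u hu A v).add (h.sol u hu A w)).congr_deriv ?_).congr (fun r _ ↦ e r)
        (e u))
      change _ = -∑ i, vel (fun u ↦ extChartAt (𝓡 n) c (γ u)) a b u i *
        (connectionMatrix (metricMatrix g c) i (extChartAt (𝓡 n) c (γ u)) *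
          frameMat c γ (fun r _ ↦ F r v + F r w) u) A v
      simp only [e', mul_add, Finset.sum_add_distrib]
      ring
    exact h.eq_of_eq h1 (v' := 0) (h0.map_add v w) hu
  · have h1 : IsFlow g c γ (fun s _ ↦ r • F s v) a b := by
      refine ⟨h.toInChart, fun u hu A _ ↦ ?_⟩
      have e : ∀ s, frameMat c γ (fun s _ ↦ r • F s v) s A v =
          r * frameMat c γ F s A v := fun s ↦ tractorCoord_smul _ _ _ _ _
      have e' : ∀ i, (connectionMatrix (metricMatrix g c) i (extChartAt (𝓡 n) c (γ u)) *
          frameMat c γ (fun s _ ↦ r • F s v) u) A v =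
          r * (connectionMatrix (metricMatrix g c) i (extChartAt (𝓡 n) c (γ u)) *
            frameMat c γ F u) A v := fun i ↦ by
        simp only [Matrix.mul_apply, Finset.mul_sum]
        refine Finset.sum_congr rfl fun B _ ↦ ?_
        rw [mul_left_comm]
        exact congrArg _ (tractorCoord_smul _ _ _ _ _)
      refine ((((h.sol u hu A v).const_mul r).congr_deriv ?_).congr (fun s _ ↦ e s) (e u))
      change _ = -∑ i, vel (fun u ↦ extChartAt (𝓡 n) c (γ u)) a b u i *
        (connectionMatrix (metricMatrix g c) i (extChartAt (𝓡 n) c (γ u)) *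
          frameMat c γ (fun s _ ↦ r • F s v) u) A v
      simp only [e', mul_neg, Finset.mul_sum]
      exact congrArg _ (Finset.sum_congr rfl fun i _ ↦ by ring)
    exact h.eq_of_eq h1 (v' := 0) (h0.map_smul r v) hu

end IsFlow

end Flow

/-! ### Parallel transport along piecewise smooth curves -/

section PFlow

variable {n p q : ℕ} {M : Type*} [TopologicalSpace M]
  [ChartedSpace (EuclideanSpace ℝ (Fin n)) M] [IsManifold (𝓡 n) ∞ M]

/-- `γ` is piecewise smooth on `[a, b]`, and `F · v` is parallel along it for every `v`. -/
inductive PFlow (g : PseudoMetric n p q M) (γ : ℝ → M) (F : ℝ → Tractor n → Tractor n) (a : ℝ) :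
    ℝ → Prop
  | nil : PFlow g γ F a a
  | cons {b b' : ℝ} (c : M) : PFlow g γ F a b → b ≤ b' → IsFlow g c γ F b b' → PFlow g γ F a b'

variable {g : PseudoMetric n p q M} {γ γ' : ℝ → M} {F F' : ℝ → Tractor n → Tractor n}
  {a b u : ℝ}

lemma IsFlow.pflow {c : M} (h : IsFlow g c γ F a b) (hab : a ≤ b) : PFlow g γ F a b :=
  .cons c .nil hab h

namespace PFlow

lemma le (h : PFlow g γ F a b) : a ≤ b := by
  induction h with
  | nil => exact le_rfl
  | cons c _ hb _ ih => exact ih.trans hb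

lemma trans {d : ℝ} (h : PFlow g γ F a b) (h' : PFlow g γ F b d) : PFlow g γ F a d := by
  induction h' with
  | nil => exact h
  | cons c _ hb hf ih => exact .cons c ih hb hf

lemma restrict (h : PFlow g γ F a b) (hu : u ∈ Icc a b) : PFlow g γ F a u := by
  induction h with
  | nil => rw [le_antisymm hu.2 hu.1]; exact .nil
  | @cons b b' c h1 hb hf ih =>
    rcases le_total u b with hub | hub
    · exact ih ⟨hu.1, hub⟩
    · exact .cons c h1 hub (hf.mono le_rfl hu.2)

lemma congr (h : PFlow g γ F a b) (hγ : EqOn γ' γ (Icc a b)) (hF : EqOn F' F (Icc a b)) :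
    PFlow g γ' F' a b := by
  induction h with
  | nil => exact .nil
  | @cons b b' c h1 hb hf ih =>
    have s1 : Icc a b ⊆ Icc a b' := Icc_subset_Icc_right hb
    have s2 : Icc b b' ⊆ Icc a b' := Icc_subset_Icc_left h1.le
    exact .cons c (ih (hγ.mono s1) (hF.mono s1)) hb (hf.congr (hγ.mono s2) (hF.mono s2))

lemma comp_affine {m k : ℝ} (hm : 0 < m) (h : PFlow g γ F a b) :
    PFlow g (fun r ↦ γ (m * r + k)) (fun r ↦ F (m * r + k)) ((a - k) / m) ((b - k) / m) := by
  induction h with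
  | nil => exact .nil
  | @cons b b' c h1 hb hf ih =>
    refine .cons c ih (by gcongr) (hf.comp_affine fun u hu ↦ ?_)
    have h2 := (div_le_iff₀ hm).mp hu.1
    have h3 := (le_div_iff₀ hm).mp hu.2
    exact ⟨by linarith, by linarith⟩

lemma comp_reverse (k : ℝ) (h : PFlow g γ F a b) :
    PFlow g (fun r ↦ γ (-1 * r + k)) (fun r ↦ F (-1 * r + k)) (k - b) (k - a) := by
  induction h with
  | nil => exact .nil
  | @cons b b' c h1 hb hf ih =>
    refine PFlow.trans (IsFlow.pflow (c := c) (hf.comp_affine fun u hu ↦ ?_) (by linarith)) ih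
    exact ⟨by linarith [hu.2], by linarith [hu.1]⟩

lemma comp_right (h : PFlow g γ F a b) (Q : Tractor n → Tractor n) :
    PFlow g γ (fun r v ↦ F r (Q v)) a b := by
  induction h with
  | nil => exact .nil
  | cons c _ hb hf ih => exact .cons c ih hb (hf.comp_right Q)

lemma continuousOn (h : PFlow g γ F a b) : ContinuousOn γ (Icc a b) := by
  induction h with
  | nil => rw [Icc_self]; exact continuousOn_singleton _ _
  | @cons b b' c h1 hb hf ih =>
    rw [← Icc_union_Icc_eq_Icc h1.le hb]
    exact ih.union_of_isClosed hf.continuousOn isClosed_Icc isClosed_Icc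

lemma isLinearMap (h : PFlow g γ F a b) (h0 : IsLinearMap ℝ (F a)) (hu : u ∈ Icc a b) :
    IsLinearMap ℝ (F u) := by
  induction h generalizing u with
  | nil => rwa [le_antisymm hu.2 hu.1]
  | @cons b b' c h1 hb hf ih =>
    rcases le_total u b with hub | hub
    · exact ih ⟨hu.1, hub⟩
    · exact hf.isLinearMap (ih ⟨h1.le, le_rfl⟩) ⟨hub, hu.2⟩

lemma metric_eq (h : PFlow g γ F a b) (hu : u ∈ Icc a b) (v w : Tractor n) :
    tractorMetric g (γ u) (F u v) (F u w) = tractorMetric g (γ a) (F a v) (F a w) := by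
  induction h generalizing u with
  | nil => rw [le_antisymm hu.2 hu.1]
  | @cons b b' c h1 hb hf ih =>
    rcases le_total u b with hub | hub
    · exact ih ⟨hu.1, hub⟩
    · rw [hf.metric_eq ⟨hub, hu.2⟩, ih ⟨h1.le, le_rfl⟩]

/-- The interval is a finite union of closed pieces. Those that miss `t₀` stay away from it, so
every time near `t₀` shares a piece with `t₀`. -/
lemma eventually_isFlow (h : PFlow g γ F a b) (hab : a < b) (t₀ : ℝ) :
    ∀ᶠ t in nhdsWithin t₀ (Icc a b), ∃ (c : M) (s s' : ℝ), IsFlow g c γ F s s' ∧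
      t ∈ Icc s s' ∧ t₀ ∈ Icc s s' := by
  have step : ∀ {b b' : ℝ} (c : M), IsFlow g c γ F b b' →
      ∀ᶠ t in nhdsWithin t₀ (Icc b b'), ∃ (c : M) (s s' : ℝ), IsFlow g c γ F s s' ∧
      t ∈ Icc s s' ∧ t₀ ∈ Icc s s' := by
    intro b b' c hf
    by_cases ht : t₀ ∈ Icc b b'
    · filter_upwards [self_mem_nhdsWithin] with t h1 using ⟨c, b, b', hf, h1, ht⟩
    · rw [notMem_closure_iff_nhdsWithin_eq_bot.mp (by rwa [isClosed_Icc.closure_eq])]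
      exact Filter.eventually_bot
  -- The empty flow has no piece at all, so the induction carries the alternative `a = b`, which
  -- `hab` excludes at the end.
  have main : ∀ {b}, PFlow g γ F a b → a = b ∨ ∀ᶠ t in nhdsWithin t₀ (Icc a b),
      ∃ (c : M) (s s' : ℝ), IsFlow g c γ F s s' ∧ t ∈ Icc s s' ∧ t₀ ∈ Icc s s' := by
    intro b h
    induction h with
    | nil => exact Or.inl rfl
    | @cons b b' c h1 hb hf ih =>
      right
      rcases ih with rfl | ih
      · exact step c hf
      · rw [← Icc_union_Icc_eq_Icc h1.le hb, nhdsWithin_union]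
        exact Filter.eventually_sup.mpr ⟨ih, step c hf⟩
  exact (main h).resolve_left hab.ne

lemma exists_partition (h : PFlow g γ F a b) : ∃ (N : ℕ) (t : ℕ → ℝ) (c : ℕ → M), Monotone t ∧
    t 0 = a ∧ t N = b ∧ ∀ k < N, IsFlow g (c k) γ F (t k) (t (k + 1)) := by
  have main : ∀ {b}, PFlow g γ F a b → ∃ (N : ℕ) (t : ℕ → ℝ) (c : ℕ → M), Monotone t ∧
      t 0 = a ∧ t N = b ∧ (∀ k, t k ≤ b) ∧ ∀ k < N, IsFlow g (c k) γ F (t k) (t (k + 1)) := by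
    intro b h
    induction h with
    | nil => exact ⟨0, fun _ ↦ a, fun _ ↦ γ a, monotone_const, rfl, rfl, fun _ ↦ le_rfl, by simp⟩
    | @cons b b' c h1 hb hf ih =>
      obtain ⟨N, t, d, ht, h0, hN, hle, hd⟩ := ih
      -- Past its last point the partition stays constant at the new endpoint. The bound `t k ≤ b`
      -- in the induction hypothesis keeps it monotone.
      refine ⟨N + 1, fun k ↦ if k ≤ N then t k else b', fun k ↦ if k < N then d k else c, ?_,
        by simp [h0], by simp, ?_, ?_⟩
      · intro i j hij
        dsimp only
        split_ifs with h2 h3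
        · exact ht hij
        · exact (hle i).trans hb
        · omega
        · exact le_rfl
      · intro k
        dsimp only
        split_ifs
        · exact (hle k).trans hb
        · exact le_rfl
      · intro k hk
        rcases (Nat.lt_succ_iff_lt_or_eq.mp hk) with h2 | rfl
        · simp only [if_pos h2, if_pos h2.le, if_pos (Nat.succ_le_of_lt h2)]
          exact hd k h2
        · simp only [lt_irrefl, le_refl, if_true, if_false, hN,
            if_neg (Nat.not_succ_le_self k)]
          exact hf
  obtain ⟨N, t, d, ht, h0, hN, -, hd⟩ := main h
  exact ⟨N, t, d, ht, h0, hN, hd⟩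

end PFlow

variable {x y z : M}

/-- Trades the partition of the definition for the inductive `PFlow`, for which concatenation,
restriction and reparametrisation are inductions. -/
lemma isParallelTransport_iff {γ : Path x y} {P : Tractor n →L[ℝ] Tractor n} :
    IsParallelTransport g γ P ↔ ∃ F : ℝ → Tractor n → Tractor n, (∀ v, F 0 v = v) ∧
      (∀ v, F 1 v = P v) ∧ PFlow g γ.extend F 0 1 := by
  constructor
  · rintro ⟨N, t, c, ht, h0, h1, hs, hd, hP⟩
    choose τ hτ0 hτ1 hτ using hP
    refine ⟨fun u v ↦ τ v u, hτ0, hτ1, ?_⟩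
    have main : ∀ (k : ℕ) (hk : k < N + 1), PFlow g γ.extend (fun u v ↦ τ v u) 0 (t ⟨k, hk⟩) := by
      intro k
      induction k with
      | zero => intro hk; rw [show (⟨0, hk⟩ : Fin (N + 1)) = 0 from rfl, h0]; exact .nil
      | succ k ih =>
        intro hk
        have hk' : k < N := by omega
        refine .cons (c ⟨k, hk'⟩) (ih (by omega)) (ht (by simp)) ⟨⟨hs ⟨k, hk'⟩, hd ⟨k, hk'⟩⟩, ?_⟩
        exact isParallelAlong_iff.mp fun v ↦ hτ v ⟨k, hk'⟩
    rw [← h1]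
    exact main N (by omega)
  · rintro ⟨F, h0, h1, hF⟩
    obtain ⟨N, t, c, ht, ht0, ht1, hc⟩ := hF.exists_partition
    refine ⟨N, fun k ↦ t k, fun k ↦ c k, fun i j hij ↦ ht hij, ht0, ht1,
      fun k ↦ (hc k k.2).source, fun k ↦ (hc k k.2).smooth,
      fun v ↦ ⟨fun u ↦ F u v, h0 v, h1 v, fun k ↦ ?_⟩⟩
    exact isParallelAlong_iff.mpr (hc k k.2).sol v

/-- A piecewise parallel family of linear maps is the parallel transport along a path. -/
lemma PFlow.exists_path (h : PFlow g γ F a b) (h0 : ∀ v, F a v = v) {P : Tractor n →L[ℝ] Tractor n}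
    (hP : ∀ v, F b v = P v) : ∃ δ : Path (γ a) (γ b), IsParallelTransport g δ P := by
  rcases h.le.eq_or_lt with rfl | hab
  · refine ⟨Path.refl _, isParallelTransport_iff.mpr ⟨fun _ v ↦ v, fun _ ↦ rfl, fun v ↦ ?_, ?_⟩⟩
    · rw [← hP, h0]
    · obtain ⟨c, hc⟩ : ∃ c : M, γ a ∈ chartSource (n := n) c :=
        ⟨γ a, mem_extChartAt_source (I := 𝓡 n) (γ a)⟩
      refine IsFlow.pflow (c := c) ⟨⟨fun u hu ↦ by simpa using hc, ?_⟩, fun u hu A B ↦ ?_⟩ zero_le_one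
      · simpa using contDiffOn_const
      · have e : ∀ i, vel (fun u ↦ extChartAt (𝓡 n) c ((Path.refl (γ a)).extend u)) 0 1 u i = 0 := by
          intro i
          simp [vel]
        simp only [e, zero_mul, Finset.sum_const_zero, neg_zero]
        refine (hasDerivWithinAt_const u (Icc 0 1) (tractorCoord c (γ a) B A)).congr
          (fun r _ ↦ ?_) ?_ <;> simp [frameMat]
  · have hba : 0 < b - a := sub_pos.mpr hab
    have hm : ∀ u ∈ Icc (0 : ℝ) 1, (b - a) * u + a ∈ Icc a b := fun u hu ↦
      ⟨by nlinarith [hu.1], by nlinarith [hu.2]⟩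
    have hcont : ContinuousOn (fun u ↦ γ ((b - a) * u + a)) (Icc 0 1) :=
      h.continuousOn.comp (by fun_prop) hm
    let δ : Path (γ a) (γ b) :=
      { toFun := fun u ↦ γ ((b - a) * u + a)
        continuous_toFun := continuousOn_iff_continuous_domRestrict.mp hcont
        source' := by simp
        target' := by simp }
    have h2 := h.comp_affine (m := b - a) (k := a) hba
    rw [sub_self, zero_div, div_self hba.ne'] at h2
    refine ⟨δ, isParallelTransport_iff.mpr ⟨_, fun v ↦ ?_, fun v ↦ ?_,
      h2.congr (fun u hu ↦ ?_) fun u _ ↦ rfl⟩⟩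
    · simp [h0]
    · simp [hP]
    · rw [Path.extend_apply _ hu]
      rfl

namespace IsParallelTransport

lemma trans {γ : Path x y} {δ : Path y z} {P Q : Tractor n →L[ℝ] Tractor n}
    (hP : IsParallelTransport g γ P) (hQ : IsParallelTransport g δ Q) :
    IsParallelTransport g (γ.trans δ) (Q * P) := by
  rw [isParallelTransport_iff] at hP hQ ⊢
  obtain ⟨F, f0, f1, hF⟩ := hP
  obtain ⟨E, e0, e1, hE⟩ := hQ
  have h1 := hF.comp_affine (m := 2) (k := 0) two_pos
  -- The second flow starts at the vectors reached by the first, and both run at double speed.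
  have h2 := (hE.comp_right P).comp_affine (m := 2) (k := -1) two_pos
  norm_num at h1 h2
  refine ⟨fun u v ↦ if u ≤ 1 / 2 then F (2 * u) v else E (2 * u + -1) (P v), fun v ↦ by simp [f0],
    fun v ↦ ?_, PFlow.trans (b := 1 / 2) (h1.congr (fun u hu ↦ ?_) fun u hu ↦ ?_)
    (h2.congr (fun u hu ↦ ?_) fun u hu ↦ ?_)⟩
  · norm_num [e1]
  · rw [Path.trans, Path.extend_apply _ ⟨hu.1, hu.2.trans (by norm_num)⟩]
    have h3 : u ≤ 2⁻¹ := by simpa using hu.2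
    simp [h3]
  · funext v
    have h3 : u ≤ 2⁻¹ := by simpa using hu.2
    simp [h3]
  · rw [Path.trans, Path.extend_apply _ ⟨le_trans (by norm_num) hu.1, hu.2⟩]
    rcases hu.1.eq_or_lt with rfl | h3
    · norm_num
    · have h4 : ¬ u ≤ 2⁻¹ := by simpa using h3
      simp [h4, sub_eq_add_neg]
  · funext v
    rcases hu.1.eq_or_lt with rfl | h3
    · norm_num [f1, e0]
    · have h4 : ¬ u ≤ 2⁻¹ := by simpa using h3
      simp [h4]

lemma symm {γ : Path x y} {P : (Tractor n →L[ℝ] Tractor n)ˣ}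
    (hP : IsParallelTransport g γ P) :
    IsParallelTransport g γ.symm (P⁻¹ : (Tractor n →L[ℝ] Tractor n)ˣ) := by
  rw [isParallelTransport_iff] at hP ⊢
  obtain ⟨F, f0, f1, hF⟩ := hP
  -- Run backwards, the flow starts at `P`; relabelling the initial vectors by `P⁻¹` makes it start
  -- at the identity.
  have h1 := (hF.comp_right (P⁻¹ : (Tractor n →L[ℝ] Tractor n)ˣ)).comp_reverse 1
  norm_num at h1
  refine ⟨_, fun v ↦ ?_, fun v ↦ ?_, h1.congr (fun u hu ↦ ?_) fun _ _ ↦ rfl⟩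
  · norm_num [f1]
    rw [← mul_apply_eq_comp, Units.mul_inv, one_apply_eq_self]
  · norm_num [f0]
  · rw [Path.extend_symm_apply, sub_eq_neg_add]

end IsParallelTransport

end PFlow

/-! ### Monodromy of a locally constant cocycle -/

section Monodromy

open Filter Topology

/-- Continuation along null-homotopic loops of a locally constant cocycle is trivial. -/
theorem continuation_eq_of_nullhomotopic {X Γ : Type*} [TopologicalSpace X] [Group Γ]
    {U : X → Set X} (hU : ∀ i, IsOpen (U i)) (hmem : ∀ i, i ∈ U i) {σ : X → X → Γ}
    (hσ : ∀ i j, ∀ y ∈ U i ∩ U j, ∀ᶠ y' in 𝓝 y,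
      σ i y' * (σ i y)⁻¹ = σ j y' * (σ j y)⁻¹)
    {x : X} {γ : Path x x} (hγ : γ.Homotopic (Path.refl x)) {e : unitInterval → Γ}
    (he : ∀ t₀, ∀ᶠ t in 𝓝 t₀, e t * (e t₀)⁻¹ = σ (γ t₀) (γ t) * (σ (γ t₀) (γ t₀))⁻¹) :
    e 1 = e 0 := by
  -- For the discrete topology, a continuous map into `Γ` is a locally constant one.
  let _ : TopologicalSpace Γ := ⊥
  have : DiscreteTopology Γ := ⟨rfl⟩
  have hc : ∀ i j, ContinuousOn (fun y ↦ (σ j y)⁻¹ * σ i y) (U i ∩ U j) := by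
    intro i j y hy
    refine (ContinuousAt.congr (f := fun _ ↦ (σ j y)⁻¹ * σ i y) continuousAt_const
      ?_).continuousWithinAt
    filter_upwards [hσ i j y hy] with y' hy'
    have := congrArg (fun s ↦ (σ j y')⁻¹ * s * σ i y) hy'
    simpa [mul_assoc] using this.symm
  -- The bundle with fibre `Γ` whose coordinate changes are left multiplications by the ratios `(σ j
  -- y)⁻¹ * σ i y`. These are locally constant by `hσ`, so the total space is a covering of `X`.
  let Z : FiberBundleCore X X Γ :=
    { baseSet := U
      isOpen_baseSet := hU
      indexAt := id
      mem_baseSet_at := hmem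
      coordChange := fun i j y f ↦ (σ j y)⁻¹ * σ i y * f
      coordChange_self := fun i x _ v ↦ by simp
      continuousOn_coordChange := fun i j ↦
        ((hc i j).comp continuousOn_fst fun _ h ↦ h.1).mul continuousOn_snd
      coordChange_comp := fun i j k x _ v ↦ by simp [mul_assoc] }
  have cov : IsCoveringMap (Bundle.TotalSpace.proj : Z.TotalSpace → X) :=
    FiberBundle.isCoveringMap (F := Γ) (E := Z.Fiber)
  -- A lift of `γ`: in the bundle chart at `γ t₀` its fibre coordinate is `(σ (γ t₀) (γ t))⁻¹ * e
  -- t`, which is constant near `t₀` by `he`.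
  let L : unitInterval → Z.TotalSpace := fun t ↦ ⟨γ t, (σ (γ t) (γ t))⁻¹ * e t⟩
  have hL : Continuous L := by
    rw [continuous_iff_continuousAt]
    intro t₀
    rw [FiberBundle.continuousAt_totalSpace Γ (E := Z.Fiber)]
    refine ⟨γ.continuous.continuousAt, ContinuousAt.congr
      (f := fun _ ↦ (σ (γ t₀) (γ t₀))⁻¹ * e t₀) continuousAt_const ?_⟩
    filter_upwards [he t₀] with t ht
    change _ = (σ (γ t₀) (γ t))⁻¹ * σ (γ t) (γ t) * ((σ (γ t) (γ t))⁻¹ * e t)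
    have := congrArg (fun s ↦ (σ (γ t₀) (γ t))⁻¹ * s * e t₀) ht
    simpa [mul_assoc] using this.symm
  have h0 : γ.toContinuousMap 0 = Bundle.TotalSpace.proj (L 0) := rfl
  have h0' : (Path.refl x).toContinuousMap 0 = Bundle.TotalSpace.proj (L 0) := by simp [L]
  have h1 := cov.liftPath_apply_one_eq_of_homotopicRel hγ (L 0) h0 h0'
  have h2 : cov.liftPath γ.toContinuousMap (L 0) h0 1 = L 1 :=
    (congrFun ((cov.eq_liftPath_iff (Γ := L) h0).mpr ⟨hL, rfl, rfl⟩) 1).symm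
  have h3 : cov.liftPath (Path.refl x).toContinuousMap (L 0) h0' 1 = L 0 :=
    (congrFun ((cov.eq_liftPath_iff (Γ := fun _ ↦ L 0) h0').mpr
      ⟨continuous_const, by funext t; simp [L], rfl⟩) 1).symm
  rw [h2, h3] at h1
  have h4 : ∀ t, γ t = x → L t = ⟨x, (σ x x)⁻¹ * e t⟩ := fun t ht ↦ by simp only [L]; rw [ht]
  rw [h4 1 γ.target, h4 0 γ.source] at h1
  exact mul_left_cancel (eq_of_heq (Bundle.TotalSpace.mk.inj h1).2)

end Monodromy

/-! ### Transport along short segments -/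

section Segments

open Filter Topology Metric
open scoped NNReal

/-- Picard–Lindelöf on the unit ball around `1`. There `‖x‖ ≤ 2`, so the right side has norm at most
`2 * δ ≤ 1` and time can run up to `1`. The explicit bound is what keeps short transports close to
the identity. -/
lemma exists_linear_ode {𝔸 : Type*} [NormedRing 𝔸] [NormedAlgebra ℝ 𝔸] [CompleteSpace 𝔸]
    [NormOneClass 𝔸] {A : ℝ → 𝔸} {δ : ℝ} (hA : ContinuousOn A (Icc 0 1))
    (hδ : ∀ t ∈ Icc (0 : ℝ) 1, ‖A t‖ ≤ δ) (hδ' : δ ≤ 1 / 4) :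
    ∃ X : ℝ → 𝔸, X 0 = 1 ∧ (∀ t ∈ Icc (0 : ℝ) 1, HasDerivWithinAt X (A t * X t) (Icc 0 1) t) ∧
      ∀ t ∈ Icc (0 : ℝ) 1, ‖X t - 1‖ ≤ 2 * δ := by
  have h0 : (0 : ℝ) ∈ Icc (0 : ℝ) 1 := ⟨le_rfl, zero_le_one⟩
  have hδ0 : 0 ≤ δ := (norm_nonneg _).trans (hδ 0 h0)
  have hPL : IsPicardLindelof (fun t x ↦ A t * x) (⟨0, h0⟩ : Icc (0 : ℝ) 1) (1 : 𝔸) 1 0 1 1 := by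
    refine ⟨fun t ht ↦ LipschitzWith.lipschitzOnWith ?_, fun x _ ↦ hA.mul continuousOn_const,
      fun t ht x hx ↦ ?_, by simp⟩
    · refine LipschitzWith.of_dist_le_mul fun x y ↦ ?_
      rw [dist_eq_norm, dist_eq_norm, ← mul_sub, NNReal.coe_one]
      exact (norm_mul_le _ _).trans (mul_le_mul_of_nonneg_right ((hδ t ht).trans (by linarith))
        (norm_nonneg _))
    · have h1 : ‖x‖ ≤ 2 := by
        have h2 : ‖x - 1‖ ≤ 1 := by simpa [dist_eq_norm] using hx
        have h3 := norm_add_le (x - 1) 1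
        rw [sub_add_cancel, norm_one] at h3
        linarith
      rw [NNReal.coe_one]
      exact (norm_mul_le _ _).trans ((mul_le_mul (hδ t ht) h1 (norm_nonneg _) hδ0).trans
        (by linarith))
  obtain ⟨X, hX0, hX⟩ := hPL.exists_eq_forall_mem_Icc_hasDerivWithinAt₀
  have hX0' : X 0 = 1 := hX0
  refine ⟨X, hX0', hX, fun t ht ↦ ?_⟩
  -- The existence theorem used returns the solution without a bound; Grönwall recovers `‖X t‖ ≤ exp
  -- (δ * t) ≤ 2`.
  have hb : ∀ t ∈ Icc (0 : ℝ) 1, ‖X t‖ ≤ 2 := by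
    intro t ht
    have h1 := norm_le_gronwallBound_of_norm_deriv_right_le (f := X) (f' := fun t ↦ A t * X t)
      (δ := 1) (K := δ) (ε := 0) (a := 0) (b := 1) (fun t ht ↦ (hX t ht).continuousWithinAt)
      (fun t ht ↦ (hX t (Ico_subset_Icc_self ht)).mono_of_mem_nhdsWithin
        (Icc_mem_nhdsGE_of_mem ht)) (by rw [hX0', norm_one]) (fun t ht ↦ by
        rw [add_zero]
        exact (norm_mul_le _ _).trans (mul_le_mul_of_nonneg_right
          (hδ t (Ico_subset_Icc_self ht)) (norm_nonneg _))) t ht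
    rw [gronwallBound_ε0, one_mul, sub_zero] at h1
    have h2 : δ * t ≤ 1 / 4 := by nlinarith [ht.1, ht.2]
    have h3 : Real.exp (δ * t) ≤ 2 := by
      have h4 : Real.exp (δ * t) ≤ Real.exp (Real.log 2) :=
        Real.exp_le_exp.mpr (by linarith [Real.log_two_gt_d9])
      rwa [Real.exp_log two_pos] at h4
    exact h1.trans h3
  have h1 := norm_image_sub_le_of_norm_deriv_le_segment' (C := 2 * δ) hX (fun t ht ↦ by
    have ht' := Ico_subset_Icc_self ht
    have := (norm_mul_le (A t) (X t)).trans
      (mul_le_mul (hδ t ht') (hb t ht') (norm_nonneg _) hδ0)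
    linarith) t ht
  rw [hX0', sub_zero] at h1
  nlinarith [ht.2]

variable {n : ℕ} {𝔸 : Type*} [NormedRing 𝔸] [NormedAlgebra ℝ 𝔸]

/-- The connection form as a function of the point and the direction. -/
def formOp (W : Fin n → EuclideanSpace ℝ (Fin n) → 𝔸) (z : EuclideanSpace ℝ (Fin n)) :
    EuclideanSpace ℝ (Fin n) →L[ℝ] 𝔸 :=
  ∑ i, (EuclideanSpace.proj (𝕜 := ℝ) i : EuclideanSpace ℝ (Fin n) →L[ℝ] ℝ).smulRight (W i z)

variable {W : Fin n → EuclideanSpace ℝ (Fin n) → 𝔸} {O : Set (EuclideanSpace ℝ (Fin n))}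

lemma formOp_apply (z v : EuclideanSpace ℝ (Fin n)) : formOp W z v = ∑ i, v i • W i z := by
  simp [formOp, sum_apply]

lemma formOp_single (z : EuclideanSpace ℝ (Fin n)) (i : Fin n) :
    formOp W z (EuclideanSpace.single i 1) = W i z := by
  rw [formOp_apply, Finset.sum_eq_single i] <;> simp +contextual

lemma continuousOn_formOp (hW : ∀ i, ContinuousOn (W i) O) : ContinuousOn (formOp W) O := by
  refine continuousOn_finsetSum _ fun i _ ↦ ?_
  exact ((ContinuousLinearMap.smulRightL ℝ (EuclideanSpace ℝ (Fin n)) (𝔸)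
    (EuclideanSpace.proj (𝕜 := ℝ) i)).continuous.comp_continuousOn (hW i))

/-- The line from `z` to `z'`. -/
def line (z z' : EuclideanSpace ℝ (Fin n)) (t : ℝ) : EuclideanSpace ℝ (Fin n) := z + t • (z' - z)

lemma line_mem_ball {z₀ z z' : EuclideanSpace ℝ (Fin n)} {r : ℝ} (hz : z ∈ ball z₀ r)
    (hz' : z' ∈ ball z₀ r) {t : ℝ} (ht : t ∈ Icc (0 : ℝ) 1) : line z z' t ∈ ball z₀ r := by
  have := (convex_ball z₀ r).add_smul_sub_mem hz hz' ht
  exact this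

lemma contDiff_line (z z' : EuclideanSpace ℝ (Fin n)) : ContDiff ℝ ∞ (line z z') := by
  unfold line
  fun_prop

lemma isCurve_line {z₀ z z' : EuclideanSpace ℝ (Fin n)} {r : ℝ} (hz : z ∈ ball z₀ r)
    (hz' : z' ∈ ball z₀ r) : IsCurve (ball z₀ r) (line z z') 0 1 :=
  ⟨(contDiff_line z z').contDiffOn, fun _ ht ↦ line_mem_ball hz hz' ht⟩

/-- `T z z'` is the parallel transport along the segment from `z` to `z'` inside a ball on which
transport along segments differs from the identity by at most `η`. -/
structure IsSegmentTransport (W : Fin n → EuclideanSpace ℝ (Fin n) → 𝔸)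
    (z₀ : EuclideanSpace ℝ (Fin n)) (r η : ℝ)
    (T : EuclideanSpace ℝ (Fin n) → EuclideanSpace ℝ (Fin n) → 𝔸) : Prop where
  isSol : ∀ z ∈ ball z₀ r, ∀ z' ∈ ball z₀ r,
    ∃ X : ℝ → 𝔸, X 0 = 1 ∧ X 1 = T z z' ∧
    ∀ t ∈ Icc (0 : ℝ) 1, HasDerivWithinAt X (-formOp W (line z z' t) (z' - z) * X t) (Icc 0 1) t
  norm_le : ∀ z ∈ ball z₀ r, ∀ z' ∈ ball z₀ r, ‖T z z' - 1‖ ≤ η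
  isLittleO : ∀ z ∈ ball z₀ r,
    (fun z' ↦ T z z' - 1 + formOp W z (z' - z)) =o[𝓝 z] (fun z' ↦ z' - z)

theorem exists_isSegmentTransport [CompleteSpace 𝔸] [NormOneClass 𝔸] (hO : IsOpen O)
    (hW : ∀ i, ContinuousOn (W i) O)
    {z₀ : EuclideanSpace ℝ (Fin n)} (hz₀ : z₀ ∈ O) {η : ℝ} (hη : 0 < η) :
    ∃ r > 0, ball z₀ r ⊆ O ∧ ∃ T, IsSegmentTransport W z₀ r η T := by
  have hc : ContinuousAt (formOp W) z₀ := (continuousOn_formOp hW).continuousAt (hO.mem_nhds hz₀)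
  set C := ‖formOp W z₀‖ + 1 with hC
  have hC0 : 0 < C := by positivity
  obtain ⟨r₁, hr₁, hr₁O⟩ : ∃ r > 0, ball z₀ r ⊆ O ∩ {z | ‖formOp W z‖ < C} := by
    refine Metric.mem_nhds_iff.mp (inter_mem (hO.mem_nhds hz₀) ?_)
    exact hc.norm (Iio_mem_nhds (by simp [hC]))
  -- Points of the ball are at distance at most `2 * r`. The radius makes `C * (2 * r)` at most `1 /
  -- 4`, as `exists_linear_ode` requires, and at most `η / 2`, so that transport stays within `η` of
  -- `1`.
  set r := min r₁ (min (1 / 8) (η / 4) / C) with hr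
  have hr0 : 0 < r := lt_min hr₁ (div_pos (lt_min (by norm_num) (by linarith)) hC0)
  have hrC : C * (2 * r) ≤ min (1 / 4) (η / 2) := by
    have h1 : r ≤ min (1 / 8) (η / 4) / C := min_le_right _ _
    rw [le_div_iff₀ hC0] at h1
    have h2 := h1.trans (min_le_left _ _)
    have h3 := h1.trans (min_le_right _ _)
    exact le_min (by linarith) (by linarith)
  have hsub : ball z₀ r ⊆ O ∩ {z | ‖formOp W z‖ < C} :=
    (ball_subset_ball (min_le_left _ _)).trans hr₁O
  have hdist : ∀ z ∈ ball z₀ r, ∀ z' ∈ ball z₀ r, ‖z' - z‖ ≤ 2 * r := by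
    intro z hz z' hz'
    rw [← dist_eq_norm]
    have := dist_triangle_right z' z z₀
    rw [mem_ball] at hz hz'
    linarith
  have hbound : ∀ z ∈ ball z₀ r, ∀ z' ∈ ball z₀ r, ∀ t ∈ Icc (0 : ℝ) 1,
      ‖-formOp W (line z z' t) (z' - z)‖ ≤ C * ‖z' - z‖ := by
    intro z hz z' hz' t ht
    rw [norm_neg]
    exact ((formOp W _).le_opNorm _).trans (mul_le_mul_of_nonneg_right
      (hsub (line_mem_ball hz hz' ht)).2.le (norm_nonneg _))
  have hex : ∀ z ∈ ball z₀ r, ∀ z' ∈ ball z₀ r, ∃ X : ℝ → 𝔸, X 0 = 1 ∧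
      (∀ t ∈ Icc (0 : ℝ) 1,
        HasDerivWithinAt X (-formOp W (line z z' t) (z' - z) * X t) (Icc 0 1) t) ∧
      ∀ t ∈ Icc (0 : ℝ) 1, ‖X t - 1‖ ≤ 2 * (C * ‖z' - z‖) := by
    intro z hz z' hz'
    refine exists_linear_ode ?_ (hbound z hz z' hz') ?_
    · refine ContinuousOn.neg (ContinuousOn.clm_apply ((continuousOn_formOp hW).comp
        (contDiff_line z z').continuous.continuousOn
        fun t ht ↦ (hsub (line_mem_ball hz hz' ht)).1) continuousOn_const)
    · exact (mul_le_mul_of_nonneg_left (hdist z hz z' hz') hC0.le).trans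
        (hrC.trans (min_le_left _ _))
  choose! X hX0 hX hXn using hex
  refine ⟨r, hr0, fun z hz ↦ (hsub hz).1, fun z z' ↦ X z z' 1,
    fun z hz z' hz' ↦ ⟨X z z', hX0 z hz z' hz', rfl, hX z hz z' hz'⟩,
    fun z hz z' hz' ↦ ?_, fun z hz ↦ ?_⟩
  · have h1 := hXn z hz z' hz' 1 ⟨zero_le_one, le_rfl⟩
    have h2 := (mul_le_mul_of_nonneg_left (hdist z hz z' hz') hC0.le).trans
        (hrC.trans (min_le_right _ _))
    linarith
  · rw [Asymptotics.isLittleO_iff]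
    intro ε hε
    have hcz : ContinuousAt (formOp W) z :=
      (continuousOn_formOp hW).continuousAt (hO.mem_nhds (hsub hz).1)
    obtain ⟨s, hs, hsε⟩ := Metric.continuousAt_iff.mp hcz (ε / 4) (by linarith)
    -- The error has two sources: the variation of the form along the segment, at most `ε / 4 *
    -- ‖v‖`, and the deviation of `X` from `1`, at most `2 * C ^ 2 * ‖v‖ ^ 2`, which this radius
    -- bounds by `ε / 2 * ‖v‖`.
    set s' := min s (ε / (4 * C ^ 2)) with hs'
    have hs'0 : 0 < s' := lt_min hs (by positivity)
    filter_upwards [isOpen_ball.mem_nhds hz, ball_mem_nhds z hs'0] with z' hz' hz's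
    have hd : ‖z' - z‖ < s' := by rwa [mem_ball, dist_eq_norm] at hz's
    set v := z' - z with hv
    have h2 : C * ‖v‖ ≤ 1 / 4 := (mul_le_mul_of_nonneg_left (hdist z hz z' hz') hC0.le).trans
        (hrC.trans (min_le_left _ _))
    have key := norm_image_sub_le_of_norm_deriv_le_segment_01'
      (f := fun t ↦ X z z' t + t • formOp W z v)
      (f' := fun t ↦ -formOp W (line z z' t) v * X z z' t + (1 : ℝ) • formOp W z v)
      (C := ε * ‖v‖) (fun t ht ↦ (hX z hz z' hz' t ht).add
        ((hasDerivAt_id t).smul_const (formOp W z v)).hasDerivWithinAt) ?_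
    · rw [hX0 z hz z' hz'] at key
      simp only [one_smul, zero_smul, add_zero] at key
      rwa [add_sub_right_comm] at key
    · intro t ht
      have ht' := Ico_subset_Icc_self ht
      have e : -formOp W (line z z' t) v * X z z' t + (1 : ℝ) • formOp W z v =
          (formOp W z - formOp W (line z z' t)) v +
            -formOp W (line z z' t) v * (X z z' t - 1) := by
        rw [sub_apply, one_smul, mul_sub, mul_one]
        abel
      rw [e]
      have h3 : ‖formOp W z - formOp W (line z z' t)‖ ≤ ε / 4 := by
        rw [← dist_eq_norm, dist_comm]
        refine (hsε ?_).le
        rw [dist_eq_norm, line, add_sub_cancel_left, norm_smul, Real.norm_of_nonneg ht.1]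
        have := min_le_left s (ε / (4 * C ^ 2))
        nlinarith [ht.2, norm_nonneg (z' - z)]
      have h4 : ‖-formOp W (line z z' t) v * (X z z' t - 1)‖ ≤ C * ‖v‖ * (2 * (C * ‖v‖)) :=
        (norm_mul_le _ _).trans (mul_le_mul (hbound z hz z' hz' t ht') (hXn z hz z' hz' t ht')
          (norm_nonneg _) (by positivity))
      have h5 : 2 * C ^ 2 * ‖v‖ ≤ ε / 2 := by
        have h6 : ‖v‖ ≤ ε / (4 * C ^ 2) := hd.le.trans (min_le_right _ _)
        rw [le_div_iff₀ (by positivity)] at h6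
        linarith
      calc _ ≤ ‖(formOp W z - formOp W (line z z' t)) v‖ + _ := norm_add_le _ _
        _ ≤ ε / 4 * ‖v‖ + C * ‖v‖ * (2 * (C * ‖v‖)) := add_le_add
            (((_ : EuclideanSpace ℝ (Fin n) →L[ℝ] 𝔸).le_opNorm _).trans
              (mul_le_mul_of_nonneg_right h3 (norm_nonneg _))) h4
        _ = (ε / 4 + 2 * C ^ 2 * ‖v‖) * ‖v‖ := by ring
        _ ≤ ε * ‖v‖ := mul_le_mul_of_nonneg_right (by linarith) (norm_nonneg _)

/-- A field of endomorphisms preserved by transport along segments is parallel. -/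
theorem IsSegmentTransport.hasFDerivAt {z₀ z : EuclideanSpace ℝ (Fin n)} {r : ℝ}
    {T : EuclideanSpace ℝ (Fin n) → EuclideanSpace ℝ (Fin n) → 𝔸}
    (hT : IsSegmentTransport W z₀ r (1 / 2) T) {J : EuclideanSpace ℝ (Fin n) → 𝔸}
    (hJ : ∀ z ∈ ball z₀ r, ∀ z' ∈ ball z₀ r, J z' * T z z' = T z z' * J z) (hz : z ∈ ball z₀ r) :
    HasFDerivAt J ((ContinuousLinearMap.mul ℝ 𝔸 (J z) - (ContinuousLinearMap.mul ℝ 𝔸).flip (J z)) ∘L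
      formOp W z) z := by
  rw [hasFDerivAt_iff_isLittleO]
  set D : EuclideanSpace ℝ (Fin n) → 𝔸 := fun z' ↦ T z z' - 1 with hD
  have h1 := hT.isLittleO z hz
  have hDO : D =O[𝓝 z] (fun z' ↦ z' - z) := by
    have h2 : (fun z' ↦ formOp W z (z' - z)) =O[𝓝 z] (fun z' ↦ z' - z) :=
      (formOp W z).isBigO_comp _ _
    simpa [hD] using h1.isBigO.sub h2
  -- The intertwining relation with `T = 1 + D`. To first order `D` is minus the connection form, so
  -- the commutator with `J z` is the derivative, and the last term is quadratic.
  have hid : ∀ z' ∈ ball z₀ r, J z' - J z = D z' * J z - J z * D z' - (J z' - J z) * D z' := by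
    intro z' hz'
    have := hJ z hz z' hz'
    simp only [hD, sub_mul, mul_sub, one_mul, mul_one, this]
    abel
  have hball : ∀ᶠ z' in 𝓝 z, z' ∈ ball z₀ r := isOpen_ball.mem_nhds hz
  -- Since `‖D z'‖ ≤ 1 / 2`, half of `‖J z' - J z‖` absorbs the last term of `hid`.
  have hJO : (fun z' ↦ J z' - J z) =O[𝓝 z] (fun z' ↦ z' - z) := by
    refine Asymptotics.IsBigO.trans (Asymptotics.IsBigO.of_bound (4 * ‖J z‖) ?_) hDO
    filter_upwards [hball] with z' hz'
    have h3 : ‖J z' - J z‖ ≤ ‖D z'‖ * ‖J z‖ + ‖J z‖ * ‖D z'‖ + ‖J z' - J z‖ * ‖D z'‖ := by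
      conv_lhs => rw [hid z' hz']
      refine (norm_sub_le _ _).trans (add_le_add ((norm_sub_le _ _).trans (add_le_add
        (norm_mul_le _ _) (norm_mul_le _ _))) (norm_mul_le _ _))
    have h4 : ‖D z'‖ ≤ 1 / 2 := hT.norm_le z hz z' hz'
    nlinarith [norm_nonneg (J z' - J z)]
  have hbi : ∀ {f g : EuclideanSpace ℝ (Fin n) → 𝔸}, f =O[𝓝 z] (fun z' ↦ z' - z) →
      g =O[𝓝 z] (fun z' ↦ z' - z) → (fun z' ↦ f z' * g z') =o[𝓝 z] (fun z' ↦ z' - z) := by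
    intro f g hf hg
    have h0 : f =o[𝓝 z] (fun _ ↦ (1 : ℝ)) := hf.trans_isLittleO (by
      rw [Asymptotics.isLittleO_one_iff]
      exact (continuous_id.sub continuous_const).tendsto' z 0 (by simp))
    have := h0.mul_isBigO hg.norm_right
    refine Asymptotics.IsLittleO.of_norm_right (this.congr_right fun _ ↦ one_mul _)
  have hc : ∀ (c : 𝔸), (fun z' ↦ c * (D z' + formOp W z (z' - z))) =o[𝓝 z] (fun z' ↦ z' - z) :=
    fun c ↦ h1.const_mul_left c
  have hc' : ∀ (c : 𝔸), (fun z' ↦ (D z' + formOp W z (z' - z)) * c) =o[𝓝 z] (fun z' ↦ z' - z) := by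
    intro c
    exact (((ContinuousLinearMap.mul ℝ 𝔸).flip c).isBigO_comp
      (fun z' ↦ D z' + formOp W z (z' - z)) (𝓝 z)).trans_isLittleO h1
  refine (((hc' (J z)).sub (hc (J z))).sub (hbi hJO hDO)).congr' ?_ Filter.EventuallyEq.rfl
  filter_upwards [hball] with z' hz'
  conv_rhs => rw [hid z' hz']
  simp only [ContinuousLinearMap.comp_apply, sub_apply, ContinuousLinearMap.mul_apply',
    ContinuousLinearMap.flip_apply, add_mul, mul_add]
  abel

end Segments

/-! ### Segment transport for matrix connections -/

section MatrixSegments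

open Filter Topology Metric
open scoped Matrix.Norms.Operator

variable {n : ℕ} {ι : Type*} [Fintype ι]
  {W : Fin n → EuclideanSpace ℝ (Fin n) → Matrix ι ι ℝ} {O : Set (EuclideanSpace ℝ (Fin n))}

instance [DecidableEq ι] [Nonempty ι] : NormOneClass (Matrix ι ι ℝ) := by
  refine ⟨?_⟩
  rw [← Matrix.diagonal_one, Matrix.linfty_opNorm_diagonal]
  exact norm_one

omit [Fintype ι] in
lemma SmoothM.continuousOn {S : EuclideanSpace ℝ (Fin n) → Matrix ι ι ℝ} (hS : SmoothM O S) :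
    ContinuousOn S O :=
  continuousOn_pi.mpr fun A ↦ continuousOn_pi.mpr fun B ↦ (hS A B).continuousOn

variable [DecidableEq ι]

lemma isSol_line {z z' : EuclideanSpace ℝ (Fin n)} {X : ℝ → Matrix ι ι ℝ}
    (h : ∀ t ∈ Icc (0 : ℝ) 1,
      HasDerivWithinAt X (-formOp W (line z z' t) (z' - z) * X t) (Icc 0 1) t) :
    IsSol W (line z z') 0 1 X := by
  intro t ht A B
  have hv : ∀ i, vel (line z z') 0 1 t i = (z' - z) i := by
    intro i
    have h1 : HasDerivWithinAt (fun r : ℝ ↦ z i + r * (z' - z) i) ((z' - z) i) (Icc 0 1) t := by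
      simpa using (((hasDerivAt_id t).mul_const ((z' - z) i)).const_add (z i)).hasDerivWithinAt
    exact h1.derivWithin (uniqueDiffOn_Icc zero_lt_one t ht)
  refine (((Matrix.entryLinearMap ℝ ℝ A B).toContinuousLinearMap.hasFDerivAt
    ).comp_hasDerivWithinAt t (h t ht)).congr_deriv ?_
  change (-formOp W (line z z' t) (z' - z) * X t) A B = _
  simp only [hv, formOp_apply, neg_mul, Finset.sum_mul, Matrix.neg_apply, Matrix.sum_apply,
    Matrix.smul_mul, Matrix.smul_apply, smul_eq_mul]

namespace IsSegmentTransport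

variable {z₀ z : EuclideanSpace ℝ (Fin n)} {r η : ℝ}
  {T : EuclideanSpace ℝ (Fin n) → EuclideanSpace ℝ (Fin n) → Matrix ι ι ℝ}
  (hT : IsSegmentTransport W z₀ r η T)
include hT

lemma isSol_matrix {z' : EuclideanSpace ℝ (Fin n)} (hz : z ∈ ball z₀ r) (hz' : z' ∈ ball z₀ r) :
    ∃ X : ℝ → Matrix ι ι ℝ, X 0 = 1 ∧ X 1 = T z z' ∧ IsSol W (line z z') 0 1 X := by
  obtain ⟨X, h0, h1, h⟩ := hT.isSol z hz z' hz'
  exact ⟨X, h0, h1, isSol_line h⟩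

/-- The segment run backwards is the segment from `z'` to `z`, and solutions along it are unique. -/
lemma mul_eq_one {z' : EuclideanSpace ℝ (Fin n)} (hW : ∀ i, SmoothM (ball z₀ r) (W i))
    (hz : z ∈ ball z₀ r) (hz' : z' ∈ ball z₀ r) : T z' z * T z z' = 1 := by
  obtain ⟨X, h0, h1, h⟩ := hT.isSol_matrix hz hz'
  obtain ⟨Y, k0, k1, k⟩ := hT.isSol_matrix hz' hz
  have e : (fun r ↦ line z z' (-1 * r + 1)) = line z' z := by
    funext r
    simp only [line]
    module
  have h2 := h.comp_affine (isCurve_line hz hz') (m := -1) (k := 1) (a' := 0) (b' := 1)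
    fun u hu ↦ ⟨by linarith [hu.2], by linarith [hu.1]⟩
  rw [e] at h2
  have h3 := (k.mul_const (X 1)).eq_of_eq h2 (isCurve_line hz' hz) hW (by simp [k0])
    (⟨zero_le_one, le_rfl⟩ : (1 : ℝ) ∈ Icc (0 : ℝ) 1)
  simpa [k1, h1, h0] using h3

end IsSegmentTransport

/-- A field of endomorphisms preserved by transport along segments is smooth and parallel. -/
theorem IsSegmentTransport.smooth_and_parallel {z₀ : EuclideanSpace ℝ (Fin n)} {r : ℝ}
    {T : EuclideanSpace ℝ (Fin n) → EuclideanSpace ℝ (Fin n) → Matrix ι ι ℝ}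
    (hT : IsSegmentTransport W z₀ r (1 / 2) T) (hW : ∀ i, SmoothM (ball z₀ r) (W i))
    {J : EuclideanSpace ℝ (Fin n) → Matrix ι ι ℝ}
    (hJ : ∀ z ∈ ball z₀ r, ∀ z' ∈ ball z₀ r, J z' * T z z' = T z z' * J z) :
    SmoothM (ball z₀ r) J ∧
      ∀ z ∈ ball z₀ r, ∀ i, pdm i J z = J z * W i z - W i z * J z := by
  have hd : ∀ z ∈ ball z₀ r, ∀ A B, HasFDerivAt (fun y ↦ J y A B)
      (∑ i, ((J z * W i z - W i z * J z) A B) •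
        (EuclideanSpace.proj (𝕜 := ℝ) i : EuclideanSpace ℝ (Fin n) →L[ℝ] ℝ)) z := by
    intro z hz A B
    refine ((Matrix.entryLinearMap ℝ ℝ A B).toContinuousLinearMap.hasFDerivAt.comp z
      (hT.hasFDerivAt hJ hz)).congr_fderiv ?_
    ext v
    change (J z * formOp W z v - formOp W z v * J z) A B = _
    simp only [formOp_apply, Finset.mul_sum, Finset.sum_mul, Matrix.sub_apply, Matrix.sum_apply,
      Matrix.mul_smul, Matrix.smul_mul, Matrix.smul_apply, sum_apply, smul_apply, smul_eq_mul,
      ← Finset.sum_sub_distrib]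
    refine Finset.sum_congr rfl fun i _ ↦ ?_
    change _ = _ * v i
    ring
  have hpd : ∀ z ∈ ball z₀ r, ∀ i, pdm i J z = J z * W i z - W i z * J z := by
    intro z hz i
    ext A B
    simp only [pdm, Matrix.of_apply, pd, (hd z hz A B).fderiv, sum_apply, smul_apply, smul_eq_mul]
    rw [Finset.sum_eq_single i] <;> simp +contextual
  refine ⟨?_, hpd⟩
  -- Bootstrapping: the derivative of `J` is polynomial in `J` and the smooth `W`, so each step
  -- gains one order.
  have key : ∀ k : ℕ, ∀ A B, ContDiffOn ℝ k (fun y ↦ J y A B) (ball z₀ r) := by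
    intro k
    induction k with
    | zero =>
      intro A B
      exact contDiffOn_zero.mpr fun z hz ↦ (hd z hz A B).continuousAt.continuousWithinAt
    | succ k ih =>
      intro A B
      push_cast
      rw [contDiffOn_succ_iff_fderiv_of_isOpen isOpen_ball]
      refine ⟨fun z hz ↦ (hd z hz A B).differentiableAt.differentiableWithinAt, by simp, ?_⟩
      refine ContDiffOn.congr (f := fun z ↦ ∑ i, ((J z * W i z - W i z * J z) A B) •
        (EuclideanSpace.proj (𝕜 := ℝ) i : EuclideanSpace ℝ (Fin n) →L[ℝ] ℝ)) ?_
        fun z hz ↦ (hd z hz A B).fderiv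
      refine ContDiffOn.sum fun i _ ↦ ContDiffOn.fun_smul ?_ contDiffOn_const
      simp only [Matrix.sub_apply, Matrix.mul_apply]
      have hWk : ∀ C D, ContDiffOn ℝ k (fun y ↦ W i y C D) (ball z₀ r) :=
        fun C D ↦ (hW i C D).of_le (by exact_mod_cast le_top)
      exact (ContDiffOn.sum fun C _ ↦ (ih A C).mul (hWk C B)).sub
        (ContDiffOn.sum fun C _ ↦ (hWk A C).mul (ih C B))
  exact fun A B ↦ contDiffOn_infty.mpr fun k ↦ key k A B

end MatrixSegments

/-! ### Real endomorphisms of a complex vector space -/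

section ComplexStructure

variable {V κ : Type*} [AddCommGroup V] [Module ℝ V] [Fintype κ] [DecidableEq κ] (Φ : V ≃ₗ[ℝ] (κ → ℂ))

/-- Multiplication by `i` in the complex structure given by `Φ`. -/
def complexStr : Module.End ℝ V :=
  Φ.symm.toLinearMap ∘ₗ (Complex.I • LinearMap.id : (κ → ℂ) →ₗ[ℝ] (κ → ℂ)) ∘ₗ Φ.toLinearMap

omit [Fintype κ] [DecidableEq κ] in
lemma complexStr_apply (v : V) : complexStr Φ v = Φ.symm (Complex.I • Φ v) := rfl

omit [Fintype κ] [DecidableEq κ] in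
lemma complexStr_mul_self : complexStr Φ * complexStr Φ = -1 := by
  ext v
  rw [Module.End.mul_apply, complexStr_apply, complexStr_apply, LinearEquiv.apply_symm_apply,
    smul_smul, Complex.I_mul_I, neg_one_smul, map_neg, LinearEquiv.symm_apply_apply]
  rfl

/-- The complex matrix whose columns are the images of the standard basis under `A`; it represents
`A` if `A` is complex linear. -/
def complexMat : Module.End ℝ V →ₗ[ℝ] Matrix κ κ ℂ where
  toFun A := Matrix.of fun k l ↦ Φ (A (Φ.symm (Pi.single l 1))) k
  map_add' A B := by ext k l; simp
  map_smul' r A := by ext k l; simp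

variable {Φ} {A B : Module.End ℝ V}

omit [Fintype κ] in
lemma complexMat_apply (A : Module.End ℝ V) (k l : κ) :
    complexMat Φ A k l = Φ (A (Φ.symm (Pi.single l 1))) k := rfl

omit [Fintype κ] [DecidableEq κ] in
lemma map_smul_of_commute (h : A * complexStr Φ = complexStr Φ * A) (c : ℂ) (w : κ → ℂ) :
    Φ (A (Φ.symm (c • w))) = c • Φ (A (Φ.symm w)) := by
  have h1 : Φ (A (Φ.symm (Complex.I • w))) = Complex.I • Φ (A (Φ.symm w)) := by
    have := congrArg Φ (LinearMap.congr_fun h (Φ.symm w))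
    simpa [complexStr_apply] using this
  have h2 : ∀ (r : ℝ) (w : κ → ℂ), (r : ℂ) • w = r • w := fun r w ↦ by
    ext k; simp
  have h3 : c • w = c.re • w + c.im • (Complex.I • w) := by
    conv_lhs => rw [← Complex.re_add_im c]
    rw [add_smul, mul_smul, h2, h2]
  have h4 : c • Φ (A (Φ.symm w)) =
      c.re • Φ (A (Φ.symm w)) + c.im • (Complex.I • Φ (A (Φ.symm w))) := by
    conv_lhs => rw [← Complex.re_add_im c]
    rw [add_smul, mul_smul, h2, h2]
  rw [h3, h4, ← h1]
  simp only [map_add, map_smul]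

lemma complexMat_mulVec (h : A * complexStr Φ = complexStr Φ * A) (v : V) :
    Φ (A v) = (complexMat Φ A).mulVec (Φ v) := by
  have h1 : v = ∑ l, Φ.symm (Φ v l • Pi.single l (1 : ℂ)) := by
    apply Φ.injective
    rw [map_sum]
    simp only [LinearEquiv.apply_symm_apply]
    exact pi_eq_sum_univ' _
  conv_lhs => rw [h1]
  rw [map_sum, map_sum]
  simp only [map_smul_of_commute h]
  ext k
  simp only [Finset.sum_apply, Pi.smul_apply, smul_eq_mul, Matrix.mulVec, dotProduct,
    complexMat_apply]
  exact Finset.sum_congr rfl fun l _ ↦ mul_comm _ _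

/-- `complexMat` records the images of the standard basis of any real endomorphism, so only the left
factor has to be complex linear. -/
lemma complexMat_mul (h : A * complexStr Φ = complexStr Φ * A) (B : Module.End ℝ V) :
    complexMat Φ (A * B) = complexMat Φ A * complexMat Φ B := by
  ext k l
  rw [complexMat_apply, Module.End.mul_apply, complexMat_mulVec h]
  rfl

omit [Fintype κ] in
lemma complexMat_one : complexMat Φ (1 : Module.End ℝ V) = 1 := by
  ext k l
  simp [complexMat_apply, Matrix.one_apply, Pi.single_apply]

omit [Fintype κ] in
lemma complexMat_complexStr_mul (A : Module.End ℝ V) :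
    complexMat Φ (complexStr Φ * A) = Complex.I • complexMat Φ A := by
  ext k l
  simp [complexMat_apply, complexStr_apply]

/-- Anticommuting with `i` means conjugate linearity, so the coordinates are conjugated before the
matrix of `A` acts. -/
lemma complexMat_conj_of_anticommute (h : A * complexStr Φ = -(complexStr Φ * A))
    (B : Module.End ℝ V) :
    complexMat Φ (A * B) = complexMat Φ A * (complexMat Φ B).map (starRingEnd ℂ) := by
  have h1 : ∀ (c : ℂ) (w : κ → ℂ), Φ (A (Φ.symm (c • w))) = starRingEnd ℂ c • Φ (A (Φ.symm w)) := by
    intro c w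
    have h1 : Φ (A (Φ.symm (Complex.I • w))) = -(Complex.I • Φ (A (Φ.symm w))) := by
      have := congrArg Φ (LinearMap.congr_fun h (Φ.symm w))
      simpa [complexStr_apply] using this
    have h2 : ∀ (r : ℝ) (w : κ → ℂ), (r : ℂ) • w = r • w := fun r w ↦ by
      ext k; simp
    have h3 : c • w = c.re • w + c.im • (Complex.I • w) := by
      conv_lhs => rw [← Complex.re_add_im c]
      rw [add_smul, mul_smul, h2, h2]
    have h4 : starRingEnd ℂ c • Φ (A (Φ.symm w)) =
        c.re • Φ (A (Φ.symm w)) - c.im • (Complex.I • Φ (A (Φ.symm w))) := by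
      conv_lhs => rw [← Complex.re_add_im (starRingEnd ℂ c)]
      rw [add_smul, mul_smul, h2, h2, Complex.conj_re, Complex.conj_im, neg_smul, sub_eq_add_neg]
    rw [h3, h4]
    simp only [map_add, map_smul, h1, smul_neg, sub_eq_add_neg]
  ext k l
  have h2 : B (Φ.symm (Pi.single l 1)) =
      ∑ j, Φ.symm (complexMat Φ B j l • Pi.single j (1 : ℂ)) := by
    apply Φ.injective
    rw [map_sum]
    simp only [LinearEquiv.apply_symm_apply]
    exact pi_eq_sum_univ' _
  rw [complexMat_apply, Module.End.mul_apply, h2, map_sum, map_sum]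
  simp only [h1, Finset.sum_apply, Pi.smul_apply, smul_eq_mul, Matrix.mul_apply, Matrix.map_apply,
    complexMat_apply]
  exact Finset.sum_congr rfl fun l _ ↦ mul_comm _ _

/-- Conjugation by a complex linear map preserves the complex determinant and conjugation by a
conjugate linear one conjugates it; `1` is fixed either way. -/
lemma det_complexMat_conj {A A' B : Module.End ℝ V} (hA : A * A' = 1)
    (h : A * complexStr Φ = complexStr Φ * A ∨ A * complexStr Φ = -(complexStr Φ * A))
    (hB : B * complexStr Φ = complexStr Φ * B) (h1 : (complexMat Φ B).det = 1) :
    (complexMat Φ (A * B * A')).det = 1 := by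
  rcases h with h | h
  · have h2 := congrArg Matrix.det (complexMat_one (Φ := Φ))
    rw [← hA, complexMat_mul h, Matrix.det_mul, Matrix.det_one] at h2
    rw [mul_assoc, complexMat_mul h, complexMat_mul hB, Matrix.det_mul, Matrix.det_mul, h1, one_mul,
      h2]
  · have h2 := congrArg Matrix.det (complexMat_one (Φ := Φ))
    rw [← hA, complexMat_conj_of_anticommute h, Matrix.det_mul, Matrix.det_one] at h2
    rw [mul_assoc, complexMat_conj_of_anticommute h, complexMat_mul hB, Matrix.det_mul]
    have h3 : ∀ X : Matrix κ κ ℂ, (X.map (starRingEnd ℂ)).det = starRingEnd ℂ X.det := fun X ↦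
      (RingHom.map_det (starRingEnd ℂ) X).symm
    rw [h3] at h2 ⊢
    rw [Matrix.det_mul, h1, one_mul, h2]

/-- In the real basis `eₖ, i eₖ` a complex diagonal entry contributes its real part twice. -/
lemma trace_eq_two_mul_re (h : A * complexStr Φ = complexStr Φ * A) :
    LinearMap.trace ℝ V A = 2 * (complexMat Φ A).trace.re := by
  rw [← LinearMap.trace_conj' A Φ]
  let b : Module.Basis (Σ _ : κ, Fin 2) ℝ (κ → ℂ) := Pi.basis fun _ ↦ Complex.basisOneI
  rw [LinearMap.trace_eq_matrix_trace ℝ b, Matrix.trace, Matrix.trace, Complex.re_sum,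
    Fintype.sum_sigma, Finset.mul_sum]
  refine Finset.sum_congr rfl fun k _ ↦ ?_
  have e0 : b ⟨k, 0⟩ = Pi.single k 1 := by simp [b, Pi.basis_apply]
  have e1 : b ⟨k, 1⟩ = Complex.I • Pi.single k 1 := by
    simp only [b, Pi.basis_apply]
    ext j
    by_cases hj : j = k
    · subst hj; simp
    · simp [hj]
  have r0 : ∀ w : κ → ℂ, b.repr w ⟨k, 0⟩ = (w k).re := fun w ↦ by
    simp only [b, Pi.basis_repr, Complex.coe_basisOneI_repr, Matrix.cons_val_zero]
  have r1 : ∀ w : κ → ℂ, b.repr w ⟨k, 1⟩ = (w k).im := fun w ↦ by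
    simp only [b, Pi.basis_repr, Complex.coe_basisOneI_repr, Matrix.cons_val_one,
      Matrix.cons_val_fin_one]
  rw [Fin.sum_univ_two, Matrix.diag, Matrix.diag, Matrix.diag, LinearMap.toMatrix_apply,
    LinearMap.toMatrix_apply, e0, e1, r0, r1, LinearEquiv.conj_apply, LinearMap.comp_apply,
    LinearMap.comp_apply, LinearMap.comp_apply, LinearMap.comp_apply, LinearEquiv.coe_coe,
    LinearEquiv.coe_coe, map_smul_of_commute h, complexMat_apply]
  simp [two_mul]

/-- The complex trace of a complex linear endomorphism vanishes if it is orthogonal to `1` and `i`. -/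
lemma complexTrace_eq_zero (h : A * complexStr Φ = complexStr Φ * A)
    (h1 : LinearMap.trace ℝ V A = 0) (h2 : LinearMap.trace ℝ V (complexStr Φ * A) = 0) :
    (complexMat Φ A).trace = 0 := by
  have h3 : complexStr Φ * A * complexStr Φ = complexStr Φ * (complexStr Φ * A) := by
    rw [mul_assoc, h]
  rw [trace_eq_two_mul_re h] at h1
  rw [trace_eq_two_mul_re h3, complexMat_complexStr_mul, Matrix.trace_smul] at h2
  apply Complex.ext
  · simpa using h1
  · simpa using h2

end ComplexStructure

/-! ### The derivative of the determinant -/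

section DetDeriv

variable {κ : Type*} [Fintype κ] [DecidableEq κ]

lemma differentiable_det :
    Differentiable ℝ (fun X : κ → κ → ℂ ↦ Matrix.det (Matrix.of X)) := by
  simp only [Matrix.det_apply]
  refine Differentiable.fun_sum fun σ _ ↦ ?_
  refine Differentiable.const_smul ?_ _
  simp only [Matrix.of_apply]
  intro X
  refine (HasFDerivAt.finsetProd (g := fun i (X : κ → κ → ℂ) ↦ X (σ i) i) fun i _ ↦
    DifferentiableAt.hasFDerivAt ?_).differentiableAt
  fun_prop

/-- Jacobi's formula for solutions of a linear equation. -/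
lemma hasDerivWithinAt_det {X : ℝ → Matrix κ κ ℂ} {A : Matrix κ κ ℂ} {s : Set ℝ} {t : ℝ}
    (hX : ∀ k l, HasDerivWithinAt (fun r ↦ X r k l) ((A * X t) k l) s t) :
    HasDerivWithinAt (fun r ↦ (X r).det) (A.trace * (X t).det) s t := by
  have h1 : HasDerivWithinAt (fun r ↦ (fun k l ↦ X r k l : κ → κ → ℂ)) (fun k l ↦ (A * X t) k l)
      s t := hasDerivWithinAt_pi.mpr fun k ↦ hasDerivWithinAt_pi.mpr fun l ↦ hX k l
  have hd := (differentiable_det (κ := κ) (fun k l ↦ X t k l)).hasFDerivAt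
  refine (hd.comp_hasDerivWithinAt t h1).congr_deriv ?_
  -- The derivative of the determinant can be computed along this line, on which the determinant is
  -- `det (1 + h A) * det (X t)`.
  have h2 : HasDerivAt (fun h : ℝ ↦ ((fun k l ↦ X t k l) + h • fun k l ↦ (A * X t) k l :
      κ → κ → ℂ)) (fun k l ↦ (A * X t) k l) 0 := by
    simpa using ((hasDerivAt_id (0 : ℝ)).smul_const (fun k l ↦ (A * X t) k l)).const_add
      (fun k l ↦ X t k l : κ → κ → ℂ)
  have h3 := HasFDerivAt.comp_hasDerivAt_of_eq (0 : ℝ) hd h2 (by simp)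
  obtain ⟨c, hc⟩ : ∃ c : ℂ → ℂ, Differentiable ℂ c ∧ ∀ h : ℂ,
      (1 + h • A).det = 1 + A.trace * h + c h * h ^ 2 :=
    ⟨fun h ↦ _, Polynomial.differentiable _, fun h ↦ Matrix.det_one_add_smul h A⟩
  have h4 : HasDerivAt (fun h : ℝ ↦ (1 + A.trace * (h : ℂ) + c h * (h : ℂ) ^ 2) * (X t).det)
      (A.trace * (X t).det) 0 := by
    have h5 : HasDerivAt (fun h : ℂ ↦ (1 + A.trace * h + c h * h ^ 2) * (X t).det)
        (A.trace * (X t).det) (((0 : ℝ)) : ℂ) := by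
      have h6 := ((((hasDerivAt_id (0 : ℂ)).const_mul A.trace).const_add 1).add
        ((hc.1 0).hasDerivAt.mul ((hasDerivAt_id (0 : ℂ)).pow 2))).mul_const (X t).det
      simpa using h6
    exact h5.comp_ofReal
  refine h3.unique (h4.congr_of_eventuallyEq (Filter.Eventually.of_forall fun h ↦ ?_))
  simp only [Function.comp_apply]
  rw [← hc.2, ← Matrix.det_mul, add_mul, one_mul, Matrix.smul_mul]
  rfl

end DetDeriv

/-! ### Connections preserving a complex structure with trace-free curvature -/

section ComplexConnection

open Filter Topology Metric

variable {n : ℕ} {ι κ : Type*} [Fintype ι] [DecidableEq ι] [Fintype κ] [DecidableEq κ]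
  (Φ : (ι → ℝ) ≃ₗ[ℝ] (κ → ℂ))

/-- The matrix of the complex structure given by `Φ`. -/
def strMat : Matrix ι ι ℝ := Matrix.toLinAlgEquiv'.symm (complexStr Φ)

/-- The complex matrix corresponding to a real matrix under `Φ`. -/
def cmat : Matrix ι ι ℝ →ₗ[ℝ] Matrix κ κ ℂ :=
  complexMat Φ ∘ₗ (Matrix.toLinAlgEquiv' (R := ℝ) (n := ι)).toLinearMap

variable {Φ} {A B : Matrix ι ι ℝ}

omit [Fintype κ] in
lemma cmat_apply (A : Matrix ι ι ℝ) : cmat Φ A = complexMat Φ (Matrix.toLinAlgEquiv' A) := rfl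

omit [Fintype κ] [DecidableEq κ] in
lemma toLin_strMat : Matrix.toLinAlgEquiv' (strMat Φ) = complexStr Φ :=
  Matrix.toLinAlgEquiv'.apply_symm_apply _

omit [Fintype κ] [DecidableEq κ] in
lemma strMat_mul_self : strMat Φ * strMat Φ = -1 := by
  apply Matrix.toLinAlgEquiv'.injective
  rw [map_mul, toLin_strMat, complexStr_mul_self, map_neg, map_one]

omit [Fintype κ] [DecidableEq κ] in
lemma commute_toLin (h : A * strMat Φ = strMat Φ * A) :
    Matrix.toLinAlgEquiv' A * complexStr Φ = complexStr Φ * Matrix.toLinAlgEquiv' A := by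
  rw [← toLin_strMat, ← map_mul, h, map_mul]

lemma cmat_mul (h : A * strMat Φ = strMat Φ * A) (B : Matrix ι ι ℝ) :
    cmat Φ (A * B) = cmat Φ A * cmat Φ B := by
  rw [cmat_apply, map_mul, complexMat_mul (commute_toLin h)]
  rfl

omit [Fintype κ] in
lemma cmat_one : cmat Φ (1 : Matrix ι ι ℝ) = 1 := by
  rw [cmat_apply, map_one, complexMat_one]

lemma cmat_trace_eq_zero (h : A * strMat Φ = strMat Φ * A) (h1 : A.trace = 0)
    (h2 : (strMat Φ * A).trace = 0) : (cmat Φ A).trace = 0 := by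
  refine complexTrace_eq_zero (commute_toLin h) ?_ ?_
  · rw [← h1]; exact Matrix.trace_toLin'_eq A
  · rw [← h2, ← toLin_strMat]
    exact (congrArg _ (map_mul Matrix.toLinAlgEquiv' _ _).symm).trans (Matrix.trace_toLin'_eq _)

variable (Φ) in
/-- The complex trace of the connection matrices. -/
def cform (W : Fin n → EuclideanSpace ℝ (Fin n) → Matrix ι ι ℝ) (i : Fin n)
    (z : EuclideanSpace ℝ (Fin n)) : ℂ := (cmat Φ (W i z)).trace

variable {O : Set (EuclideanSpace ℝ (Fin n))} {z : EuclideanSpace ℝ (Fin n)}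
  {ζ : ℝ → EuclideanSpace ℝ (Fin n)} {a b u : ℝ}

omit [DecidableEq ι] in
lemma hasFDerivAt_linearMap_comp {F : Type*} [NormedAddCommGroup F] [NormedSpace ℝ F]
    (L : Matrix ι ι ℝ →ₗ[ℝ] F) {S : EuclideanSpace ℝ (Fin n) → Matrix ι ι ℝ} (hO : IsOpen O)
    (hz : z ∈ O) (hS : SmoothM O S) :
    ∃ D : EuclideanSpace ℝ (Fin n) →L[ℝ] F, HasFDerivAt (fun y ↦ L (S y)) D z ∧
      ∀ i, D (EuclideanSpace.single i 1) = L (pdm i S z) := by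
  classical
  have e : ∀ T : Matrix ι ι ℝ, L T = ∑ A, ∑ B, T A B • L (Matrix.single A B 1) := by
    intro T
    conv_lhs => rw [Matrix.matrix_eq_sum_single T]
    simp only [map_sum, ← map_smul, Matrix.smul_single, smul_eq_mul, mul_one]
  refine ⟨∑ A, ∑ B, (fderiv ℝ (fun y ↦ S y A B) z).smulRight (L (Matrix.single A B 1)), ?_, ?_⟩
  · rw [funext fun y ↦ e (S y)]
    exact HasFDerivAt.fun_sum fun A _ ↦ HasFDerivAt.fun_sum fun B _ ↦
      (hS.diffAt hO hz A B).hasFDerivAt.smul_const _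
  · intro i
    rw [e (pdm i S z)]
    simp [sum_apply, pdm, pd]

omit [DecidableEq ι] in
lemma hasDerivWithinAt_linearMap_comp {F : Type*} [NormedAddCommGroup F] [NormedSpace ℝ F]
    (L : Matrix ι ι ℝ →ₗ[ℝ] F) {X : ℝ → Matrix ι ι ℝ} {X' : Matrix ι ι ℝ} {s : Set ℝ}
    (h : ∀ A B, HasDerivWithinAt (fun r ↦ X r A B) (X' A B) s u) :
    HasDerivWithinAt (fun r ↦ L (X r)) (L X') s u := by
  classical
  have e : ∀ T : Matrix ι ι ℝ, L T = ∑ A, ∑ B, T A B • L (Matrix.single A B 1) := by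
    intro T
    conv_lhs => rw [Matrix.matrix_eq_sum_single T]
    simp only [map_sum, ← map_smul, Matrix.smul_single, smul_eq_mul, mul_one]
  rw [e X', funext fun r ↦ e (X r)]
  exact HasDerivWithinAt.fun_sum fun A _ ↦ HasDerivWithinAt.fun_sum fun B _ ↦
    (h A B).smul_const _

lemma IsCurve.hasDerivWithinAt (h : IsCurve O ζ a b) (hu : u ∈ Icc a b) :
    HasDerivWithinAt ζ (∑ i, vel ζ a b u i • EuclideanSpace.single i (1 : ℝ)) (Icc a b) u := by
  rw [hasDerivWithinAt_iff_hasFDerivWithinAt, hasFDerivWithinAt_euclidean]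
  intro i
  refine (h.hasDeriv_apply hu i).hasFDerivWithinAt.congr_fderiv ?_
  ext
  simp

/-- The complex determinant of parallel transport is governed by a primitive of the complex trace of
the connection matrices. -/
lemma IsSol.det_cmat {W : Fin n → EuclideanSpace ℝ (Fin n) → Matrix ι ι ℝ} {X : ℝ → Matrix ι ι ℝ}
    (hX : IsSol W ζ a b X) (hζ : IsCurve O ζ a b)
    (hW : ∀ z ∈ O, ∀ i, W i z * strMat Φ = strMat Φ * W i z)
    {f : EuclideanSpace ℝ (Fin n) → ℂ} (hf : ∀ z ∈ O, HasFDerivAt f (formOp (cform Φ W) z) z)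
    (hu : u ∈ Icc a b) :
    (cmat Φ (X u)).det * Complex.exp (f (ζ u)) = (cmat Φ (X a)).det * Complex.exp (f (ζ a)) := by
  rcases le_or_gt b a with hab | hab
  · rw [le_antisymm (hu.2.trans hab) hu.1]
  have key : ∀ v ∈ Icc a b, HasDerivWithinAt
      (fun r ↦ (cmat Φ (X r)).det * Complex.exp (f (ζ r))) 0 (Icc a b) v := by
    intro v hv
    have h1 : HasDerivWithinAt (fun r ↦ f (ζ r)) (∑ i, vel ζ a b v i • cform Φ W i (ζ v))
        (Icc a b) v := by
      refine ((hf _ (hζ.mapsTo v hv)).comp_hasDerivWithinAt v (hζ.hasDerivWithinAt hv)).congr_deriv ?_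
      simp [map_sum, formOp_single]
    have h2 : HasDerivWithinAt (fun r ↦ (cmat Φ (X r)).det)
        ((-∑ i, vel ζ a b v i • cmat Φ (W i (ζ v))).trace * (cmat Φ (X v)).det) (Icc a b) v := by
      refine hasDerivWithinAt_det fun k l ↦ ?_
      refine (hasDerivWithinAt_linearMap_comp
        ((Matrix.entryLinearMap ℝ ℂ k l) ∘ₗ cmat Φ)
        (X' := -∑ i, vel ζ a b v i • (W i (ζ v) * X v)) fun A B ↦ ?_).congr_deriv ?_
      · refine (hX v hv A B).congr_deriv ?_
        simp [Matrix.sum_apply]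
      · change (cmat Φ (-∑ i, vel ζ a b v i • (W i (ζ v) * X v))) k l = _
        simp only [map_neg, map_sum, map_smul, cmat_mul (hW _ (hζ.mapsTo v hv) _), Matrix.neg_mul,
          Matrix.sum_mul, Matrix.smul_mul]
    refine (h2.mul h1.cexp).congr_deriv ?_
    simp only [Matrix.trace_neg, Matrix.trace_sum, Matrix.trace_smul, cform]
    ring
  exact constant_of_derivWithin_zero (fun v hv ↦ (key v hv).differentiableWithinAt)
    (fun v hv ↦ (key v (Ico_subset_Icc_self hv)).derivWithin
      (uniqueDiffOn_Icc hab v (Ico_subset_Icc_self hv))) u hu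

/-- If the curvature has vanishing complex trace, the complex trace of the connection matrices has
a primitive on convex sets. -/
lemma exists_primitive_cform {W : Fin n → EuclideanSpace ℝ (Fin n) → Matrix ι ι ℝ} (hO : IsOpen O)
    (hc : Convex ℝ O) (hW : ∀ i, SmoothM O (W i))
    (hJ : ∀ z ∈ O, ∀ i, W i z * strMat Φ = strMat Φ * W i z)
    (htr : ∀ z ∈ O, ∀ i j, (cmat Φ (curv W i j z)).trace = 0) :
    ∃ f : EuclideanSpace ℝ (Fin n) → ℂ, ∀ z ∈ O, HasFDerivAt f (formOp (cform Φ W) z) z := by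
  have h1 : ∀ z ∈ O, ∀ i, ∃ D : EuclideanSpace ℝ (Fin n) →L[ℝ] ℂ,
      HasFDerivAt (cform Φ W i) D z ∧
      ∀ j, D (EuclideanSpace.single j 1) = (cmat Φ (pdm j (W i) z)).trace := fun z hz i ↦
    hasFDerivAt_linearMap_comp ((Matrix.traceLinearMap κ ℝ ℂ) ∘ₗ cmat Φ) hO hz (hW i)
  choose! D hD hD1 using h1
  -- The trace form is closed: the complex trace of the curvature is zero, and the traces of its two
  -- products cancel.
  have hsymm : ∀ z ∈ O, ∀ i j, D z i (EuclideanSpace.single j 1) =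
      D z j (EuclideanSpace.single i 1) := by
    intro z hz i j
    rw [hD1 z hz, hD1 z hz, ← sub_eq_zero, ← htr z hz j i]
    simp only [curv, map_sub, map_add, Matrix.trace_sub, Matrix.trace_add, cmat_mul (hJ z hz _)]
    rw [Matrix.trace_mul_comm (cmat Φ (W j z))]
    ring
  have hform : ∀ z ∈ O, HasFDerivAt (formOp (cform Φ W))
      (∑ i, ((ContinuousLinearMap.smulRightL ℝ (EuclideanSpace ℝ (Fin n)) ℂ
        (EuclideanSpace.proj i)) ∘L D z i)) z := by
    intro z hz
    have := HasFDerivAt.fun_sum (u := Finset.univ) fun i _ ↦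
      (ContinuousLinearMap.smulRightL ℝ (EuclideanSpace ℝ (Fin n)) ℂ
        (EuclideanSpace.proj i)).hasFDerivAt.comp z (hD z hz i)
    exact this
  refine hc.exists_forall_hasFDerivAt_of_fderiv_symmetric hO
    (fun z hz ↦ (hform z hz).differentiableAt.differentiableWithinAt) fun z hz x y ↦ ?_
  rw [(hform z hz).fderiv]
  have e : ∀ v : EuclideanSpace ℝ (Fin n), v = ∑ i, v i • EuclideanSpace.single i (1 : ℝ) := by
    intro v
    ext i
    simp [Finset.sum_apply, Pi.single_apply]
  have e2 : ∀ i v, D z i v = ∑ j, v j • D z i (EuclideanSpace.single j 1) := by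
    intro i v
    conv_lhs => rw [e v]
    rw [map_sum]
    simp only [map_smul]
  have e3 : ∀ v w, (∑ i, ((ContinuousLinearMap.smulRightL ℝ (EuclideanSpace ℝ (Fin n)) ℂ
      (EuclideanSpace.proj i)) ∘L D z i)) v w = ∑ i, w i • D z i v := by
    intro v w
    simp only [sum_apply]
    rfl
  simp only [e3, e2 _ x, e2 _ y, Finset.smul_sum]
  rw [Finset.sum_comm]
  refine Finset.sum_congr rfl fun i _ ↦ Finset.sum_congr rfl fun j _ ↦ ?_
  rw [hsymm z hz j i, smul_comm]

end ComplexConnection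

/-! ### The complex determinant of transport around small loops, in coordinates -/

section LocalHolonomy

open Filter Topology Metric
open scoped Matrix.Norms.Operator

variable {n : ℕ} {ι κ : Type*} [Fintype ι] [DecidableEq ι] [Fintype κ] [DecidableEq κ]
  {Φ : (ι → ℝ) ≃ₗ[ℝ] (κ → ℂ)} {W : Fin n → EuclideanSpace ℝ (Fin n) → Matrix ι ι ℝ}
  {z₀ : EuclideanSpace ℝ (Fin n)} {r η : ℝ}
  {T : EuclideanSpace ℝ (Fin n) → EuclideanSpace ℝ (Fin n) → Matrix ι ι ℝ}

omit [Fintype κ] [DecidableEq κ] in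
/-- In a frame in which the parallel complex structure `J` is constant, the connection matrices
commute with it. -/
lemma exists_adapted_frame {J : EuclideanSpace ℝ (Fin n) → Matrix ι ι ℝ} (hr : 0 < r)
    (hJs : SmoothM (ball z₀ r) J) (hJ2 : ∀ z ∈ ball z₀ r, J z * J z = -1)
    (hJ0 : J z₀ = strMat Φ) :
    ∃ r' > 0, r' ≤ r ∧ ∃ F F' : EuclideanSpace ℝ (Fin n) → Matrix ι ι ℝ,
      SmoothM (ball z₀ r') F ∧ SmoothM (ball z₀ r') F' ∧ F z₀ = 1 ∧ F' z₀ = 1 ∧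
      (∀ z ∈ ball z₀ r', F' z * F z = 1) ∧ (∀ z ∈ ball z₀ r', J z * F z = F z * strMat Φ) := by
  have h0 : z₀ ∈ ball z₀ r := mem_ball_self hr
  -- Because both structures square to `-1`, this intertwines the constant one with `J z`. It is `1`
  -- at `z₀`, hence invertible nearby.
  set F : EuclideanSpace ℝ (Fin n) → Matrix ι ι ℝ := fun z ↦ (1 / 2 : ℝ) • (1 - J z * strMat Φ)
  have hF : SmoothM (ball z₀ r) F :=
    .smul contDiffOn_const ((SmoothM.const _).sub (hJs.mul (.const _)))
  have hF0 : F z₀ = 1 := by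
    simp only [F, hJ0, strMat_mul_self, sub_neg_eq_add]
    rw [← two_smul ℝ (1 : Matrix ι ι ℝ), smul_smul]
    norm_num
  have hJF : ∀ z ∈ ball z₀ r, J z * F z = F z * strMat Φ := by
    intro z hz
    simp only [F, Matrix.mul_smul, Matrix.smul_mul, mul_sub, sub_mul, mul_one, one_mul]
    rw [← mul_assoc, hJ2 z hz, mul_assoc, strMat_mul_self]
    simp [add_comm]
  have hdet : ContinuousAt (fun z ↦ (F z).det) z₀ :=
    hF.det.continuousOn.continuousAt (isOpen_ball.mem_nhds h0)
  obtain ⟨s, hs, hs'⟩ : ∃ s > 0, ball z₀ s ⊆ {z | (F z).det ≠ 0} := by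
    refine Metric.mem_nhds_iff.mp (hdet.eventually_ne ?_)
    simp [hF0]
  have hunit : ∀ z ∈ ball z₀ (min s r), IsUnit (F z).det := fun z hz ↦
    (hs' (ball_subset_ball (min_le_left _ _) hz)).isUnit
  have hsub : ball z₀ (min s r) ⊆ ball z₀ r := ball_subset_ball (min_le_right _ _)
  exact ⟨min s r, lt_min hs hr, min_le_right _ _, F, fun z ↦ (F z)⁻¹, hF.mono hsub,
    (hF.mono hsub).inv hunit, hF0, by simp [hF0], fun z hz ↦ Matrix.nonsing_inv_mul _ (hunit z hz),
    fun z hz ↦ hJF z (hsub hz)⟩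

/-- If a connection preserves a complex structure and its curvature has vanishing complex trace,
then parallel transport around small loops has complex determinant `1`. -/
theorem IsSegmentTransport.det_cmat_eq_one (hT : IsSegmentTransport W z₀ r η T) (hr : 0 < r)
    (hW : ∀ i, SmoothM (ball z₀ r) (W i)) {J : EuclideanSpace ℝ (Fin n) → Matrix ι ι ℝ}
    (hJs : SmoothM (ball z₀ r) J) (hJ2 : ∀ z ∈ ball z₀ r, J z * J z = -1)
    (hJ0 : J z₀ = strMat Φ)
    (hJp : ∀ z ∈ ball z₀ r, ∀ i, pdm i J z = J z * W i z - W i z * J z)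
    (htr : ∀ z ∈ ball z₀ r, ∀ i j, (curv W i j z).trace = 0)
    (htrJ : ∀ z ∈ ball z₀ r, ∀ i j, (curv W i j z * J z).trace = 0) :
    ∃ r' > 0, r' ≤ r ∧ ∀ ζ a b X, a ≤ b → IsCurve (ball z₀ r') ζ a b → IsSol W ζ a b X → X a = 1 →
      (T (ζ b) z₀ * X b * T z₀ (ζ a)) * strMat Φ = strMat Φ * (T (ζ b) z₀ * X b * T z₀ (ζ a)) ∧
      (cmat Φ (T (ζ b) z₀ * X b * T z₀ (ζ a))).det = 1 := by
  obtain ⟨s, hs, hsr, F, F', hF, hF', hF0, hF0', hFF, hJF⟩ :=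
    exists_adapted_frame hr hJs hJ2 hJ0
  have hsub : ball z₀ s ⊆ ball z₀ r := ball_subset_ball hsr
  have hFF' : ∀ z ∈ ball z₀ s, F z * F' z = 1 := fun z hz ↦ mul_eq_one_comm.mp (hFF z hz)
  have hFJ : ∀ z ∈ ball z₀ s, F' z * J z = strMat Φ * F' z := fun z hz ↦ by
    calc F' z * J z = F' z * (J z * F z) * F' z := by
          rw [mul_assoc, mul_assoc, hFF' z hz, mul_one]
      _ = strMat Φ * F' z := by rw [hJF z hz, ← mul_assoc, hFF z hz, one_mul]
  have hWs : ∀ i, SmoothM (ball z₀ s) (W i) := fun i ↦ (hW i).mono hsub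
  -- The connection in the frame `F`. There the parallel structure is constant, so these matrices
  -- commute with it and have well-behaved complex traces.
  set W' : Fin n → EuclideanSpace ℝ (Fin n) → Matrix ι ι ℝ :=
    fun i y ↦ F' y * W i y * F y + F' y * pdm i F y with hW'
  have hW's : ∀ i, SmoothM (ball z₀ s) (W' i) := fun i ↦
    ((hF'.mul (hWs i)).mul hF).add (hF'.mul (hF.pdm isOpen_ball i))
  have hcomm : ∀ z ∈ ball z₀ s, ∀ i, W' i z * strMat Φ = strMat Φ * W' i z := by
    intro z hz i
    have h1 : pdm i J z * F z + J z * pdm i F z = pdm i F z * strMat Φ := by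
      rw [← pdm_mul isOpen_ball hz (hJs.mono hsub) hF, pdm_congr isOpen_ball hz hJF,
        pdm_mul isOpen_ball hz hF (.const _), pdm_const, mul_zero, add_zero]
    rw [hJp z (hsub hz)] at h1
    calc W' i z * strMat Φ = F' z * (W i z * (F z * strMat Φ) + pdm i F z * strMat Φ) := by
          simp only [hW']; noncomm_ring
      _ = F' z * J z * (W i z * F z + pdm i F z) := by
          rw [← h1, ← hJF z hz]; noncomm_ring
      _ = strMat Φ * W' i z := by rw [hFJ z hz]; simp only [hW']; noncomm_ring
  have hcurv : ∀ z ∈ ball z₀ s, ∀ i j, curv W' i j z = F' z * curv W i j z * F z :=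
    fun z hz i j ↦ curv_gauge isOpen_ball hz hWs hF hF' hFF i j
  have hcurvJ : ∀ z ∈ ball z₀ s, ∀ i j, curv W i j z * J z = J z * curv W i j z :=
    fun z hz ↦ curv_commute isOpen_ball (hsub hz) hW hJs hJp
  have htr' : ∀ z ∈ ball z₀ s, ∀ i j, (cmat Φ (curv W' i j z)).trace = 0 := by
    intro z hz i j
    rw [hcurv z hz]
    refine cmat_trace_eq_zero ?_ ?_ ?_
    · rw [mul_assoc, ← hJF z hz, ← mul_assoc, mul_assoc (F' z), hcurvJ z hz, ← mul_assoc, hFJ z hz]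
      simp only [mul_assoc]
    · rw [Matrix.trace_mul_comm, ← mul_assoc, hFF' z hz, one_mul, htr z (hsub hz)]
    · rw [← mul_assoc, ← mul_assoc, ← hFJ z hz, Matrix.trace_mul_comm, ← mul_assoc, ← mul_assoc,
        hFF' z hz, one_mul, ← hcurvJ z hz, htrJ z (hsub hz)]
  obtain ⟨f, hf⟩ := exists_primitive_cform isOpen_ball (convex_ball z₀ s) hW's hcomm htr'
  -- Seen in the frame `F`, transport is complex linear, and its determinant is governed by the
  -- primitive `f` of the trace form.
  have key : ∀ ζ a b X, a ≤ b → IsCurve (ball z₀ s) ζ a b → IsSol W ζ a b X → X a = 1 →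
      (F' (ζ b) * X b * F (ζ a)) * strMat Φ = strMat Φ * (F' (ζ b) * X b * F (ζ a)) ∧
      (cmat Φ (F' (ζ b) * X b * F (ζ a))).det * Complex.exp (f (ζ b)) =
        Complex.exp (f (ζ a)) := by
    intro ζ a b X hab hζ hX hX1
    have hb : b ∈ Icc a b := ⟨hab, le_rfl⟩
    have ha : a ∈ Icc a b := ⟨le_rfl, hab⟩
    constructor
    · have h1 := hX.commute hζ isOpen_ball hWs (hJs.mono hsub) (fun y hy ↦ hJp y (hsub hy)) hX1 hb
      calc (F' (ζ b) * X b * F (ζ a)) * strMat Φ = F' (ζ b) * (X b * J (ζ a)) * F (ζ a) := by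
            rw [mul_assoc, ← hJF _ (hζ.mapsTo a ha)]; simp only [mul_assoc]
        _ = _ := by rw [← h1, ← mul_assoc, hFJ _ (hζ.mapsTo b hb)]; simp only [mul_assoc]
    · have h1 := ((hX.gauge (W' := W') hζ isOpen_ball hF' fun y hy i ↦ ?_).mul_const
        (F (ζ a))).det_cmat hζ hcomm hf hb
      · simp only [hX1, mul_one] at h1
        rw [h1, hFF _ (hζ.mapsTo a ha), cmat_one, Matrix.det_one, one_mul]
      · rw [pdm_inverse isOpen_ball hy hF hF' hFF]
        simp only [hW', add_mul, mul_assoc, hFF' y hy, mul_one]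
        abel
  refine ⟨s, hs, hsr, fun ζ a b X hab hζ hX hX1 ↦ ?_⟩
  have hz : ζ a ∈ ball z₀ s := hζ.mapsTo a ⟨le_rfl, hab⟩
  have hz' : ζ b ∈ ball z₀ s := hζ.mapsTo b ⟨hab, le_rfl⟩
  have h0 : z₀ ∈ ball z₀ s := mem_ball_self hs
  obtain ⟨Y, hY0, hY1, hY⟩ := hT.isSol_matrix (hsub hz') (hsub h0)
  obtain ⟨Z, hZ0, hZ1, hZ⟩ := hT.isSol_matrix (hsub h0) (hsub hz)
  have l0 : ∀ w w' : EuclideanSpace ℝ (Fin n), line w w' 0 = w := fun w w' ↦ by simp [line]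
  have l1 : ∀ w w' : EuclideanSpace ℝ (Fin n), line w w' 1 = w' := fun w w' ↦ by simp [line]
  obtain ⟨c1, d1⟩ := key _ 0 1 Y zero_le_one (isCurve_line hz' h0) hY hY0
  obtain ⟨c2, d2⟩ := key ζ a b X hab hζ hX hX1
  obtain ⟨c3, d3⟩ := key _ 0 1 Z zero_le_one (isCurve_line h0 hz) hZ hZ0
  rw [l0, l1, hY1, hF0'] at c1 d1
  rw [l0, l1, hZ1, hF0] at c3 d3
  -- The loop consists of three legs. The frames cancel at the two junctions and are `1` at `z₀`,
  -- and the three exponential factors telescope.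
  have e : T (ζ b) z₀ * X b * T z₀ (ζ a) = (1 * T (ζ b) z₀ * F (ζ b)) *
      ((F' (ζ b) * X b * F (ζ a)) * (F' (ζ a) * T z₀ (ζ a) * 1)) := by
    calc _ = T (ζ b) z₀ * (F (ζ b) * F' (ζ b)) * X b * (F (ζ a) * F' (ζ a)) * T z₀ (ζ a) := by
          rw [hFF' _ hz, hFF' _ hz', mul_one, mul_one]
      _ = _ := by simp only [mul_assoc, one_mul, mul_one]
  rw [e]
  have hmul : ∀ {A B : Matrix ι ι ℝ}, A * strMat Φ = strMat Φ * A → B * strMat Φ = strMat Φ * B →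
      A * B * strMat Φ = strMat Φ * (A * B) := fun {A B} hA hB ↦ by
    rw [mul_assoc, hB, ← mul_assoc, hA, mul_assoc]
  refine ⟨hmul c1 (hmul c2 c3), ?_⟩
  rw [cmat_mul c1, cmat_mul c2, Matrix.det_mul, Matrix.det_mul]
  have hE := Complex.exp_ne_zero (f z₀)
  have hEa := Complex.exp_ne_zero (f (ζ a))
  have hEb := Complex.exp_ne_zero (f (ζ b))
  apply mul_right_cancel₀ (mul_ne_zero (mul_ne_zero hE hEa) hEb)
  rw [one_mul (_ * _), show ∀ x y z p q r : ℂ, x * (y * z) * (p * q * r) = (x * p) * (y * r) * (z * q) from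
    fun _ _ _ _ _ _ ↦ by ring, d1, d2, d3]
  ring

omit [Fintype κ] [DecidableEq κ] in
/-- If transport around small triangles commutes or anticommutes with the complex structure, then it
commutes and the complex structure extends to a parallel one. -/
theorem IsSegmentTransport.exists_parallel_complexStr [Nonempty ι]
    (hT : IsSegmentTransport W z₀ r (1 / 10) T)
    (hr : 0 < r) (hW : ∀ i, SmoothM (ball z₀ r) (W i))
    (hQ : ∀ z ∈ ball z₀ r, ∀ z' ∈ ball z₀ r,
      (T z' z₀ * T z z' * T z₀ z) * strMat Φ = strMat Φ * (T z' z₀ * T z z' * T z₀ z) ∨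
      (T z' z₀ * T z z' * T z₀ z) * strMat Φ = -(strMat Φ * (T z' z₀ * T z z' * T z₀ z))) :
    SmoothM (ball z₀ r) (fun z ↦ T z₀ z * strMat Φ * T z z₀) ∧
    ∀ z ∈ ball z₀ r, ∀ i, pdm i (fun z ↦ T z₀ z * strMat Φ * T z z₀) z =
      T z₀ z * strMat Φ * T z z₀ * W i z - W i z * (T z₀ z * strMat Φ * T z z₀) := by
  have h0 : z₀ ∈ ball z₀ r := mem_ball_self hr
  have hQ' : ∀ z ∈ ball z₀ r, ∀ z' ∈ ball z₀ r,
      (T z' z₀ * T z z' * T z₀ z) * strMat Φ = strMat Φ * (T z' z₀ * T z z' * T z₀ z) := by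
    intro z hz z' hz'
    refine (hQ z hz z' hz').resolve_right fun hneg ↦ ?_
    have k1 := hT.norm_le z' hz' z₀ h0
    have k2 := hT.norm_le z hz z' hz'
    have k3 := hT.norm_le z₀ h0 z hz
    set A := T z' z₀ - 1
    set B := T z z' - 1
    set C := T z₀ z - 1
    set E := T z' z₀ * T z z' * T z₀ z - 1 with hE
    have e1 : E = A * B * C + A * B + A * C + B * C + A + B + C := by
      simp only [hE, A, B, C]; noncomm_ring
    -- Each factor is within `1 / 10` of the identity, so the product is within `1.1 ^ 3 - 1 < 1 /
    -- 2` of it.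
    have k4 : ‖E‖ ≤ 1 / 2 := by
      have hAB := (norm_mul_le A B).trans (mul_le_mul k1 k2 (norm_nonneg _) (by norm_num))
      have hAC := (norm_mul_le A C).trans (mul_le_mul k1 k3 (norm_nonneg _) (by norm_num))
      have hBC := (norm_mul_le B C).trans (mul_le_mul k2 k3 (norm_nonneg _) (by norm_num))
      have hABC := (norm_mul_le (A * B) C).trans (mul_le_mul hAB k3 (norm_nonneg _) (by norm_num))
      rw [e1]
      have := norm_add_le (A * B * C + A * B + A * C + B * C + A + B) C
      have := norm_add_le (A * B * C + A * B + A * C + B * C + A) B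
      have := norm_add_le (A * B * C + A * B + A * C + B * C) A
      have := norm_add_le (A * B * C + A * B + A * C) (B * C)
      have := norm_add_le (A * B * C + A * B) (A * C)
      have := norm_add_le (A * B * C) (A * B)
      linarith
    have hQE : T z' z₀ * T z z' * T z₀ z = 1 + E := by rw [hE]; abel
    rw [hQE, add_mul, mul_add, one_mul, mul_one] at hneg
    -- Anticommuting with `1 + E` would make `2 * ‖J‖` at most `‖J‖`, so that `J` vanishes, against
    -- `J * J = -1`.
    have e2 : (2 : ℝ) • strMat Φ = -(E * strMat Φ + strMat Φ * E) := by
      rw [two_smul]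
      have := sub_eq_zero.mpr hneg
      rw [← sub_eq_zero, ← this]
      abel
    have k5 : 2 * ‖strMat Φ‖ ≤ ‖strMat Φ‖ := by
      calc 2 * ‖strMat Φ‖ = ‖(2 : ℝ) • strMat Φ‖ := by rw [norm_smul]; norm_num
        _ ≤ ‖E‖ * ‖strMat Φ‖ + ‖strMat Φ‖ * ‖E‖ := by
            rw [e2, norm_neg]
            exact (norm_add_le _ _).trans (add_le_add (norm_mul_le _ _) (norm_mul_le _ _))
        _ ≤ 1 / 2 * ‖strMat Φ‖ + ‖strMat Φ‖ * (1 / 2) :=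
            add_le_add (mul_le_mul_of_nonneg_right k4 (norm_nonneg _))
              (mul_le_mul_of_nonneg_left k4 (norm_nonneg _))
        _ = ‖strMat Φ‖ := by ring
    have k6 : strMat Φ = 0 := norm_le_zero_iff.mp (by linarith)
    have k7 := strMat_mul_self (Φ := Φ)
    rw [k6, mul_zero] at k7
    exact one_ne_zero (neg_eq_zero.mp k7.symm)
  have hT2 : IsSegmentTransport W z₀ r (1 / 2) T :=
    ⟨hT.isSol, fun z hz z' hz' ↦ (hT.norm_le z hz z' hz').trans (by norm_num), hT.isLittleO⟩
  -- The structure is spread out from `z₀` along radii. Other segments preserve it because the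
  -- triangle that they form with two radii commutes with the structure at `z₀`.
  refine hT2.smooth_and_parallel hW fun z hz z' hz' ↦ ?_
  have i1 := hT.mul_eq_one hW hz' h0
  have i2 := hT.mul_eq_one hW h0 hz
  have i3 : T z₀ z * T z z₀ = 1 := mul_eq_one_comm.mp i2
  calc T z₀ z' * strMat Φ * T z' z₀ * T z z'
      = T z₀ z' * (strMat Φ * (T z' z₀ * T z z' * T z₀ z)) * T z z₀ := by
        simp only [mul_assoc, i3, mul_one]
    _ = (T z₀ z' * T z' z₀) * T z z' * (T z₀ z * strMat Φ * T z z₀) := by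
        rw [← hQ' z hz z' hz']; simp only [mul_assoc]
    _ = _ := by rw [i1, one_mul]

/-- Parallel transport of the tractor connection around small loops has complex determinant `1` if
it commutes or anticommutes with a skew complex structure. -/
theorem IsMetricOn.det_cmat_transport {G : EuclideanSpace ℝ (Fin n) → Matrix (Fin n) (Fin n) ℝ}
    {O : Set (EuclideanSpace ℝ (Fin n))} (h : IsMetricOn O G) (hn : 3 ≤ n) (hrO : ball z₀ r ⊆ O)
    (hr : 0 < r) {Φ : (TIndex n → ℝ) ≃ₗ[ℝ] (κ → ℂ)}
    {T : EuclideanSpace ℝ (Fin n) → EuclideanSpace ℝ (Fin n) → Matrix (TIndex n) (TIndex n) ℝ}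
    (hT : IsSegmentTransport (connectionMatrix G) z₀ r (1 / 10) T)
    (hskew : (strMat Φ).transpose * tractorH G z₀ + tractorH G z₀ * strMat Φ = 0)
    (hQ : ∀ z ∈ ball z₀ r, ∀ z' ∈ ball z₀ r,
      (T z' z₀ * T z z' * T z₀ z) * strMat Φ = strMat Φ * (T z' z₀ * T z z' * T z₀ z) ∨
      (T z' z₀ * T z z' * T z₀ z) * strMat Φ = -(strMat Φ * (T z' z₀ * T z z' * T z₀ z))) :
    ∃ r' > 0, r' ≤ r ∧ ∀ ζ a b X, a ≤ b → IsCurve (ball z₀ r') ζ a b →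
      IsSol (connectionMatrix G) ζ a b X → X a = 1 →
      (T (ζ b) z₀ * X b * T z₀ (ζ a)) * strMat Φ = strMat Φ * (T (ζ b) z₀ * X b * T z₀ (ζ a)) ∧
      (cmat Φ (T (ζ b) z₀ * X b * T z₀ (ζ a))).det = 1 := by
  have h0 : z₀ ∈ ball z₀ r := mem_ball_self hr
  have hW : ∀ i, SmoothM (ball z₀ r) (connectionMatrix G i) := fun i ↦
    (h.connectionMatrix_smooth i).mono hrO
  obtain ⟨hJs, hJp⟩ := hT.exists_parallel_complexStr hr hW hQ
  have i1 : ∀ z ∈ ball z₀ r, T z z₀ * T z₀ z = 1 := fun z hz ↦ hT.mul_eq_one hW h0 hz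
  have hT0 : T z₀ z₀ = 1 := by
    obtain ⟨X, hX0, hX1, hX⟩ := hT.isSol_matrix h0 h0
    have hc : IsSol (connectionMatrix G) (line z₀ z₀) 0 1 (fun _ ↦ (1 : Matrix (TIndex n) (TIndex n) ℝ)) := by
      intro u hu A B
      have hv : ∀ i, vel (line z₀ z₀) 0 1 u i = 0 := fun i ↦ by simp [vel, line]
      simpa [hv] using hasDerivWithinAt_const u (Icc (0 : ℝ) 1) ((1 : Matrix (TIndex n) (TIndex n) ℝ) A B)
    rw [← hX1]
    exact hX.eq_of_eq hc (isCurve_line h0 h0) hW hX0 ⟨zero_le_one, le_rfl⟩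
  -- The two real traces come from skewness of the tractor curvature and from
  -- `curvature_of_commute`, applied to the local parallel structure.
  refine hT.det_cmat_eq_one hr hW hJs (fun z hz ↦ ?_) (by simp [hT0]) hJp
    (fun z hz i j ↦ h.tractorCurvature_trace (hrO hz) i j) fun z hz ↦
    (h.curvature_of_commute (hrO hz) hn ?_
      (curv_commute isOpen_ball hz hW hJs hJp)).2
  · calc T z₀ z * strMat Φ * T z z₀ * (T z₀ z * strMat Φ * T z z₀)
        = T z₀ z * strMat Φ * (T z z₀ * T z₀ z) * strMat Φ * T z z₀ := by simp only [mul_assoc]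
      _ = -(T z₀ z * T z z₀) := by
          rw [i1 z hz, mul_one, mul_assoc (T z₀ z), strMat_mul_self]; simp
      _ = -1 := by rw [mul_eq_one_comm.mp (i1 z hz)]
  -- Radial transport is an isometry of tractor metrics, so it carries skewness from `z₀` to `z`.
  · obtain ⟨X, hX0, hX1, hX⟩ := hT.isSol_matrix h0 hz
    have l0 : line z₀ z 0 = z₀ := by simp [line]
    have l1 : line z₀ z 1 = z := by simp [line]
    have hiso := hX.isometry (isCurve_line h0 hz) isOpen_ball (h.tractorH_smooth.mono hrO)
      (fun y hy i ↦ h.pdm_tractorH (hrO hy) i) (⟨zero_le_one, le_rfl⟩ : (1 : ℝ) ∈ Icc (0 : ℝ) 1)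
    rw [hX0, hX1, l0, l1, Matrix.transpose_one, one_mul, mul_one] at hiso
    have hinv : T z₀ z * T z z₀ = 1 := mul_eq_one_comm.mp (i1 z hz)
    have e1 : (T z₀ z).transpose * tractorH G z = tractorH G z₀ * T z z₀ := by
      rw [← hiso, mul_assoc, hinv, mul_one]
    have e2 : tractorH G z * T z₀ z = (T z z₀).transpose * tractorH G z₀ := by
      have : (T z z₀).transpose * (T z₀ z).transpose = 1 := by
        rw [← Matrix.transpose_mul, hinv, Matrix.transpose_one]
      rw [← hiso, mul_assoc, ← mul_assoc, this, one_mul]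
    calc (T z₀ z * strMat Φ * T z z₀).transpose * tractorH G z +
          tractorH G z * (T z₀ z * strMat Φ * T z z₀)
        = (T z z₀).transpose * (strMat Φ).transpose * ((T z₀ z).transpose * tractorH G z) +
          (tractorH G z * T z₀ z) * strMat Φ * T z z₀ := by
          simp only [Matrix.transpose_mul, mul_assoc]
      _ = (T z z₀).transpose * ((strMat Φ).transpose * tractorH G z₀ + tractorH G z₀ * strMat Φ) *
          T z z₀ := by rw [e1, e2]; simp only [mul_add, add_mul, mul_assoc]
      _ = 0 := by rw [hskew]; simp

end LocalHolonomy

/-! ### Parallel transport as an invertible map, and its matrix in a chart -/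

section TransportUnits

open Filter Topology

variable {n p q : ℕ} {M : Type*} [TopologicalSpace M]
  [ChartedSpace (EuclideanSpace ℝ (Fin n)) M]

variable (n) in
/-- Continuous linear automorphisms of the space of tractors, as linear maps. -/
def lin : (Tractor n →L[ℝ] Tractor n)ˣ →* Module.End ℝ (Tractor n) :=
  ((ContinuousLinearMap.toLinearMapRingHom : (Tractor n →L[ℝ] Tractor n) →+* _) :
    (Tractor n →L[ℝ] Tractor n) →* Module.End ℝ (Tractor n)).comp (Units.coeHom _)

@[simp] lemma lin_apply (P : (Tractor n →L[ℝ] Tractor n)ˣ) (v : Tractor n) :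
    lin n P v = (P : Tractor n →L[ℝ] Tractor n) v := rfl

lemma lin_mul_inv (P : (Tractor n →L[ℝ] Tractor n)ˣ) : lin n P * lin n P⁻¹ = 1 := by
  rw [← map_mul, mul_inv_cancel, map_one]

lemma lin_inv_mul (P : (Tractor n →L[ℝ] Tractor n)ˣ) : lin n P⁻¹ * lin n P = 1 := by
  rw [← map_mul, inv_mul_cancel, map_one]

lemma exists_unit {F : Tractor n → Tractor n} (hF : IsLinearMap ℝ F) (hi : Function.Injective F) :
    ∃ P : (Tractor n →L[ℝ] Tractor n)ˣ, ∀ v, F v = (P : Tractor n →L[ℝ] Tractor n) v :=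
  ⟨(LinearEquiv.ofInjectiveEndo (IsLinearMap.mk' F hF) hi).toContinuousLinearEquiv.toUnit,
    fun _ ↦ rfl⟩

/-- The tractor with given components in the frame of the chart at `c`. -/
def frameMap (c x : M) : (TIndex n → ℝ) →ₗ[ℝ] Tractor n :=
  Fintype.linearCombination ℝ (tractorFrame c (extChartAt (𝓡 n) c x))

lemma frameMap_apply (c x : M) (w : TIndex n → ℝ) :
    frameMap c x w = ∑ A, w A • tractorFrame c (extChartAt (𝓡 n) c x) A := rfl

variable [IsManifold (𝓡 n) ∞ M] {g : PseudoMetric n p q M} {c x y y' y'' : M}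

lemma tractorMetric_nondegenerate {v : Tractor n} (h : ∀ w, tractorMetric g x v w = 0) : v = 0 := by
  have h0 : ∀ w : EuclideanSpace ℝ (Fin n), g.inner x w (0 : EuclideanSpace ℝ (Fin n)) = 0 :=
    fun w ↦ map_zero (g.inner x w)
  have h1 : v.1 = 0 := by simpa [tractorMetric, h0] using h (0, 0, 1)
  have h2 : v.2.2 = 0 := by simpa [tractorMetric, h0] using h (1, 0, 0)
  have h3 : v.2.1 = 0 := inner_nondegenerate g x fun w ↦ by
    simpa [tractorMetric] using h (0, w, 0)
  exact Prod.ext h1 (Prod.ext h3 h2)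

/-- Transport preserves the non-degenerate tractor metric, so it is injective, and the fibres have
the same finite dimension. -/
lemma PFlow.exists_unit {γ : ℝ → M} {F : ℝ → Tractor n → Tractor n} {a b u : ℝ}
    (h : PFlow g γ F a b) (h0 : ∀ v, F a v = v) (hu : u ∈ Icc a b) :
    ∃ P : (Tractor n →L[ℝ] Tractor n)ˣ, ∀ v, F u v = (P : Tractor n →L[ℝ] Tractor n) v := by
  have hl : IsLinearMap ℝ (F u) :=
    h.isLinearMap ⟨fun v w ↦ by simp [h0], fun r v ↦ by simp [h0]⟩ hu
  refine ConformalTractor.exists_unit hl ((injective_iff_map_eq_zero (hl.mk' (F u))).mpr fun v hv ↦ ?_)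
  refine tractorMetric_nondegenerate (g := g) (x := γ a) fun w ↦ ?_
  have h1 := h.metric_eq hu v w
  rw [h0, h0] at h1
  have h2 : F u v = 0 := hv
  have h3 : g.inner (γ u) (0 : EuclideanSpace ℝ (Fin n)) (F u w).2.1 = 0 :=
    congrArg (fun L : TangentSpace (𝓡 n) (γ u) →L[ℝ] ℝ ↦ L (F u w).2.1) (map_zero (g.inner (γ u)))
  rw [← h1, h2]
  simp [tractorMetric, h3]

lemma coordMap_frameMap (hx : x ∈ chartSource (n := n) c) (w : TIndex n → ℝ) :
    coordMap c x (frameMap c x w) = w := by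
  have hz : extChartAt (𝓡 n) c x ∈ chartTarget c := (extChartAt (𝓡 n) c).map_source hx
  funext A
  rw [frameMap_apply, map_sum, Finset.sum_apply]
  have := fun B ↦ tractorCoord_frame hz A B
  rw [pt_extChartAt hx] at this
  have e : ∀ B, coordMap c x (w B • tractorFrame c (extChartAt (𝓡 n) c x) B) A =
      w B * if A = B then 1 else 0 := fun B ↦ by
    rw [map_smul, Pi.smul_apply, smul_eq_mul]
    exact congrArg _ (this B)
  rw [Finset.sum_congr rfl fun B _ ↦ e B]
  simp only [mul_ite, mul_one, mul_zero, Finset.sum_ite_eq, Finset.mem_univ, if_true]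

lemma frameMap_coordMap (hx : x ∈ chartSource (n := n) c) (v : Tractor n) :
    frameMap c x (coordMap c x v) = v :=
  coordMap_injective hx (coordMap_frameMap hx _)

/-- The components in the chart at `c` of a tractor at `x`, as a linear equivalence. -/
def coordEquiv (hx : x ∈ chartSource (n := n) c) : Tractor n ≃ₗ[ℝ] (TIndex n → ℝ) :=
  LinearEquiv.ofLinearMap (coordMap c x) (frameMap c x)
    (LinearMap.ext (coordMap_frameMap hx)) (LinearMap.ext (frameMap_coordMap hx))

omit [IsManifold (𝓡 n) ∞ M] in
/-- The matrix in the chart at `c` of a linear map from the tractors at `y` to those at `y'`. -/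
def flowMat (c y y' : M) (L : Module.End ℝ (Tractor n)) : Matrix (TIndex n) (TIndex n) ℝ :=
  LinearMap.toMatrix' (coordMap c y' ∘ₗ L ∘ₗ frameMap c y)

omit [IsManifold (𝓡 n) ∞ M] in
lemma flowMat_apply (L : Module.End ℝ (Tractor n)) (A B : TIndex n) :
    flowMat c y y' L A B =
      tractorCoord c y' (L (tractorFrame c (extChartAt (𝓡 n) c y) B)) A := by
  rw [flowMat, LinearMap.toMatrix'_apply]
  simp only [LinearMap.comp_apply]
  rw [frameMap, Fintype.linearCombination_apply_single, one_smul]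
  rfl

lemma flowMat_mulVec (hy : y ∈ chartSource (n := n) c) (L : Module.End ℝ (Tractor n))
    (v : Tractor n) : (flowMat c y y' L).mulVec (coordMap c y v) = coordMap c y' (L v) := by
  rw [flowMat, ← Matrix.toLin'_apply, Matrix.toLin'_toMatrix']
  simp only [LinearMap.comp_apply, frameMap_coordMap hy]

lemma flowMat_mul (hy' : y' ∈ chartSource (n := n) c) (L L' : Module.End ℝ (Tractor n)) :
    flowMat c y' y'' L' * flowMat c y y' L = flowMat c y y'' (L' * L) := by
  rw [flowMat, flowMat, ← LinearMap.toMatrix'_comp, flowMat]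
  congr 1
  refine LinearMap.ext fun w ↦ ?_
  simp only [LinearMap.comp_apply, frameMap_coordMap hy', Module.End.mul_apply]

lemma flowMat_one (hy : y ∈ chartSource (n := n) c) : flowMat c y y (1 : Module.End ℝ (Tractor n)) = 1 := by
  rw [flowMat, ← LinearMap.toMatrix'_one]
  congr 1
  refine LinearMap.ext fun w ↦ ?_
  simp only [LinearMap.comp_apply, Module.End.one_apply, coordMap_frameMap hy]

lemma flowMat_injective (hy : y ∈ chartSource (n := n) c) (hy' : y' ∈ chartSource (n := n) c) :
    Function.Injective (flowMat (n := n) c y y') := fun L L' h ↦ LinearMap.ext fun v ↦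
  coordMap_injective hy' (by rw [← flowMat_mulVec hy, h, flowMat_mulVec hy])

omit [IsManifold (𝓡 n) ∞ M] in
lemma flowMat_neg (L : Module.End ℝ (Tractor n)) : flowMat c y y' (-L) = -flowMat c y y' L := by
  rw [flowMat, flowMat, ← map_neg]
  congr 1
  ext w : 1
  simp

omit [IsManifold (𝓡 n) ∞ M] in
lemma eq_flowMat {L : Module.End ℝ (Tractor n)} {X : Matrix (TIndex n) (TIndex n) ℝ}
    (h : ∀ v, coordMap c y' (L (frameMap c y v)) = X.mulVec v) : flowMat c y y' L = X := by
  rw [flowMat, ← LinearMap.toMatrix'_toLin' X]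
  congr 1
  refine LinearMap.ext fun v ↦ ?_
  rw [Matrix.toLin'_apply, ← h]
  rfl

/-- There is a smooth curve in `V`, inside a chart, along which the transport from `y` to `y'` is
`P`. -/
def FlowsTo (g : PseudoMetric n p q M) (V : Set M) (y y' : M)
    (P : (Tractor n →L[ℝ] Tractor n)ˣ) : Prop :=
  ∃ (c : M) (γ : ℝ → M) (F : ℝ → Tractor n → Tractor n) (a b : ℝ), a ≤ b ∧ IsFlow g c γ F a b ∧
    γ a = y ∧ γ b = y' ∧ (∀ u ∈ Icc a b, γ u ∈ V) ∧ (∀ v, F a v = v) ∧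
    ∀ v, F b v = (P : Tractor n →L[ℝ] Tractor n) v

lemma FlowsTo.exists_path {V : Set M} {P : (Tractor n →L[ℝ] Tractor n)ˣ}
    (h : FlowsTo g V y y' P) :
    ∃ γ : Path y y', IsParallelTransport g γ (P : Tractor n →L[ℝ] Tractor n) := by
  obtain ⟨c, γ, F, a, b, hab, hF, rfl, rfl, -, h0, h1⟩ := h
  exact (hF.pflow hab).exists_path h0 h1

lemma IsFlow.isSol_flowMat {γ : ℝ → M} {F : ℝ → Tractor n → Tractor n} {a b : ℝ}
    (h : IsFlow g c γ F a b) (hab : a ≤ b) (h0 : ∀ v, F a v = v)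
    {P : (Tractor n →L[ℝ] Tractor n)ˣ} (hP : ∀ v, F b v = (P : Tractor n →L[ℝ] Tractor n) v) :
    ∃ X : ℝ → Matrix (TIndex n) (TIndex n) ℝ, X a = 1 ∧ X b = flowMat c (γ a) (γ b) (lin n P) ∧
      IsSol (connectionMatrix (metricMatrix g c)) (fun u ↦ extChartAt (𝓡 n) c (γ u)) a b X := by
  refine ⟨fun u ↦ (frameMat c γ F u).submatrix id
    fun B ↦ tractorFrame c (extChartAt (𝓡 n) c (γ a)) B, ?_, ?_, fun u hu A B ↦ ?_⟩
  · rw [← flowMat_one (h.source a ⟨le_rfl, hab⟩)]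
    ext A B
    rw [flowMat_apply]
    simp [frameMat, h0]
  · ext A B
    rw [flowMat_apply]
    simp [frameMat, hP]
  · exact h.sol u hu A _

/-- The way back from `IsFlow.isSol_flowMat`: a solution of the coordinate equation is realised by
transport on the manifold. -/
lemma exists_flowsTo {ζ : ℝ → EuclideanSpace ℝ (Fin n)} {a b : ℝ} (hab : a ≤ b)
    (hζ : IsCurve (chartTarget c) ζ a b) {X : ℝ → Matrix (TIndex n) (TIndex n) ℝ}
    (hX : IsSol (connectionMatrix (metricMatrix g c)) ζ a b X) (hX1 : X a = 1) {V : Set M}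
    (hV : ∀ u ∈ Icc a b, pt c (ζ u) ∈ V) :
    ∃ P, FlowsTo g V (pt c (ζ a)) (pt c (ζ b)) P ∧
      flowMat c (pt c (ζ a)) (pt c (ζ b)) (lin n P) = X b := by
  have hs : ∀ u ∈ Icc a b, pt c (ζ u) ∈ chartSource (n := n) c := fun u hu ↦
    pt_mem (hζ.mapsTo u hu)
  have hext : EqOn (fun u ↦ extChartAt (𝓡 n) c (pt c (ζ u))) ζ (Icc a b) := fun u hu ↦
    extChartAt_pt (hζ.mapsTo u hu)
  have ha : a ∈ Icc a b := ⟨le_rfl, hab⟩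
  have hb : b ∈ Icc a b := ⟨hab, le_rfl⟩
  set F : ℝ → Tractor n → Tractor n := fun u v ↦
    frameMap c (pt c (ζ u)) ((X u).mulVec (coordMap c (pt c (ζ a)) v)) with hF
  have hF0 : ∀ v, F a v = v := fun v ↦ by
    simp only [hF, hX1, Matrix.one_mulVec, frameMap_coordMap (hs a ha)]
  have hflow : IsFlow g c (fun u ↦ pt c (ζ u)) F a b := by
    refine ⟨⟨hs, hζ.smooth.congr hext⟩, ?_⟩
    refine ((hX.mul_const (Matrix.of fun A v ↦ coordMap c (pt c (ζ a)) v A)).congr_curve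
      hext).congr fun u hu ↦ ?_
    ext A v
    exact congrFun (coordMap_frameMap (hs u hu) _) A
  obtain ⟨P, hP⟩ := (hflow.pflow hab).exists_unit hF0 hb
  refine ⟨P, ⟨c, _, F, a, b, hab, hflow, rfl, rfl, hV, hF0, hP⟩, eq_flowMat fun v ↦ ?_⟩
  rw [lin_apply, ← hP]
  simp only [hF, coordMap_frameMap (hs b hb), coordMap_frameMap (hs a ha)]

end TransportUnits

/-! ### Joining nearby points by transport -/

section SmallTransport

open Filter Topology Metric
open scoped Matrix.Norms.Operator

variable {n p q : ℕ} {M : Type*} [TopologicalSpace M]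
  [ChartedSpace (EuclideanSpace ℝ (Fin n)) M] [IsManifold (𝓡 n) ∞ M]
  {g : PseudoMetric n p q M} {y : M}

lemma IsSegmentTransport.exists_flowsTo {c : M} {z₀ : EuclideanSpace ℝ (Fin n)} {r η : ℝ}
    {T : EuclideanSpace ℝ (Fin n) → EuclideanSpace ℝ (Fin n) → Matrix (TIndex n) (TIndex n) ℝ}
    (hT : IsSegmentTransport (connectionMatrix (metricMatrix g c)) z₀ r η T)
    (hr : ball z₀ r ⊆ chartTarget c) {V : Set M} (hV : ∀ z ∈ ball z₀ r, pt c z ∈ V)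
    {z z' : EuclideanSpace ℝ (Fin n)} (hz : z ∈ ball z₀ r) (hz' : z' ∈ ball z₀ r) :
    ∃ P, FlowsTo g V (pt c z) (pt c z') P ∧
      flowMat c (pt c z) (pt c z') (lin n P) = T z z' := by
  obtain ⟨X, h0, h1, hX⟩ := hT.isSol_matrix hz hz'
  have hc := isCurve_line hz hz'
  obtain ⟨P, hP, hPX⟩ := ConformalTractor.exists_flowsTo zero_le_one
    (hc.mono_set fun u hu ↦ hr (hc.mapsTo u hu)) hX h0 fun u hu ↦ hV _ (hc.mapsTo u hu)
  have l0 : line z z' 0 = z := by simp [line]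
  have l1 : line z z' 1 = z' := by simp [line]
  rw [l0, l1] at hP hPX
  exact ⟨P, hP, hPX.trans h1⟩

/-- All points near `y` are reached from `y` by transport inside a given neighbourhood. -/
lemma eventually_flowsTo {V : Set M} (hV : IsOpen V) (hy : y ∈ V) :
    ∀ᶠ y' in 𝓝 y, (∃ P, FlowsTo g V y y' P) ∧ ∃ P, FlowsTo g V y' y P := by
  have hs : y ∈ chartSource (n := n) y := mem_extChartAt_source (I := 𝓡 n) y
  set z₀ := extChartAt (𝓡 n) y y with hz₀
  have hp : pt y z₀ = y := pt_extChartAt hs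
  set O := chartTarget (n := n) y ∩ pt y ⁻¹' V with hO
  have hOo : IsOpen O :=
    (continuousOn_extChartAt_symm y).isOpen_inter_preimage (isOpen_chartTarget y) hV
  have hz₀O : z₀ ∈ O := ⟨(extChartAt (𝓡 n) y).map_source hs, by rwa [mem_preimage, hp]⟩
  obtain ⟨r, hr, hrO, T, hT⟩ := exists_isSegmentTransport hOo
    (W := connectionMatrix (metricMatrix g y))
    (fun i ↦ ((connectionMatrix_metricMatrix_smooth g y i).mono inter_subset_left).continuousOn)
    hz₀O (one_pos)
  have h0 : z₀ ∈ ball z₀ r := mem_ball_self hr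
  filter_upwards [(isOpen_extChartAt_source (I := 𝓡 n) y).mem_nhds hs,
    (continuousAt_extChartAt (I := 𝓡 n) y).preimage_mem_nhds (ball_mem_nhds z₀ hr)] with y' hy' hb
  have hp' : pt y (extChartAt (𝓡 n) y y') = y' := pt_extChartAt hy'
  obtain ⟨P, hP, -⟩ := hT.exists_flowsTo (hrO.trans inter_subset_left) (V := V)
    (fun z hz ↦ (hrO hz).2) h0 hb
  obtain ⟨Q, hQ, -⟩ := hT.exists_flowsTo (hrO.trans inter_subset_left) (V := V)
    (fun z hz ↦ (hrO hz).2) hb h0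
  rw [hp, hp'] at hP hQ
  exact ⟨⟨P, hP⟩, Q, hQ⟩

end SmallTransport

/-! ### Small loops on the manifold -/

section SmallLoops

open Filter Topology Metric
open scoped Matrix.Norms.Operator

variable {n p q : ℕ} {M : Type*} [TopologicalSpace M]
  [ChartedSpace (EuclideanSpace ℝ (Fin n)) M] [IsManifold (𝓡 n) ∞ M]
  {κ : Type*} {c x : M} {Φ : Tractor n ≃ₗ[ℝ] (κ → ℂ)}

lemma strMat_coordEquiv (hx : x ∈ chartSource (n := n) c) :
    strMat ((coordEquiv hx).symm.trans Φ) = flowMat c x x (complexStr Φ) := rfl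

lemma cmat_coordEquiv [DecidableEq κ] (hx : x ∈ chartSource (n := n) c)
    (L : Module.End ℝ (Tractor n)) :
    cmat ((coordEquiv hx).symm.trans Φ) (flowMat c x x L) = complexMat Φ L := by
  ext k l
  have h1 : ∀ v, (flowMat c x x L).mulVec v = coordMap c x (L (frameMap c x v)) := fun v ↦ by
    rw [← flowMat_mulVec hx, coordMap_frameMap hx]
  rw [cmat_apply, complexMat_apply, complexMat_apply]
  change Φ (frameMap c x ((flowMat c x x L).mulVec
    (coordMap c x (Φ.symm (Pi.single l 1))))) k = _
  rw [h1, frameMap_coordMap hx, frameMap_coordMap hx]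

lemma flowMat_commute (hx : x ∈ chartSource (n := n) c) {L J : Module.End ℝ (Tractor n)} :
    flowMat c x x L * flowMat c x x J = flowMat c x x J * flowMat c x x L ↔ L * J = J * L := by
  rw [flowMat_mul hx, flowMat_mul hx]
  exact (flowMat_injective hx hx).eq_iff

lemma flowMat_anticommute (hx : x ∈ chartSource (n := n) c) {L J : Module.End ℝ (Tractor n)} :
    flowMat c x x L * flowMat c x x J = -(flowMat c x x J * flowMat c x x L) ↔
      L * J = -(J * L) := by
  rw [flowMat_mul hx, flowMat_mul hx, ← flowMat_neg]
  exact (flowMat_injective hx hx).eq_iff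

variable [Fintype κ] [DecidableEq κ]

/-- If the holonomy at `x` commutes or anticommutes with a skew complex structure, then transport
around small loops near `x` has complex determinant `1`. -/
theorem exists_local_transport (hn : 3 ≤ n) (g : PseudoMetric n p q M) (x : M)
    (hskew : ∀ v w, tractorMetric g x (complexStr Φ v) w +
      tractorMetric g x v (complexStr Φ w) = 0)
    (hloop : ∀ P : (Tractor n →L[ℝ] Tractor n)ˣ,
      (∃ γ : Path x x, IsParallelTransport g γ (P : Tractor n →L[ℝ] Tractor n)) →
      lin n P * complexStr Φ = complexStr Φ * lin n P ∨
      lin n P * complexStr Φ = -(complexStr Φ * lin n P)) :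
    ∃ U : Set M, IsOpen U ∧ x ∈ U ∧ ∃ R : M → (Tractor n →L[ℝ] Tractor n)ˣ,
      (∀ y ∈ U, ∃ γ : Path x y, IsParallelTransport g γ (R y : Tractor n →L[ℝ] Tractor n)) ∧
      ∀ y y' P, FlowsTo g U y y' P →
        lin n ((R y')⁻¹ * P * R y) * complexStr Φ = complexStr Φ * lin n ((R y')⁻¹ * P * R y) ∧
        (complexMat Φ (lin n ((R y')⁻¹ * P * R y))).det = 1 := by
  have hs : x ∈ chartSource (n := n) x := mem_extChartAt_source (I := 𝓡 n) x
  set z₀ := extChartAt (𝓡 n) x x with hz₀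
  have hp : pt x z₀ = x := pt_extChartAt hs
  have hG := isMetricOn_metricMatrix g x
  have hz₀O : z₀ ∈ chartTarget (n := n) x := (extChartAt (𝓡 n) x).map_source hs
  obtain ⟨r, hr, hrO, T, hT⟩ := exists_isSegmentTransport (isOpen_chartTarget (n := n) x)
    (W := connectionMatrix (metricMatrix g x))
    (fun i ↦ (connectionMatrix_metricMatrix_smooth g x i).continuousOn) hz₀O
    (η := 1 / 10) (by norm_num)
  have h0 : z₀ ∈ ball z₀ r := mem_ball_self hr
  have hW : ∀ i, SmoothM (ball z₀ r) (connectionMatrix (metricMatrix g x) i) := fun i ↦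
    (connectionMatrix_metricMatrix_smooth g x i).mono hrO
  have hsrc : ∀ {z}, z ∈ ball z₀ r → pt x z ∈ chartSource (n := n) x := fun hz ↦ pt_mem (hrO hz)
  have hstr := strMat_coordEquiv (Φ := Φ) hs
  -- A triangle with vertex `z₀` is a loop at `x`, so the hypothesis on the holonomy applies to it.
  have hQ : ∀ z ∈ ball z₀ r, ∀ z' ∈ ball z₀ r,
      (T z' z₀ * T z z' * T z₀ z) * strMat ((coordEquiv hs).symm.trans Φ) =
        strMat ((coordEquiv hs).symm.trans Φ) * (T z' z₀ * T z z' * T z₀ z) ∨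
      (T z' z₀ * T z z' * T z₀ z) * strMat ((coordEquiv hs).symm.trans Φ) =
        -(strMat ((coordEquiv hs).symm.trans Φ) * (T z' z₀ * T z z' * T z₀ z)) := by
    intro z hz z' hz'
    obtain ⟨P₁, hP₁, e₁⟩ := hT.exists_flowsTo hrO (V := univ) (fun _ _ ↦ mem_univ _) h0 hz
    obtain ⟨P₂, hP₂, e₂⟩ := hT.exists_flowsTo hrO (V := univ) (fun _ _ ↦ mem_univ _) hz hz'
    obtain ⟨P₃, hP₃, e₃⟩ := hT.exists_flowsTo hrO (V := univ) (fun _ _ ↦ mem_univ _) hz' h0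
    rw [hp] at hP₁ e₁ hP₃ e₃
    obtain ⟨γ₁, k₁⟩ := hP₁.exists_path
    obtain ⟨γ₂, k₂⟩ := hP₂.exists_path
    obtain ⟨γ₃, k₃⟩ := hP₃.exists_path
    have e : T z' z₀ * T z z' * T z₀ z = flowMat x x x (lin n (P₃ * (P₂ * P₁))) := by
      rw [← e₁, ← e₂, ← e₃, mul_assoc, flowMat_mul (hsrc hz), flowMat_mul (hsrc hz'), map_mul,
        map_mul]
    rw [e, hstr, flowMat_commute hs, flowMat_anticommute hs]
    exact hloop _ ⟨_, (k₁.trans k₂).trans k₃⟩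
  have hsk : (strMat ((coordEquiv hs).symm.trans Φ)).transpose * tractorH (metricMatrix g x) z₀ +
      tractorH (metricMatrix g x) z₀ * strMat ((coordEquiv hs).symm.trans Φ) = 0 := by
    have h1 := skew_matrix g hz₀O (S := complexStr Φ) (by rw [hp]; exact hskew)
    have h2 : flowMat x x x (complexStr Φ) = Matrix.of fun A B ↦
        tractorCoord x (pt x z₀) (complexStr Φ (tractorFrame x z₀ B)) A := by
      ext A B
      rw [flowMat_apply, hp]
      rfl
    rw [hstr, h2]
    exact h1
  obtain ⟨s, hs0, hsr, hloc⟩ := hG.det_cmat_transport hn hrO hr hT hsk hQ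
  have hsub : ball z₀ s ⊆ ball z₀ r := ball_subset_ball hsr
  -- `R y` is transport along the radius to `y`; outside the small ball its value `1` plays no role.
  have hR : ∀ y : M, ∃ R : (Tractor n →L[ℝ] Tractor n)ˣ,
      y ∈ chartSource (n := n) x ∩ extChartAt (𝓡 n) x ⁻¹' ball z₀ s →
      (FlowsTo g univ x y R ∧ flowMat x x y (lin n R) = T z₀ (extChartAt (𝓡 n) x y)) := by
    intro y
    by_cases hy : y ∈ chartSource (n := n) x ∩ extChartAt (𝓡 n) x ⁻¹' ball z₀ s
    · obtain ⟨P, hP, e⟩ := hT.exists_flowsTo hrO (V := univ) (fun _ _ ↦ mem_univ _) h0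
        (hsub hy.2)
      rw [hp, pt_extChartAt hy.1] at hP e
      exact ⟨P, fun _ ↦ ⟨hP, e⟩⟩
    · exact ⟨1, fun h ↦ absurd h hy⟩
  choose R hR using hR
  refine ⟨chartSource (n := n) x ∩ extChartAt (𝓡 n) x ⁻¹' ball z₀ s,
    (continuousOn_extChartAt x).isOpen_inter_preimage (isOpen_extChartAt_source x) isOpen_ball,
    ⟨hs, mem_ball_self hs0⟩, R, fun y hy ↦ (hR y hy).1.exists_path, ?_⟩
  rintro y y' P ⟨c, γ, F, a, b, hab, hF, rfl, rfl, hV, hF0, hFP⟩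
  have ha := hV a ⟨le_rfl, hab⟩
  have hb := hV b ⟨hab, le_rfl⟩
  have hF' : IsFlow g x γ F a b := hF.change_chart fun u hu ↦ (hV u hu).1
  obtain ⟨X, hX0, hX1, hX⟩ := hF'.isSol_flowMat hab hF0 hFP
  obtain ⟨k1, k2⟩ := hloc _ a b X hab (hF'.isCurve.mono_set fun u hu ↦ (hV u hu).2) hX hX0
  have hinv : T (extChartAt (𝓡 n) x (γ b)) z₀ = flowMat x (γ b) x (lin n (R (γ b))⁻¹) := by
    have h1 := hT.mul_eq_one hW h0 (hsub hb.2)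
    have h2 : flowMat x x (γ b) (lin n (R (γ b))) * flowMat x (γ b) x (lin n (R (γ b))⁻¹) = 1 := by
      rw [flowMat_mul hs, lin_mul_inv, flowMat_one hb.1]
    rw [(hR _ hb).2] at h2
    calc _ = T (extChartAt (𝓡 n) x (γ b)) z₀ * (T z₀ (extChartAt (𝓡 n) x (γ b)) *
          flowMat x (γ b) x (lin n (R (γ b))⁻¹)) := by rw [h2, mul_one]
      _ = _ := by rw [← mul_assoc, h1, one_mul]
  rw [hinv, hX1, ← (hR _ ha).2, flowMat_mul hb.1, flowMat_mul ha.1, ← map_mul, ← map_mul] at k1 k2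
  rw [hstr, flowMat_commute hs] at k1
  rw [cmat_coordEquiv] at k2
  exact ⟨k1, k2⟩

end SmallLoops

/-! ### From small loops to null-homotopic loops -/

section Global

open Filter Topology

universe u

/-- The projection of `N` modulo `K`, extended by `1` to all of `H`; a total function spares
membership proofs in the cocycle below. -/
lemma exists_quotient_map {H : Type u} [Group H] {N K : Subgroup H}
    (hconj : ∀ a ∈ N, ∀ k ∈ K, a * k * a⁻¹ ∈ K) :
    ∃ (Γ : Type u) (_ : Group Γ) (φ : H → Γ), (∀ a ∈ N, ∀ b ∈ N, φ (a * b) = φ a * φ b) ∧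
      (∀ a ∈ N, φ a⁻¹ = (φ a)⁻¹) ∧ ∀ a ∈ N, φ a = 1 ↔ a ∈ K := by
  classical
  have hn : (K.subgroupOf N).Normal := ⟨fun k hk a ↦ hconj a a.2 k hk⟩
  refine ⟨N ⧸ K.subgroupOf N, inferInstance,
    fun a ↦ if h : a ∈ N then QuotientGroup.mk ⟨a, h⟩ else 1, fun a ha b hb ↦ ?_, fun a ha ↦ ?_,
    fun a ha ↦ ?_⟩
  · simp only [dif_pos ha, dif_pos hb, dif_pos (mul_mem ha hb)]
    rfl
  · simp only [dif_pos ha, dif_pos (inv_mem ha)]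
    rfl
  · simp only [dif_pos ha]
    exact QuotientGroup.eq_one_iff _

variable {n p q : ℕ} {M : Type*} [TopologicalSpace M]
  [ChartedSpace (EuclideanSpace ℝ (Fin n)) M]

lemma end_mul_neg {V : Type*} [AddCommGroup V] [Module ℝ V] (A B : Module.End ℝ V) :
    A * -B = -(A * B) := mul_neg A B

lemma end_neg_mul {V : Type*} [AddCommGroup V] [Module ℝ V] (A B : Module.End ℝ V) :
    -A * B = -(A * B) := neg_mul A B

section Subgroups

variable {κ : Type*} (Φ : Tractor n ≃ₗ[ℝ] (κ → ℂ))

/-- The automorphisms commuting or anticommuting with the complex structure. -/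
def semilinearSubgroup : Subgroup (Tractor n →L[ℝ] Tractor n)ˣ where
  carrier := {P | lin n P * complexStr Φ = complexStr Φ * lin n P ∨
      lin n P * complexStr Φ = -(complexStr Φ * lin n P)}
  mul_mem' := by
    rintro P Q (hP | hP) (hQ | hQ)
    · left; rw [map_mul, mul_assoc, hQ, ← mul_assoc, hP, mul_assoc]
    · right; rw [map_mul, mul_assoc, hQ, end_mul_neg, ← mul_assoc, hP, mul_assoc]
    · right; rw [map_mul, mul_assoc, hQ, ← mul_assoc, hP, end_neg_mul, mul_assoc]
    · left; rw [map_mul, mul_assoc, hQ, end_mul_neg, ← mul_assoc, hP, end_neg_mul, neg_neg, mul_assoc]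
  one_mem' := by left; rw [map_one, one_mul, mul_one]
  inv_mem' := by
    have key : ∀ (P : (Tractor n →L[ℝ] Tractor n)ˣ) X, lin n P⁻¹ * (lin n P * X * lin n P⁻¹) =
        X * lin n P⁻¹ := fun P X ↦ by
      rw [mul_assoc, ← mul_assoc, lin_inv_mul, one_mul]
    have key' : ∀ (P : (Tractor n →L[ℝ] Tractor n)ˣ) X, lin n P⁻¹ * (X * lin n P * lin n P⁻¹) =
        lin n P⁻¹ * X := fun P X ↦ by
      rw [mul_assoc X, lin_mul_inv, mul_one]
    rintro P (hP | hP)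
    · left; rw [← key, hP, key']
    · right
      rw [← key P (complexStr Φ), hP, ← key' P (complexStr Φ)]
      simp only [end_neg_mul, end_mul_neg, neg_neg]

variable [Fintype κ] [DecidableEq κ]

/-- The complex linear automorphisms of complex determinant `1`. -/
def specialSubgroup : Subgroup (Tractor n →L[ℝ] Tractor n)ˣ where
  carrier := {P | lin n P * complexStr Φ = complexStr Φ * lin n P ∧
    (complexMat Φ (lin n P)).det = 1}
  mul_mem' := by
    rintro P Q ⟨hP, hP1⟩ ⟨hQ, hQ1⟩
    refine ⟨by rw [map_mul, mul_assoc, hQ, ← mul_assoc, hP, mul_assoc], ?_⟩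
    rw [map_mul, complexMat_mul hP, Matrix.det_mul, hP1, hQ1, one_mul]
  one_mem' := ⟨by rw [map_one, one_mul, mul_one], by rw [map_one, complexMat_one, Matrix.det_one]⟩
  inv_mem' := by
    rintro P ⟨hP, hP1⟩
    refine ⟨?_, ?_⟩
    · calc lin n P⁻¹ * complexStr Φ = lin n P⁻¹ * (complexStr Φ * lin n P) * lin n P⁻¹ := by
            rw [mul_assoc, mul_assoc, lin_mul_inv, mul_one]
        _ = _ := by rw [← hP, ← mul_assoc, lin_inv_mul, one_mul]
    · have := congrArg Matrix.det (complexMat_mul hP (lin n P⁻¹))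
      rw [lin_mul_inv, complexMat_one, Matrix.det_one, Matrix.det_mul, hP1, one_mul] at this
      exact this.symm

variable {Φ}

lemma specialSubgroup_le : specialSubgroup Φ ≤ semilinearSubgroup Φ := fun _ h ↦ Or.inl h.1

/-- Conjugation by `P` sends `i` to `± i`, and `Q` commutes with both; the determinant is handled by
`det_complexMat_conj`. -/
lemma conj_mem_specialSubgroup {P Q : (Tractor n →L[ℝ] Tractor n)ˣ}
    (hP : P ∈ semilinearSubgroup Φ) (hQ : Q ∈ specialSubgroup Φ) :
    P * Q * P⁻¹ ∈ specialSubgroup Φ := by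
  refine ⟨?_, ?_⟩
  · have h : ∀ s : Module.End ℝ (Tractor n), s = complexStr Φ ∨ s = -complexStr Φ →
        lin n Q * s = s * lin n Q := by
      rintro s (rfl | rfl)
      · exact hQ.1
      · rw [end_mul_neg, end_neg_mul, hQ.1]
    obtain ⟨s, hs, hs'⟩ : ∃ s : Module.End ℝ (Tractor n), (s = complexStr Φ ∨ s = -complexStr Φ) ∧
        complexStr Φ * lin n P = lin n P * s := by
      rcases hP with hP | hP
      · exact ⟨_, Or.inl rfl, hP.symm⟩
      · exact ⟨_, Or.inr rfl, by rw [end_mul_neg, hP, neg_neg]⟩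
    have hs'' : lin n P⁻¹ * complexStr Φ = s * lin n P⁻¹ := by
      calc lin n P⁻¹ * complexStr Φ = lin n P⁻¹ * (complexStr Φ * lin n P) * lin n P⁻¹ := by
            rw [mul_assoc, mul_assoc, lin_mul_inv, mul_one]
        _ = _ := by rw [hs', ← mul_assoc, lin_inv_mul, one_mul]
    rw [map_mul, map_mul, mul_assoc, hs'', ← mul_assoc, mul_assoc (lin n P), h s hs, ← mul_assoc,
      ← hs']
    simp only [mul_assoc]
  · rw [map_mul (lin n), map_mul (lin n)]
    exact det_complexMat_conj (lin_mul_inv P) hP hQ.1 hQ.2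

end Subgroups

variable [IsManifold (𝓡 n) ∞ M] {g : PseudoMetric n p q M} {x y y' y'' : M}
  {P Q : (Tractor n →L[ℝ] Tractor n)ˣ}

/-- `P` is parallel transport along some path from `y` to `y'`. -/
def IsTransport (g : PseudoMetric n p q M) (y y' : M) (P : (Tractor n →L[ℝ] Tractor n)ˣ) : Prop :=
  ∃ γ : Path y y', IsParallelTransport g γ (P : Tractor n →L[ℝ] Tractor n)

namespace IsTransport

lemma trans (hP : IsTransport g y y' P) (hQ : IsTransport g y' y'' Q) :
    IsTransport g y y'' (Q * P) := by
  obtain ⟨γ, hγ⟩ := hP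
  obtain ⟨δ, hδ⟩ := hQ
  exact ⟨_, hγ.trans hδ⟩

lemma symm (hP : IsTransport g y y' P) : IsTransport g y' y P⁻¹ := by
  obtain ⟨γ, hγ⟩ := hP
  exact ⟨_, hγ.symm⟩

lemma metric_eq (hP : IsTransport g y y' P) (v w : Tractor n) :
    tractorMetric g y' ((P : Tractor n →L[ℝ] Tractor n) v) ((P : Tractor n →L[ℝ] Tractor n) w) =
      tractorMetric g y v w := by
  obtain ⟨γ, hγ⟩ := hP
  obtain ⟨F, h0, h1, hF⟩ := isParallelTransport_iff.mp hγ
  have := hF.metric_eq ⟨zero_le_one, le_rfl⟩ v w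
  simpa [h0, h1] using this

end IsTransport

lemma PFlow.isTransport {γ : ℝ → M} {F : ℝ → Tractor n → Tractor n} {a b : ℝ}
    (h : PFlow g γ F a b) (h0 : ∀ v, F a v = v)
    (hP : ∀ v, F b v = (P : Tractor n →L[ℝ] Tractor n) v) : IsTransport g (γ a) (γ b) P :=
  h.exists_path h0 hP

variable {κ : Type*} [Fintype κ] [DecidableEq κ] {Φ : Tractor n ≃ₗ[ℝ] (κ → ℂ)}

/-- The version of `exists_local_transport` at another point. -/
lemma exists_local_transport_conj (hn : 3 ≤ n)
    (hskew : ∀ v w, tractorMetric g x (complexStr Φ v) w +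
      tractorMetric g x v (complexStr Φ w) = 0)
    (hloop : ∀ P, IsTransport g x x P → P ∈ semilinearSubgroup Φ) (hQ : IsTransport g x y Q) :
    ∃ U : Set M, IsOpen U ∧ y ∈ U ∧ ∃ R : M → (Tractor n →L[ℝ] Tractor n)ˣ,
      (∀ z ∈ U, IsTransport g y z (R z)) ∧
      ∀ z z' P, FlowsTo g U z z' P → Q⁻¹ * ((R z')⁻¹ * P * R z) * Q ∈ specialSubgroup Φ := by
  -- The complex structure is carried to `y` by `Q`. It remains skew, and the holonomy at `y` is the
  -- conjugate by `Q` of that at `x`.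
  set e : Tractor n ≃ₗ[ℝ] Tractor n := (ContinuousLinearEquiv.unitsEquiv ℝ _ Q).toLinearEquiv
  have hstr : complexStr (e.symm.trans Φ) = lin n Q * complexStr Φ * lin n Q⁻¹ := rfl
  have hmat : ∀ L, complexMat (e.symm.trans Φ) L = complexMat Φ (lin n Q⁻¹ * L * lin n Q) :=
    fun _ ↦ rfl
  have hconj : ∀ L, lin n Q⁻¹ * L * lin n Q * complexStr Φ =
      lin n Q⁻¹ * (L * (lin n Q * complexStr Φ * lin n Q⁻¹)) * lin n Q := fun L ↦ by
    simp only [mul_assoc, lin_inv_mul, mul_one]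
  have hconj' : ∀ L, complexStr Φ * (lin n Q⁻¹ * L * lin n Q) =
      lin n Q⁻¹ * (lin n Q * complexStr Φ * lin n Q⁻¹ * L) * lin n Q := fun L ↦ by
    calc _ = lin n Q⁻¹ * lin n Q * complexStr Φ * lin n Q⁻¹ * L * lin n Q := by
          rw [lin_inv_mul, one_mul]; simp only [mul_assoc]
      _ = _ := by simp only [mul_assoc]
  have hinj : ∀ L L', lin n Q⁻¹ * L * lin n Q = lin n Q⁻¹ * L' * lin n Q → L = L' := by
    intro L L' h
    have h1 := congrArg (fun X ↦ lin n Q * X * lin n Q⁻¹) h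
    have h2 : ∀ X, lin n Q * (lin n Q⁻¹ * X * lin n Q) * lin n Q⁻¹ = X := fun X ↦ by
      calc _ = (lin n Q * lin n Q⁻¹) * X * (lin n Q * lin n Q⁻¹) := by simp only [mul_assoc]
        _ = X := by rw [lin_mul_inv, one_mul, mul_one]
    simpa only [h2] using h1
  have hskew' : ∀ v w, tractorMetric g y (complexStr (e.symm.trans Φ) v) w +
      tractorMetric g y v (complexStr (e.symm.trans Φ) w) = 0 := by
    intro v w
    have h1 := hskew (lin n Q⁻¹ v) (lin n Q⁻¹ w)
    rw [← hQ.metric_eq, ← hQ.metric_eq] at h1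
    have h2 : ∀ v, (Q : Tractor n →L[ℝ] Tractor n) (lin n Q⁻¹ v) = v := fun v ↦
      LinearMap.congr_fun (lin_mul_inv Q) v
    rw [h2, h2] at h1
    exact h1
  have hloop' : ∀ P, IsTransport g y y P →
      lin n P * complexStr (e.symm.trans Φ) = complexStr (e.symm.trans Φ) * lin n P ∨
      lin n P * complexStr (e.symm.trans Φ) = -(complexStr (e.symm.trans Φ) * lin n P) := by
    intro P hP
    have h1 := hloop (Q⁻¹ * P * Q) (by
      rw [mul_assoc]; exact (hQ.trans hP).trans hQ.symm)
    rw [hstr]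
    rcases h1 with h1 | h1
    · left
      apply hinj
      rw [← hconj, ← hconj', ← map_mul, ← map_mul, h1]
    · right
      apply hinj
      rw [← hconj, end_mul_neg, end_neg_mul, ← hconj', ← map_mul, ← map_mul, h1]
  obtain ⟨U, hU, hy, R, hR, hloc⟩ := exists_local_transport (Φ := e.symm.trans Φ) hn g y hskew' hloop'
  refine ⟨U, hU, hy, R, hR, fun z z' P hP ↦ ?_⟩
  obtain ⟨h1, h2⟩ := hloc z z' P hP
  rw [hstr] at h1
  refine ⟨?_, ?_⟩
  · rw [map_mul, map_mul, hconj, h1, hconj']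
  · rw [map_mul (lin n), map_mul (lin n), ← hmat, h2]

/-- If the holonomy at `x` consists of maps commuting or anticommuting with a skew complex
structure, then the restricted holonomy is complex linear of determinant `1`. -/
theorem transport_mem_specialSubgroup (hn : 3 ≤ n)
    (hskew : ∀ v w, tractorMetric g x (complexStr Φ v) w +
      tractorMetric g x v (complexStr Φ w) = 0)
    (hloop : ∀ P, IsTransport g x x P → P ∈ semilinearSubgroup Φ) {γ : Path x x}
    (hγ : γ.Homotopic (Path.refl x))
    (hP : IsParallelTransport g γ (P : Tractor n →L[ℝ] Tractor n)) :
    P ∈ specialSubgroup Φ := by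
  obtain ⟨Γ, _, φ, φmul, φinv, φone⟩ := exists_quotient_map (N := semilinearSubgroup Φ)
    (K := specialSubgroup Φ) fun a ha k hk ↦ conj_mem_specialSubgroup ha hk
  -- A reference transport from `x` to each reachable point. It need not depend continuously on the
  -- point, and `M` need not be connected.
  have hC : ∀ y, ∃ C : (Tractor n →L[ℝ] Tractor n)ˣ,
      (∃ Q, IsTransport g x y Q) → IsTransport g x y C := by
    intro y
    by_cases h : ∃ Q, IsTransport g x y Q
    · obtain ⟨Q, hQ⟩ := h
      exact ⟨Q, fun _ ↦ hQ⟩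
    · exact ⟨1, fun h' ↦ absurd h' h⟩
  choose C hC using hC
  have hlocal : ∀ i : M, ∃ U : Set M, IsOpen U ∧ i ∈ U ∧
      ∃ R : M → (Tractor n →L[ℝ] Tractor n)ˣ, ((∃ Q, IsTransport g x i Q) →
        (∀ z ∈ U, IsTransport g i z (R z)) ∧ ∀ z z' P, FlowsTo g U z z' P →
          (C i)⁻¹ * ((R z')⁻¹ * P * R z) * C i ∈ specialSubgroup Φ) ∧
        ((¬ ∃ Q, IsTransport g x i Q) → ∀ z ∈ U, ¬ ∃ Q, IsTransport g x z Q) := by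
    intro i
    by_cases h : ∃ Q, IsTransport g x i Q
    · obtain ⟨U, hU, hi, R, hR⟩ := exists_local_transport_conj hn hskew hloop (hC i h)
      exact ⟨U, hU, hi, R, fun _ ↦ hR, fun h' ↦ absurd h h'⟩
    -- Points near `i` can be joined to `i`, so if `i` is out of reach of `x`, so are they.
    · obtain ⟨U, hUi, hU, hi⟩ :=
        mem_nhds_iff.mp (eventually_flowsTo (g := g) (y := i) isOpen_univ (mem_univ i))
      refine ⟨U, hU, hi, 1, fun h' ↦ absurd h' h, fun _ z hz ⟨Q, hQ⟩ ↦ h ?_⟩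
      obtain ⟨S, hS⟩ := (hUi hz).2
      exact ⟨_, hQ.trans hS.exists_path⟩
  choose U hU hmem R hR hR' using hlocal
  classical
  -- The local transport from `i` to `y`, closed up to a loop at `x` by the reference transports,
  -- modulo complex determinant `1`.
  set σ : M → M → Γ := fun i y ↦
    if ∃ Q, IsTransport g x i Q then φ ((C y)⁻¹ * R i y * C i) else 1
  -- Inside `U i` any transport from `y` to `y'` agrees with `R i y' * (R i y)⁻¹` up to the special
  -- subgroup. So the ratio of the values of `σ` is the class of that transport and does not depend
  -- on `i`.
  have step : ∀ i y y' S, (∃ Q, IsTransport g x i Q) → y ∈ U i → y' ∈ U i →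
      FlowsTo g (U i) y y' S → σ i y' * (σ i y)⁻¹ = φ ((C y')⁻¹ * S * C y) := by
    intro i y y' S hi hy hy' hS
    have hN : ∀ z ∈ U i, (C z)⁻¹ * R i z * C i ∈ semilinearSubgroup Φ := by
      intro z hz
      have h1 := (hC i hi).trans ((hR i hi).1 z hz)
      refine hloop _ ?_
      rw [mul_assoc]
      exact h1.trans (hC z ⟨_, h1⟩).symm
    have hK := (hR i hi).2 y y' S hS
    simp only [σ, if_pos hi]
    rw [← φinv _ (hN y hy)]
    have e : (C y')⁻¹ * S * C y = ((C y')⁻¹ * R i y' * C i) *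
        ((C i)⁻¹ * ((R i y')⁻¹ * S * R i y) * C i) * ((C y)⁻¹ * R i y * C i)⁻¹ := by group
    rw [e, φmul _ (mul_mem (hN y' hy') (specialSubgroup_le hK)) _ (inv_mem (hN y hy)),
      φmul _ (hN y' hy') _ (specialSubgroup_le hK), (φone _ (specialSubgroup_le hK)).mpr hK, mul_one]
  have hσ : ∀ i j, ∀ y ∈ U i ∩ U j, ∀ᶠ y' in 𝓝 y,
      σ i y' * (σ i y)⁻¹ = σ j y' * (σ j y)⁻¹ := by
    intro i j y hy
    have hiff : ∀ k, y ∈ U k → ((∃ Q, IsTransport g x k Q) ↔ ∃ Q, IsTransport g x y Q) :=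
      fun k hk ↦ ⟨fun h ↦ ⟨_, (hC k h).trans ((hR k h).1 y hk)⟩,
        fun h ↦ by_contra fun h' ↦ hR' k h' y hk h⟩
    by_cases hr : ∃ Q, IsTransport g x y Q
    · filter_upwards [eventually_flowsTo (g := g) ((hU i).inter (hU j)) hy,
        ((hU i).inter (hU j)).mem_nhds hy] with y' ⟨⟨S, hS⟩, _⟩ hy'
      have hSi : ∀ k, U i ∩ U j ⊆ U k → FlowsTo g (U k) y y' S := by
        intro k hk
        obtain ⟨c, δ, F, a, b, h1, h2, h3, h4, h5, h6⟩ := hS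
        exact ⟨c, δ, F, a, b, h1, h2, h3, h4, fun u hu ↦ hk (h5 u hu), h6⟩
      rw [step i y y' S ((hiff i hy.1).mpr hr) hy.1 hy'.1 (hSi i inter_subset_left),
        step j y y' S ((hiff j hy.2).mpr hr) hy.2 hy'.2 (hSi j inter_subset_right)]
    · refine Eventually.of_forall fun y' ↦ ?_
      simp only [σ, if_neg (fun h ↦ hr ((hiff i hy.1).mp h)),
        if_neg (fun h ↦ hr ((hiff j hy.2).mp h))]
  obtain ⟨F, hF0, hF1, hF⟩ := isParallelTransport_iff.mp hP
  have hunit : ∀ t : unitInterval, ∃ S : (Tractor n →L[ℝ] Tractor n)ˣ,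
      ∀ v, F t v = (S : Tractor n →L[ℝ] Tractor n) v := fun t ↦ hF.exists_unit hF0 t.2
  choose S hS using hunit
  have hext : ∀ t : unitInterval, γ.extend t = γ t := fun t ↦ γ.extend_apply t.2
  have hST : ∀ t : unitInterval, IsTransport g x (γ t) (S t) := by
    intro t
    have h1 := (hF.restrict t.2).isTransport hF0 (hS t)
    rwa [hext, γ.extend_zero] at h1
  have hSN : ∀ t : unitInterval, (C (γ t))⁻¹ * S t ∈ semilinearSubgroup Φ := fun t ↦
    hloop _ ((hST t).trans (hC _ ⟨_, hST t⟩).symm)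
  have hflow : ∀ (t t' : unitInterval) (c : M) (V : Set M), t ≤ t' →
      IsFlow g c γ.extend F t t' → (∀ u ∈ Icc (t : ℝ) t', γ.extend u ∈ V) →
      FlowsTo g V (γ t) (γ t') (S t' * (S t)⁻¹) := by
    intro t t' c V htt hf hV
    have h1 : ∀ v, (S t : Tractor n →L[ℝ] Tractor n)
        ((((S t)⁻¹ : (Tractor n →L[ℝ] Tractor n)ˣ) : Tractor n →L[ℝ] Tractor n) v) = v := fun v ↦
      LinearMap.congr_fun (lin_mul_inv (S t)) v
    refine ⟨c, γ.extend, _, t, t', htt,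
      hf.comp_right (((S t)⁻¹ : (Tractor n →L[ℝ] Tractor n)ˣ) : Tractor n →L[ℝ] Tractor n),
      hext t, hext t', hV, fun v ↦ ?_, fun v ↦ ?_⟩
    · rw [hS, h1]
    · rw [hS]
      rfl
  have hquot : ∀ t t', φ ((C (γ t'))⁻¹ * S t') * (φ ((C (γ t))⁻¹ * S t))⁻¹ =
      φ ((C (γ t'))⁻¹ * (S t' * (S t)⁻¹) * C (γ t)) := by
    intro t t'
    rw [← φinv _ (hSN t), ← φmul _ (hSN t') _ (inv_mem (hSN t)), mul_inv_rev, inv_inv]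
    simp only [mul_assoc]
  -- The continued element is the class of transport along `γ` up to time `t`, brought back to `x`
  -- by the reference transport.
  have key := continuation_eq_of_nullhomotopic hU hmem hσ hγ
    (e := fun t ↦ φ ((C (γ t))⁻¹ * S t)) ?_
  · have hS0 : S 0 = 1 := by
      ext1
      refine ContinuousLinearMap.ext fun v ↦ ?_
      rw [← hS]
      exact hF0 v
    have hS1 : S 1 = P := by
      ext1
      refine ContinuousLinearMap.ext fun v ↦ ?_
      rw [← hS]
      exact hF1 v
    have hx : IsTransport g x x P := ⟨γ, hP⟩
    have hCx := hloop _ (hC x ⟨P, hx⟩)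
    simp only [γ.source, γ.target, hS0, hS1, mul_one] at key
    rw [φmul _ (inv_mem hCx) _ (hloop _ hx)] at key
    exact (φone _ (hloop _ hx)).mp (mul_eq_left.mp key)
  · intro t₀
    have hr : ∃ Q, IsTransport g x (γ t₀) Q := ⟨_, hST t₀⟩
    have h1 : ∀ᶠ t : unitInterval in 𝓝 t₀, ∃ (c : M) (s s' : ℝ), IsFlow g c γ.extend F s s' ∧
        (t : ℝ) ∈ Icc s s' ∧ (t₀ : ℝ) ∈ Icc s s' := by
      have := hF.eventually_isFlow zero_lt_one (t₀ : ℝ)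
      rw [nhds_subtype_eq_comap_nhdsWithin]
      exact this.comap _
    have h2 : ∀ᶠ t : unitInterval in 𝓝 t₀, ∀ u ∈ uIcc (t₀ : ℝ) t, γ.extend u ∈ U (γ t₀) := by
      have hc : ContinuousAt γ.extend (t₀ : ℝ) := γ.continuous_extend.continuousAt
      obtain ⟨δ, hδ, hδU⟩ := Metric.mem_nhds_iff.mp (hc.preimage_mem_nhds
        ((hU (γ t₀)).mem_nhds (by rw [hext]; exact hmem _)))
      filter_upwards [Metric.ball_mem_nhds t₀ hδ] with t ht u hu
      refine hδU ((convex_ball (t₀ : ℝ) δ).ordConnected.uIcc_subset (Metric.mem_ball_self hδ) ?_ hu)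
      exact ht
    filter_upwards [h1, h2] with t ⟨c, s, s', hf, ht, ht₀⟩ htU
    have hm : γ t ∈ U (γ t₀) := by rw [← hext t]; exact htU _ right_mem_uIcc
    rcases le_total t₀ t with hle | hle
    · rw [uIcc_of_le (show (t₀ : ℝ) ≤ t from hle)] at htU
      rw [hquot, step (γ t₀) (γ t₀) (γ t) _ hr (hmem _) hm
        (hflow t₀ t c _ hle (hf.mono ht₀.1 ht.2) htU)]
    · rw [uIcc_of_ge (show (t : ℝ) ≤ t₀ from hle)] at htU
      have h3 := step (γ t₀) (γ t) (γ t₀) _ hr hm (hmem _)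
        (hflow t t₀ c _ hle (hf.mono ht.1 ht₀.2) htU)
      rw [← hquot] at h3
      have h4 := congrArg (·⁻¹) h3
      simp only [mul_inv_rev, inv_inv] at h4
      exact h4.symm

end Global

/-! ### The holonomy algebra -/

section HolonomyAlgebra

open Filter Topology
open scoped Matrix

variable {n p q : ℕ} {M : Type*} [TopologicalSpace M]
  [ChartedSpace (EuclideanSpace ℝ (Fin n)) M]

instance : NormedAlgebra ℚ (Tractor n →L[ℝ] Tractor n) := NormedAlgebra.restrictScalars ℚ ℝ _

section Transfer

variable {k l : ℕ} {Φ : Tractor n ≃ₗ[ℝ] (Fin k ⊕ Fin l → ℂ)} {A : Tractor n →L[ℝ] Tractor n}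
  {X : Matrix (Fin k ⊕ Fin l) (Fin k ⊕ Fin l) ℂ}

lemma commute_of_mulVec (h : ∀ v, Φ (A v) = X *ᵥ Φ v) :
    (A : Module.End ℝ (Tractor n)) * complexStr Φ = complexStr Φ * (A : Module.End ℝ (Tractor n)) :=
  LinearMap.ext fun v ↦ Φ.injective <| by
    change Φ (A (Φ.symm (Complex.I • Φ v))) = Φ (Φ.symm (Complex.I • Φ (A v)))
    rw [h, h, LinearEquiv.apply_symm_apply, LinearEquiv.apply_symm_apply, Matrix.mulVec_smul]

lemma complexMat_of_mulVec (h : ∀ v, Φ (A v) = X *ᵥ Φ v) :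
    complexMat Φ (A : Module.End ℝ (Tractor n)) = X := by
  ext i j
  rw [complexMat_apply]
  change Φ (A (Φ.symm (Pi.single j 1))) i = _
  rw [h, LinearEquiv.apply_symm_apply, Matrix.mulVec_single_one]
  rfl

lemma exists_mulVec (Φ : Tractor n ≃ₗ[ℝ] (Fin k ⊕ Fin l → ℂ))
    (X : Matrix (Fin k ⊕ Fin l) (Fin k ⊕ Fin l) ℂ) :
    ∃ A : Tractor n →L[ℝ] Tractor n, ∀ v, Φ (A v) = X *ᵥ Φ v :=
  ⟨LinearMap.toContinuousLinearMap (Φ.symm.toLinearMap ∘ₗ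
    (Matrix.mulVecLin X).restrictScalars ℝ ∘ₗ Φ.toLinearMap), fun v ↦ by simp⟩

variable (k l) in
lemma hermitianForm_mul_self : hermitianForm k l * hermitianForm k l = 1 := by
  rw [hermitianForm, LieAlgebra.Orthogonal.indefiniteDiagonal, Matrix.diagonal_mul_diagonal,
    ← Matrix.diagonal_one]
  congr 1
  funext i
  rcases i with i | i <;> simp

variable (k l) in
lemma hermitianForm_conjTranspose : (hermitianForm k l)ᴴ = hermitianForm k l := by
  rw [hermitianForm, LieAlgebra.Orthogonal.indefiniteDiagonal, Matrix.diagonal_conjTranspose]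
  congr 1
  funext i
  rcases i with i | i <;> simp

/-- The unitary algebra spans all matrices over `ℂ`. -/
lemma exists_unitaryAlgebra_decomposition (Z : Matrix (Fin k ⊕ Fin l) (Fin k ⊕ Fin l) ℂ) :
    ∃ X ∈ unitaryAlgebra k l, ∃ Y ∈ unitaryAlgebra k l, (2 : ℂ) • Z = X - Complex.I • Y := by
  set H := hermitianForm k l with hH
  have h1 : H * H = 1 := hermitianForm_mul_self k l
  have h2 : Hᴴ = H := hermitianForm_conjTranspose k l
  have h3 : ∀ W, H * (H * W) = W := fun W ↦ by rw [← mul_assoc, h1, one_mul]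
  -- `H * (Zᴴ * H)` is the adjoint of `Z` for the Hermitian form: `Z` is split into its skew and
  -- self-adjoint parts, up to a factor, and `i` makes the latter skew.
  refine ⟨Z - H * (Zᴴ * H), ?_, Complex.I • (Z + H * (Zᴴ * H)), ?_, ?_⟩
  · change _ᴴ * H + H * _ = 0
    simp only [Matrix.conjTranspose_sub, Matrix.conjTranspose_mul, h2,
      Matrix.conjTranspose_conjTranspose, mul_sub, sub_mul, mul_assoc, h1, mul_one, h3]
    abel
  · change _ᴴ * H + H * _ = 0
    simp only [Matrix.conjTranspose_add, Matrix.conjTranspose_smul, Matrix.conjTranspose_mul, h2,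
      Matrix.conjTranspose_conjTranspose, mul_add, add_mul, mul_assoc, h1, mul_one, h3,
      Matrix.smul_mul, Matrix.mul_smul, Complex.star_def, Complex.conj_I, neg_smul, smul_add,
      Matrix.neg_mul]
    abel
  · rw [smul_smul, Complex.I_mul_I, neg_smul, one_smul, two_smul]
    abel

lemma I_mem_unitaryAlgebra : (Complex.I • 1 : Matrix (Fin k ⊕ Fin l) (Fin k ⊕ Fin l) ℂ) ∈
    unitaryAlgebra k l := by
  change _ᴴ * _ + _ * _ = 0
  simp

/-- A complex matrix with square `-1` commuting with the unitary algebra is `± i`. -/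
lemma eq_I_or_neg_I {Y : Matrix (Fin k ⊕ Fin l) (Fin k ⊕ Fin l) ℂ} (hY : Y * Y = -1)
    (h : ∀ X ∈ unitaryAlgebra k l, X * Y = Y * X) :
    Y = Complex.I • 1 ∨ Y = -(Complex.I • 1) := by
  -- The complex span of the unitary algebra is everything, so `Y` is central, hence a scalar with
  -- square `-1`.
  have h1 : ∀ Z, Z * Y = Y * Z := by
    intro Z
    obtain ⟨A, hA, B, hB, e⟩ := exists_unitaryAlgebra_decomposition Z
    have h2 : (2 : ℂ) • (Z * Y) = (2 : ℂ) • (Y * Z) := by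
      rw [← Matrix.smul_mul, ← Matrix.mul_smul, e, sub_mul, mul_sub, h A hA, Matrix.smul_mul,
        Matrix.mul_smul, h B hB]
    exact smul_right_injective _ two_ne_zero h2
  obtain ⟨c, rfl⟩ := Matrix.mem_range_scalar_of_commute_single (M := Y) fun i j _ ↦ h1 _
  rcases isEmpty_or_nonempty (Fin k ⊕ Fin l) with hE | ⟨⟨i⟩⟩
  · left
    ext i
    exact isEmptyElim i
  · have h3 := congrFun (congrFun hY i) i
    rw [← map_mul] at h3
    simp only [Matrix.scalar_apply, Matrix.diagonal_apply_eq, Matrix.neg_apply,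
      Matrix.one_apply_eq] at h3
    have h4 : (c - Complex.I) * (c + Complex.I) = 0 := by
      linear_combination h3 - Complex.I_mul_I
    rcases mul_eq_zero.mp h4 with h5 | h5
    · left
      rw [sub_eq_zero.mp h5, Matrix.smul_one_eq_diagonal, Matrix.scalar_apply]
    · right
      rw [eq_neg_of_add_eq_zero_left h5, Matrix.smul_one_eq_diagonal, Matrix.scalar_apply,
        Matrix.diagonal_neg]

end Transfer

section Exp

variable {κ : Type*} [Fintype κ] [DecidableEq κ] {Φ : Tractor n ≃ₗ[ℝ] (κ → ℂ)}
  {A : Tractor n →L[ℝ] Tractor n}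

lemma exp_zero_smul (A : Tractor n →L[ℝ] Tractor n) : NormedSpace.exp ((0 : ℝ) • A) = 1 :=
  (congrArg _ (zero_smul ℝ A)).trans NormedSpace.exp_zero

lemma hasDerivAt_linearMap_exp {F : Type*} [NormedAddCommGroup F] [NormedSpace ℝ F]
    (L : (Tractor n →L[ℝ] Tractor n) →ₗ[ℝ] F) :
    HasDerivAt (fun t : ℝ ↦ L (NormedSpace.exp (t • A))) (L A) 0 := by
  have h1 := hasDerivAt_exp_smul_const (𝕂 := ℝ) A 0
  rw [exp_zero_smul, one_mul] at h1
  exact (LinearMap.toContinuousLinearMap L).hasFDerivAt.comp_hasDerivAt 0 h1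

omit [Fintype κ] [DecidableEq κ] in
lemma commute_of_exp (h : ∀ t : ℝ, ((NormedSpace.exp (t • A) : Tractor n →L[ℝ] Tractor n) :
      Module.End ℝ (Tractor n)) * complexStr Φ =
      complexStr Φ * ((NormedSpace.exp (t • A) : Tractor n →L[ℝ] Tractor n) :
      Module.End ℝ (Tractor n))) :
    (A : Module.End ℝ (Tractor n)) * complexStr Φ =
      complexStr Φ * (A : Module.End ℝ (Tractor n)) := by
  refine LinearMap.ext fun v ↦ ?_
  have h1 := hasDerivAt_linearMap_exp (A := A)
    ((LinearMap.applyₗ (complexStr Φ v)) ∘ₗ ContinuousLinearMap.coeLM ℝ)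
  have h2 := hasDerivAt_linearMap_exp (A := A)
    ((complexStr Φ) ∘ₗ (LinearMap.applyₗ v) ∘ₗ ContinuousLinearMap.coeLM ℝ)
  refine h1.unique (h2.congr_of_eventuallyEq (Eventually.of_forall fun t ↦ ?_))
  exact LinearMap.congr_fun (h t) v

lemma trace_eq_zero_of_det_exp (h : ∀ t : ℝ, (complexMat Φ
      ((NormedSpace.exp (t • A) : Tractor n →L[ℝ] Tractor n) : Module.End ℝ (Tractor n))).det = 1) :
    (complexMat Φ (A : Module.End ℝ (Tractor n))).trace = 0 := by
  have h0 : complexMat Φ ((NormedSpace.exp ((0 : ℝ) • A) : Tractor n →L[ℝ] Tractor n) :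
      Module.End ℝ (Tractor n)) = 1 := by
    rw [exp_zero_smul]
    exact complexMat_one
  have h1 := hasDerivWithinAt_det (s := univ) (t := 0) (A := complexMat Φ A)
    (X := fun t : ℝ ↦ complexMat Φ
      ((NormedSpace.exp (t • A) : Tractor n →L[ℝ] Tractor n) : Module.End ℝ (Tractor n)))
    fun i j ↦ by
      rw [h0, mul_one]
      exact (hasDerivAt_linearMap_exp (A := A) ((Matrix.entryLinearMap ℝ ℂ i j) ∘ₗ complexMat Φ ∘ₗ
        ContinuousLinearMap.coeLM ℝ)).hasDerivWithinAt
  simp only [h, mul_one] at h1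
  exact (h1.hasDerivAt univ_mem).unique (hasDerivAt_const _ _)

end Exp

section UnitaryExp

open scoped Matrix.Norms.Operator

variable {k l : ℕ} {Φ : Tractor n ≃ₗ[ℝ] (Fin k ⊕ Fin l → ℂ)} {A : Tractor n →L[ℝ] Tractor n}

lemma mem_unitaryAlgebra_of_exp
    (h : ∀ t : ℝ, NormedSpace.exp (t • A) ∈ transfer Φ (unitaryGroup k l)) :
    complexMat Φ (A : Module.End ℝ (Tractor n)) ∈ unitaryAlgebra k l := by
  set X : ℝ → Matrix (Fin k ⊕ Fin l) (Fin k ⊕ Fin l) ℂ := fun t ↦ complexMat Φ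
      ((NormedSpace.exp (t • A) : Tractor n →L[ℝ] Tractor n) : Module.End ℝ (Tractor n)) with hX
  have h0 : X 0 = 1 := by
    simp only [hX]
    rw [exp_zero_smul]
    exact complexMat_one
  have hd : HasDerivAt X (complexMat Φ (A : Module.End ℝ (Tractor n))) 0 :=
    hasDerivAt_linearMap_exp (A := A) (complexMat Φ ∘ₗ ContinuousLinearMap.coeLM ℝ)
  have hU : ∀ t, (X t)ᴴ * hermitianForm k l * X t = hermitianForm k l := by
    intro t
    obtain ⟨Y, hY, e⟩ := h t
    simp only [hX]
    rw [complexMat_of_mulVec e]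
    exact hY
  let star' : Matrix (Fin k ⊕ Fin l) (Fin k ⊕ Fin l) ℂ →ₗ[ℝ] Matrix (Fin k ⊕ Fin l) _ ℂ :=
    { toFun := fun Y ↦ Yᴴ
      map_add' := Matrix.conjTranspose_add
      map_smul' := fun r Y ↦ by simp }
  have hs : HasDerivAt (fun t ↦ (X t)ᴴ) (complexMat Φ (A : Module.End ℝ (Tractor n)))ᴴ 0 :=
    hasDerivAt_linearMap_exp (A := A) (star' ∘ₗ complexMat Φ ∘ₗ ContinuousLinearMap.coeLM ℝ)
  have h1 := (hs.mul_const (hermitianForm k l)).mul hd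
  have h2 : HasDerivAt (fun _ : ℝ ↦ hermitianForm k l) 0 0 := hasDerivAt_const _ _
  have h3 := h1.unique (h2.congr_of_eventuallyEq (Eventually.of_forall hU))
  rw [h0, Matrix.conjTranspose_one, one_mul, mul_one] at h3
  exact h3

end UnitaryExp

variable [IsManifold (𝓡 n) ∞ M] {g : PseudoMetric n p q M} {x : M}

lemma restrictedHolonomyGroup_subset : restrictedHolonomyGroup g x ⊆ holonomyGroup g x :=
  fun _ ⟨γ, _, h⟩ ↦ ⟨γ, h⟩

/-- If `γ` realises `P`, the conjugate is transport along `γ⁻¹`, then a contractible loop, then `γ`;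
contracting the middle loop leaves `γ⁻¹` followed by `γ`. -/
lemma conj_mem_restrictedHolonomyGroup {P : (Tractor n →L[ℝ] Tractor n)ˣ}
    (hP : IsTransport g x x P) {A : Tractor n →L[ℝ] Tractor n}
    (hA : A ∈ restrictedHolonomyGroup g x) :
    (P : Tractor n →L[ℝ] Tractor n) * A * (P⁻¹ : (Tractor n →L[ℝ] Tractor n)ˣ) ∈
      restrictedHolonomyGroup g x := by
  obtain ⟨γ, hγ⟩ := hP
  obtain ⟨δ, hδ, hA⟩ := hA
  refine ⟨(γ.symm.trans δ).trans γ, ?_, ?_⟩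
  · have h1 : (γ.symm.trans δ).Homotopic γ.symm :=
      ((Path.Homotopic.refl γ.symm).hcomp hδ).trans ⟨Path.Homotopy.transRefl γ.symm⟩
    exact (h1.hcomp (Path.Homotopic.refl γ)).trans
      (Path.Homotopic.symm ⟨Path.Homotopy.reflSymmTrans γ⟩)
  · rw [mul_assoc]
    exact (hγ.symm.trans hA).trans hγ

lemma conj_mem_holonomyAlgebra {P : (Tractor n →L[ℝ] Tractor n)ˣ}
    (hP : IsTransport g x x P) {A : Tractor n →L[ℝ] Tractor n} (hA : A ∈ holonomyAlgebra g x) :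
    (P : Tractor n →L[ℝ] Tractor n) * A * (P⁻¹ : (Tractor n →L[ℝ] Tractor n)ˣ) ∈
      holonomyAlgebra g x := by
  intro t
  have e : t • ((P : Tractor n →L[ℝ] Tractor n) * A * (P⁻¹ : (Tractor n →L[ℝ] Tractor n)ˣ)) =
      (P : Tractor n →L[ℝ] Tractor n) * (t • A) * (P⁻¹ : (Tractor n →L[ℝ] Tractor n)ˣ) :=
    ContinuousLinearMap.ext fun v ↦ (map_smul (P : Tractor n →L[ℝ] Tractor n) t _).symm
  rw [e, NormedSpace.exp_units_conj]
  exact conj_mem_restrictedHolonomyGroup hP (hA t)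

section

variable {κ : Type*} [Fintype κ] [DecidableEq κ] {Φ : Tractor n ≃ₗ[ℝ] (κ → ℂ)}

/-- If the holonomy consists of maps commuting or anticommuting with a skew complex structure, then
the holonomy algebra is complex linear of complex trace `0`. -/
theorem holonomyAlgebra_commute_and_trace (hn : 3 ≤ n)
    (hskew : ∀ v w, tractorMetric g x (complexStr Φ v) w +
      tractorMetric g x v (complexStr Φ w) = 0)
    (hloop : ∀ P, IsTransport g x x P → P ∈ semilinearSubgroup Φ)
    {A : Tractor n →L[ℝ] Tractor n} (hA : A ∈ holonomyAlgebra g x) :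
    (A : Module.End ℝ (Tractor n)) * complexStr Φ = complexStr Φ * (A : Module.End ℝ (Tractor n)) ∧
      (complexMat Φ (A : Module.End ℝ (Tractor n))).trace = 0 := by
  have h1 : ∀ t : ℝ, ∃ P ∈ specialSubgroup Φ,
      (P : Tractor n →L[ℝ] Tractor n) = NormedSpace.exp (t • A) := by
    intro t
    obtain ⟨P, hP⟩ := NormedSpace.isUnit_exp (t • A)
    obtain ⟨γ, hγ, ht⟩ := hA t
    rw [← hP] at ht
    exact ⟨P, transport_mem_specialSubgroup hn hskew hloop hγ ht, hP⟩
  refine ⟨commute_of_exp fun t ↦ ?_, trace_eq_zero_of_det_exp fun t ↦ ?_⟩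
  · obtain ⟨P, hP, e⟩ := h1 t
    rw [← e]
    exact hP.1
  · obtain ⟨P, hP, e⟩ := h1 t
    rw [← e]
    exact hP.2

end

section Hermitian

variable {k l : ℕ} {Φ : Tractor n ≃ₗ[ℝ] (Fin k ⊕ Fin l → ℂ)}

/-- The Hermitian form is conjugate linear on the left, so moving `i` from one side to the other
changes its sign. -/
lemma IsHermitianIdentification.skew (h : IsHermitianIdentification g x Φ) (v w : Tractor n) :
    tractorMetric g x (complexStr Φ v) w + tractorMetric g x v (complexStr Φ w) = 0 := by
  rw [h, h]
  simp only [complexStr_apply, LinearEquiv.apply_symm_apply, star_smul, Matrix.mulVec_smul,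
    smul_dotProduct, dotProduct_smul, smul_eq_mul, Complex.star_def, Complex.conj_I]
  simp

/-- Unitary holonomy is complex linear, which gives complex trace zero; skewness for the Hermitian
form comes from differentiating one-parameter groups of unitary maps. -/
theorem holonomyAlgebra_subset_specialUnitary (hn : 3 ≤ n) (hΦ : IsHermitianIdentification g x Φ)
    (h : holonomyGroup g x ⊆ transfer Φ (unitaryGroup k l)) :
    holonomyAlgebra g x ⊆ transfer Φ (specialUnitaryAlgebra k l) := by
  intro A hA
  have hloop : ∀ P, IsTransport g x x P → P ∈ semilinearSubgroup Φ := by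
    rintro P hP
    obtain ⟨X, -, hX⟩ := h hP
    exact Or.inl (commute_of_mulVec hX)
  obtain ⟨h1, h2⟩ := holonomyAlgebra_commute_and_trace hn hΦ.skew hloop hA
  exact ⟨complexMat Φ A,
    ⟨mem_unitaryAlgebra_of_exp fun t ↦ h (restrictedHolonomyGroup_subset (hA t)), h2⟩,
    fun v ↦ complexMat_mulVec h1 v⟩

/-- Equality would put `i` in the algebra and force every holonomy to commute or anticommute with
`i`. The algebra would then have complex trace zero, but `i` has trace `(k + l) i`. -/
theorem holonomyAlgebra_ne_unitary (hn : 3 ≤ n) (hkl : 0 < k + l)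
    (hΦ : IsHermitianIdentification g x Φ) :
    holonomyAlgebra g x ≠ transfer Φ (unitaryAlgebra k l) := by
  intro h
  have hmem : ∀ X ∈ unitaryAlgebra k l, ∀ A : Tractor n →L[ℝ] Tractor n,
      (∀ v, Φ (A v) = X *ᵥ Φ v) → A ∈ holonomyAlgebra g x := fun X hX A hA ↦ by
    rw [h]; exact ⟨X, hX, hA⟩
  have hcomm : ∀ A ∈ holonomyAlgebra g x, (A : Module.End ℝ (Tractor n)) * complexStr Φ =
      complexStr Φ * (A : Module.End ℝ (Tractor n)) := fun A hA ↦ by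
    rw [h] at hA
    obtain ⟨X, -, hX⟩ := hA
    exact commute_of_mulVec hX
  obtain ⟨J, hJ⟩ := exists_mulVec Φ (Complex.I • 1)
  have hJmem := hmem _ I_mem_unitaryAlgebra J hJ
  have hJc : (J : Module.End ℝ (Tractor n)) = complexStr Φ := LinearMap.ext fun v ↦
    Φ.injective <| by
      change Φ (J v) = Φ (Φ.symm (Complex.I • Φ v))
      rw [hJ, LinearEquiv.apply_symm_apply, Matrix.smul_mulVec, Matrix.one_mulVec]
  have hloop : ∀ P, IsTransport g x x P → P ∈ semilinearSubgroup Φ := by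
    intro P hP
    set S : Module.End ℝ (Tractor n) := lin n P * complexStr Φ * lin n P⁻¹ with hS
    -- The holonomy group normalises its algebra, so the conjugate `S` of `i` lies in `𝔲` and is
    -- complex linear.
    have hSJ : S * complexStr Φ = complexStr Φ * S := by
      have h1 := hcomm _ (conj_mem_holonomyAlgebra hP hJmem)
      have h2 : ((P * J * (P⁻¹ : (Tractor n →L[ℝ] Tractor n)ˣ) : Tractor n →L[ℝ] Tractor n) :
          Module.End ℝ (Tractor n)) = S := by
        rw [hS, ← hJc]
        rfl
      rwa [h2] at h1
    have hSS : S * S = -1 := by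
      calc S * S = lin n P * (complexStr Φ * (lin n P⁻¹ * lin n P) * complexStr Φ) * lin n P⁻¹ := by
            simp only [hS, mul_assoc]
        _ = -(lin n P * lin n P⁻¹) := by
            rw [lin_inv_mul, mul_one, complexStr_mul_self, end_mul_neg, mul_one, end_neg_mul]
        _ = -1 := by rw [lin_mul_inv]
    -- Conjugating an element of `𝔲` by `P⁻¹` stays in `𝔲`, so the result commutes with `i`;
    -- conjugating back, the element commutes with `S`.
    have hSA : ∀ X ∈ unitaryAlgebra k l, X * complexMat Φ S = complexMat Φ S * X := by
      intro X hX
      obtain ⟨A, hA⟩ := exists_mulVec Φ X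
      have h1 := hcomm _ (conj_mem_holonomyAlgebra hP.symm (hmem X hX A hA))
      have h2 : (A : Module.End ℝ (Tractor n)) * S = S * (A : Module.End ℝ (Tractor n)) := by
        have h3 := congrArg (fun Y ↦ lin n P * Y * lin n P⁻¹) h1
        have h4 : lin n P * (lin n P⁻¹ * (A : Module.End ℝ (Tractor n)) * lin n P * complexStr Φ) *
            lin n P⁻¹ = A * S := by
          calc _ = (lin n P * lin n P⁻¹) * A * S := by simp only [hS, mul_assoc]
            _ = _ := by rw [lin_mul_inv, one_mul]
        have h5 : lin n P * (complexStr Φ * (lin n P⁻¹ * (A : Module.End ℝ (Tractor n)) * lin n P)) *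
            lin n P⁻¹ = S * A := by
          calc _ = S * A * (lin n P * lin n P⁻¹) := by simp only [hS, mul_assoc]
            _ = _ := by rw [lin_mul_inv, mul_one]
        rw [← h4, ← h5]
        rw [inv_inv] at h3
        exact h3
      rw [← complexMat_of_mulVec hA, ← complexMat_mul (commute_of_mulVec hA), h2,
        complexMat_mul hSJ]
    have hY : complexMat Φ S * complexMat Φ S = -1 := by
      rw [← complexMat_mul hSJ, hSS, map_neg, complexMat_one]
    have hSP : S * lin n P = lin n P * complexStr Φ := by
      rw [hS, mul_assoc, lin_inv_mul, mul_one]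
    rcases eq_I_or_neg_I hY hSA with h1 | h1
    · left
      have h2 : S = complexStr Φ := LinearMap.ext fun v ↦ Φ.injective <| by
        rw [complexMat_mulVec hSJ, h1, complexStr_apply, LinearEquiv.apply_symm_apply,
          Matrix.smul_mulVec, Matrix.one_mulVec]
      rw [← hSP, h2]
    · right
      have h2 : S = -complexStr Φ := LinearMap.ext fun v ↦ Φ.injective <| by
        rw [complexMat_mulVec hSJ, h1, LinearMap.neg_apply, map_neg, complexStr_apply,
          LinearEquiv.apply_symm_apply, Matrix.neg_mulVec, Matrix.smul_mulVec, Matrix.one_mulVec]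
      rw [← hSP, h2, end_neg_mul]
  have h1 := (holonomyAlgebra_commute_and_trace hn hΦ.skew hloop hJmem).2
  rw [complexMat_of_mulVec hJ, Matrix.trace_smul, Matrix.trace_one, smul_eq_mul] at h1
  have h2 := (mul_eq_zero.mp h1).resolve_left Complex.I_ne_zero
  rw [Nat.cast_eq_zero, Fintype.card_sum, Fintype.card_fin, Fintype.card_fin] at h2
  omega

end Hermitian

end HolonomyAlgebra

end ConformalTractor

end

open ConformalTractor in
theorem proposition2p1 {n p q : ℕ} (hn : 3 ≤ n) {M : Type*} [TopologicalSpace M] [T2Space M]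
    [SecondCountableTopology M] [ChartedSpace (EuclideanSpace ℝ (Fin n)) M]
    [IsManifold (𝓡 n) ∞ M] (c : ConformalStructure n p q M) :
    (∀ s : AdjointTractorField c, s.IsParallel →
      ∀ (g : PseudoMetric n p q M) (hg : IsRepresentative c g),
        IsConformalKilling g s.vectorField ∧
        (∀ a : M, ∀ z ∈ (extChartAt (𝓡 n) a).target, ∀ j : Fin n,
          ∑ i, vectorCoord a (pt a z) (s.vectorField (pt a z)) i •
            tractorCurvature (metricMatrix g a) i j z = 0) ∧
        (∀ a : M, ∀ z ∈ (extChartAt (𝓡 n) a).target, ∀ i j : Fin n,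
          (tractorCurvature (metricMatrix g a) i j z *
            endMatrix (s.toEnd g hg) a z).trace = 0)) ∧
    (∀ p' q' : ℕ, p = 2 * p' + 1 → q = 2 * q' + 1 →
      ∀ g : PseudoMetric n p q M, IsRepresentative c g → ∀ x : M,
      ∀ Φ : Tractor n ≃ₗ[ℝ] (Fin (p' + 1) ⊕ Fin (q' + 1) → ℂ), IsHermitianIdentification g x Φ →
        (holonomyGroup g x ⊆ transfer Φ (unitaryGroup (p' + 1) (q' + 1)) →
          holonomyAlgebra g x ⊆ transfer Φ (specialUnitaryAlgebra (p' + 1) (q' + 1))) ∧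
        holonomyAlgebra g x ≠ transfer Φ (unitaryAlgebra (p' + 1) (q' + 1))) := by
  refine ⟨fun s hs g hg ↦ ⟨s.isConformalKilling hs hg, fun a z hz ↦
    (s.curvature_eq_zero hs hg hn hz).1, fun a z hz ↦ (s.curvature_eq_zero hs hg hn hz).2⟩,
    fun p' q' _ _ g _ x Φ hΦ ↦ ⟨holonomyAlgebra_subset_specialUnitary hn hΦ,
      holonomyAlgebra_ne_unitary hn (by omega) hΦ⟩⟩
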